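/- Let $P\subset\mathbb R^3$ be a (not necessarily convex) polyhedron: a nonempty compact set which is the closure of its interior and whose boundary is contained in a finite union of planes. Faces, edges and vertices of $P$ are the geometric ones: the relatively open faces are the connected components of the set of boundary points near which $P$ is a half-space; the remaining boundary points form the 1-skeleton (the union of the edges); the vertices are the boundary points near which $P$ is not translation invariant in any direction, and the degree of a vertex is the number of edges issuing from it. Let $e(P)$ be the total edge length, $v(P)$ the volume, and $m(P)=e(P)^3/v(P)$ the Melzak ratio. A vertex $H$ of $P$ is *negatively exposed* if it has an open neighbourhood $U$ such that $U\cap P^{c}$ is convex. Theorem. Let $F$ be a face of $P$ and let $A\neq B$ be two adjacent vertices of $F$ (the endpoints of an edge of $F$) such that every vertex of $F$ other than $A$ and $B$ is negatively exposed. Then at least one of the following holds: (i) every vertex of $F$ that does not lie on the line through $A$ and $B$ has degree $3$ (if, as is usual, that line contains no vertex of $F$ other than $A$ and $B$, these are all vertices of $F$ except possibly $A$ and $B$); (ii) $P$ can be perturbed to improve the Melzak ratio: there are $\varepsilon>0$ and a family $(P_t)_{t\in[0,\varepsilon]}$ of polyhedra with $P_0=P$ such that $P_t$ and its boundary $\partial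 P_t$ depend continuously on $t$ in the Hausdorff distance, and $m(P_t)<m(P)$ for all $t\in(0,\varepsilon]$. -/

import Mathlib

open Set Filter Topology MeasureTheory
open scoped RealInnerProductSpace

namespace Melzak

noncomputable section

/-- Euclidean three-space. -/
abbrev E3 : Type := EuclideanSpace ℝ (Fin 3)

/-- A (not necessarily convex) solid polyhedron: a nonempty compact set that is the closure of its
interior and whose boundary is contained in finitely many planes `⟪n, x⟫ = c`, `n ≠ 0`. -/
structure IsPolyhedron (P : Set E3) : Prop where
  nonempty : P.Nonempty
  isCompact : IsCompact P
  closure_interior : closure (interior P) = P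
  exists_planes : ∃ S : Set (E3 × ℝ), S.Finite ∧ (∀ p ∈ S, p.1 ≠ 0) ∧
    frontier P ⊆ ⋃ p ∈ S, {x : E3 | ⟪p.1, x⟫ = p.2}

/-- Relative interior points of faces: boundary points near which `P` is a half-space. -/
def facePoints (P : Set E3) : Set E3 :=
  {x | x ∈ frontier P ∧ ∃ n : E3, n ≠ 0 ∧ ∀ᶠ y in 𝓝 x, (y ∈ P ↔ ⟪n, y - x⟫ ≤ 0)}

/-- The 1-skeleton, i.e. the union of all edges together with all vertices: boundary points near
which the boundary is not flat. -/
def skeleton (P : Set E3) : Set E3 := frontier P \ facePoints P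

/-- Near `x`, the set `P` is invariant under translation in the direction `u`. -/
def LocallyInvariant (P : Set E3) (x u : E3) : Prop :=
  ∃ r : ℝ, 0 < r ∧ ∀ y ∈ Metric.ball x r, ∀ s : ℝ,
    y + s • u ∈ Metric.ball x r → (y ∈ P ↔ y + s • u ∈ P)

/-- Vertices: boundary points near which `P` is not translation invariant in any direction
(near a relative interior point of a face it is so in two independent directions, near a relative
interior point of an edge exactly in the direction of the edge). -/
def vertices (P : Set E3) : Set E3 :=
  {x | x ∈ frontier P ∧ ∀ u : E3, u ≠ 0 → ¬ LocallyInvariant P x u}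

/-- Relative interior points of edges. -/
def edgePoints (P : Set E3) : Set E3 := skeleton P \ vertices P

/-- `F` is the relative interior of a face of `P`: a connected component of the flat part of the
boundary. The face itself is the closed planar region `closure F`. -/
def IsOpenFace (P F : Set E3) : Prop :=
  ∃ x ∈ facePoints P, F = connectedComponentIn (facePoints P) x

/-- The vertices of `P` lying on the face `closure F`. -/
def faceVertices (P F : Set E3) : Set E3 := vertices P ∩ closure F

/-- `A` and `B` are the two endpoints of an edge of the face `closure F`. -/
def AdjacentOnFace (P F : Set E3) (A B : E3) : Prop :=
  A ≠ B ∧ A ∈ faceVertices P F ∧ B ∈ faceVertices P F ∧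
    openSegment ℝ A B ⊆ edgePoints P ∩ closure F

/-- The degree of a vertex `H`: the number of edges starting at `H`, counted by their unit
directions. -/
def degree (P : Set E3) (H : E3) : ℕ :=
  {u : E3 | ‖u‖ = 1 ∧ ∀ᶠ s in 𝓝[>] (0 : ℝ), H + s • u ∈ edgePoints P}.ncard

/-- `H` is exposed for the complement of `P`. -/
def NegativelyExposed (P : Set E3) (H : E3) : Prop :=
  ∃ U : Set E3, IsOpen U ∧ H ∈ U ∧ Convex ℝ (U ∩ Pᶜ)

/-- The total edge length of `P`: the one-dimensional Hausdorff measure of the union of its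
edges. -/
def edgeLength (P : Set E3) : ℝ := (Measure.hausdorffMeasure 1 (skeleton P)).toReal

/-- The Melzak ratio: the cube of the edge length divided by the volume. -/
def melzakRatio (P : Set E3) : ℝ := edgeLength P ^ 3 / (volume P).toReal

/-- `Q t`, for `t ∈ [0, ε]`, is a perturbation of the polyhedron `P`: a family of polyhedra with
`Q 0 = P` which, together with the boundaries, is continuous in the Hausdorff distance. -/
structure IsPerturbation (P : Set E3) (ε : ℝ) (Q : ℝ → Set E3) : Prop where
  pos : 0 < ε
  zero : Q 0 = P
  isPolyhedron : ∀ t ∈ Icc 0 ε, IsPolyhedron (Q t)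
  continuous : ∀ s ∈ Icc 0 ε,
    Tendsto (fun t => Metric.hausdorffEDist (Q t) (Q s)) (𝓝[Icc 0 ε] s) (𝓝 0)
  continuous_frontier : ∀ s ∈ Icc 0 ε,
    Tendsto (fun t => Metric.hausdorffEDist (frontier (Q t)) (frontier (Q s)))
      (𝓝[Icc 0 ε] s) (𝓝 0)

/-- `P` can be perturbed to improve (strictly decrease) the Melzak ratio. -/
def CanBeImproved (P : Set E3) : Prop :=
  ∃ (ε : ℝ) (Q : ℝ → Set E3), IsPerturbation P ε Q ∧
    ∀ t ∈ Ioc 0 ε, melzakRatio (Q t) < melzakRatio P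

end

end Melzak

/-!
The perturbation is a rotation of the plane of `F` about the line `A B`. Let `a` be the affine
functional of the plane, so that `P` is `aff a ≤ 0` near the points of `F`, and let `b` be a
functional vanishing on the line, with gradient in the plane. For small `s` the plane `aff a = 0` is
replaced by `aff a = s * aff b` (`rotate`): on one side of the line a thin wedge is added to `P`, on
the other side one is removed.

Off the line, the complement of `P` is convex near every point of `F`. At the vertices this is
negative exposure; elsewhere the germ of `P` can be slid along an edge until a vertex is reached
(`FacePlane.complConvexAt`), and local convexity then means that the complement is locally the
intersection of the half-spaces of the adjacent faces (`IsArrangement.convexAt`). Consequently the line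
cuts `F` into finitely many convex polygons (`convex_piece`), each with an irredundant list of
neighbouring planes (`ConvexPiece`, `FacePlane.exists_hingedFace`), and the rotation only
affects thin zones over these polygons.

The first-order change of the edge length is controlled piece by piece
(`ConvexPiece.exists_length_bound`). If the rotated plane met only the planes of the sides of the
polygon, then every corner would move along the common line of two of those planes, and the length
would be the differentiable function `Ψ`: the perimeter of the displaced polygon, corrected by the
displacements of its corners. When the plane moves out of the polyhedron, a further plane through a
corner cuts this configuration off. By the triangle inequality in each facet the true length is
at most `Ψ`, and it is smaller by at least `c * s` with `c > 0` if some plane touches the polygon only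
in a vertex (`exists_slack`). When the plane moves into the polyhedron, such planes play no role, and
`Ψ` bounds the length again. The volume is differentiable at `s = 0`
(`ConvexPiece.exists_volume_wedge`). Hence the first-order variation of `e ^ 3 / v` is bounded by a
linear function of `s`, lowered by a positive multiple of `|s|` for one sign of `s` at least, and it
is negative in one of the two directions (`HingedFace.canBeImproved`).

If no such plane exists, then a vertex of `F` off the line lies on no neighbouring plane other than
those of the two sides meeting there. The complement of `P` is near it the intersection of three
independent half-spaces, and the degree is three (`ConvexPiece.degree_eq_three`).
-/

namespace Melzak

section

/-! ### Affine functionals -/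

/-- The value at `x` of the affine functional `⟪n, ·⟫ - c` encoded by the pair `p = (n, c)`. Pairs form
a real vector space, on which `aff` is linear. -/
noncomputable def aff (p : E3 × ℝ) (x : E3) : ℝ := ⟪p.1, x⟫ - p.2

theorem continuous_aff (p : E3 × ℝ) : Continuous (aff p) := by
  unfold aff; fun_prop

theorem aff_add_vec (p : E3 × ℝ) (x w : E3) : aff p (x + w) = aff p x + ⟪p.1, w⟫ := by
  simp only [aff, inner_add_right]; ring

theorem aff_add_smul (p : E3 × ℝ) (x w : E3) (t : ℝ) :
    aff p (x + t • w) = aff p x + t * ⟪p.1, w⟫ := by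
  rw [aff_add_vec, inner_smul_right]

theorem inner_sub_eq_aff (p : E3 × ℝ) (x y : E3) : ⟪p.1, y - x⟫ = aff p y - aff p x := by
  simp only [aff, inner_sub_right]; ring

theorem aff_move (p : E3 × ℝ) (x y : E3) (t : ℝ) :
    aff p (x + t • (y - x)) = (1 - t) * aff p x + t * aff p y := by
  rw [aff_add_smul, inner_sub_eq_aff]; ring

theorem aff_combo (p : E3 × ℝ) (x y : E3) {s t : ℝ} (h : s + t = 1) :
    aff p (s • x + t • y) = s * aff p x + t * aff p y := by
  obtain rfl : s = 1 - t := by linarith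
  simp only [aff, inner_add_right, inner_smul_right]; ring

@[simp] theorem aff_neg (p : E3 × ℝ) (x : E3) : aff (-p) x = -aff p x := by
  simp only [aff, Prod.fst_neg, Prod.snd_neg, inner_neg_left]; ring

theorem aff_sub (p q : E3 × ℝ) (x : E3) : aff (p - q) x = aff p x - aff q x := by
  simp only [aff, Prod.fst_sub, Prod.snd_sub, inner_sub_left]; ring

@[simp] theorem aff_smul (r : ℝ) (p : E3 × ℝ) (x : E3) : aff (r • p) x = r * aff p x := by
  simp only [aff, Prod.smul_fst, Prod.smul_snd, smul_eq_mul, real_inner_smul_left]; ring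

/-- Moving along the gradient of `p`. -/
theorem aff_add_grad (p : E3 × ℝ) (x : E3) (t : ℝ) :
    aff p (x + t • p.1) = aff p x + t * ‖p.1‖ ^ 2 := by
  rw [aff_add_smul, real_inner_self_eq_norm_sq]

theorem grad_ne_zero {p : E3 × ℝ} {x y : E3} (h : aff p x ≠ aff p y) : p.1 ≠ 0 := by
  intro h0; apply h; simp [aff, h0]

theorem isClosed_aff_eq (p : E3 × ℝ) : IsClosed {x | aff p x = 0} :=
  isClosed_eq (continuous_aff p) continuous_const

theorem isClosed_aff_nonneg (p : E3 × ℝ) : IsClosed {x | 0 ≤ aff p x} :=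
  isClosed_le continuous_const (continuous_aff p)

theorem isOpen_aff_pos (p : E3 × ℝ) : IsOpen {x | 0 < aff p x} :=
  isOpen_lt continuous_const (continuous_aff p)

theorem eventually_aff_pos {p : E3 × ℝ} {x : E3} (h : 0 < aff p x) : ∀ᶠ y in 𝓝 x, 0 < aff p y :=
  (isOpen_aff_pos p).mem_nhds h

theorem eventually_aff_neg {p : E3 × ℝ} {x : E3} (h : aff p x < 0) : ∀ᶠ y in 𝓝 x, aff p y < 0 :=
  (isOpen_lt (continuous_aff p) continuous_const).mem_nhds h

/-- A small step from `x` towards a given direction stays in a given neighbourhood. -/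
theorem eventually_move {x w : E3} {φ : E3 → Prop} (h : ∀ᶠ y in 𝓝 x, φ y) :
    ∀ᶠ t in 𝓝 (0 : ℝ), φ (x + t • w) := by
  have : Tendsto (fun t : ℝ => x + t • w) (𝓝 0) (𝓝 x) := by
    have : Continuous (fun t : ℝ => x + t • w) := by fun_prop
    simpa using this.tendsto 0
  exact this.eventually h

/-- The same for small positive steps, together with a bound on their size. -/
theorem exists_small_move {x : E3} (w : E3) {φ : E3 → Prop} (h : ∀ᶠ y in 𝓝 x, φ y) {ε : ℝ}
    (hε : 0 < ε) : ∃ t : ℝ, 0 < t ∧ t < ε ∧ φ (x + t • w) := by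
  have h1 := (eventually_move (w := w) h).filter_mono (nhdsWithin_le_nhds (s := Ioi 0))
  have h2 : ∀ᶠ t in 𝓝[>] (0 : ℝ), t ∈ Ioo 0 ε := Ioo_mem_nhdsGT hε
  obtain ⟨t, ht, ht'⟩ := (h1.and h2).exists
  exact ⟨t, ht'.1, ht'.2, ht⟩

theorem mem_closure_of_moves {x w : E3} {s : Set E3} {ε : ℝ} (hε : 0 < ε)
    (h : ∀ t, 0 < t → t < ε → x + t • w ∈ s) : x ∈ closure s := by
  rw [mem_closure_iff_nhds]
  intro U hU
  obtain ⟨t, h0, h1, h2⟩ := exists_small_move w (φ := fun y => y ∈ U) hU hε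
  exact ⟨_, h2, h t h0 h1⟩

/-- A nonempty open set is not covered by finitely many planes. -/
theorem exists_mem_open_forall_aff_ne (T : Set (E3 × ℝ)) (hT : T.Finite) (hn : ∀ p ∈ T, p.1 ≠ 0)
    {V : Set E3} (hV : IsOpen V) (hne : V.Nonempty) : ∃ y ∈ V, ∀ p ∈ T, aff p y ≠ 0 := by
  induction T, hT using Set.Finite.induction_on generalizing V with
  | empty => obtain ⟨y, hy⟩ := hne; exact ⟨y, hy, by simp⟩
  | @insert p T _ _ ih =>
    have hp := hn p (mem_insert _ _)
    have hopen : IsOpen (V ∩ {x | aff p x ≠ 0}) :=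
      hV.inter (isClosed_aff_eq p).isOpen_compl
    have hne' : (V ∩ {x | aff p x ≠ 0}).Nonempty := by
      obtain ⟨y, hy⟩ := hne
      by_cases h : aff p y = 0
      · obtain ⟨t, ht, -, hty⟩ := exists_small_move p.1 (hV.mem_nhds hy) one_pos
        refine ⟨_, hty, ?_⟩
        simp only [mem_ofPred_eq, aff_add_grad, h, zero_add]
        have : 0 < ‖p.1‖ := norm_pos_iff.2 hp
        positivity
      · exact ⟨y, hy, h⟩
    obtain ⟨y, hy, hy'⟩ := ih (fun q hq => hn q (mem_insert_of_mem _ hq)) hopen hne'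
    refine ⟨y, hy.1, ?_⟩
    rintro q (rfl | hq)
    exacts [hy.2, hy' q hq]

/-- A functional with nonzero gradient is not constant on any ball. -/
theorem exists_aff_neg_near {p : E3 × ℝ} (hp : p.1 ≠ 0) {x : E3} (hx : aff p x ≤ 0) {φ : E3 → Prop}
    (h : ∀ᶠ y in 𝓝 x, φ y) : ∃ y, aff p y < 0 ∧ φ y := by
  obtain ⟨t, ht, -, hty⟩ := exists_small_move (-p.1) h one_pos
  refine ⟨_, ?_, hty⟩
  rw [aff_add_smul, inner_neg_right, real_inner_self_eq_norm_sq]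
  have : 0 < ‖p.1‖ := norm_pos_iff.2 hp
  nlinarith [mul_pos ht (pow_pos this 2)]

/-! ### Linear algebra in three-space -/

/-- Two vectors of three-space have a common orthogonal direction. -/
theorem exists_ne_zero_orthogonal (u v : E3) : ∃ d : E3, d ≠ 0 ∧ ⟪u, d⟫ = 0 ∧ ⟪v, d⟫ = 0 := by
  have hlt : Module.finrank ℝ (Submodule.span ℝ {u, v}) < Module.finrank ℝ E3 := by
    calc _ ≤ ({u, v} : Finset E3).card := by
            have := finrank_span_finset_le_card (R := ℝ) ({u, v} : Finset E3)
            rwa [Set.finrank, Finset.coe_pair] at this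
      _ ≤ 2 := Finset.card_le_two
      _ < _ := by simp
  have hne : (Submodule.span ℝ {u, v})ᗮ ≠ ⊥ := by
    intro h
    rw [Submodule.orthogonal_eq_bot_iff] at h
    rw [h] at hlt; simp at hlt
  obtain ⟨d, hd, hd0⟩ := Submodule.exists_mem_ne_zero_of_ne_bot hne
  rw [Submodule.mem_orthogonal] at hd
  exact ⟨d, hd0, hd u (Submodule.subset_span (by simp)), hd v (Submodule.subset_span (by simp))⟩

/-- A vector orthogonal to three independent vectors vanishes. -/
theorem eq_zero_of_orthogonal {u : Fin 3 → E3} (hu : LinearIndependent ℝ u) {w : E3}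
    (h : ∀ i, ⟪u i, w⟫ = 0) : w = 0 := by
  have hspan : Submodule.span ℝ (range u) = ⊤ :=
    hu.span_eq_top_of_card_eq_finrank (by simp)
  have hw : ∀ x ∈ Submodule.span ℝ (range u), ⟪x, w⟫ = 0 := by
    intro x hx
    induction hx using Submodule.span_induction with
    | mem x hx => obtain ⟨i, rfl⟩ := hx; exact h i
    | zero => simp
    | add x y _ _ hx hy => rw [inner_add_left, hx, hy, add_zero]
    | smul a x _ hx => rw [real_inner_smul_left, hx, mul_zero]
  have := hw w (by rw [hspan]; trivial)
  exact inner_self_eq_zero.1 this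

/-- Three vectors orthogonal to a common nonzero vector are linearly dependent. -/
theorem exists_relation_of_orthogonal (u : Fin 3 → E3) {w : E3} (hw : w ≠ 0)
    (h : ∀ i, ⟪u i, w⟫ = 0) :
    ∃ α β γ : ℝ, (α ≠ 0 ∨ β ≠ 0 ∨ γ ≠ 0) ∧ α • u 0 + β • u 1 + γ • u 2 = 0 := by
  have hd : ¬ LinearIndependent ℝ u := fun hu => hw (eq_zero_of_orthogonal hu h)
  rw [Fintype.not_linearIndependent_iff] at hd
  obtain ⟨c, hc, i, hi⟩ := hd
  rw [Fin.sum_univ_three] at hc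
  refine ⟨c 0, c 1, c 2, ?_, hc⟩
  fin_cases i
  exacts [Or.inl hi, Or.inr (Or.inl hi), Or.inr (Or.inr hi)]

theorem linearIndependent_cons_orthogonal {u v d : E3} (huv : LinearIndependent ℝ ![u, v])
    (hd : d ≠ 0) (hud : ⟪u, d⟫ = 0) (hvd : ⟪v, d⟫ = 0) : LinearIndependent ℝ ![d, u, v] := by
  refine LinearIndependent.finCons' d _ huv ?_
  intro c y hy h
  have hy : ⟪y, d⟫ = 0 := by
    have hz : ∀ x ∈ Submodule.span ℝ (range ![u, v]), ⟪x, d⟫ = 0 := by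
      intro x hx
      induction hx using Submodule.span_induction with
      | mem x hx => obtain ⟨i, rfl⟩ := hx; fin_cases i; exacts [hud, hvd]
      | zero => simp
      | add x y _ _ hx hy => rw [inner_add_left, hx, hy, add_zero]
      | smul a x _ hx => rw [real_inner_smul_left, hx, mul_zero]
    exact hz _ hy
  have h2 : ⟪c • d + y, d⟫ = 0 := by rw [h]; simp
  rw [inner_add_left, hy, add_zero, real_inner_smul_left] at h2
  have : ⟪d, d⟫ ≠ 0 := by simpa using hd
  exact (mul_eq_zero.1 h2).resolve_right this

/-- The vectors orthogonal to two independent ones form a line. -/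
theorem exists_eq_smul_of_orthogonal {u v : E3} (huv : LinearIndependent ℝ ![u, v]) {d w : E3}
    (hd : d ≠ 0) (hud : ⟪u, d⟫ = 0) (hvd : ⟪v, d⟫ = 0) (huw : ⟪u, w⟫ = 0) (hvw : ⟪v, w⟫ = 0) :
    ∃ r : ℝ, w = r • d := by
  have hli := linearIndependent_cons_orthogonal huv hd hud hvd
  refine ⟨⟪d, w⟫ / ⟪d, d⟫, ?_⟩
  have hdd : ⟪d, d⟫ ≠ 0 := by simpa using hd
  rw [← sub_eq_zero]
  apply eq_zero_of_orthogonal hli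
  intro i
  fin_cases i
  · simp only [Fin.zero_eta, Matrix.cons_val_zero, inner_sub_right, inner_smul_right]
    field_simp; ring
  · simp [inner_sub_right, inner_smul_right, hud, huw]
  · simp [inner_sub_right, inner_smul_right, hvd, hvw]

/-- Three affine functionals vanishing at two distinct points belong to a pencil. -/
theorem exists_pencil_relation (p q r : E3 × ℝ) {x y : E3} (hxy : x ≠ y)
    (hpx : aff p x = 0) (hpy : aff p y = 0) (hqx : aff q x = 0) (hqy : aff q y = 0)
    (hrx : aff r x = 0) (hry : aff r y = 0) :
    ∃ α β γ : ℝ, (α ≠ 0 ∨ β ≠ 0 ∨ γ ≠ 0) ∧ ∀ z, α * aff p z + β * aff q z + γ * aff r z = 0 := by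
  obtain ⟨α, β, γ, h0, h⟩ := exists_relation_of_orthogonal ![p.1, q.1, r.1]
    (w := y - x) (sub_ne_zero.2 hxy.symm) (by
      intro i; fin_cases i
      · simpa [hpx, hpy] using inner_sub_eq_aff p x y
      · simpa [hqx, hqy] using inner_sub_eq_aff q x y
      · simpa [hrx, hry] using inner_sub_eq_aff r x y)
  refine ⟨α, β, γ, h0, fun z => ?_⟩
  have hz : ∀ s : E3 × ℝ, aff s x = 0 → aff s z = ⟪s.1, z - x⟫ := by
    intro s hs; rw [inner_sub_eq_aff, hs, sub_zero]
  rw [hz p hpx, hz q hqx, hz r hrx, ← real_inner_smul_left, ← real_inner_smul_left,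
    ← real_inner_smul_left, ← inner_add_left, ← inner_add_left]
  simp only [Matrix.cons_val_zero, Matrix.cons_val_one, Matrix.cons_val_two, Matrix.head_cons,
    Matrix.tail_cons] at h
  rw [h, inner_zero_left]

/-- If three functionals of a pencil are positive at a common point, one of them is a nonnegative
combination of the other two. -/
theorem pencil_nonneg_combination {f g h : E3 → ℝ} {α β γ : ℝ} (h0 : α ≠ 0 ∨ β ≠ 0 ∨ γ ≠ 0)
    (hrel : ∀ z, α * f z + β * g z + γ * h z = 0) {x : E3} (hf : 0 < f x) (hg : 0 < g x)
    (hh : 0 < h x) :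
    (∃ s t : ℝ, 0 ≤ s ∧ 0 ≤ t ∧ 0 < s + t ∧ ∀ z, f z = s * g z + t * h z) ∨
    (∃ s t : ℝ, 0 ≤ s ∧ 0 ≤ t ∧ 0 < s + t ∧ ∀ z, g z = s * f z + t * h z) ∨
    (∃ s t : ℝ, 0 ≤ s ∧ 0 ≤ t ∧ 0 < s + t ∧ ∀ z, h z = s * f z + t * g z) := by
  have key : ∀ {f g h : E3 → ℝ} {α β γ : ℝ}, (∀ z, α * f z + β * g z + γ * h z = 0) →
      0 < f x → 0 < g x → 0 < h x → ((α < 0 ∧ 0 ≤ β ∧ 0 ≤ γ) ∨ (0 < α ∧ β ≤ 0 ∧ γ ≤ 0)) →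
      (∃ s t : ℝ, 0 ≤ s ∧ 0 ≤ t ∧ 0 < s + t ∧ ∀ z, f z = s * g z + t * h z) := by
    intro f g h α β γ hrel hf hg hh hs
    have hα : α ≠ 0 := by rcases hs with hs | hs <;> [exact hs.1.ne; exact hs.1.ne']
    have e : ∀ z, f z = (-β / α) * g z + (-γ / α) * h z := by
      intro z; field_simp; linarith [hrel z]
    have n1 : 0 ≤ -β / α := by
      rcases hs with hs | hs
      · exact div_nonneg_of_nonpos (by linarith [hs.2.1]) hs.1.le
      · exact div_nonneg (by linarith [hs.2.1]) hs.1.le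
    have n2 : 0 ≤ -γ / α := by
      rcases hs with hs | hs
      · exact div_nonneg_of_nonpos (by linarith [hs.2.2]) hs.1.le
      · exact div_nonneg (by linarith [hs.2.2]) hs.1.le
    refine ⟨_, _, n1, n2, ?_, e⟩
    by_contra hc
    have e1 : -β / α = 0 := by linarith
    have e2 : -γ / α = 0 := by linarith
    have := e x
    rw [e1, e2] at this
    linarith
  have hpos : ∀ {α β γ : ℝ}, α * f x + β * g x + γ * h x = 0 → 0 ≤ α → 0 ≤ β → 0 ≤ γ →
      α = 0 ∧ β = 0 ∧ γ = 0 := by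
    intro α β γ h0 a b c
    have a' := mul_nonneg a hf.le
    have b' := mul_nonneg b hg.le
    have c' := mul_nonneg c hh.le
    refine ⟨?_, ?_, ?_⟩
    · exact (mul_eq_zero.1 (by linarith : α * f x = 0)).resolve_right hf.ne'
    · exact (mul_eq_zero.1 (by linarith : β * g x = 0)).resolve_right hg.ne'
    · exact (mul_eq_zero.1 (by linarith : γ * h x = 0)).resolve_right hh.ne'
  have h1 := hpos (hrel x)
  have h2 := hpos (α := -α) (β := -β) (γ := -γ) (by linarith [hrel x])
  have hcond : ((α < 0 ∧ 0 ≤ β ∧ 0 ≤ γ) ∨ (0 < α ∧ β ≤ 0 ∧ γ ≤ 0)) ∨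
      ((β < 0 ∧ 0 ≤ α ∧ 0 ≤ γ) ∨ (0 < β ∧ α ≤ 0 ∧ γ ≤ 0)) ∨
      ((γ < 0 ∧ 0 ≤ α ∧ 0 ≤ β) ∨ (0 < γ ∧ α ≤ 0 ∧ β ≤ 0)) := by grind
  rcases hcond with hc | hc | hc
  · exact Or.inl (key hrel hf hg hh hc)
  · exact Or.inr (Or.inl (key (fun z => by linarith [hrel z]) hg hf hh hc))
  · exact Or.inr (Or.inr (key (fun z => by linarith [hrel z]) hh hf hg hc))

/-! ### Bounded polyhedra -/

theorem convex_aff_nonneg (p : E3 × ℝ) : Convex ℝ {x | 0 ≤ aff p x} := by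
  intro x hx y hy s t hs ht hst
  simp only [mem_ofPred_eq] at *
  rw [aff_combo p x y hst]; positivity

theorem convex_aff_pos (p : E3 × ℝ) : Convex ℝ {x | 0 < aff p x} := by
  intro x hx y hy s t hs ht hst
  simp only [mem_ofPred_eq] at *
  rw [aff_combo p x y hst]
  rcases hs.eq_or_lt with rfl | hs
  · obtain rfl : t = 1 := by linarith
    simpa using hy
  · have := mul_pos hs hx
    have := mul_nonneg ht hy.le
    linarith

/-- The extreme points of a polyhedron are determined by the constraints active there. -/
theorem finite_extremePoints {T : Set (E3 × ℝ)} (hT : T.Finite) :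
    (extremePoints ℝ {x | ∀ p ∈ T, 0 ≤ aff p x}).Finite := by
  have hfin : (𝒫 T).Finite := hT.finite_subsets
  refine Finite.of_finite_image (f := fun x => {p ∈ T | aff p x = 0})
    (hfin.subset ?_) ?_
  · rintro _ ⟨x, -, rfl⟩; exact sep_subset _ _
  intro x hx y hy hxy
  by_contra hne
  simp only at hxy
  -- both `x + t • (x - y)` and `x - t • (x - y)` are feasible for small `t`
  have hfeas : ∀ w : E3, (∀ p ∈ T, aff p x = 0 → ⟪p.1, w⟫ = 0) →
      ∀ᶠ t in 𝓝 (0 : ℝ), x + t • w ∈ {x | ∀ p ∈ T, 0 ≤ aff p x} := by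
    intro w hw
    simp only [mem_ofPred_eq]
    rw [hT.eventually_all]
    intro p hp
    rcases (hx.1 p hp).eq_or_lt with h0 | h0
    · filter_upwards with t
      rw [aff_add_smul, hw p hp h0.symm, ← h0]; simp
    · exact (eventually_move (eventually_aff_pos h0)).mono fun t ht => ht.le
  have h0 : ∀ p ∈ T, aff p x = 0 → ⟪p.1, y - x⟫ = 0 := by
    intro p hp h
    have : p ∈ {p ∈ T | aff p y = 0} := hxy ▸ ⟨hp, h⟩
    rw [inner_sub_eq_aff, h, this.2, sub_zero]
  have h1 : ∀ p ∈ T, aff p x = 0 → ⟪p.1, -(y - x)⟫ = 0 := by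
    intro p hp h; rw [inner_neg_right, h0 p hp h, neg_zero]
  have hev := ((hfeas _ h0).and (hfeas _ h1)).filter_mono (nhdsWithin_le_nhds (s := Ioi 0))
  obtain ⟨t, ⟨ha, hb⟩, ht⟩ := (hev.and self_mem_nhdsWithin).exists
  have ht : 0 < t := ht
  have hseg : x ∈ openSegment ℝ (x + t • (y - x)) (x + t • -(y - x)) :=
    ⟨1/2, 1/2, by norm_num, by norm_num, by norm_num, by module⟩
  have := hx.2 ha hb hseg
  rw [add_eq_left, smul_eq_zero] at this
  rcases this with h | h
  · exact ht.ne' h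
  · exact hne (sub_eq_zero.1 h).symm

/-- If on a bounded polyhedron `f ≥ 0` and `f = 0` forces `g ≤ 0`, then `f` dominates a positive
multiple of `g`: it suffices to compare the two at the finitely many extreme points. -/
theorem polyhedron_gap {T : Set (E3 × ℝ)} (hT : T.Finite)
    (hb : Bornology.IsBounded {x | ∀ p ∈ T, 0 ≤ aff p x}) (f g : E3 × ℝ)
    (hf : ∀ x, (∀ p ∈ T, 0 ≤ aff p x) → 0 ≤ aff f x)
    (hfg : ∀ x, (∀ p ∈ T, 0 ≤ aff p x) → aff f x = 0 → aff g x ≤ 0) :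
    ∃ c : ℝ, 0 < c ∧ ∀ x, (∀ p ∈ T, 0 ≤ aff p x) → c * aff g x ≤ aff f x := by
  set X := {x | ∀ p ∈ T, 0 ≤ aff p x} with hX
  have hXeq : X = ⋂ p ∈ T, {x | 0 ≤ aff p x} := by ext; simp [hX]
  have hcl : IsClosed X := by
    rw [hXeq]; exact isClosed_biInter fun p _ => isClosed_aff_nonneg p
  have hconv : Convex ℝ X := by
    rw [hXeq]; exact convex_iInter₂ fun p _ => convex_aff_nonneg p
  have hcomp : IsCompact X := Metric.isCompact_of_isClosed_isBounded hcl hb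
  have hfin : (extremePoints ℝ X).Finite := finite_extremePoints hT
  have hhull : convexHull ℝ (extremePoints ℝ X) = X := by
    rw [← (hfin.isCompact_convexHull ℝ).isClosed.closure_eq]
    exact closure_convexHull_extremePoints hcomp hconv
  have hev : ∀ᶠ c in 𝓝[>] (0 : ℝ), ∀ v ∈ extremePoints ℝ X, c * aff g v ≤ aff f v := by
    rw [hfin.eventually_all]
    intro v hv
    rcases (hf v hv.1).eq_or_lt with h0 | h0
    · filter_upwards [self_mem_nhdsWithin] with c hc
      have := hfg v hv.1 h0.symm
      have hc : 0 < c := hc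
      nlinarith
    · have : Tendsto (fun c : ℝ => c * aff g v) (𝓝[>] 0) (𝓝 (0 * aff g v)) :=
        (tendsto_id.mul_const _).mono_left nhdsWithin_le_nhds
      rw [zero_mul] at this
      exact (this.eventually_lt_const h0).mono fun c hc => hc.le
  obtain ⟨c, hc, hc0⟩ := (hev.and self_mem_nhdsWithin).exists
  refine ⟨c, hc0, fun x hx => ?_⟩
  have hsub : X ⊆ {x | 0 ≤ aff (f - c • g) x} := by
    rw [← hhull]
    refine convexHull_min (fun v hv => ?_) (convex_aff_nonneg _)
    simp only [mem_ofPred_eq, aff_sub, aff_smul]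
    linarith [hc v hv]
  have := hsub hx
  simp only [mem_ofPred_eq, aff_sub, aff_smul] at this
  linarith

end

section

/-! ### Convex pieces of a hinged face -/

/-- The closed polyhedral region cut out by the half-spaces `aff p ≥ 0`, `p ∈ I`. -/
def Kc (I : Finset (E3 × ℝ)) : Set E3 := {x | ∀ p ∈ I, 0 ≤ aff p x}

/-- The open polyhedral region cut out by the half-spaces `aff p > 0`, `p ∈ I`. -/
def Ko (I : Finset (E3 × ℝ)) : Set E3 := {x | ∀ p ∈ I, 0 < aff p x}

/-- The planar convex polygon in the plane `aff a = 0`, on the side `aff b ≥ 0` of the hinge, cut out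
by the half-spaces of `I`. -/
def base (a b : E3 × ℝ) (I : Finset (E3 × ℝ)) : Set E3 :=
  {x | aff a x = 0 ∧ 0 ≤ aff b x ∧ x ∈ Kc I}

/-- The side of the polygon `base a b I` (possibly a single point) in the plane `aff p = 0`. -/
def edge (a b : E3 × ℝ) (I : Finset (E3 × ℝ)) (p : E3 × ℝ) : Set E3 :=
  {x | x ∈ base a b I ∧ aff p x = 0}

/-- A convex polygon `base a b I` together with an irredundant system `I` of half-spaces, each
of which touches the polygon off the hinge `aff a = aff b = 0` and contributes a facet to the region
`{aff a > 0} ∩ Ko I`. -/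
structure ConvexPiece (a b : E3 × ℝ) (I : Finset (E3 × ℝ)) : Prop where
  norm_a : ‖a.1‖ = 1
  orth : ⟪a.1, b.1⟫ = 0
  bdd : Bornology.IsBounded (base a b I)
  interior_point : ∃ x, aff a x = 0 ∧ 0 < aff b x ∧ x ∈ Ko I
  touch : ∀ p ∈ I, ∃ z ∈ edge a b I p, 0 < aff b z
  facet : ∀ p ∈ I, ∃ w, aff p w = 0 ∧ 0 < aff a w ∧ ∀ q ∈ I, q ≠ p → 0 < aff q w

theorem isClosed_Kc (I : Finset (E3 × ℝ)) : IsClosed (Kc I) := by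
  have : Kc I = ⋂ p ∈ I, {x | 0 ≤ aff p x} := by ext; simp [Kc]
  rw [this]; exact isClosed_biInter fun p _ => isClosed_aff_nonneg p

theorem isOpen_Ko (I : Finset (E3 × ℝ)) : IsOpen (Ko I) := by
  have : Ko I = ⋂ p ∈ I, {x | 0 < aff p x} := by ext; simp [Ko]
  rw [this]; exact isOpen_biInter_finset fun p _ => isOpen_aff_pos p

theorem convex_Kc (I : Finset (E3 × ℝ)) : Convex ℝ (Kc I) := by
  have : Kc I = ⋂ p ∈ I, {x | 0 ≤ aff p x} := by ext; simp [Kc]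
  rw [this]; exact convex_iInter₂ fun p _ => convex_aff_nonneg p

theorem convex_Ko (I : Finset (E3 × ℝ)) : Convex ℝ (Ko I) := by
  have : Ko I = ⋂ p ∈ I, {x | 0 < aff p x} := by ext; simp [Ko]
  rw [this]; exact convex_iInter₂ fun p _ => convex_aff_pos p

theorem Ko_subset_Kc (I : Finset (E3 × ℝ)) : Ko I ⊆ Kc I := fun _ h p hp => (h p hp).le

theorem isClosed_base (a b : E3 × ℝ) (I : Finset (E3 × ℝ)) : IsClosed (base a b I) :=
  (isClosed_aff_eq a).inter ((isClosed_aff_nonneg b).inter (isClosed_Kc I))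

/-- Points of a convex set stay in it when moved towards another of its points. -/
theorem Convex.move_mem {s : Set E3} (hs : Convex ℝ s) {x y : E3} (hx : x ∈ s) (hy : y ∈ s) {t : ℝ}
    (h0 : 0 ≤ t) (h1 : t ≤ 1) : x + t • (y - x) ∈ s :=
  hs.add_smul_sub_mem hx hy ⟨h0, h1⟩

/-- The part of `Kc I` over the polygon with small slope over the hinge is close to the polygon. -/
theorem exists_slope_of_open {a b : E3 × ℝ} {I : Finset (E3 × ℝ)}
    (hb : Bornology.IsBounded (base a b I)) (hne : (base a b I).Nonempty) {U : Set E3}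
    (hU : IsOpen U) (hsub : base a b I ⊆ U) :
    ∃ s > 0, ∀ x ∈ Kc I, 0 ≤ aff b x → |aff a x| ≤ s * aff b x → x ∈ U := by
  have key : ∀ D : Set E3, IsCompact D → (∀ x ∈ D, x ∉ base a b I) →
      ∃ s > 0, ∀ x ∈ D, x ∈ Kc I → 0 ≤ aff b x → ¬ |aff a x| ≤ s * aff b x := by
    intro D hD hdis
    set D' := D ∩ (Kc I ∩ {x | 0 ≤ aff b x}) with hD'
    have hcomp : IsCompact D' := hD.inter_right ((isClosed_Kc I).inter (isClosed_aff_nonneg b))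
    rcases D'.eq_empty_or_nonempty with he | hne
    · refine ⟨1, one_pos, fun x hx hK hbx => ?_⟩
      exact absurd (show x ∈ D' from ⟨hx, hK, hbx⟩) (by simp [he])
    · obtain ⟨x1, hx1, hmin⟩ := hcomp.exists_isMinOn hne (continuous_aff a).abs.continuousOn
      obtain ⟨x2, hx2, hmax⟩ := hcomp.exists_isMaxOn hne (continuous_aff b).continuousOn
      have hpos : 0 < |aff a x1| := by
        rw [abs_pos]; intro h0
        exact hdis x1 hx1.1 ⟨h0, hx1.2.2, hx1.2.1⟩
      have hM : 0 ≤ aff b x2 := hx2.2.2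
      refine ⟨|aff a x1| / (aff b x2 + 1), by positivity, fun x hx hK hbx hle => ?_⟩
      have h1 : |aff a x1| ≤ |aff a x| := hmin (show x ∈ D' from ⟨hx, hK, hbx⟩)
      have h2 : aff b x ≤ aff b x2 := hmax (show x ∈ D' from ⟨hx, hK, hbx⟩)
      have h3 : |aff a x1| / (aff b x2 + 1) * aff b x < |aff a x1| := by
        rw [div_mul_eq_mul_div, div_lt_iff₀ (by linarith)]
        nlinarith
      linarith
  obtain ⟨R, hR⟩ := hb.subset_ball (0 : E3)
  obtain ⟨x0, hx0⟩ := hne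
  obtain ⟨s1, hs1, h1⟩ := key (Metric.sphere 0 R) (isCompact_sphere 0 R) (by
    intro x hx hxb
    have := hR hxb
    rw [Metric.mem_ball] at this; rw [Metric.mem_sphere] at hx; linarith)
  obtain ⟨s2, hs2, h2⟩ := key (Metric.closedBall 0 R \ U) ((isCompact_closedBall 0 R).diff hU)
    (fun x hx hxb => hx.2 (hsub hxb))
  refine ⟨min s1 s2, lt_min hs1 hs2, fun x hK hbx hle => ?_⟩
  by_contra hxU
  have hle1 : |aff a x| ≤ s1 * aff b x :=
    hle.trans (mul_le_mul_of_nonneg_right (min_le_left _ _) hbx)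
  have hle2 : |aff a x| ≤ s2 * aff b x :=
    hle.trans (mul_le_mul_of_nonneg_right (min_le_right _ _) hbx)
  by_cases hxR : x ∈ Metric.closedBall (0 : E3) R
  · exact h2 x ⟨hxR, hxU⟩ hK hbx hle2
  -- the segment from a point of the polygon to `x` crosses the sphere of radius `R`
  have hcont : ContinuousOn (fun t : ℝ => ‖x0 + t • (x - x0)‖) (Icc 0 1) := by fun_prop
  have hmem : R ∈ Icc ‖x0 + (0:ℝ) • (x - x0)‖ ‖x0 + (1:ℝ) • (x - x0)‖ := by
    have := hR hx0
    rw [mem_ball_zero_iff] at this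
    rw [mem_closedBall_zero_iff, not_le] at hxR
    simp only [zero_smul, add_zero, one_smul, add_sub_cancel]
    exact ⟨this.le, hxR.le⟩
  obtain ⟨t, ht, htR⟩ := intermediate_value_Icc (zero_le_one' ℝ) hcont hmem
  refine h1 (x0 + t • (x - x0)) (by simpa using htR) ?_ ?_ ?_
  · exact Convex.move_mem (convex_Kc I) hx0.2.2 hK ht.1 ht.2
  · exact Convex.move_mem (convex_aff_nonneg b) hx0.2.1 hbx ht.1 ht.2
  · rw [aff_move, aff_move, hx0.1, mul_zero, zero_add, abs_mul, abs_of_nonneg ht.1]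
    have h0 : 0 ≤ (1 - t) * aff b x0 := mul_nonneg (by linarith [ht.2]) hx0.2.1
    have := mul_le_mul_of_nonneg_left hle1 ht.1
    nlinarith [mul_nonneg hs1.le h0]

/-- A compact convex set inside a line is a segment; its ends minimise and maximise the coordinate
along the line. -/
theorem exists_segment_of_line {E : Set E3} (hc : IsCompact E) (hconv : Convex ℝ E)
    (hne : E.Nonempty) (d : E3) (hd : ∀ x ∈ E, ∀ y ∈ E, ∃ r : ℝ, y - x = r • d) :
    ∃ X ∈ E, ∃ Y ∈ E, E = segment ℝ X Y ∧ ∀ z ∈ E, ⟪d, X⟫ ≤ ⟪d, z⟫ ∧ ⟪d, z⟫ ≤ ⟪d, Y⟫ := by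
  have hcont : ContinuousOn (fun x : E3 => ⟪d, x⟫) E := by fun_prop
  obtain ⟨X, hX, hmin⟩ := hc.exists_isMinOn hne hcont
  obtain ⟨Y, hY, hmax⟩ := hc.exists_isMaxOn hne hcont
  have hb : ∀ z ∈ E, ⟪d, X⟫ ≤ ⟪d, z⟫ ∧ ⟪d, z⟫ ≤ ⟪d, Y⟫ := fun z hz => ⟨hmin hz, hmax hz⟩
  refine ⟨X, hX, Y, hY, ?_, hb⟩
  apply Subset.antisymm _ (hconv.segment_subset hX hY)
  intro z hz
  obtain ⟨r, hr⟩ := hd X hX z hz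
  obtain ⟨r', hr'⟩ := hd X hX Y hY
  have hz' : z = X + r • d := by rw [← hr]; abel
  have hY' : Y = X + r' • d := by rw [← hr']; abel
  by_cases hd0 : d = 0
  · rw [hz', hd0, smul_zero, add_zero]; exact left_mem_segment _ _ _
  have hdd : 0 < ⟪d, d⟫ := real_inner_self_pos.2 hd0
  have h1 := hb z hz
  rw [hz', hY'] at h1
  simp only [inner_add_right, inner_smul_right] at h1
  have hr0 : 0 ≤ r := by nlinarith
  have hrr : r ≤ r' := by nlinarith
  rw [segment_eq_image']
  rcases hr0.eq_or_lt with h | h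
  · exact ⟨0, by simp, by rw [hz', ← h]; simp⟩
  · have hr'pos : 0 < r' := by linarith
    refine ⟨r / r', ⟨by positivity, (div_le_one hr'pos).2 hrr⟩, ?_⟩
    simp only
    rw [hr', smul_smul, div_mul_cancel₀ _ hr'pos.ne', hz']

variable {a b : E3 × ℝ} {I : Finset (E3 × ℝ)}

theorem ConvexPiece.base_nonempty (hC : ConvexPiece a b I) : (base a b I).Nonempty := by
  obtain ⟨x, h1, h2, h3⟩ := hC.interior_point
  exact ⟨x, h1, h2.le, Ko_subset_Kc I h3⟩

theorem ConvexPiece.isCompact_base (hC : ConvexPiece a b I) : IsCompact (base a b I) :=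
  Metric.isCompact_of_isClosed_isBounded (isClosed_base a b I) hC.bdd

theorem convex_base (a b : E3 × ℝ) (I : Finset (E3 × ℝ)) : Convex ℝ (base a b I) := by
  have h : Convex ℝ {x | aff a x = 0} := by
    intro x hx y hy s t _ _ hst
    simp only [mem_ofPred_eq] at *
    rw [aff_combo a x y hst, hx, hy]; simp
  exact h.inter ((convex_aff_nonneg b).inter (convex_Kc I))

theorem convex_edge (a b : E3 × ℝ) (I : Finset (E3 × ℝ)) (p : E3 × ℝ) :
    Convex ℝ (edge a b I p) := by
  have h : Convex ℝ {x | aff p x = 0} := by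
    intro x hx y hy s t _ _ hst
    simp only [mem_ofPred_eq] at *
    rw [aff_combo p x y hst, hx, hy]; simp
  exact (convex_base a b I).inter h

theorem ConvexPiece.isCompact_edge (hC : ConvexPiece a b I) (p : E3 × ℝ) :
    IsCompact (edge a b I p) :=
  hC.isCompact_base.inter_right (isClosed_aff_eq p)

/-- A point where `a` and all constraints are positive. -/
theorem ConvexPiece.exists_pos (hC : ConvexPiece a b I) : ∃ x, 0 < aff a x ∧ x ∈ Ko I := by
  obtain ⟨x, h1, -, h3⟩ := hC.interior_point
  obtain ⟨t, ht, -, htK⟩ := exists_small_move a.1 ((isOpen_Ko I).mem_nhds h3) one_pos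
  refine ⟨_, ?_, htK⟩
  rw [aff_add_grad, h1, hC.norm_a]; simpa using ht

/-- The planes `a`, `p`, `q` have at most one common point. -/
theorem ConvexPiece.eq_of_two_planes (hC : ConvexPiece a b I) {p q : E3 × ℝ} (hp : p ∈ I)
    (hq : q ∈ I) (hpq : p ≠ q) {x y : E3} (hax : aff a x = 0) (hay : aff a y = 0)
    (hpx : aff p x = 0) (hpy : aff p y = 0) (hqx : aff q x = 0) (hqy : aff q y = 0) : x = y := by
  by_contra hxy
  obtain ⟨α, β, γ, h0, hrel⟩ := exists_pencil_relation a p q hxy hax hay hpx hpy hqx hqy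
  obtain ⟨z, hza, hzK⟩ := hC.exists_pos
  obtain ⟨x0, hx0a, -, hx0K⟩ := hC.interior_point
  rcases pencil_nonneg_combination h0 hrel hza (hzK p hp) (hzK q hq) with
    ⟨s, t, hs, ht, hst, h⟩ | ⟨s, t, hs, ht, hst, h⟩ | ⟨s, t, hs, ht, hst, h⟩
  · have := h x0
    rw [hx0a] at this
    have h1 := hx0K p hp
    have h2 := hx0K q hq
    rcases hs.eq_or_lt with rfl | hs
    · nlinarith [mul_pos (show 0 < t by linarith) h2]
    · nlinarith [mul_pos hs h1, mul_nonneg ht h2.le]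
  · obtain ⟨w, hw, hwa, hwI⟩ := hC.facet p hp
    have h2 := hwI q hq hpq.symm
    have := h w
    rcases hs.eq_or_lt with rfl | hs
    · nlinarith [mul_pos (show 0 < t by linarith) h2]
    · nlinarith [mul_pos hs hwa, mul_nonneg ht h2.le]
  · obtain ⟨w, hw, hwa, hwI⟩ := hC.facet q hq
    have h2 := hwI p hp hpq
    have := h w
    rcases hs.eq_or_lt with rfl | hs
    · nlinarith [mul_pos (show 0 < t by linarith) h2]
    · nlinarith [mul_pos hs hwa, mul_nonneg ht h2.le]

/-- Three distinct planes of an irredundant system have at most one common point. -/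
theorem ConvexPiece.eq_of_three_planes (hC : ConvexPiece a b I) {p q r : E3 × ℝ} (hp : p ∈ I)
    (hq : q ∈ I) (hr : r ∈ I) (hpq : p ≠ q) (hpr : p ≠ r) (hqr : q ≠ r) {x y : E3}
    (hpx : aff p x = 0) (hpy : aff p y = 0) (hqx : aff q x = 0) (hqy : aff q y = 0)
    (hrx : aff r x = 0) (hry : aff r y = 0) : x = y := by
  by_contra hxy
  obtain ⟨α, β, γ, h0, hrel⟩ := exists_pencil_relation p q r hxy hpx hpy hqx hqy hrx hry
  obtain ⟨x0, -, -, hx0K⟩ := hC.interior_point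
  have key : ∀ p q r : E3 × ℝ, p ∈ I → q ∈ I → r ∈ I → q ≠ p → r ≠ p →
      ¬ ∃ s t : ℝ, 0 ≤ s ∧ 0 ≤ t ∧ 0 < s + t ∧ ∀ z, aff p z = s * aff q z + t * aff r z := by
    rintro p q r hp hq hr hqp hrp ⟨s, t, hs, ht, hst, h⟩
    obtain ⟨w, hw, -, hwI⟩ := hC.facet p hp
    have h1 := hwI q hq hqp
    have h2 := hwI r hr hrp
    have := h w
    rcases hs.eq_or_lt with rfl | hs
    · nlinarith [mul_pos (show 0 < t by linarith) h2]
    · nlinarith [mul_pos hs h1, mul_nonneg ht h2.le]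
  rcases pencil_nonneg_combination h0 hrel (hx0K p hp) (hx0K q hq) (hx0K r hr) with h | h | h
  · exact key p q r hp hq hr hpq.symm hpr.symm h
  · exact key q p r hq hp hr hpq hqr.symm h
  · exact key r p q hr hp hq hpr hqr h

/-- The gradients of two functionals with a common zero, one of them vanishing somewhere where
the other does not, and not identically zero, are independent. -/
theorem linearIndependent_grad {p q : E3 × ℝ} {x y z : E3} (hpx : aff p x = 0) (hqx : aff q x = 0)
    (hpy : aff p y = 0) (hqy : aff q y ≠ 0) (hpz : aff p z ≠ 0) :
    LinearIndependent ℝ ![p.1, q.1] := by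
  rw [LinearIndependent.pair_iff]
  intro s t h
  have hval : ∀ w, s * aff p w + t * aff q w = 0 := by
    intro w
    have h1 := inner_sub_eq_aff p x w
    have h2 := inner_sub_eq_aff q x w
    rw [hpx, sub_zero] at h1
    rw [hqx, sub_zero] at h2
    rw [← h1, ← h2, ← real_inner_smul_left, ← real_inner_smul_left, ← inner_add_left, h,
      inner_zero_left]
  have ht : t = 0 := by
    have := hval y
    rw [hpy, mul_zero, zero_add] at this
    exact (mul_eq_zero.1 this).resolve_right hqy
  refine ⟨?_, ht⟩
  have := hval z
  rw [ht, zero_mul, add_zero] at this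
  exact (mul_eq_zero.1 this).resolve_right hpz

theorem ConvexPiece.linearIndependent_pair (hC : ConvexPiece a b I) {p q : E3 × ℝ} (hp : p ∈ I)
    (hq : q ∈ I) (hpq : p ≠ q) {x : E3} (hpx : aff p x = 0) (hqx : aff q x = 0) :
    LinearIndependent ℝ ![p.1, q.1] := by
  obtain ⟨w, hw, -, hwI⟩ := hC.facet p hp
  obtain ⟨x0, -, -, hx0K⟩ := hC.interior_point
  exact linearIndependent_grad hpx hqx hw (hwI q hq hpq.symm).ne' (hx0K p hp).ne'

theorem ConvexPiece.linearIndependent_face (hC : ConvexPiece a b I) {p : E3 × ℝ} (hp : p ∈ I) :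
    LinearIndependent ℝ ![p.1, a.1] := by
  obtain ⟨z, hz, -⟩ := hC.touch p hp
  obtain ⟨x0, h1, -, hx0K⟩ := hC.interior_point
  obtain ⟨w, hw, hwa, -⟩ := hC.facet p hp
  exact linearIndependent_grad hz.2 hz.1.1 hw hwa.ne' (hx0K p hp).ne'

theorem ConvexPiece.exists_edge_eq_segment (hC : ConvexPiece a b I) {p : E3 × ℝ} (hp : p ∈ I) :
    ∃ X Y, edge a b I p = segment ℝ X Y := by
  obtain ⟨z, hz, -⟩ := hC.touch p hp
  obtain ⟨d, hd, hpd, had⟩ := exists_ne_zero_orthogonal p.1 a.1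
  obtain ⟨X, -, Y, -, h, -⟩ := exists_segment_of_line (hC.isCompact_edge p) (convex_edge a b I p)
    ⟨z, hz⟩ d (by
      intro x hx y hy
      refine exists_eq_smul_of_orthogonal (hC.linearIndependent_face hp) hd hpd had ?_ ?_
      · rw [inner_sub_eq_aff, hx.2, hy.2, sub_zero]
      · rw [inner_sub_eq_aff, hx.1.1, hy.1.1, sub_zero])
  exact ⟨X, Y, h⟩

/-- A step from a point of `Kc I` into a direction respecting the active constraints. -/
theorem eventually_move_mem_Kc {X d : E3} (hX : X ∈ Kc I)
    (hd : ∀ q ∈ I, aff q X = 0 → 0 ≤ ⟪q.1, d⟫) :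
    ∀ᶠ e in 𝓝[>] (0 : ℝ), X + e • d ∈ Kc I := by
  have : ∀ᶠ e in 𝓝[>] (0 : ℝ), ∀ q ∈ I, 0 ≤ aff q (X + e • d) := by
    rw [Finset.eventually_all]
    intro q hq
    rcases (hX q hq).eq_or_lt with h0 | h0
    · filter_upwards [self_mem_nhdsWithin] with e he
      rw [aff_add_smul, ← h0, zero_add]
      exact mul_nonneg (le_of_lt he) (hd q hq h0.symm)
    · exact ((eventually_move (eventually_aff_pos h0)).filter_mono nhdsWithin_le_nhds).mono
        fun e he => he.le
  exact this

/-- Rotating the segment towards an interior point around a boundary point `X` of the polygon, in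
the direction `v`, until the first constraint becomes active, produces a side at `X`. -/
theorem ConvexPiece.exists_side (hC : ConvexPiece a b I) {X v : E3} {j : E3 × ℝ} (hj : j ∈ I)
    (hX : X ∈ base a b I) (hbX : 0 < aff b X) (hjX : aff j X = 0) (hav : ⟪a.1, v⟫ = 0)
    (hjv : ⟪j.1, v⟫ = 0) (hk : ∃ k ∈ I, aff k X = 0 ∧ ⟪k.1, v⟫ < 0) :
    ∃ k ∈ I, aff k X = 0 ∧ ⟪k.1, v⟫ < 0 ∧ ∃ Z ∈ edge a b I k, 0 < aff j Z := by
  classical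
  obtain ⟨x0, hx0a, hx0b, hx0K⟩ := hC.interior_point
  set A := I.filter (fun k => aff k X = 0 ∧ ⟪k.1, v⟫ < 0) with hA
  have hAne : A.Nonempty := by
    obtain ⟨k, hk, h⟩ := hk
    exact ⟨k, by simp [hA, hk, h]⟩
  obtain ⟨k, hkA, hmin⟩ := A.exists_min_image (fun k => aff k x0 / (-⟪k.1, v⟫)) hAne
  obtain ⟨hkI, hkX, hkv⟩ := by simpa [hA] using hkA
  set t := aff k x0 / (-⟪k.1, v⟫) with ht
  have ht0 : 0 ≤ t := div_nonneg (hx0K k hkI).le (by linarith)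
  set d := (x0 - X) + t • v with hd
  have hin : ∀ q : E3 × ℝ, ⟪q.1, d⟫ = aff q x0 - aff q X + t * ⟪q.1, v⟫ := by
    intro q; rw [hd, inner_add_right, inner_sub_eq_aff, inner_smul_right]
  have hact : ∀ q ∈ I, aff q X = 0 → 0 ≤ ⟪q.1, d⟫ := by
    intro q hq hqX
    rw [hin, hqX, sub_zero]
    by_cases hqv : ⟪q.1, v⟫ < 0
    · have := hmin q (by simp [hA, hq, hqX, hqv])
      rw [le_div_iff₀ (by linarith)] at this
      linarith
    · have := hx0K q hq
      have := mul_nonneg ht0 (not_lt.1 hqv)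
      linarith
  have hev := eventually_move_mem_Kc hX.2.2 hact
  have hevb := (eventually_move (w := d) (eventually_aff_pos hbX)).filter_mono
    (nhdsWithin_le_nhds (s := Ioi 0))
  obtain ⟨e, ⟨he1, he2⟩, he0⟩ := ((hev.and hevb).and self_mem_nhdsWithin).exists
  have he0 : 0 < e := he0
  refine ⟨k, hkI, hkX, hkv, X + e • d, ⟨⟨?_, he2.le, he1⟩, ?_⟩, ?_⟩
  · rw [aff_add_smul, hin, hX.1, hx0a, hav]; ring
  · rw [aff_add_smul, hin, hkX, ht]
    have : ⟪k.1, v⟫ ≠ 0 := hkv.ne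
    field_simp; ring
  · rw [aff_add_smul, hin, hjX, hjv]
    have := mul_pos he0 (hx0K j hj)
    linarith

/-- The data at an end `X` of the side `[X, Y]` of the polygon in the plane `p`: a functional `q`
vanishing at `X` and positive at `Y`, which is the neighbouring side if `X` is off the hinge
and the hinge functional `b` otherwise, and the direction `f` of the line `p = q = 0`, normalised by
`⟪a.1, f⟫ = 1`, along which the corner moves (a corner on the hinge does not move). -/
structure Corner (a b : E3 × ℝ) (I : Finset (E3 × ℝ)) (p : E3 × ℝ) (X Y f : E3) (q : E3 × ℝ) :
    Prop where
  left_mem : X ∈ edge a b I p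
  right_mem : Y ∈ edge a b I p
  af : ⟪a.1, f⟫ = 1
  pf : aff b X = 0 ∨ ⟪p.1, f⟫ = 0
  qf : aff b X = 0 ∨ ⟪q.1, f⟫ = 0
  qX : aff q X = 0
  qY : 0 < aff q Y
  other : ∀ k ∈ I, k ≠ p → aff k X = 0 → 0 < aff k Y
  kind : (aff b X = 0 ∧ q = b) ∨ (0 < aff b X ∧ q ∈ I ∧ q ≠ p ∧ ∃ Z ∈ edge a b I q, Z ≠ X)

/-- A side of positive length has a corner at each end; off the hinge, the second side of the corner is
found by turning around `X`. -/
theorem ConvexPiece.exists_corner (hC : ConvexPiece a b I) {p : E3 × ℝ} (hp : p ∈ I) {X Y : E3}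
    (hE : edge a b I p = segment ℝ X Y) (hXY : X ≠ Y) : ∃ f q, Corner a b I p X Y f q := by
  have hX : X ∈ edge a b I p := hE ▸ left_mem_segment ℝ X Y
  have hY : Y ∈ edge a b I p := hE ▸ right_mem_segment ℝ X Y
  have hother : ∀ k ∈ I, k ≠ p → aff k X = 0 → 0 < aff k Y := by
    intro k hk hkp hkX
    refine lt_of_le_of_ne (hY.1.2.2 k hk) fun h => hXY ?_
    exact hC.eq_of_two_planes hp hk hkp.symm hX.1.1 hY.1.1 hX.2 hY.2 hkX h.symm
  rcases hX.1.2.1.eq_or_lt with hb0 | hb0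
  · refine ⟨a.1, b, hX, hY, ?_, Or.inl hb0.symm, Or.inl hb0.symm, hb0.symm, ?_, hother,
      Or.inl ⟨hb0.symm, rfl⟩⟩
    · rw [real_inner_self_eq_norm_sq, hC.norm_a]; norm_num
    · obtain ⟨z, hz, hbz⟩ := hC.touch p hp
      rw [hE] at hz
      obtain ⟨s, t, hs, ht, hst, rfl⟩ := hz
      rw [aff_combo b X Y hst, ← hb0] at hbz
      by_contra hneg
      have := mul_nonneg ht (neg_nonneg.2 (not_lt.1 hneg))
      linarith
  · -- the side does not extend beyond `X`, so some constraint stops it there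
    have hv : ∃ k ∈ I, aff k X = 0 ∧ ⟪k.1, X - Y⟫ < 0 := by
      by_contra! hcon
      have hev := eventually_move_mem_Kc hX.1.2.2 hcon
      have hevb := (eventually_move (w := X - Y) (eventually_aff_pos hb0)).filter_mono
        (nhdsWithin_le_nhds (s := Ioi 0))
      obtain ⟨e, ⟨he1, he2⟩, he0⟩ := ((hev.and hevb).and self_mem_nhdsWithin).exists
      have he0 : 0 < e := he0
      have hmem : X + e • (X - Y) ∈ edge a b I p := by
        refine ⟨⟨?_, he2.le, he1⟩, ?_⟩
        · rw [aff_add_smul, inner_sub_eq_aff, hX.1.1, hY.1.1]; ring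
        · rw [aff_add_smul, inner_sub_eq_aff, hX.2, hY.2]; ring
      rw [hE, segment_eq_image'] at hmem
      obtain ⟨t, ht, h⟩ := hmem
      have h2 : (e + t) • (X - Y) = 0 := by
        have h : X + t • (Y - X) = X + e • (X - Y) := h
        have : (e + t) • (X - Y) = X + e • (X - Y) - (X + t • (Y - X)) := by module
        rw [this, h, sub_self]
      rcases smul_eq_zero.1 h2 with h3 | h3
      · linarith [ht.1]
      · exact hXY (sub_eq_zero.1 h3)
    obtain ⟨q, hq, hqX, hqv, Z, hZ, hpZ⟩ := hC.exists_side hp hX.1 hb0 hX.2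
      (by rw [inner_sub_eq_aff, hX.1.1, hY.1.1, sub_zero])
      (by rw [inner_sub_eq_aff, hX.2, hY.2, sub_zero]) hv
    have hqp : q ≠ p := by
      rintro rfl
      rw [inner_sub_eq_aff, hX.2, hY.2] at hqv
      linarith
    obtain ⟨d, hd, hpd, hqd⟩ := exists_ne_zero_orthogonal p.1 q.1
    have had : ⟪a.1, d⟫ ≠ 0 := by
      intro h
      have hmv : ∀ r : E3 × ℝ, aff r X = 0 → ⟪r.1, d⟫ = 0 → aff r (X + d) = 0 := by
        intro r h1 h2; rw [aff_add_vec, h1, h2, add_zero]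
      have := hC.eq_of_two_planes hp hq hqp.symm hX.1.1 (hmv a hX.1.1 h) hX.2 (hmv p hX.2 hpd)
        hqX (hmv q hqX hqd)
      exact hd (left_eq_add.1 this)
    refine ⟨(⟪a.1, d⟫)⁻¹ • d, q, hX, hY, ?_, Or.inr ?_, Or.inr ?_, hqX, hother q hq hqp hqX, hother,
      Or.inr ⟨hb0, hq, hqp, Z, hZ, ?_⟩⟩
    · rw [inner_smul_right, inv_mul_cancel₀ had]
    · rw [inner_smul_right, hpd, mul_zero]
    · rw [inner_smul_right, hqd, mul_zero]
    · rintro rfl; rw [hX.2] at hpZ; exact lt_irrefl _ hpZ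

/-- At a corner off the hinge, every affine functional is determined by its value at the corner, its
growth along the two sides and its growth along the third direction `f`. -/
theorem ConvexPiece.corner_aff (hC : ConvexPiece a b I) {p : E3 × ℝ} (hp : p ∈ I) {X Y f : E3}
    {q : E3 × ℝ} (hc : Corner a b I p X Y f q) (hbX : 0 < aff b X) :
    q ∈ I ∧ q ≠ p ∧ ∃ Z ∈ edge a b I q, Z ≠ X ∧ 0 < aff p Z ∧
      (∀ k ∈ I, k ≠ q → aff k X = 0 → 0 < aff k Z) ∧
      ∀ (k : E3 × ℝ) (y : E3), aff k y = aff k X + aff q y / aff q Y * (aff k Y - aff k X) +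
        aff p y / aff p Z * (aff k Z - aff k X) + aff a y * ⟪k.1, f⟫ := by
  obtain ⟨hq, hqp, Z, hZ, hZX⟩ : q ∈ I ∧ q ≠ p ∧ ∃ Z ∈ edge a b I q, Z ≠ X := by
    rcases hc.kind with h | h
    · exact absurd h.1 hbX.ne'
    · exact h.2
  have hX := hc.left_mem
  have hY := hc.right_mem
  have hother : ∀ k ∈ I, k ≠ q → aff k X = 0 → 0 < aff k Z := by
    intro k hk hkq hkX
    refine lt_of_le_of_ne (hZ.1.2.2 k hk) fun h => hZX.symm ?_
    exact hC.eq_of_two_planes hq hk hkq.symm hX.1.1 hZ.1.1 hc.qX hZ.2 hkX h.symm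
  have hpZ : 0 < aff p Z := hother p hp hqp.symm hX.2
  refine ⟨hq, hqp, Z, hZ, hZX, hpZ, hother, fun k y => ?_⟩
  have hpf : ⟪p.1, f⟫ = 0 := hc.pf.resolve_left hbX.ne'
  have hqf : ⟪q.1, f⟫ = 0 := hc.qf.resolve_left hbX.ne'
  have hli : LinearIndependent ℝ ![a.1, p.1, q.1] := by
    rw [Fintype.linearIndependent_iff]
    intro c hsum
    rw [Fin.sum_univ_three] at hsum
    simp only [Matrix.cons_val_zero, Matrix.cons_val_one, Matrix.cons_val_two, Matrix.head_cons,
      Matrix.tail_cons] at hsum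
    have hin : ∀ w : E3, c 0 * ⟪a.1, w⟫ + c 1 * ⟪p.1, w⟫ + c 2 * ⟪q.1, w⟫ = 0 := by
      intro w
      rw [← real_inner_smul_left, ← real_inner_smul_left, ← real_inner_smul_left,
        ← inner_add_left, ← inner_add_left, hsum, inner_zero_left]
    have h0 := hin f
    have h1 := hin (Z - X)
    have h2 := hin (Y - X)
    simp only [inner_sub_eq_aff, hc.af, hpf, hqf, hX.1.1, hY.1.1, hZ.1.1, hX.2, hY.2, hZ.2, hc.qX,
      sub_zero, mul_zero, add_zero, zero_add, mul_one] at h0 h1 h2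
    have e1 := (mul_eq_zero.1 h1).resolve_right hpZ.ne'
    have e2 := (mul_eq_zero.1 h2).resolve_right hc.qY.ne'
    intro i; fin_cases i
    exacts [h0, e1, e2]
  -- up to scaling, `Y - X`, `Z - X` and `f` form the basis dual to the normals of `q`, `p`, `a`
  have hz : y - X - ((aff q y / aff q Y) • (Y - X) + (aff p y / aff p Z) • (Z - X) +
      aff a y • f) = 0 := by
    apply eq_zero_of_orthogonal hli
    have hqY := hc.qY.ne'
    have hpZ' := hpZ.ne'
    intro i; fin_cases i
    · simp only [Fin.zero_eta, Matrix.cons_val_zero, inner_sub_right _ (y - X), inner_add_right,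
        inner_smul_right, inner_sub_eq_aff, hc.af, hX.1.1, hY.1.1, hZ.1.1]
      ring
    · simp only [Fin.mk_one, Matrix.cons_val_one, Matrix.cons_val_zero, inner_sub_right _ (y - X),
        inner_add_right, inner_smul_right, inner_sub_eq_aff, hpf, hX.2, hY.2]
      field_simp; ring
    · simp only [Fin.reduceFinMk, Matrix.cons_val, inner_sub_right _ (y - X),
        inner_add_right, inner_smul_right, inner_sub_eq_aff, hqf, hc.qX, hZ.2]
      field_simp; ring
  have := congrArg (fun w => ⟪k.1, w⟫) hz
  simp only [inner_sub_right _ (y - X), inner_add_right, inner_smul_right, inner_sub_eq_aff,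
    inner_zero_right] at this
  linarith

/-- Planes other than those of the two sides bend away from the third direction at a corner. -/
theorem ConvexPiece.corner_inner_neg (hC : ConvexPiece a b I) {p : E3 × ℝ} (hp : p ∈ I)
    {X Y f : E3} {q : E3 × ℝ} (hc : Corner a b I p X Y f q) (hbX : 0 < aff b X) {k : E3 × ℝ}
    (hk : k ∈ I) (hkp : k ≠ p) (hkq : k ≠ q) (hkX : aff k X = 0) : ⟪k.1, f⟫ < 0 := by
  obtain ⟨hq, hqp, Z, hZ, hZX, hpZ, hotherZ, hval⟩ := hC.corner_aff hp hc hbX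
  obtain ⟨w, hw, hwa, hwI⟩ := hC.facet k hk
  have h := hval k w
  rw [hw, hkX, sub_zero, sub_zero, zero_add] at h
  have h1 : 0 < aff q w / aff q Y * aff k Y :=
    mul_pos (div_pos (hwI q hq hkq.symm) hc.qY) (hc.other k hk hkp hkX)
  have h2 : 0 < aff p w / aff p Z * aff k Z :=
    mul_pos (div_pos (hwI p hp hkp.symm) hpZ) (hotherZ k hk hkq hkX)
  by_contra hneg
  have := mul_nonneg hwa.le (not_lt.1 hneg)
  linarith

/-- A plane touching the polygon only in a vertex `X` meets a corner formed by two other planes. -/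
theorem ConvexPiece.exists_corner_of_subsingleton (hC : ConvexPiece a b I) {j : E3 × ℝ} (hj : j ∈ I)
    {X : E3} (hE : edge a b I j = {X}) :
    0 < aff b X ∧ ∃ p ∈ I, ∃ Y f q, edge a b I p = segment ℝ X Y ∧ X ≠ Y ∧
      Corner a b I p X Y f q ∧ p ≠ j ∧ q ≠ j := by
  have hX : X ∈ edge a b I j := by rw [hE]; rfl
  have hbX : 0 < aff b X := by
    obtain ⟨z, hz, hbz⟩ := hC.touch j hj
    rw [hE] at hz; rwa [← mem_singleton_iff.1 hz]
  refine ⟨hbX, ?_⟩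
  obtain ⟨v, hv, hav, hjv⟩ := exists_ne_zero_orthogonal a.1 j.1
  have hk : ∃ k ∈ I, aff k X = 0 ∧ ⟪k.1, v⟫ < 0 := by
    by_contra! hcon
    have hev := eventually_move_mem_Kc hX.1.2.2 hcon
    have hevb := (eventually_move (w := v) (eventually_aff_pos hbX)).filter_mono
      (nhdsWithin_le_nhds (s := Ioi 0))
    obtain ⟨e, ⟨he1, he2⟩, he0⟩ := ((hev.and hevb).and self_mem_nhdsWithin).exists
    have he0 : 0 < e := he0
    have hmem : X + e • v ∈ edge a b I j := by
      refine ⟨⟨?_, he2.le, he1⟩, ?_⟩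
      · rw [aff_add_smul, hX.1.1, hav]; ring
      · rw [aff_add_smul, hX.2, hjv]; ring
    rw [hE, mem_singleton_iff, add_eq_left, smul_eq_zero] at hmem
    exact hmem.elim he0.ne' hv
  -- turning from the plane `j` around `X` leads to a side at `X`
  obtain ⟨p, hp, hpX, -, Z, hZ, hjZ⟩ := hC.exists_side hj hX.1 hbX hX.2 hav hjv hk
  have hpj : p ≠ j := by rintro rfl; exact hjZ.ne' hZ.2
  have hXp : X ∈ edge a b I p := ⟨hX.1, hpX⟩
  obtain ⟨X1, Y1, hseg⟩ := hC.exists_edge_eq_segment hp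
  have hX1 : X1 ∈ edge a b I p := hseg ▸ left_mem_segment ℝ X1 Y1
  have hY1 : Y1 ∈ edge a b I p := hseg ▸ right_mem_segment ℝ X1 Y1
  have huniq : ∀ x ∈ base a b I, aff j x = 0 → x = X := by
    intro x hx h
    have : x ∈ edge a b I j := ⟨hx, h⟩
    rwa [hE] at this
  -- `X` is an end of this side, as `j` is nonnegative on it and vanishes only at `X`
  have hend : X = X1 ∨ X = Y1 := by
    have hXp' := hXp
    rw [hseg, segment_eq_image'] at hXp'
    obtain ⟨t, ⟨ht0, ht1⟩, hXt⟩ := hXp'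
    have hXt : X1 + t • (Y1 - X1) = X := hXt
    have hval := aff_move j X1 Y1 t
    rw [hXt, hX.2] at hval
    have h1 := hX1.1.2.2 j hj
    have h2 := hY1.1.2.2 j hj
    rcases ht0.eq_or_lt with rfl | ht0
    · left; simpa using hXt.symm
    · right
      have : aff j Y1 = 0 := by
        have := mul_nonneg (by linarith : 0 ≤ 1 - t) h1
        have h3 := mul_nonneg ht0.le h2
        exact (mul_eq_zero.1 (by linarith : t * aff j Y1 = 0)).resolve_left ht0.ne'
      exact (huniq Y1 hY1.1 this).symm
  have fin : ∀ Y, edge a b I p = segment ℝ X Y → ∃ p ∈ I, ∃ Y f q, edge a b I p = segment ℝ X Y ∧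
      X ≠ Y ∧ Corner a b I p X Y f q ∧ p ≠ j ∧ q ≠ j := by
    intro Y hseg
    have hXY : X ≠ Y := by
      rintro rfl
      rw [hseg, segment_same, mem_singleton_iff] at hZ
      rw [hZ, hX.2] at hjZ; exact lt_irrefl _ hjZ
    obtain ⟨f, q, hc⟩ := hC.exists_corner hp hseg hXY
    refine ⟨p, hp, Y, f, q, hseg, hXY, hc, hpj, ?_⟩
    rintro rfl
    obtain ⟨-, -, Z', hZ', hne, -⟩ := hC.corner_aff hp hc hbX
    exact hne (huniq Z' hZ'.1 hZ'.2)
  rcases hend with rfl | rfl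
  · exact fin _ hseg
  · exact fin X1 (hseg.trans (segment_symm ℝ _ _))

end

section

/-! ### One-dimensional measure of sets lying on finitely many planes -/

/-- Length, as one-dimensional Hausdorff measure. -/
noncomputable abbrev lenM : Measure E3 := Measure.hausdorffMeasure 1

instance : NullSingletonClass lenM := Measure.nullSingletonClass_hausdorff E3 one_pos

theorem lenM_segment (X Y : E3) : lenM (segment ℝ X Y) = ENNReal.ofReal ‖X - Y‖ := by
  rw [lenM, hausdorffMeasure_segment, edist_dist, dist_eq_norm]

theorem lenM_openSegment (X Y : E3) : lenM (openSegment ℝ X Y) = ENNReal.ofReal ‖X - Y‖ := by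
  rw [← lenM_segment]
  apply le_antisymm (measure_mono (openSegment_subset_segment ℝ X Y))
  rw [← insert_endpoints_openSegment]
  refine (measure_mono (t := openSegment ℝ X Y ∪ {X, Y}) ?_).trans ((measure_union_le _ _).trans ?_)
  · intro z; simp only [mem_insert_iff, mem_union, mem_singleton_iff]; tauto
  · rw [(Set.toFinite {X, Y}).measure_zero, add_zero]

open Classical in
/-- The number of functionals of `I` vanishing at `x`. -/
noncomputable def activeCount (I : Finset (E3 × ℝ)) (x : E3) : ℕ := (I.filter (aff · x = 0)).card

theorem activeCount_eq_sum (I : Finset (E3 × ℝ)) (x : E3) :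
    (activeCount I x : ENNReal) = ∑ p ∈ I, {y | aff p y = 0}.indicator (fun _ => (1 : ENNReal)) x := by
  classical
  simp only [activeCount, Set.indicator_apply, mem_ofPred_eq, Finset.sum_boole]

theorem measurable_activeCount (I : Finset (E3 × ℝ)) :
    Measurable (fun x => (activeCount I x : ENNReal)) := by
  simp only [activeCount_eq_sum]
  exact Finset.measurable_sum _ fun p _ =>
    measurable_const.indicator (isClosed_aff_eq p).measurableSet

theorem sum_lenM_inter (I : Finset (E3 × ℝ)) (A : Set E3) :
    ∑ p ∈ I, lenM (A ∩ {x | aff p x = 0}) = ∫⁻ x in A, (activeCount I x : ENNReal) ∂lenM := by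
  simp only [activeCount_eq_sum]
  rw [lintegral_finsetSum]
  · refine Finset.sum_congr rfl fun p _ => ?_
    rw [lintegral_indicator_const (isClosed_aff_eq p).measurableSet,
      Measure.restrict_apply (isClosed_aff_eq p).measurableSet, inter_comm, one_mul]
  · exact fun p _ => measurable_const.indicator (isClosed_aff_eq p).measurableSet

theorem sum_lenM_inter_le {I : Finset (E3 × ℝ)} {A : Set E3} {n : ℕ}
    (h : lenM {x ∈ A | n < activeCount I x} = 0) :
    ∑ p ∈ I, lenM (A ∩ {x | aff p x = 0}) ≤ n * lenM A := by
  rw [sum_lenM_inter, ← setLIntegral_const]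
  apply lintegral_mono_ae
  rw [ae_iff, Measure.restrict_apply]
  · convert h using 2; ext x; simp [and_comm]
  · have := measurableSet_lt measurable_const (measurable_activeCount I) (f := fun _ => (n : ENNReal))
    convert this using 1; ext x; simp

theorem le_sum_lenM_inter {I : Finset (E3 × ℝ)} {A : Set E3} {n : ℕ}
    (h : ∀ x ∈ A, n ≤ activeCount I x) :
    n * lenM A ≤ ∑ p ∈ I, lenM (A ∩ {x | aff p x = 0}) := by
  rw [sum_lenM_inter, ← setLIntegral_const]
  apply lintegral_mono_ae
  rw [ae_iff, Measure.restrict_apply]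
  · convert measure_empty (μ := lenM) using 2
    ext x
    simp only [mem_inter_iff, mem_ofPred_eq, mem_empty_iff_false, iff_false, not_and, Nat.cast_le,
      not_le]
    exact fun h1 h2 => absurd (h x h2) (by omega)
  · have := measurableSet_lt (measurable_activeCount I) measurable_const (g := fun _ => (n : ENNReal))
    convert this using 1; ext x; simp

/-- Points lying on more than `n` planes form a null set if any `n + 1` planes meet in at most one
point. -/
theorem lenM_eq_zero_of_subsets {I : Finset (E3 × ℝ)} {A : Set E3} {n : ℕ}
    (h : ∀ J ⊆ I, J.card = n + 1 → {x ∈ A | ∀ p ∈ J, aff p x = 0}.Subsingleton) :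
    lenM {x ∈ A | n < activeCount I x} = 0 := by
  classical
  have hsub : {x ∈ A | n < activeCount I x} ⊆
      ⋃ J ∈ I.powerset.filter (fun J => J.card = n + 1), {x ∈ A | ∀ p ∈ J, aff p x = 0} := by
    rintro x ⟨hxA, hx⟩
    obtain ⟨J, hJ, hJc⟩ := Finset.exists_subset_card_eq (n := n + 1) (s := I.filter (aff · x = 0)) hx
    simp only [mem_iUnion]
    refine ⟨J, ?_, hxA, fun p hp => (Finset.mem_filter.1 (hJ hp)).2⟩
    simp only [Finset.mem_filter, Finset.mem_powerset]
    exact ⟨hJ.trans (Finset.filter_subset _ _), hJc⟩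
  refine measure_mono_null hsub ((measure_biUnion_null_iff (Finset.countable_toSet _)).2 ?_)
  intro J hJ
  simp only [Finset.coe_filter, Finset.mem_powerset, mem_ofPred_eq] at hJ
  exact (h J hJ.1 hJ.2).measure_zero _

/-! ### Moving corners -/

/-- The coefficient of the displacement of a corner. -/
noncomputable def shift (b : E3 × ℝ) (X f : E3) (s : ℝ) : ℝ := s * aff b X / (1 - s * ⟪b.1, f⟫)

/-- The position of the corner `X` once the plane `a = 0` has been rotated to `a = s b`: the point of
the line through `X` with direction `f` in the rotated plane. -/
noncomputable def pos (b : E3 × ℝ) (X f : E3) (s : ℝ) : E3 := X + shift b X f s • f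

variable {a b : E3 × ℝ} {I : Finset (E3 × ℝ)}

theorem eventually_denom (b : E3 × ℝ) (f : E3) : ∀ᶠ s in 𝓝 (0 : ℝ),
    1 / 2 < 1 - s * ⟪b.1, f⟫ ∧ 1 - s * ⟪b.1, f⟫ < 2 := by
  have hc : Continuous fun s : ℝ => 1 - s * ⟪b.1, f⟫ := by fun_prop
  have := hc.tendsto 0
  simp only [zero_mul, sub_zero] at this
  exact (this.eventually_const_lt (by norm_num)).and (this.eventually_lt_const (by norm_num))

theorem differentiableAt_shift (b : E3 × ℝ) (X f : E3) : DifferentiableAt ℝ (shift b X f) 0 := by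
  unfold shift
  refine DifferentiableAt.div (by fun_prop) (by fun_prop) (by simp)

@[simp] theorem shift_zero (b : E3 × ℝ) (X f : E3) : shift b X f 0 = 0 := by simp [shift]

@[simp] theorem pos_zero (b : E3 × ℝ) (X f : E3) : pos b X f 0 = X := by simp [pos]

theorem differentiableAt_pos (b : E3 × ℝ) (X f : E3) : DifferentiableAt ℝ (pos b X f) 0 := by
  unfold pos
  exact ((differentiableAt_shift b X f).smul_const f).const_add X

theorem tendsto_pos (b : E3 × ℝ) (X f : E3) : Tendsto (pos b X f) (𝓝 0) (𝓝 X) := by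
  simpa using (differentiableAt_pos b X f).continuousAt.tendsto

theorem eventually_pos_aff {k b : E3 × ℝ} {X f : E3} (h : 0 < aff k X) :
    ∀ᶠ s in 𝓝 (0 : ℝ), 0 < aff k (pos b X f s) :=
  (tendsto_pos b X f).eventually (eventually_aff_pos h)

theorem shift_eq_zero {X f : E3} (h : aff b X = 0) (s : ℝ) : shift b X f s = 0 := by
  simp [shift, h]

theorem aff_pos (k b : E3 × ℝ) (X f : E3) (s : ℝ) :
    aff k (pos b X f s) = aff k X + shift b X f s * ⟪k.1, f⟫ := by rw [pos, aff_add_smul]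

theorem norm_pos_sub (b : E3 × ℝ) (X f : E3) (s : ℝ) :
    ‖X - pos b X f s‖ = |shift b X f s| * ‖f‖ := by
  rw [pos, sub_add_cancel_left, norm_neg, norm_smul, Real.norm_eq_abs]

section corner
variable {p q : E3 × ℝ} {X Y f : E3} {s : ℝ}

theorem Corner.aff_p_pos (hc : Corner a b I p X Y f q) (s : ℝ) : aff p (pos b X f s) = 0 := by
  rw [aff_pos, hc.left_mem.2]
  rcases hc.pf with h | h
  · rw [shift_eq_zero h]; simp
  · rw [h]; simp

theorem Corner.aff_q_pos (hc : Corner a b I p X Y f q) (s : ℝ) : aff q (pos b X f s) = 0 := by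
  rw [aff_pos, hc.qX]
  rcases hc.qf with h | h
  · rw [shift_eq_zero h]; simp
  · rw [h]; simp

theorem Corner.aff_a_pos (hc : Corner a b I p X Y f q) (hs : 0 < 1 - s * ⟪b.1, f⟫) :
    aff a (pos b X f s) = s * aff b (pos b X f s) := by
  rw [aff_pos, aff_pos, hc.left_mem.1.1, hc.af, shift]
  field_simp; ring

theorem Corner.shift_nonneg (hc : Corner a b I p X Y f q) (hs : 0 < 1 - s * ⟪b.1, f⟫)
    (h0 : 0 ≤ s) : 0 ≤ shift b X f s :=
  div_nonneg (mul_nonneg h0 hc.left_mem.1.2.1) hs.le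

theorem Corner.shift_nonpos (hc : Corner a b I p X Y f q) (hs : 0 < 1 - s * ⟪b.1, f⟫)
    (h0 : s ≤ 0) : shift b X f s ≤ 0 :=
  div_nonpos_of_nonpos_of_nonneg (mul_nonpos_of_nonpos_of_nonneg h0 hc.left_mem.1.2.1) hs.le

/-- Corners move monotonically along their lines. -/
theorem pos_mem_segment {s' : ℝ}
    (hs : 0 < 1 - s * ⟪b.1, f⟫) (hs' : 0 < 1 - s' * ⟪b.1, f⟫) (h : s < s') (h0 : s' ≤ 0) :
    pos b X f s' ∈ segment ℝ X (pos b X f s) := by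
  rw [segment_eq_image']
  have hsn : s < 0 := by linarith
  refine ⟨s' * (1 - s * ⟪b.1, f⟫) / (s * (1 - s' * ⟪b.1, f⟫)), ⟨?_, ?_⟩, ?_⟩
  · exact div_nonneg_of_nonpos (mul_nonpos_of_nonpos_of_nonneg h0 hs.le)
      (mul_nonpos_of_nonpos_of_nonneg hsn.le hs'.le)
  · rw [div_le_one_of_neg (mul_neg_of_neg_of_pos hsn hs')]
    nlinarith
  · simp only [pos, add_sub_cancel_left, smul_smul, shift]
    congr 2
    have := hs.ne'; have := hs'.ne'; have := hsn.ne
    field_simp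

end corner

theorem eventually_linearIndependent {u : E3} (h : LinearIndependent ℝ ![u, a.1]) (b : E3 × ℝ) :
    ∀ᶠ s in 𝓝 (0 : ℝ), LinearIndependent ℝ ![u, (a - s • b).1] := by
  have hopen := isOpen_setOfPred_linearIndependent (𝕜 := ℝ) (E := E3) (ι := Fin 2)
  have hcont : Continuous fun s : ℝ => ![u, (a - s • b).1] := by
    refine continuous_pi fun i => ?_
    fin_cases i
    · exact continuous_const
    · simp only [Prod.fst_sub, Prod.smul_fst]
      fun_prop
  have : (fun s : ℝ => ![u, (a - s • b).1]) 0 ∈ {f : Fin 2 → E3 | LinearIndependent ℝ f} := by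
    simpa using h
  exact hcont.continuousAt.preimage_mem_nhds (hopen.mem_nhds this)

theorem aff_tilt_eq_zero {x : E3} {s : ℝ} : aff (a - s • b) x = 0 ↔ aff a x = s * aff b x := by
  rw [aff_sub, aff_smul, sub_eq_zero]

/-- A side `[X, Y]` of positive length with its two corners. -/
structure Side (a b : E3 × ℝ) (I : Finset (E3 × ℝ)) (p : E3 × ℝ) (X Y f : E3) (q : E3 × ℝ)
    (f' : E3) (q' : E3 × ℝ) : Prop where
  mem : p ∈ I
  ne : X ≠ Y
  left : Corner a b I p X Y f q
  right : Corner a b I p Y X f' q'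

theorem Side.symm {p q q' : E3 × ℝ} {X Y f f' : E3} (h : Side a b I p X Y f q f' q') :
    Side a b I p Y X f' q' f q := ⟨h.mem, h.ne.symm, h.right, h.left⟩

theorem ConvexPiece.exists_side_of_not_subsingleton (hC : ConvexPiece a b I) {p : E3 × ℝ}
    (hp : p ∈ I) (h : ¬ (edge a b I p).Subsingleton) :
    ∃ X Y f q f' q', Side a b I p X Y f q f' q' := by
  obtain ⟨X, Y, hE⟩ := hC.exists_edge_eq_segment hp
  have hXY : X ≠ Y := by
    rintro rfl
    rw [hE, segment_same] at h; exact h subsingleton_singleton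
  obtain ⟨f, q, hc⟩ := hC.exists_corner hp hE hXY
  obtain ⟨f', q', hc'⟩ := hC.exists_corner hp (hE.trans (segment_symm ℝ X Y)) hXY.symm
  exact ⟨X, Y, f, q, f', q', hp, hXY, hc, hc'⟩

/-- The trace of the rotated plane in the plane of a side, between the two neighbouring constraints,
is the segment joining the displaced corners. -/
theorem ConvexPiece.eventually_mem_side (hC : ConvexPiece a b I) {p q q' : E3 × ℝ} {X Y f f' : E3}
    (h : Side a b I p X Y f q f' q') : ∀ᶠ s in 𝓝 (0 : ℝ),
      pos b X f s ≠ pos b Y f' s ∧ aff a (pos b X f s) = s * aff b (pos b X f s) ∧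
      aff a (pos b Y f' s) = s * aff b (pos b Y f' s) ∧
      ∀ y, aff p y = 0 → aff a y = s * aff b y → 0 ≤ aff q y → 0 ≤ aff q' y →
        ∃ t ∈ Icc (0 : ℝ) 1, y = pos b X f s + t • (pos b Y f' s - pos b X f s) := by
  have hqY := eventually_pos_aff (b := b) (f := f') h.left.qY
  have hqX := eventually_pos_aff (b := b) (f := f) h.right.qY
  filter_upwards [eventually_denom b f, eventually_denom b f', hqY, hqX,
    eventually_linearIndependent (hC.linearIndependent_face h.mem) b] with s h1 h2 h3 h4 hli
  have hX := h.left.aff_a_pos (s := s) (by linarith [h1.1])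
  have hY := h.right.aff_a_pos (s := s) (by linarith [h2.1])
  have hne : pos b X f s ≠ pos b Y f' s := by
    intro heq
    rw [← heq, h.left.aff_q_pos] at h3; exact lt_irrefl _ h3
  refine ⟨hne, hX, hY, fun y hy1 hy2 hy3 hy4 => ?_⟩
  obtain ⟨t, ht⟩ := exists_eq_smul_of_orthogonal hli (d := pos b Y f' s - pos b X f s)
    (w := y - pos b X f s) (sub_ne_zero.2 hne.symm)
    (by rw [inner_sub_eq_aff, h.left.aff_p_pos, h.right.aff_p_pos, sub_zero])
    (by rw [inner_sub_eq_aff, aff_tilt_eq_zero.2 hX, aff_tilt_eq_zero.2 hY, sub_zero])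
    (by rw [inner_sub_eq_aff, h.left.aff_p_pos, hy1, sub_zero])
    (by rw [inner_sub_eq_aff, aff_tilt_eq_zero.2 hX, aff_tilt_eq_zero.2 hy2, sub_zero])
  have hy : y = pos b X f s + t • (pos b Y f' s - pos b X f s) := by rw [← ht]; abel
  refine ⟨t, ⟨?_, ?_⟩, hy⟩
  · rw [hy, aff_move, h.left.aff_q_pos] at hy3
    by_contra hneg
    nlinarith
  · rw [hy, aff_move, h.right.aff_q_pos] at hy4
    by_contra hneg
    nlinarith

end

section

variable {a b : E3 × ℝ} {I : Finset (E3 × ℝ)}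

/-! ### First-order estimates on each facet -/

/-- The section of `Kc I` by the rotated plane `a = s b`. -/
def top (a b : E3 × ℝ) (I : Finset (E3 × ℝ)) (s : ℝ) : Set E3 :=
  {x | x ∈ Kc I ∧ aff a x = s * aff b x ∧ 0 ≤ aff b x}

/-- The boundary of the section `top`, off the hinge. -/
def rim (a b : E3 × ℝ) (I : Finset (E3 × ℝ)) (s : ℝ) : Set E3 :=
  {x | x ∈ Kc I ∧ aff a x = s * aff b x ∧ 0 < aff b x ∧ ∃ p ∈ I, aff p x = 0}

/-- The union of the edges and vertices of the polyhedral region `Kc I`. -/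
def ridge (I : Finset (E3 × ℝ)) : Set E3 :=
  {x | x ∈ Kc I ∧ ∃ p ∈ I, ∃ q ∈ I, p ≠ q ∧ aff p x = 0 ∧ aff q x = 0}

/-- The part of the ridges strictly between the original and the rotated plane, when the plane is
rotated towards `a > 0`. -/
def ridgeUp (a b : E3 × ℝ) (I : Finset (E3 × ℝ)) (s : ℝ) : Set E3 :=
  {x | x ∈ ridge I ∧ 0 < aff b x ∧ 0 < aff a x ∧ aff a x < s * aff b x}

/-- The part of the ridges between the rotated and the original plane, when the plane is rotated
towards `a < 0`. -/
def ridgeDown (a b : E3 × ℝ) (I : Finset (E3 × ℝ)) (s : ℝ) : Set E3 :=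
  {x | x ∈ ridge I ∧ 0 < aff b x ∧ s * aff b x < aff a x ∧ aff a x ≤ 0}

theorem Corner.q_nonneg {p q : E3 × ℝ} {X Y f x : E3} (hc : Corner a b I p X Y f q) (hx : x ∈ Kc I)
    (hb : 0 ≤ aff b x) : 0 ≤ aff q x := by
  rcases hc.kind with h | h
  · rw [h.2]; exact hb
  · exact hx q h.2.1

theorem isClosed_top (a b : E3 × ℝ) (I : Finset (E3 × ℝ)) (s : ℝ) : IsClosed (top a b I s) :=
  (isClosed_Kc I).inter ((isClosed_eq (continuous_aff a) ((continuous_aff b).const_mul s)).inter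
    (isClosed_aff_nonneg b))

theorem convex_aff_eq_mul (a b : E3 × ℝ) (s : ℝ) : Convex ℝ {x | aff a x = s * aff b x} := by
  intro x hx y hy u v _ _ huv
  simp only [mem_ofPred_eq] at *
  rw [aff_combo a x y huv, aff_combo b x y huv, hx, hy]; ring

theorem convex_top (a b : E3 × ℝ) (I : Finset (E3 × ℝ)) (s : ℝ) : Convex ℝ (top a b I s) :=
  (convex_Kc I).inter ((convex_aff_eq_mul a b s).inter (convex_aff_nonneg b))

theorem convex_aff_eq_zero (p : E3 × ℝ) : Convex ℝ {x | aff p x = 0} := by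
  simpa using convex_aff_eq_mul p 0 0

theorem rim_subset_top {s : ℝ} : rim a b I s ⊆ top a b I s := fun _ h => ⟨h.1, h.2.1, h.2.2.1.le⟩

/-- The section `top` stays close to the polygon. -/
theorem eventually_top_subset (hbd : Bornology.IsBounded (base a b I)) (hne : (base a b I).Nonempty)
    {U : Set E3} (hU : IsOpen U) (hsub : base a b I ⊆ U) :
    ∀ᶠ s in 𝓝 (0 : ℝ), top a b I s ⊆ U := by
  obtain ⟨s0, hs0, h⟩ := exists_slope_of_open hbd hne hU hsub
  filter_upwards [Metric.ball_mem_nhds (0 : ℝ) hs0] with s hs x hx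
  rw [mem_ball_zero_iff, Real.norm_eq_abs] at hs
  refine h x hx.1 hx.2.2 ?_
  rw [hx.2.1, abs_mul, abs_of_nonneg hx.2.2]
  exact mul_le_mul_of_nonneg_right hs.le hx.2.2

theorem eventually_isCompact_top (hbd : Bornology.IsBounded (base a b I))
    (hne : (base a b I).Nonempty) : ∀ᶠ s in 𝓝 (0 : ℝ), IsCompact (top a b I s) := by
  obtain ⟨R, hR⟩ := hbd.subset_ball (0 : E3)
  filter_upwards [eventually_top_subset hbd hne Metric.isOpen_ball hR] with s hs
  exact Metric.isCompact_of_isClosed_isBounded (isClosed_top a b I s) (Metric.isBounded_ball.subset hs)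

/-- A segment joining a vertex of the polygon to a point of the rotated section, inside the
intersection of two planes, consists of ridge points. -/
theorem ConvexPiece.openSegment_subset_ridgeUp (hC : ConvexPiece a b I) {j k : E3 × ℝ} (hj : j ∈ I)
    (hk : k ∈ I) (hjk : j ≠ k) {X V : E3} {s : ℝ} (hs : 0 < s) (hX : X ∈ base a b I)
    (hbX : 0 < aff b X) (hV : V ∈ top a b I s) (hjX : aff j X = 0) (hkX : aff k X = 0)
    (hjV : aff j V = 0) (hkV : aff k V = 0) :
    openSegment ℝ X V ⊆ {x | x ∈ ridgeUp a b I s ∧ aff j x = 0 ∧ aff k x = 0} := by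
  have hbV : 0 < aff b V := by
    refine lt_of_le_of_ne hV.2.2 fun h => ?_
    have haV : aff a V = 0 := by rw [hV.2.1, ← h, mul_zero]
    have := hC.eq_of_two_planes hj hk hjk hX.1 haV hjX hjV hkX hkV
    rw [← this] at h; exact hbX.ne h
  rintro _ ⟨u, v, hu, hv, huv, rfl⟩
  have hjx : aff j (u • X + v • V) = 0 := by rw [aff_combo j X V huv, hjX, hjV]; simp
  have hkx : aff k (u • X + v • V) = 0 := by rw [aff_combo k X V huv, hkX, hkV]; simp
  refine ⟨⟨⟨convex_Kc I hX.2.2 hV.1 hu.le hv.le huv, j, hj, k, hk, hjk, hjx, hkx⟩, ?_, ?_, ?_⟩,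
    hjx, hkx⟩
  · rw [aff_combo b X V huv]; positivity
  · rw [aff_combo a X V huv, hX.1, hV.2.1]; positivity
  · rw [aff_combo a X V huv, aff_combo b X V huv, hX.1, hV.2.1]
    have := mul_pos hs (mul_pos hu hbX)
    linarith

/-- The end of the trace of the rotated plane in a facet lies on another plane through the same
corner. -/
theorem ConvexPiece.eventually_end_active (hC : ConvexPiece a b I) {p q q' : E3 × ℝ}
    {X Y f f' : E3} (h : Side a b I p X Y f q f' q') (hbX : 0 < aff b X) :
    ∀ᶠ s in 𝓝 (0 : ℝ), ∀ V ∈ top a b I s, aff p V = 0 →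
      (∀ z ∈ top a b I s, aff p z = 0 → ⟪pos b Y f' s - pos b X f s, V⟫ ≤
        ⟪pos b Y f' s - pos b X f s, z⟫) → ∃ k ∈ I, k ≠ p ∧ aff k X = 0 ∧ aff k V = 0 := by
  have hk : ∀ᶠ s in 𝓝 (0 : ℝ), ∀ k ∈ I, 0 < aff k X → 0 < aff k (pos b X f s) := by
    rw [Finset.eventually_all]
    intro k _
    by_cases hkX : 0 < aff k X
    · exact (eventually_pos_aff hkX).mono fun s hs _ => hs
    · exact Eventually.of_forall fun s hs => absurd hs hkX
  filter_upwards [hk, eventually_pos_aff (b := b) (f := f) hbX, hC.eventually_mem_side h]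
    with s hks hbs ⟨hne, haX, haY, hmem⟩ V hV hpV hmin
  by_contra! hcon
  set A := pos b X f s
  set B := pos b Y f' s
  obtain ⟨t, ht, hVt⟩ := hmem V hpV hV.2.1 (h.left.q_nonneg hV.1 hV.2.2) (h.right.q_nonneg hV.1 hV.2.2)
  have hpA : aff p A = 0 := h.left.aff_p_pos s
  rcases ht.1.eq_or_lt with ht0 | ht0
  · have hVA : V = A := by rw [hVt, ← ht0]; simp
    obtain ⟨hq, hqp, -⟩ := hC.corner_aff h.mem h.left hbX
    exact hcon q hq hqp h.left.qX (by rw [hVA]; exact h.left.aff_q_pos s)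
  · -- moving `V` slightly towards `A` stays in the section
    have hev : ∀ᶠ e in 𝓝[>] (0 : ℝ), ∀ k ∈ I, 0 ≤ aff k (V + e • (A - V)) := by
      rw [Finset.eventually_all]
      intro k hkI
      by_cases hkp : k = p
      · subst hkp
        filter_upwards with e
        rw [aff_move, hpV, hpA]; simp
      rcases (h.left.left_mem.1.2.2 k hkI).eq_or_lt with h0 | h0
      · have hpos : 0 < aff k V := lt_of_le_of_ne (hV.1 k hkI) (Ne.symm (hcon k hkI hkp h0.symm))
        exact ((eventually_move (eventually_aff_pos hpos)).filter_mono nhdsWithin_le_nhds).mono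
          fun e he => he.le
      · have hA := hks k hkI h0
        have hVk := hV.1 k hkI
        filter_upwards [Ioo_mem_nhdsGT (zero_lt_one' ℝ)] with e he
        rw [aff_move]
        have := mul_nonneg (by linarith [he.2] : 0 ≤ 1 - e) hVk
        have := mul_pos he.1 hA
        linarith
    obtain ⟨e, he, he1⟩ := (hev.and (Ioo_mem_nhdsGT (zero_lt_one' ℝ))).exists
    have hmemtop : V + e • (A - V) ∈ top a b I s := by
      refine ⟨he, ?_, ?_⟩
      · rw [aff_move, aff_move, hV.2.1, haX]; ring
      · rw [aff_move]
        have := mul_nonneg (by linarith [he1.2] : 0 ≤ 1 - e) hV.2.2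
        have := mul_pos he1.1 hbs
        linarith
    have := hmin _ hmemtop (by rw [aff_move, hpV, hpA]; simp)
    have hAV : A - V = -(t • (B - A)) := by rw [hVt]; abel
    rw [inner_add_right, hAV, smul_neg, inner_neg_right, inner_smul_right, inner_smul_right] at this
    have hBA : 0 < ⟪B - A, B - A⟫ := real_inner_self_pos.2 (sub_ne_zero.2 hne.symm)
    have := mul_pos he1.1 (mul_pos ht0 hBA)
    linarith

end

section

variable {a b : E3 × ℝ} {I : Finset (E3 × ℝ)}

/-- The shape of the trace of the rotated plane in a facet along a side `[X, Y]`: it is contained in a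
segment `[V, W]` on the segment joining the displaced corners, and `V`, `W` are joined by
ridges to those of the corners `X`, `Y` which are off the hinge. -/
theorem ConvexPiece.eventually_trace (hC : ConvexPiece a b I) {p q q' : E3 × ℝ}
    {X Y f f' : E3} (h : Side a b I p X Y f q f' q') :
    ∀ᶠ s in 𝓝 (0 : ℝ), ∃ V ∈ top a b I s, ∃ W ∈ top a b I s, aff p V = 0 ∧ aff p W = 0 ∧
      rim a b I s ∩ {x | aff p x = 0} ⊆ segment ℝ V W ∧
      ‖pos b X f s - V‖ + ‖V - W‖ + ‖W - pos b Y f' s‖ = ‖pos b X f s - pos b Y f' s‖ ∧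
      (0 < aff b X → ∃ k ∈ I, k ≠ p ∧ aff k X = 0 ∧ aff k V = 0) ∧
      (0 < aff b Y → ∃ k ∈ I, k ≠ p ∧ aff k Y = 0 ∧ aff k W = 0) := by
  have hX : ∀ᶠ s in 𝓝 (0 : ℝ), 0 < aff b X → ∀ V ∈ top a b I s, aff p V = 0 →
      (∀ z ∈ top a b I s, aff p z = 0 → ⟪pos b Y f' s - pos b X f s, V⟫ ≤
        ⟪pos b Y f' s - pos b X f s, z⟫) → ∃ k ∈ I, k ≠ p ∧ aff k X = 0 ∧ aff k V = 0 := by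
    by_cases hb : 0 < aff b X
    · exact (hC.eventually_end_active h hb).mono fun s hs _ => hs
    · exact Eventually.of_forall fun s hs => absurd hs hb
  have hY : ∀ᶠ s in 𝓝 (0 : ℝ), 0 < aff b Y → ∀ V ∈ top a b I s, aff p V = 0 →
      (∀ z ∈ top a b I s, aff p z = 0 → ⟪pos b X f s - pos b Y f' s, V⟫ ≤
        ⟪pos b X f s - pos b Y f' s, z⟫) → ∃ k ∈ I, k ≠ p ∧ aff k Y = 0 ∧ aff k V = 0 := by
    by_cases hb : 0 < aff b Y
    · exact (hC.eventually_end_active h.symm hb).mono fun s hs _ => hs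
    · exact Eventually.of_forall fun s hs => absurd hs hb
  -- the midpoint of the displaced corners shows that the trace is not empty
  have hk : ∀ᶠ s in 𝓝 (0 : ℝ), ∀ k ∈ I, k ≠ p →
      0 < aff k (pos b X f s) + aff k (pos b Y f' s) := by
    rw [Finset.eventually_all]
    intro k hkI
    by_cases hkp : k = p
    · exact Eventually.of_forall fun s hs => absurd hkp hs
    have hpos : 0 < aff k X + aff k Y := by
      rcases (h.left.left_mem.1.2.2 k hkI).eq_or_lt with h0 | h0
      · have := h.left.other k hkI hkp h0.symm
        linarith
      · linarith [h.left.right_mem.1.2.2 k hkI]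
    have ht : Tendsto (fun s => aff k (pos b X f s) + aff k (pos b Y f' s)) (𝓝 0)
        (𝓝 (aff k X + aff k Y)) :=
      (((continuous_aff k).tendsto X).comp (tendsto_pos b X f)).add
        (((continuous_aff k).tendsto Y).comp (tendsto_pos b Y f'))
    exact (ht.eventually_const_lt hpos).mono fun s hs _ => hs
  have hb : ∀ᶠ s in 𝓝 (0 : ℝ), 0 < aff b (pos b X f s) + aff b (pos b Y f' s) := by
    have hpos : 0 < aff b X + aff b Y := by
      have h1 := h.left.left_mem.1.2.1
      have h2 := h.left.right_mem.1.2.1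
      rcases h.left.kind with hk | hk
      · have := h.left.qY; rw [hk.2] at this; linarith
      · linarith [hk.1]
    have ht : Tendsto (fun s => aff b (pos b X f s) + aff b (pos b Y f' s)) (𝓝 0)
        (𝓝 (aff b X + aff b Y)) :=
      (((continuous_aff b).tendsto X).comp (tendsto_pos b X f)).add
        (((continuous_aff b).tendsto Y).comp (tendsto_pos b Y f'))
    exact ht.eventually_const_lt hpos
  filter_upwards [hX, hY, hk, hb, hC.eventually_mem_side h,
    eventually_isCompact_top hC.bdd hC.base_nonempty] with s hXs hYs hks hbs ⟨hne, haX, haY, hmem⟩ hcpt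
  set A := pos b X f s
  set B := pos b Y f' s
  have hpA : aff p A = 0 := h.left.aff_p_pos s
  have hpB : aff p B = 0 := h.right.aff_p_pos s
  set E := top a b I s ∩ {x | aff p x = 0} with hE
  have hEc : IsCompact E := hcpt.inter_right (isClosed_aff_eq p)
  have hEconv : Convex ℝ E := (convex_top a b I s).inter (convex_aff_eq_zero p)
  have hmid : A + (1 / 2 : ℝ) • (B - A) ∈ E := by
    refine ⟨⟨fun k hkI => ?_, ?_, ?_⟩, ?_⟩
    · rw [aff_move]
      by_cases hkp : k = p
      · subst hkp; rw [hpA, hpB]; simp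
      · linarith [hks k hkI hkp]
    · rw [aff_move, aff_move, haX, haY]; ring
    · rw [aff_move]; linarith
    · show aff p _ = 0
      rw [aff_move, hpA, hpB]; simp
  have hline : ∀ x ∈ E, ∃ t ∈ Icc (0 : ℝ) 1, x = A + t • (B - A) := fun x hx =>
    hmem x hx.2 hx.1.2.1 (h.left.q_nonneg hx.1.1 hx.1.2.2) (h.right.q_nonneg hx.1.1 hx.1.2.2)
  obtain ⟨V, hV, W, hW, hseg, hmm⟩ := exists_segment_of_line hEc hEconv ⟨_, hmid⟩ (B - A) (by
    intro x hx y hy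
    obtain ⟨t, -, rfl⟩ := hline x hx
    obtain ⟨u, -, rfl⟩ := hline y hy
    exact ⟨u - t, by module⟩)
  refine ⟨V, hV.1, W, hW.1, hV.2, hW.2, ?_, ?_, fun hbX => ?_, fun hbY => ?_⟩
  · rw [← hseg]
    exact inter_subset_inter_left _ rim_subset_top
  · obtain ⟨t, ht, hVt⟩ := hline V hV
    obtain ⟨u, hu, hWu⟩ := hline W hW
    have htu : t ≤ u := by
      have := (hmm W hW).1
      rw [hVt, hWu, inner_add_right, inner_add_right, inner_smul_right, inner_smul_right] at this
      have hBA : 0 < ⟪B - A, B - A⟫ := real_inner_self_pos.2 (sub_ne_zero.2 hne.symm)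
      nlinarith
    have e1 : A - V = -(t • (B - A)) := by rw [hVt]; abel
    have e2 : V - W = -((u - t) • (B - A)) := by rw [hVt, hWu]; module
    have e3 : W - B = -((1 - u) • (B - A)) := by rw [hWu]; module
    rw [e1, e2, e3, norm_neg, norm_neg, norm_neg, norm_smul, norm_smul, norm_smul,
      Real.norm_of_nonneg ht.1, Real.norm_of_nonneg (by linarith), Real.norm_of_nonneg (by linarith [hu.2]),
      norm_sub_rev A B]
    ring
  · exact hXs hbX V hV.1 hV.2 fun z hz hpz => (hmm z ⟨hz, hpz⟩).1
  · refine hYs hbY W hW.1 hW.2 fun z hz hpz => ?_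
    have := (hmm z ⟨hz, hpz⟩).2
    rw [← neg_sub B A, inner_neg_left, inner_neg_left]
    linarith

/-- Two ridges on one facet, issuing from different corners, contribute the sum of their lengths. -/
theorem ConvexPiece.le_lenM_ridgeUp (hC : ConvexPiece a b I) {p q q' : E3 × ℝ} {X Y f f' : E3}
    (h : Side a b I p X Y f q f' q') {V W : E3} {s : ℝ} (hs : 0 < s) (hV : V ∈ top a b I s)
    (hW : W ∈ top a b I s) (hpV : aff p V = 0) (hpW : aff p W = 0)
    (hX : 0 < aff b X → ∃ k ∈ I, k ≠ p ∧ aff k X = 0 ∧ aff k V = 0)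
    (hY : 0 < aff b Y → ∃ k ∈ I, k ≠ p ∧ aff k Y = 0 ∧ aff k W = 0) :
    ENNReal.ofReal ((if 0 < aff b X then ‖X - V‖ else 0) + (if 0 < aff b Y then ‖Y - W‖ else 0)) ≤
      lenM (ridgeUp a b I s ∩ {x | aff p x = 0}) := by
  have sX : ∀ k ∈ I, k ≠ p → aff k X = 0 → aff k V = 0 → 0 < aff b X →
      openSegment ℝ X V ⊆ {x | x ∈ ridgeUp a b I s ∧ aff p x = 0 ∧ aff k x = 0} :=
    fun k hk hkp hkX hkV hbX => hC.openSegment_subset_ridgeUp h.mem hk hkp.symm hs h.left.left_mem.1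
      hbX hV h.left.left_mem.2 hkX hpV hkV
  have sY : ∀ k ∈ I, k ≠ p → aff k Y = 0 → aff k W = 0 → 0 < aff b Y →
      openSegment ℝ Y W ⊆ {x | x ∈ ridgeUp a b I s ∧ aff p x = 0 ∧ aff k x = 0} :=
    fun k hk hkp hkX hkV hbX => hC.openSegment_subset_ridgeUp h.mem hk hkp.symm hs h.right.left_mem.1
      hbX hW h.right.left_mem.2 hkX hpW hkV
  by_cases hbX : 0 < aff b X <;> by_cases hbY : 0 < aff b Y
  · obtain ⟨k, hk, hkp, hkX, hkV⟩ := hX hbX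
    obtain ⟨l, hl, hlp, hlY, hlW⟩ := hY hbY
    have hkY : 0 < aff k Y := h.left.other k hk hkp hkX
    rw [if_pos hbX, if_pos hbY, ENNReal.ofReal_add (norm_nonneg _) (norm_nonneg _),
      ← lenM_openSegment, ← lenM_openSegment,
      ← measure_inter_add_sdiff (μ := lenM) (ridgeUp a b I s ∩ {x | aff p x = 0}) (isClosed_aff_eq k).measurableSet]
    refine add_le_add (measure_mono fun x hx => ?_) (measure_mono fun x hx => ?_)
    · have := sX k hk hkp hkX hkV hbX hx
      exact ⟨⟨this.1, this.2.1⟩, this.2.2⟩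
    · have h1 := sY l hl hlp hlY hlW hbY hx
      refine ⟨⟨h1.1, h1.2.1⟩, fun h0 => ?_⟩
      obtain ⟨u, v, hu, hv, huv, rfl⟩ := hx
      have h0 : aff k (u • Y + v • W) = 0 := h0
      rw [aff_combo k Y W huv] at h0
      have := mul_pos hu hkY
      have := mul_nonneg hv.le (hW.1 k hk)
      linarith
  · obtain ⟨k, hk, hkp, hkX, hkV⟩ := hX hbX
    rw [if_pos hbX, if_neg hbY, add_zero, ← lenM_openSegment]
    exact measure_mono fun x hx => ⟨(sX k hk hkp hkX hkV hbX hx).1, (sX k hk hkp hkX hkV hbX hx).2.1⟩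
  · obtain ⟨l, hl, hlp, hlY, hlW⟩ := hY hbY
    rw [if_neg hbX, if_pos hbY, zero_add, ← lenM_openSegment]
    exact measure_mono fun x hx => ⟨(sY l hl hlp hlY hlW hbY hx).1, (sY l hl hlp hlY hlW hbY hx).2.1⟩
  · simp [hbX, hbY]

/-- A corner at which a further plane meets: the ridge of the facet leaves the line along which the
corner would move, and the triangle inequality is strict to first order. -/
theorem ConvexPiece.exists_slack (hC : ConvexPiece a b I) {p q q' : E3 × ℝ} {X Y f f' : E3}
    (h : Side a b I p X Y f q f' q') (hbX : 0 < aff b X) {j : E3 × ℝ} (hj : j ∈ I) (hjp : j ≠ p)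
    (hjq : j ≠ q) (hjX : aff j X = 0) : ∃ c > 0, ∀ᶠ s in 𝓝[>] (0 : ℝ), ∀ V ∈ top a b I s,
      aff p V = 0 → ∀ k ∈ I, k ≠ p → aff k X = 0 → aff k V = 0 →
      ‖X - pos b X f s‖ + c * s ≤ ‖pos b X f s - V‖ + ‖X - V‖ := by
  have key : ∀ k ∈ I, k ≠ p → aff k X = 0 → ∃ c > 0, ∀ᶠ s in 𝓝[>] (0 : ℝ), ∀ V ∈ top a b I s,
      aff p V = 0 → aff k V = 0 →
      ‖X - pos b X f s‖ + c * s ≤ ‖pos b X f s - V‖ + ‖X - V‖ := by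
    intro k hk hkp hkX
    by_cases hkq : k = q
    · -- a ridge in the plane `q` would end at the displaced corner, where `j` is negative
      subst hkq
      refine ⟨1, one_pos, ?_⟩
      filter_upwards [(hC.eventually_mem_side h).filter_mono nhdsWithin_le_nhds,
        (eventually_denom b f).filter_mono nhdsWithin_le_nhds,
        (eventually_pos_aff (b := b) (f := f') h.left.qY).filter_mono nhdsWithin_le_nhds,
        self_mem_nhdsWithin] with s ⟨_, _, _, hmem⟩ hden hqB hs V hV hpV hkV
      exfalso
      obtain ⟨t, ht, hVt⟩ := hmem V hpV hV.2.1 (h.left.q_nonneg hV.1 hV.2.2)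
        (h.right.q_nonneg hV.1 hV.2.2)
      have ht0 : t = 0 := by
        rw [hVt, aff_move, h.left.aff_q_pos, mul_zero, zero_add] at hkV
        exact (mul_eq_zero.1 hkV).resolve_right hqB.ne'
      rw [ht0, zero_smul, add_zero] at hVt
      have h1 := hV.1 j hj
      rw [hVt, aff_pos, hjX, zero_add] at h1
      have h2 : 0 < shift b X f s :=
        div_pos (mul_pos hs hbX) (by linarith [hden.1])
      nlinarith [hC.corner_inner_neg h.mem h.left hbX hj hjp hjq hjX]
    · -- otherwise the direction `r` of the ridge is not parallel to `f`, and the angle between them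
      -- gives the slack `κ`
      obtain ⟨d, hd, hpd, hkd⟩ := exists_ne_zero_orthogonal p.1 k.1
      have hX := h.left.left_mem
      have had : ⟪a.1, d⟫ ≠ 0 := by
        intro h0
        have hmv : ∀ r : E3 × ℝ, aff r X = 0 → ⟪r.1, d⟫ = 0 → aff r (X + d) = 0 := by
          intro r h1 h2; rw [aff_add_vec, h1, h2, add_zero]
        have := hC.eq_of_two_planes h.mem hk (Ne.symm hkp) hX.1.1 (hmv a hX.1.1 h0) hX.2
          (hmv p hX.2 hpd) hkX (hmv k hkX hkd)
        exact hd (left_eq_add.1 this)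
      set r := (⟪a.1, d⟫)⁻¹ • d with hr
      have har : ⟪a.1, r⟫ = 1 := by rw [hr, inner_smul_right, inv_mul_cancel₀ had]
      have hpr : ⟪p.1, r⟫ = 0 := by rw [hr, inner_smul_right, hpd, mul_zero]
      have hkr : ⟪k.1, r⟫ = 0 := by rw [hr, inner_smul_right, hkd, mul_zero]
      have hr0 : r ≠ 0 := by intro h0; rw [h0, inner_zero_right] at har; exact one_ne_zero har.symm
      have hf0 : f ≠ 0 := by
        intro h0; have := h.left.af; rw [h0, inner_zero_right] at this; exact one_ne_zero this.symm
      have hkf := hC.corner_inner_neg h.mem h.left hbX hk hkp hkq hkX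
      have hlt : ⟪r, f⟫ < ‖r‖ * ‖f‖ := by
        rw [inner_lt_norm_mul_iff_real]
        intro heq
        have := congrArg (fun w => ⟪k.1, w⟫) heq
        simp only [inner_smul_right, hkr, mul_zero] at this
        have := mul_neg_of_pos_of_neg (norm_pos_iff.2 hr0) hkf
        linarith
      have hfn : 0 < ‖f‖ := norm_pos_iff.2 hf0
      set κ := ‖r‖ - ⟪r, f⟫ / ‖f‖ with hκ
      have hκ0 : 0 < κ := by rw [hκ, sub_pos, div_lt_iff₀ hfn]; exact hlt
      refine ⟨κ * aff b X / 2, by positivity, ?_⟩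
      filter_upwards [(eventually_denom b f).filter_mono nhdsWithin_le_nhds,
        (eventually_denom b r).filter_mono nhdsWithin_le_nhds, self_mem_nhdsWithin]
        with s hden hdenr hs V hV hpV hkV
      have hs : 0 < s := hs
      obtain ⟨β, hβ⟩ := exists_eq_smul_of_orthogonal
        (hC.linearIndependent_pair h.mem hk (Ne.symm hkp) hX.2 hkX) hr0 hpr hkr (w := V - X)
        (by rw [inner_sub_eq_aff, hpV, hX.2, sub_zero])
        (by rw [inner_sub_eq_aff, hkV, hkX, sub_zero])
      have hVX : V = X + β • r := by rw [← hβ]; abel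
      have hβs : β * (1 - s * ⟪b.1, r⟫) = s * aff b X := by
        have := hV.2.1
        rw [hVX, aff_add_smul, aff_add_smul, hX.1.1, har] at this
        linarith
      have hβ2 : s * aff b X / 2 ≤ β := by
        have : 0 < s * aff b X := mul_pos hs hbX
        nlinarith [hdenr.1, hdenr.2]
      have hβ0 : 0 ≤ β := le_trans (by positivity) hβ2
      set τ := shift b X f s with hτ
      have hτ0 : 0 ≤ τ := h.left.shift_nonneg (by linarith [hden.1]) hs.le
      have e1 : ‖X - pos b X f s‖ = τ * ‖f‖ := by rw [norm_pos_sub, abs_of_nonneg hτ0]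
      have e2 : ‖X - V‖ = β * ‖r‖ := by
        rw [hVX, sub_add_cancel_left, norm_neg, norm_smul, Real.norm_of_nonneg hβ0]
      have e3 : τ * ‖f‖ - β * (⟪r, f⟫ / ‖f‖) ≤ ‖pos b X f s - V‖ := by
        have e : pos b X f s - V = τ • f - β • r := by rw [hVX, pos]; abel
        have h1 := real_inner_le_norm (τ • f - β • r) f
        rw [inner_sub_left, real_inner_smul_left, real_inner_smul_left,
          real_inner_self_eq_norm_sq] at h1
        rw [e]
        have h2 : τ * ‖f‖ - β * (⟪r, f⟫ / ‖f‖) = (τ * ‖f‖ ^ 2 - β * ⟪r, f⟫) / ‖f‖ := by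
          field_simp
        rw [h2, div_le_iff₀ hfn]; exact h1
      rw [e1, e2]
      have : κ * (s * aff b X / 2) ≤ κ * β := mul_le_mul_of_nonneg_left hβ2 hκ0.le
      rw [hκ] at this ⊢
      linarith
  choose! c hc0 hc using key
  -- a lower bound for the finitely many constants
  have h1 : ∀ᶠ e in 𝓝[>] (0 : ℝ), ∀ k ∈ I, k ≠ p → aff k X = 0 → e ≤ c k := by
    rw [Finset.eventually_all]
    intro k hk
    by_cases hh : k ≠ p ∧ aff k X = 0
    · filter_upwards [Ioo_mem_nhdsGT (hc0 k hk hh.1 hh.2)] with e he _ _ using he.2.le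
    · exact Eventually.of_forall fun e h2 h3 => absurd ⟨h2, h3⟩ hh
  obtain ⟨e, he, he0⟩ := (h1.and self_mem_nhdsWithin).exists
  refine ⟨e, he0, ?_⟩
  have h2 : ∀ᶠ s in 𝓝[>] (0 : ℝ), ∀ k ∈ I, k ≠ p → aff k X = 0 → ∀ V ∈ top a b I s,
      aff p V = 0 → aff k V = 0 →
      ‖X - pos b X f s‖ + c k * s ≤ ‖pos b X f s - V‖ + ‖X - V‖ := by
    rw [Finset.eventually_all]
    intro k hk
    by_cases hh : k ≠ p ∧ aff k X = 0
    · exact (hc k hk hh.1 hh.2).mono fun s hs _ _ => hs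
    · exact Eventually.of_forall fun e h2 h3 => absurd ⟨h2, h3⟩ hh
  filter_upwards [h2, self_mem_nhdsWithin] with s hs hs0 V hV hpV k hk hkp hkX hkV
  have := hs k hk hkp hkX V hV hpV hkV
  have := mul_le_mul_of_nonneg_right (he k hk hkp hkX) (le_of_lt hs0)
  linarith

/-- The facet inequality: the rim gains, compared with the motion of the corners, at most as much
as the ridges of the facet. The constant `c` is the slack available at the corner `X`. -/
theorem ConvexPiece.facet_inequality (hC : ConvexPiece a b I) {p q q' : E3 × ℝ} {X Y f f' : E3}
    (h : Side a b I p X Y f q f' q') {c : ℝ} (hc : 0 ≤ c)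
    (hslack : c = 0 ∨ (0 < aff b X ∧ ∀ᶠ s in 𝓝[>] (0 : ℝ), ∀ V ∈ top a b I s,
      aff p V = 0 → ∀ k ∈ I, k ≠ p → aff k X = 0 → aff k V = 0 →
      ‖X - pos b X f s‖ + c * s ≤ ‖pos b X f s - V‖ + ‖X - V‖)) :
    ∀ᶠ s in 𝓝[>] (0 : ℝ), lenM (rim a b I s ∩ {x | aff p x = 0}) +
      ENNReal.ofReal (shift b X f s * ‖f‖ + shift b Y f' s * ‖f'‖ + c * s) ≤
      ENNReal.ofReal ‖pos b X f s - pos b Y f' s‖ + lenM (ridgeUp a b I s ∩ {x | aff p x = 0}) := by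
  have hsl : ∀ᶠ s in 𝓝[>] (0 : ℝ), ∀ V ∈ top a b I s, aff p V = 0 →
      (0 < aff b X → ∃ k ∈ I, k ≠ p ∧ aff k X = 0 ∧ aff k V = 0) →
      ‖X - pos b X f s‖ + c * s ≤
        ‖pos b X f s - V‖ + (if 0 < aff b X then ‖X - V‖ else 0) := by
    rcases hslack with rfl | ⟨hbX, hs⟩
    · filter_upwards with s V hV hpV hk
      rw [zero_mul, add_zero]
      split_ifs with hb
      · calc ‖X - pos b X f s‖ = ‖(X - V) - (pos b X f s - V)‖ := by congr 1; abel
          _ ≤ ‖X - V‖ + ‖pos b X f s - V‖ := norm_sub_le _ _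
          _ = _ := add_comm _ _
      · have hb0 : aff b X = 0 := le_antisymm (not_lt.1 hb) h.left.left_mem.1.2.1
        rw [norm_pos_sub, shift_eq_zero hb0]; simp
    · filter_upwards [hs] with s hs V hV hpV hk
      obtain ⟨k, hk, hkp, hkX, hkV⟩ := hk hbX
      rw [if_pos hbX]
      exact hs V hV hpV k hk hkp hkX hkV
  filter_upwards [hsl, (hC.eventually_trace h).filter_mono nhdsWithin_le_nhds,
    (eventually_denom b f).filter_mono nhdsWithin_le_nhds,
    (eventually_denom b f').filter_mono nhdsWithin_le_nhds, self_mem_nhdsWithin]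
    with s hsl ⟨V, hV, W, hW, hpV, hpW, hsub, hsum, hX, hY⟩ hd hd' hs
  have hs : 0 < s := hs
  have hτX := h.left.shift_nonneg (s := s) (by linarith [hd.1]) hs.le
  have hτY := h.right.shift_nonneg (s := s) (by linarith [hd'.1]) hs.le
  have h1 := hsl V hV hpV hX
  have h2 : ‖Y - pos b Y f' s‖ ≤ ‖W - pos b Y f' s‖ + (if 0 < aff b Y then ‖Y - W‖ else 0) := by
    split_ifs with hb
    · calc ‖Y - pos b Y f' s‖ = ‖(Y - W) + (W - pos b Y f' s)‖ := by congr 1; abel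
        _ ≤ ‖Y - W‖ + ‖W - pos b Y f' s‖ := norm_add_le _ _
        _ = _ := add_comm _ _
    · have hb0 : aff b Y = 0 := le_antisymm (not_lt.1 hb) h.right.left_mem.1.2.1
      rw [norm_pos_sub, shift_eq_zero hb0]; simp
  rw [norm_pos_sub, abs_of_nonneg hτX] at h1
  rw [norm_pos_sub, abs_of_nonneg hτY] at h2
  have h3 := hC.le_lenM_ridgeUp h hs hV hW hpV hpW hX hY
  have h4 : lenM (rim a b I s ∩ {x | aff p x = 0}) ≤ ENNReal.ofReal ‖V - W‖ := by
    rw [← lenM_segment]; exact measure_mono hsub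
  have n1 : 0 ≤ (if 0 < aff b X then ‖X - V‖ else 0) + (if 0 < aff b Y then ‖Y - W‖ else 0) := by
    positivity
  calc _ ≤ ENNReal.ofReal ‖V - W‖ +
        ENNReal.ofReal (shift b X f s * ‖f‖ + shift b Y f' s * ‖f'‖ + c * s) := by gcongr
    _ = ENNReal.ofReal (‖V - W‖ + (shift b X f s * ‖f‖ + shift b Y f' s * ‖f'‖ + c * s)) := by
        rw [ENNReal.ofReal_add (norm_nonneg _) (by positivity)]
    _ ≤ ENNReal.ofReal (‖pos b X f s - pos b Y f' s‖ +
          ((if 0 < aff b X then ‖X - V‖ else 0) + (if 0 < aff b Y then ‖Y - W‖ else 0))) := by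
        apply ENNReal.ofReal_le_ofReal; linarith
    _ = _ := ENNReal.ofReal_add (norm_nonneg _) n1
    _ ≤ _ := by gcongr

end

section

variable {a b : E3 × ℝ} {I : Finset (E3 × ℝ)}

/-- At an end `V ≠ W` of the trace of the rotated plane in a facet touching the polygon only at
`X`, another plane through `X` is active. -/
theorem exists_active_at_end {j : E3 × ℝ} {X V W : E3} {s : ℝ}
    (hfar : ∀ k ∈ I, 0 < aff k X → 0 < aff k V) (hbV : 0 < aff b V) (hV : V ∈ top a b I s)
    (hW : W ∈ top a b I s) (hjV : aff j V = 0) (hjW : aff j W = 0) (hX : X ∈ base a b I)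
    (hend : ∀ e : ℝ, 0 < e → V + e • (V - W) ∈ top a b I s → aff j (V + e • (V - W)) = 0 → False) :
    ∃ k ∈ I, k ≠ j ∧ aff k X = 0 ∧ aff k V = 0 := by
  by_contra! hcon
  have hmv : ∀ p : E3 × ℝ, ∀ e : ℝ, aff p (V + e • (V - W)) = (1 + e) * aff p V - e * aff p W := by
    intro p e; rw [aff_add_smul, inner_sub_eq_aff]; ring
  have hev : ∀ᶠ e in 𝓝[>] (0 : ℝ), ∀ k ∈ I, 0 ≤ aff k (V + e • (V - W)) := by
    rw [Finset.eventually_all]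
    intro k hk
    by_cases hkj : k = j
    · subst hkj
      filter_upwards with e
      rw [hmv, hjV, hjW]; simp
    have hpos : 0 < aff k V := by
      rcases (hX.2.2 k hk).eq_or_lt with h0 | h0
      · exact lt_of_le_of_ne (hV.1 k hk) (Ne.symm (hcon k hk hkj h0.symm))
      · exact hfar k hk h0
    exact ((eventually_move (eventually_aff_pos hpos)).filter_mono nhdsWithin_le_nhds).mono
      fun e he => he.le
  have hevb := (eventually_move (w := V - W) (eventually_aff_pos hbV)).filter_mono
    (nhdsWithin_le_nhds (s := Ioi 0))
  obtain ⟨e, ⟨he, heb⟩, he0⟩ := ((hev.and hevb).and self_mem_nhdsWithin).exists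
  refine hend e he0 ⟨he, ?_, heb.le⟩ ?_
  · rw [hmv, hmv, hV.2.1, hW.2.1]; ring
  · rw [hmv, hjV, hjW]; simp

/-- For a plane touching the polygon only at a vertex, the rim is at most as long as the ridges of the
facet: the facet is cut in a triangle with apex at the vertex. -/
theorem ConvexPiece.facet_inequality_of_subsingleton (hC : ConvexPiece a b I) {j : E3 × ℝ}
    (hj : j ∈ I) {X : E3} (hE : edge a b I j = {X}) :
    ∀ᶠ s in 𝓝[>] (0 : ℝ), lenM (rim a b I s ∩ {x | aff j x = 0}) ≤
      lenM (ridgeUp a b I s ∩ {x | aff j x = 0}) := by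
  have hX : X ∈ edge a b I j := by rw [hE]; rfl
  obtain ⟨hbX, -⟩ := hC.exists_corner_of_subsingleton hj hE
  -- near the plane `j`, the section is close to `X`
  have hN : ∀ᶠ y in 𝓝 X, 0 < aff b y ∧ ∀ k ∈ I, 0 < aff k X → 0 < aff k y := by
    refine (eventually_aff_pos hbX).and ?_
    rw [Finset.eventually_all]
    intro k _
    by_cases h : 0 < aff k X
    · exact (eventually_aff_pos h).mono fun y hy _ => hy
    · exact Eventually.of_forall fun y hy => absurd hy h
  obtain ⟨N, hNsub, hNo, hXN⟩ := eventually_nhds_iff.1 hN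
  have hU : IsOpen ({x | aff j x ≠ 0} ∪ {x | x ∈ N}) :=
    (isClosed_aff_eq j).isOpen_compl.union hNo
  have hsub : base a b I ⊆ {x | aff j x ≠ 0} ∪ {x | x ∈ N} := by
    intro x hx
    by_cases h : aff j x = 0
    · have : x ∈ edge a b I j := ⟨hx, h⟩
      rw [hE, mem_singleton_iff] at this
      right; rw [this]; exact hXN
    · exact Or.inl h
  filter_upwards [(eventually_top_subset hC.bdd hC.base_nonempty hU hsub).filter_mono
      nhdsWithin_le_nhds, (eventually_isCompact_top hC.bdd hC.base_nonempty).filter_mono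
      nhdsWithin_le_nhds, (eventually_linearIndependent (hC.linearIndependent_face hj) b).filter_mono
      nhdsWithin_le_nhds, self_mem_nhdsWithin] with s htop hcpt hli hs
  have hs : 0 < s := hs
  have hnear : ∀ y ∈ top a b I s, aff j y = 0 →
      0 < aff b y ∧ ∀ k ∈ I, 0 < aff k X → 0 < aff k y := by
    intro y hy hjy
    rcases htop hy with h | h
    · exact absurd hjy h
    · exact hNsub y h
  set E := top a b I s ∩ {x | aff j x = 0} with hEdef
  have hrimE : rim a b I s ∩ {x | aff j x = 0} ⊆ E := inter_subset_inter_left _ rim_subset_top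
  rcases E.eq_empty_or_nonempty with he | hne
  · rw [he] at hrimE
    rw [subset_empty_iff.1 hrimE]; simp
  obtain ⟨d, hd, hjd, hnd⟩ := exists_ne_zero_orthogonal j.1 (a - s • b).1
  obtain ⟨V, hV, W, hW, hseg, hmm⟩ := exists_segment_of_line (hcpt.inter_right (isClosed_aff_eq j))
    ((convex_top a b I s).inter (convex_aff_eq_zero j)) hne d (by
      intro x hx y hy
      refine exists_eq_smul_of_orthogonal hli hd hjd hnd ?_ ?_
      · rw [inner_sub_eq_aff, hx.2, hy.2, sub_zero]
      · rw [inner_sub_eq_aff, aff_tilt_eq_zero.2 hx.1.2.1, aff_tilt_eq_zero.2 hy.1.2.1, sub_zero])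
  by_cases hVW : V = W
  · subst hVW
    rw [segment_same] at hseg
    have : lenM (rim a b I s ∩ {x | aff j x = 0}) = 0 :=
      measure_mono_null hrimE (by rw [hEdef, hseg]; exact measure_singleton _)
    rw [this]; exact zero_le
  have hdVW : ⟪d, V⟫ < ⟪d, W⟫ := by
    refine lt_of_le_of_ne (hmm V hV).2 fun heq => hVW ?_
    obtain ⟨r, hr⟩ := exists_eq_smul_of_orthogonal hli hd hjd hnd (w := W - V)
      (by rw [inner_sub_eq_aff, hV.2, hW.2, sub_zero])
      (by rw [inner_sub_eq_aff, aff_tilt_eq_zero.2 hV.1.2.1, aff_tilt_eq_zero.2 hW.1.2.1, sub_zero])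
    have h2 : ⟪d, W - V⟫ = 0 := by rw [inner_sub_right, heq, sub_self]
    rw [hr, inner_smul_right] at h2
    have hr0 : r = 0 := (mul_eq_zero.1 h2).resolve_right (by simpa using hd)
    rw [hr0, zero_smul, sub_eq_zero] at hr
    exact hr.symm
  obtain ⟨k, hk, hkj, hkX, hkV⟩ := exists_active_at_end (hnear V hV.1 hV.2).2 (hnear V hV.1 hV.2).1
    hV.1 hW.1 hV.2 hW.2 hX.1 (fun e he h1 h2 => by
      have := (hmm _ ⟨h1, h2⟩).1
      rw [inner_add_right, inner_smul_right, inner_sub_right] at this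
      nlinarith)
  obtain ⟨l, hl, hlj, hlX, hlW⟩ := exists_active_at_end (hnear W hW.1 hW.2).2 (hnear W hW.1 hW.2).1
    hW.1 hV.1 hW.2 hV.2 hX.1 (fun e he h1 h2 => by
      have := (hmm _ ⟨h1, h2⟩).2
      rw [inner_add_right, inner_smul_right, inner_sub_right] at this
      nlinarith)
  -- the ends lie on different ridges, since each ridge meets the rotated plane only once
  have hkW : 0 < aff k W := by
    refine lt_of_le_of_ne (hW.1.1 k hk) fun h0 => hVW ?_
    have htilt : aff (a - s • b) X ≠ 0 := by
      rw [aff_sub, aff_smul, hX.1.1]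
      have := mul_pos hs hbX
      linarith
    have hVX : V - X ≠ 0 := by
      intro h; rw [sub_eq_zero] at h
      exact htilt (h ▸ aff_tilt_eq_zero.2 hV.1.2.1)
    obtain ⟨r, hr⟩ := exists_eq_smul_of_orthogonal (hC.linearIndependent_pair hj hk hkj.symm hX.2 hkX)
      hVX (w := W - X)
      (by rw [inner_sub_eq_aff, hV.2, hX.2, sub_zero]) (by rw [inner_sub_eq_aff, hkV, hkX, sub_zero])
      (by rw [inner_sub_eq_aff, hW.2, hX.2, sub_zero]) (by rw [inner_sub_eq_aff, ← h0, hkX, sub_zero])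
    have hWX : W = X + r • (V - X) := by rw [← hr]; abel
    have h1 := aff_tilt_eq_zero.2 hW.1.2.1
    rw [hWX, aff_move, aff_tilt_eq_zero.2 hV.1.2.1, mul_zero, add_zero] at h1
    have hr1 : r = 1 := by
      have := (mul_eq_zero.1 h1).resolve_right htilt
      linarith
    rw [hWX, hr1]; simp
  have sV := hC.openSegment_subset_ridgeUp hj hk hkj.symm hs hX.1 hbX hV.1 hX.2 hkX hV.2 hkV
  have sW := hC.openSegment_subset_ridgeUp hj hl hlj.symm hs hX.1 hbX hW.1 hX.2 hlX hW.2 hlW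
  calc lenM (rim a b I s ∩ {x | aff j x = 0}) ≤ lenM (segment ℝ V W) := by
        rw [← hseg]; exact measure_mono hrimE
    _ = ENNReal.ofReal ‖V - W‖ := lenM_segment V W
    _ ≤ ENNReal.ofReal (‖X - V‖ + ‖X - W‖) := by
        apply ENNReal.ofReal_le_ofReal
        calc ‖V - W‖ = ‖(X - W) - (X - V)‖ := by congr 1; abel
          _ ≤ _ := by rw [add_comm]; exact norm_sub_le _ _
    _ = lenM (openSegment ℝ X V) + lenM (openSegment ℝ X W) := by
        rw [lenM_openSegment, lenM_openSegment, ENNReal.ofReal_add (norm_nonneg _) (norm_nonneg _)]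
    _ ≤ lenM (ridgeUp a b I s ∩ {x | aff j x = 0} ∩ {x | aff k x = 0}) +
          lenM ((ridgeUp a b I s ∩ {x | aff j x = 0}) \ {x | aff k x = 0}) := by
        refine add_le_add (measure_mono fun x hx => ?_) (measure_mono fun x hx => ?_)
        · have := sV hx
          exact ⟨⟨this.1, this.2.1⟩, this.2.2⟩
        · have h1 := sW hx
          refine ⟨⟨h1.1, h1.2.1⟩, fun h0 => ?_⟩
          obtain ⟨u, v, hu, hv, huv, rfl⟩ := hx
          have h0 : aff k (u • X + v • W) = 0 := h0
          rw [aff_combo k X W huv, hkX] at h0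
          have := mul_pos hv hkW
          linarith
    _ = _ := measure_inter_add_sdiff _ (isClosed_aff_eq k).measurableSet

/-! ### Rotation away from the ridges -/

/-- Statements holding near `0` hold on a whole interval `(s, 0]` for small negative `s`. -/
theorem eventually_forall_Ioc {φ : ℝ → Prop} (h : ∀ᶠ s in 𝓝 (0 : ℝ), φ s) :
    ∀ᶠ s in 𝓝[<] (0 : ℝ), ∀ t, s ≤ t → t ≤ 0 → φ t := by
  obtain ⟨ε, hε, hb⟩ := Metric.eventually_nhds_iff.1 h
  filter_upwards [Ioo_mem_nhdsLT (neg_lt_zero.2 hε)] with s hs t h1 h2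
  apply hb
  rw [Real.dist_eq, sub_zero, abs_lt]
  exact ⟨by linarith [hs.1], by linarith⟩

/-- Below the polygon, only the ridges traced by the moving corners appear. -/
theorem ConvexPiece.eventually_ridgeDown (hC : ConvexPiece a b I) {p q q' : E3 × ℝ} {X Y f f' : E3}
    (h : Side a b I p X Y f q f' q') : ∀ᶠ s in 𝓝[<] (0 : ℝ),
      ridgeDown a b I s ∩ {x | aff p x = 0} ⊆
        segment ℝ X (pos b X f s) ∪ segment ℝ Y (pos b Y f' s) := by
  -- the contribution of the planes through the left corner
  have left : ∀ {X Y f f' : E3} {q q' : E3 × ℝ}, Side a b I p X Y f q f' q' → ∀ᶠ s in 𝓝 (0 : ℝ),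
      s ≤ 0 → ∀ k ∈ I, k ≠ p → aff k X = 0 → ∀ y, y ∈ Kc I → aff p y = 0 →
      aff a y = s * aff b y → 0 < aff b y → aff k y = 0 → y = pos b X f s := by
    intro X Y f f' q q' h
    have hk : ∀ᶠ s in 𝓝 (0 : ℝ), ∀ k ∈ I, k ≠ p → aff k X = 0 → 0 < aff k (pos b Y f' s) := by
      rw [Finset.eventually_all]
      intro k hk
      by_cases hh : k ≠ p ∧ aff k X = 0
      · exact (eventually_pos_aff (h.left.other k hk hh.1 hh.2)).mono fun s hs _ _ => hs
      · exact Eventually.of_forall fun e h2 h3 => absurd ⟨h2, h3⟩ hh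
    filter_upwards [hk, hC.eventually_mem_side h, eventually_denom b f]
      with s hks ⟨_, _, _, hmem⟩ hden hs k hk hkp hkX y hyK hpy hay hby hky
    obtain ⟨t, ht, hyt⟩ := hmem y hpy hay (h.left.q_nonneg hyK hby.le) (h.right.q_nonneg hyK hby.le)
    have hA : 0 ≤ aff k (pos b X f s) := by
      rw [aff_pos, hkX, zero_add]
      rcases h.left.kind with hk' | hk'
      · rw [shift_eq_zero hk'.1]; simp
      · by_cases hkq : k = q
        · subst hkq
          rw [h.left.qf.resolve_left hk'.1.ne']; simp
        · exact mul_nonneg_of_nonpos_of_nonpos (h.left.shift_nonpos (by linarith [hden.1]) hs)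
            (hC.corner_inner_neg h.mem h.left hk'.1 hk hkp hkq hkX).le
    rw [hyt, aff_move] at hky
    have h1 := mul_nonneg (by linarith [ht.2] : 0 ≤ 1 - t) hA
    have hB := hks k hk hkp hkX
    have ht0 : t = 0 := by
      have := mul_nonneg ht.1 hB.le
      exact (mul_eq_zero.1 (by linarith : t * aff k (pos b Y f' s) = 0)).resolve_right hB.ne'
    rw [hyt, ht0]; simp
  have hfar : ∀ᶠ s in 𝓝 (0 : ℝ), ∀ k ∈ I, 0 < aff k X → 0 < aff k Y →
      0 < aff k (pos b X f s) ∧ 0 < aff k (pos b Y f' s) := by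
    rw [Finset.eventually_all]
    intro k hk
    by_cases hh : 0 < aff k X ∧ 0 < aff k Y
    · exact ((eventually_pos_aff hh.1).and (eventually_pos_aff hh.2)).mono fun s hs _ _ => hs
    · exact Eventually.of_forall fun e h2 h3 => absurd ⟨h2, h3⟩ hh
  filter_upwards [eventually_forall_Ioc (left h), eventually_forall_Ioc (left h.symm),
    eventually_forall_Ioc hfar, eventually_forall_Ioc (hC.eventually_mem_side h),
    eventually_forall_Ioc (eventually_denom b f), eventually_forall_Ioc (eventually_denom b f'),
    self_mem_nhdsWithin] with s hl hr hfar hmem hd hd' hs0 y hy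
  have hs0 : s < 0 := hs0
  obtain ⟨⟨⟨hyK, p1, hp1, p2, hp2, hne, hy1, hy2⟩, hby, hlo, hhi⟩, hpy⟩ := hy
  have hpy : aff p y = 0 := hpy
  obtain ⟨k, hk, hkp, hky⟩ : ∃ k ∈ I, k ≠ p ∧ aff k y = 0 := by
    by_cases h1 : p1 = p
    · exact ⟨p2, hp2, fun h2 => hne (h1.trans h2.symm), hy2⟩
    · exact ⟨p1, hp1, h1, hy1⟩
  set t := aff a y / aff b y with ht
  have hts : s < t := by rw [ht, lt_div_iff₀ hby]; exact hlo
  have ht0 : t ≤ 0 := div_nonpos_of_nonpos_of_nonneg hhi hby.le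
  have hay : aff a y = t * aff b y := by rw [ht]; field_simp
  rcases (h.left.left_mem.1.2.2 k hk).eq_or_lt with hkX | hkX
  · left
    rw [hl t hts.le ht0 ht0 k hk hkp hkX.symm y hyK hpy hay hby hky]
    exact pos_mem_segment (by linarith [(hd s le_rfl hs0.le).1]) (by linarith [(hd t hts.le ht0).1])
      hts ht0
  rcases (h.left.right_mem.1.2.2 k hk).eq_or_lt with hkY | hkY
  · right
    rw [hr t hts.le ht0 ht0 k hk hkp hkY.symm y hyK hpy hay hby hky]
    exact pos_mem_segment (by linarith [(hd' s le_rfl hs0.le).1])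
      (by linarith [(hd' t hts.le ht0).1]) hts ht0
  · exfalso
    obtain ⟨u, hu, hyu⟩ := (hmem t hts.le ht0).2.2.2 y hpy hay (h.left.q_nonneg hyK hby.le)
      (h.right.q_nonneg hyK hby.le)
    obtain ⟨h1, h2⟩ := hfar t hts.le ht0 k hk hkX hkY
    have hpos : 0 < aff k y := by
      rw [hyu]; exact Convex.move_mem (convex_aff_pos k) h1 h2 hu.1 hu.2
    exact hpos.ne' hky

/-- A facet touching the polygon only at a vertex does not reach below the plane of the polygon. -/
theorem ConvexPiece.nonneg_of_subsingleton (hC : ConvexPiece a b I) {j : E3 × ℝ} (hj : j ∈ I) {X : E3}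
    (hE : edge a b I j = {X}) {y : E3} (hy : y ∈ Kc I) (hjy : aff j y = 0) : 0 ≤ aff a y := by
  have hX : X ∈ edge a b I j := by rw [hE]; rfl
  obtain ⟨hbX, p, hp, Y, f, q, -, hXY, hc, hpj, hqj⟩ := hC.exists_corner_of_subsingleton hj hE
  obtain ⟨hq, hqp, Z, hZ, hZX, hpZ, hother, hval⟩ := hC.corner_aff hp hc hbX
  have hneg := hC.corner_inner_neg hp hc hbX hj hpj.symm hqj.symm hX.2
  have h1 := hval j y
  rw [hjy, hX.2, sub_zero, sub_zero, zero_add] at h1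
  have h2 : 0 ≤ aff q y / aff q Y * aff j Y :=
    mul_nonneg (div_nonneg (hy q hq) hc.qY.le) (hc.other j hj hpj.symm hX.2).le
  have h3 : 0 ≤ aff p y / aff p Z * aff j Z :=
    mul_nonneg (div_nonneg (hy p hp) hpZ.le) (hother j hj hqj.symm hX.2).le
  by_contra hcon
  have := mul_pos_of_neg_of_neg (not_le.1 hcon) hneg
  linarith

/-- The polygon is cut out by the planes of its sides of positive length. -/
theorem ConvexPiece.base_filter_subset (hC : ConvexPiece a b I) {J : Finset (E3 × ℝ)}
    (hJ : ∀ p ∈ I, ¬ (edge a b I p).Subsingleton → p ∈ J) : base a b J ⊆ base a b I := by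
  rintro y ⟨hay, hby, hyJ⟩
  refine ⟨hay, hby, fun j hj => ?_⟩
  by_cases hs : (edge a b I j).Subsingleton
  · obtain ⟨z, hz, -⟩ := hC.touch j hj
    have hE := hs.eq_singleton_of_mem hz
    obtain ⟨hbX, p, hp, Y, f, q, hseg, hXY, hc, hpj, hqj⟩ := hC.exists_corner_of_subsingleton hj hE
    obtain ⟨hq, hqp, Z, hZ, hZX, hpZ, hother, hval⟩ := hC.corner_aff hp hc hbX
    have hpJ : p ∈ J := hJ p hp fun h => hXY (h hc.left_mem hc.right_mem)
    have hqJ : q ∈ J := hJ q hq fun h => hZX (h hZ ⟨hz.1, hc.qX⟩)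
    rw [hval j y, hz.2, sub_zero, sub_zero, hay, zero_mul, add_zero, zero_add]
    exact add_nonneg
      (mul_nonneg (div_nonneg (hyJ q hqJ) hc.qY.le) (hc.other j hj hpj.symm hz.2).le)
      (mul_nonneg (div_nonneg (hyJ p hpJ) hpZ.le) (hother j hj hqj.symm hz.2).le)
  · exact hyJ j (hJ j hj hs)

end

section

variable {a b : E3 × ℝ} {I : Finset (E3 × ℝ)}

/-! ### Perimeter comparison -/

/-- The nearest-point projection onto a closed convex set is `1`-Lipschitz. -/
theorem exists_lipschitz_projection {T : Set E3} (hc : IsClosed T) (hconv : Convex ℝ T)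
    (hne : T.Nonempty) : ∃ π : E3 → E3, LipschitzWith 1 π ∧
      ∀ x ∈ T, ∀ y, (∀ z ∈ T, ⟪y - x, z - x⟫ ≤ 0) → π y = x := by
  have hex : ∀ u : E3, ∃ v ∈ T, ∀ z ∈ T, ⟪u - v, z - v⟫ ≤ 0 := by
    intro u
    obtain ⟨v, hv, h⟩ := exists_norm_eq_iInf_of_complete_convex hne hc.isComplete hconv u
    exact ⟨v, hv, (norm_eq_iInf_iff_real_inner_le_zero hconv hv).1 h⟩
  choose π hπ hvar using hex
  have key : ∀ u v x y : E3, ⟪u - x, y - x⟫ ≤ 0 → ⟪v - y, x - y⟫ ≤ 0 → ‖x - y‖ ≤ ‖u - v‖ := by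
    intro u v x y h1 h2
    have h3 : ‖x - y‖ ^ 2 ≤ ⟪u - v, x - y⟫ := by
      rw [← real_inner_self_eq_norm_sq]
      simp only [inner_sub_left, inner_sub_right] at *
      linarith [real_inner_comm x y, real_inner_comm u x, real_inner_comm u y,
        real_inner_comm v x, real_inner_comm v y]
    have h4 := real_inner_le_norm (u - v) (x - y)
    by_contra hlt
    rw [not_le] at hlt
    nlinarith [norm_nonneg (u - v), norm_nonneg (x - y)]
  refine ⟨π, LipschitzWith.of_dist_le_mul fun u v => ?_, fun x hx y hy => ?_⟩
  · rw [dist_eq_norm, dist_eq_norm, NNReal.coe_one, one_mul]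
    exact key u v _ _ (hvar u _ (hπ v)) (hvar v _ (hπ u))
  · have := key y y (π y) x (hvar y x hx) (hy _ (hπ y))
    rw [sub_self, norm_zero] at this
    exact sub_eq_zero.1 (norm_eq_zero.1 (le_antisymm this (norm_nonneg _)))

/-- The perimeter of the section `top`, off the hinge, is at most that of the polygon of displaced
corners, which contains it: the projection onto the section is `1`-Lipschitz and maps the boundary of the
larger polygon onto that of the smaller one. -/
theorem ConvexPiece.lenM_rim_le (hC : ConvexPiece a b I) {J : Finset (E3 × ℝ)} (hJI : J ⊆ I)
    (hJ : ∀ p ∈ I, ¬ (edge a b I p).Subsingleton → p ∈ J) {X Y f f' : E3 × ℝ → E3}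
    {q q' : E3 × ℝ → E3 × ℝ}
    (hS : ∀ p ∈ J, Side a b I p (X p) (Y p) (f p) (q p) (f' p) (q' p)) :
    ∀ᶠ s in 𝓝 (0 : ℝ), lenM (rim a b I s) ≤
      ∑ p ∈ J, ENNReal.ofReal ‖pos b (X p) (f p) s - pos b (Y p) (f' p) s‖ := by
  have hsub : base a b J ⊆ base a b I := hC.base_filter_subset hJ
  have hne : (base a b J).Nonempty := by
    obtain ⟨x, hx⟩ := hC.base_nonempty
    exact ⟨x, hx.1, hx.2.1, fun p hp => hx.2.2 p (hJI hp)⟩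
  have hqJ : ∀ {Z W g : E3} {p q : E3 × ℝ}, Corner a b I p Z W g q → q = b ∨ q ∈ J := by
    intro Z W g p q hc
    rcases hc.kind with h | ⟨-, hq, -, Z', hZ', hne⟩
    · exact Or.inl h.2
    · exact Or.inr (hJ q hq fun h => hne (h hZ' ⟨hc.left_mem.1, hc.qX⟩))
  have hmem : ∀ᶠ s in 𝓝 (0 : ℝ), ∀ p ∈ J, ∀ y, aff p y = 0 → aff a y = s * aff b y →
      0 ≤ aff (q p) y → 0 ≤ aff (q' p) y →
      y ∈ segment ℝ (pos b (X p) (f p) s) (pos b (Y p) (f' p) s) := by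
    rw [Finset.eventually_all]
    intro p hp
    filter_upwards [hC.eventually_mem_side (hS p hp)] with s ⟨_, _, _, hs⟩ y h1 h2 h3 h4
    obtain ⟨t, ht, rfl⟩ := hs y h1 h2 h3 h4
    rw [segment_eq_image']
    exact ⟨t, ht, rfl⟩
  have hli : ∀ᶠ s in 𝓝 (0 : ℝ), ∀ p ∈ I, LinearIndependent ℝ ![p.1, (a - s • b).1] := by
    rw [Finset.eventually_all]
    exact fun p hp => eventually_linearIndependent (hC.linearIndependent_face hp) b
  filter_upwards [hmem, hli, eventually_isCompact_top (hC.bdd.subset hsub) hne] with s hmem hli hcpt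
  rcases (rim a b I s).eq_empty_or_nonempty with he | ⟨x1, hx1⟩
  · rw [he]; simp
  obtain ⟨π, hlip, hπ⟩ := exists_lipschitz_projection (isClosed_top a b I s) (convex_top a b I s)
    ⟨x1, rim_subset_top hx1⟩
  have himg : rim a b I s ⊆
      π '' ⋃ p ∈ J, segment ℝ (pos b (X p) (f p) s) (pos b (Y p) (f' p) s) := by
    intro x hx
    obtain ⟨hxK, hax, hbx, j, hj, hjx⟩ := hx
    set n := (a - s • b).1 with hn
    have hn0 : n ≠ 0 := (hli j hj).ne_zero 1
    have hnn : ⟪n, n⟫ ≠ 0 := by simpa using hn0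
    -- the gradient of `j` along the rotated plane
    set ν := j.1 - (⟪j.1, n⟫ / ⟪n, n⟫) • n with hν
    have hnν : ⟪n, ν⟫ = 0 := by
      rw [hν, inner_sub_right, inner_smul_right, real_inner_comm j.1 n]
      field_simp; ring
    have hν0 : ν ≠ 0 := by
      intro h0
      have := LinearIndependent.pair_iff.1 (hli j hj) 1 (-(⟪j.1, n⟫ / ⟪n, n⟫)) (by
        rw [one_smul, neg_smul, ← sub_eq_add_neg]; exact h0)
      exact one_ne_zero this.1
    have hvar : ∀ t : ℝ, 0 ≤ t → ∀ z ∈ top a b I s, ⟪x - t • ν - x, z - x⟫ ≤ 0 := by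
      intro t ht z hz
      have h1 : ⟪ν, z - x⟫ = aff j z := by
        rw [hν, inner_sub_left, real_inner_smul_left, inner_sub_eq_aff, hjx, hn, inner_sub_eq_aff,
          aff_tilt_eq_zero.2 hz.2.1, aff_tilt_eq_zero.2 hax]; ring
      rw [sub_sub_cancel_left, inner_neg_left, real_inner_smul_left, h1]
      have := mul_nonneg ht (hz.1 j hj)
      linarith
    have htilt : ∀ t : ℝ, aff a (x - t • ν) = s * aff b (x - t • ν) := by
      intro t
      rw [← aff_tilt_eq_zero, sub_eq_add_neg x, ← neg_smul, aff_add_smul, ← hn, hnν,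
        aff_tilt_eq_zero.2 hax]; simp
    -- follow the outward normal until it leaves the larger polygon
    set S := {t : ℝ | 0 ≤ t ∧ x - t • ν ∈ top a b J s} with hS'
    have hScl : IsClosed S := by
      refine isClosed_Ici.inter ((isClosed_top a b J s).preimage (by fun_prop))
    have h0S : (0 : ℝ) ∈ S := by
      refine ⟨le_rfl, ?_⟩
      rw [zero_smul, sub_zero]
      exact ⟨fun p hp => hxK p (hJI hp), hax, hbx.le⟩
    have hSb : BddAbove S := by
      obtain ⟨R, hR⟩ := hcpt.isBounded.exists_norm_le
      refine ⟨(R + ‖x‖) / ‖ν‖, fun t ht => ?_⟩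
      rw [le_div_iff₀ (norm_pos_iff.2 hν0)]
      have h1 := hR _ ht.2
      have h2 : ‖t • ν‖ ≤ ‖x - t • ν‖ + ‖x‖ := by
        calc ‖t • ν‖ = ‖x - (x - t • ν)‖ := by congr 1; abel
          _ ≤ _ := by rw [add_comm]; exact norm_sub_le _ _
      rw [norm_smul, Real.norm_of_nonneg ht.1] at h2
      linarith
    have htS := hScl.csSup_mem ⟨0, h0S⟩ hSb
    set t := sSup S with ht
    set y := x - t • ν with hy
    have hact : aff b y = 0 ∨ ∃ k ∈ J, aff k y = 0 := by
      by_contra! hcon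
      have hb : 0 < aff b y := lt_of_le_of_ne htS.2.2.2 hcon.1.symm
      have hk : ∀ k ∈ J, 0 < aff k y := fun k hk =>
        lt_of_le_of_ne (htS.2.1 k hk) (hcon.2 k hk).symm
      have hev : ∀ᶠ z in 𝓝 y, 0 < aff b z ∧ z ∈ Ko J :=
        (eventually_aff_pos hb).and ((isOpen_Ko J).mem_nhds hk)
      obtain ⟨e, he, -, heb, heK⟩ := exists_small_move (-ν) hev one_pos
      have hmove : y + e • -ν = x - (t + e) • ν := by rw [hy]; module
      rw [hmove] at heb heK
      have : t + e ∈ S := ⟨by linarith [htS.1], Ko_subset_Kc J heK, htilt _, heb.le⟩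
      have := le_csSup hSb this
      linarith
    have hyx := hvar t htS.1
    rcases hact with hb | ⟨k, hk, hky⟩
    · exfalso
      have hay : aff a y = 0 := by rw [htilt, ← hy, hb, mul_zero]
      have hyI := hsub ⟨hay, hb.ge, htS.2.1⟩
      have h1 := hyx y ⟨hyI.2.2, htilt t, hb.ge⟩
      rw [← hy, real_inner_self_nonpos, sub_eq_zero] at h1
      rw [h1] at hb; exact hbx.ne' hb
    · refine ⟨y, ?_, hπ x ⟨hxK, hax, hbx.le⟩ y hyx⟩
      have hqn : ∀ {r : E3 × ℝ}, r = b ∨ r ∈ J → 0 ≤ aff r y := by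
        rintro r (rfl | hr)
        exacts [htS.2.2.2, htS.2.1 r hr]
      exact mem_biUnion hk (hmem k hk y hky (htilt t) (hqn (hqJ (hS k hk).left))
        (hqn (hqJ (hS k hk).right)))
  calc lenM (rim a b I s) ≤ _ := measure_mono himg
    _ ≤ (1 : NNReal) ^ (1 : ℝ) * lenM (⋃ p ∈ J, segment ℝ (pos b (X p) (f p) s) (pos b (Y p) (f' p) s)) :=
        hlip.hausdorffMeasure_image_le zero_le_one _
    _ = lenM (⋃ p ∈ J, segment ℝ (pos b (X p) (f p) s) (pos b (Y p) (f' p) s)) := by simp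
    _ ≤ ∑ p ∈ J, lenM (segment ℝ (pos b (X p) (f p) s) (pos b (Y p) (f' p) s)) :=
        measure_biUnion_finset_le _ _
    _ = _ := Finset.sum_congr rfl fun p _ => lenM_segment _ _

theorem lenM_le_sum {A : Set E3} (h : ∀ x ∈ A, ∃ p ∈ I, aff p x = 0) :
    lenM A ≤ ∑ p ∈ I, lenM (A ∩ {x | aff p x = 0}) := by
  refine (measure_mono (t := ⋃ p ∈ I, A ∩ {x | aff p x = 0}) fun x hx => ?_).trans
    (measure_biUnion_finset_le _ _)
  obtain ⟨p, hp, hpx⟩ := h x hx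
  exact mem_biUnion (show p ∈ (I : Set _) from hp) ⟨hx, hpx⟩

/-- Without constraints the polygon would be an unbounded half-plane. -/
theorem nonempty_of_isBounded_base (hb : Bornology.IsBounded (base a b I))
    (hne : (base a b I).Nonempty) : I.Nonempty := by
  rw [Finset.nonempty_iff_ne_empty]
  rintro rfl
  obtain ⟨d, hd, had, hbd⟩ := exists_ne_zero_orthogonal a.1 b.1
  obtain ⟨x, hx⟩ := hne
  obtain ⟨R, hR⟩ := hb.exists_norm_le
  have h : ∀ t : ℝ, 0 ≤ t → t * ‖d‖ ≤ R + ‖x‖ := by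
    intro t ht
    have h1 := hR (x + t • d) ⟨by rw [aff_add_smul, had, hx.1]; simp,
      by rw [aff_add_smul, hbd, mul_zero, add_zero]; exact hx.2.1, by simp [Kc]⟩
    calc t * ‖d‖ = ‖x + t • d - x‖ := by rw [add_sub_cancel_left, norm_smul, Real.norm_of_nonneg ht]
      _ ≤ _ := (norm_sub_le _ _).trans (by linarith)
  have hd' := norm_pos_iff.2 hd
  have hR0 : 0 ≤ R + ‖x‖ := by simpa using h 0 le_rfl
  have := h ((R + ‖x‖ + 1) / ‖d‖) (by positivity)
  rw [div_mul_cancel₀ _ hd'.ne'] at this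
  linarith

/-- The variation of the edge length caused by rotating the plane of a convex piece. The function `Ψ` is
the length computed with corners of degree three only; it bounds the variation from above for
rotations in both directions, and with a strict first-order gain `c` for rotations towards
`aff a > 0` if some plane touches the polygon only in a vertex. -/
theorem ConvexPiece.exists_length_bound (hC : ConvexPiece a b I) :
    ∃ (Ψ : ℝ → ℝ) (c : ℝ), 0 ≤ c ∧ DifferentiableAt ℝ Ψ 0 ∧
      ENNReal.ofReal (Ψ 0) ≤ lenM (rim a b I 0) ∧
      (∀ᶠ s in 𝓝[>] (0 : ℝ), lenM (rim a b I s) + ENNReal.ofReal (c * s) ≤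
        ENNReal.ofReal (Ψ s) + lenM (ridgeUp a b I s)) ∧
      (∀ᶠ s in 𝓝[<] (0 : ℝ), lenM (rim a b I s) + lenM (ridgeDown a b I s) ≤
        ENNReal.ofReal (Ψ s)) ∧
      ((∃ j ∈ I, (edge a b I j).Subsingleton) → 0 < c) ∧ 0 < Ψ 0 := by
  classical
  set J := I.filter (fun p => ¬ (edge a b I p).Subsingleton) with hJdef
  have hJI : J ⊆ I := Finset.filter_subset _ _
  have hJmem : ∀ p, p ∈ J ↔ p ∈ I ∧ ¬ (edge a b I p).Subsingleton := fun p => by simp [hJdef]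
  -- choose the corners of every side, preferring a left corner with a further plane through it
  have hdata : ∀ p ∈ J, ∃ (X Y f : E3) (q : E3 × ℝ) (f' : E3) (q' : E3 × ℝ) (c : ℝ),
      Side a b I p X Y f q f' q' ∧ 0 ≤ c ∧
      (c = 0 ∨ (0 < aff b X ∧ ∀ᶠ s in 𝓝[>] (0 : ℝ), ∀ V ∈ top a b I s,
        aff p V = 0 → ∀ k ∈ I, k ≠ p → aff k X = 0 → aff k V = 0 →
        ‖X - pos b X f s‖ + c * s ≤ ‖pos b X f s - V‖ + ‖X - V‖)) ∧
      ((∃ (X Y f : E3) (q : E3 × ℝ) (f' : E3) (q' : E3 × ℝ), Side a b I p X Y f q f' q' ∧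
        0 < aff b X ∧ ∃ j ∈ I, j ≠ p ∧ j ≠ q ∧ aff j X = 0) → 0 < c) := by
    intro p hp
    by_cases hex : ∃ (X Y f : E3) (q : E3 × ℝ) (f' : E3) (q' : E3 × ℝ), Side a b I p X Y f q f' q' ∧
        0 < aff b X ∧ ∃ j ∈ I, j ≠ p ∧ j ≠ q ∧ aff j X = 0
    · obtain ⟨X, Y, f, q, f', q', hS, hbX, j, hj, hjp, hjq, hjX⟩ := hex
      obtain ⟨c, hc, hsl⟩ := hC.exists_slack hS hbX hj hjp hjq hjX
      exact ⟨X, Y, f, q, f', q', c, hS, hc.le, Or.inr ⟨hbX, hsl⟩, fun _ => hc⟩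
    · obtain ⟨X, Y, f, q, f', q', hS⟩ :=
        hC.exists_side_of_not_subsingleton ((hJmem p).1 hp).1 ((hJmem p).1 hp).2
      exact ⟨X, Y, f, q, f', q', 0, hS, le_rfl, Or.inl rfl, fun h => absurd h hex⟩
  choose! X Y f q f' q' c hS hc0 hcs hcpos using hdata
  set L : ℝ → ℝ := fun s => ∑ p ∈ J, ‖pos b (X p) (f p) s - pos b (Y p) (f' p) s‖ with hL
  set σ : ℝ → ℝ := fun s => ∑ p ∈ J,
    (shift b (X p) (f p) s * ‖f p‖ + shift b (Y p) (f' p) s * ‖f' p‖) with hσ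
  set C := ∑ p ∈ J, c p with hCdef
  have hC0 : 0 ≤ C := Finset.sum_nonneg hc0
  have hLnn : ∀ s, 0 ≤ L s := fun s => Finset.sum_nonneg fun p _ => norm_nonneg _
  have hsub_single : ∀ j ∈ I, j ∉ J → ∃ x, edge a b I j = {x} := by
    intro j hj hjJ
    have hs : (edge a b I j).Subsingleton := by
      by_contra h; exact hjJ ((hJmem j).2 ⟨hj, h⟩)
    obtain ⟨z, hz, -⟩ := hC.touch j hj
    exact ⟨z, hs.eq_singleton_of_mem hz⟩
  refine ⟨fun s => L s - σ s / 2, C / 2, by positivity, ?_, ?_, ?_, ?_, ?_, ?_⟩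
  · refine DifferentiableAt.sub ?_ (DifferentiableAt.div_const ?_ _)
    · refine DifferentiableAt.fun_sum fun p hp => ?_
      refine DifferentiableAt.norm ℝ ((differentiableAt_pos _ _ _).sub (differentiableAt_pos _ _ _)) ?_
      rw [pos_zero, pos_zero, sub_ne_zero]
      exact (hS p hp).ne
    · exact DifferentiableAt.fun_sum fun p hp => ((differentiableAt_shift _ _ _).mul_const _).add
        ((differentiableAt_shift _ _ _).mul_const _)
  · -- `Ψ 0` is the total length of the sides
    have e : L 0 - σ 0 / 2 = ∑ p ∈ J, ‖X p - Y p‖ := by simp [hL, hσ]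
    change ENNReal.ofReal (L 0 - σ 0 / 2) ≤ _
    rw [e, ENNReal.ofReal_sum_of_nonneg fun p _ => norm_nonneg _]
    calc _ ≤ ∑ p ∈ J, lenM (rim a b I 0 ∩ {x | aff p x = 0}) := by
          refine Finset.sum_le_sum fun p hp => ?_
          rw [← lenM_openSegment]
          refine measure_mono ?_
          have h := hS p hp
          rintro _ ⟨u, v, hu, hv, huv, rfl⟩
          have h1 := h.left.left_mem
          have h2 := h.left.right_mem
          have hp0 : aff p (u • X p + v • Y p) = 0 := by
            rw [aff_combo _ _ _ huv, h1.2, h2.2]; simp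
          refine ⟨⟨convex_Kc I h1.1.2.2 h2.1.2.2 hu.le hv.le huv, ?_, ?_, p, hJI hp, hp0⟩, hp0⟩
          · rw [aff_combo _ _ _ huv, h1.1.1, h2.1.1]; simp
          · rw [aff_combo _ _ _ huv]
            rcases h.left.kind with hk | hk
            · have := h.left.qY
              rw [hk.2] at this
              rw [hk.1]; positivity
            · have := h2.1.2.1
              have := hk.1
              positivity
      _ ≤ ∑ p ∈ I, lenM (rim a b I 0 ∩ {x | aff p x = 0}) :=
          Finset.sum_le_sum_of_subset hJI
      _ ≤ (1 : ℕ) * lenM (rim a b I 0) := by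
          refine sum_lenM_inter_le (lenM_eq_zero_of_subsets fun K hK hKc => ?_)
          obtain ⟨p, r, hpr, rfl⟩ := Finset.card_eq_two.1 hKc
          rintro x ⟨hx, hx'⟩ y ⟨hy, hy'⟩
          simp only [Finset.insert_subset_iff, Finset.singleton_subset_iff] at hK
          refine hC.eq_of_two_planes hK.1 hK.2 hpr ?_ ?_ (hx' p (by simp)) (hy' p (by simp))
            (hx' r (by simp)) (hy' r (by simp))
          · rw [hx.2.1, zero_mul]
          · rw [hy.2.1, zero_mul]
      _ = _ := by simp
  · -- rotation towards `aff a > 0`: in the sum of the facet inequalities every ridge counts twice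
    have hfac : ∀ᶠ s in 𝓝[>] (0 : ℝ), ∀ p ∈ J, lenM (rim a b I s ∩ {x | aff p x = 0}) +
        ENNReal.ofReal (shift b (X p) (f p) s * ‖f p‖ + shift b (Y p) (f' p) s * ‖f' p‖ + c p * s) ≤
        ENNReal.ofReal ‖pos b (X p) (f p) s - pos b (Y p) (f' p) s‖ +
          lenM (ridgeUp a b I s ∩ {x | aff p x = 0}) := by
      rw [Finset.eventually_all]
      exact fun p hp => hC.facet_inequality (hS p hp) (hc0 p hp) (hcs p hp)
    have hver : ∀ᶠ s in 𝓝[>] (0 : ℝ), ∀ j ∈ I \ J, lenM (rim a b I s ∩ {x | aff j x = 0}) ≤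
        lenM (ridgeUp a b I s ∩ {x | aff j x = 0}) := by
      rw [Finset.eventually_all]
      intro j hj
      rw [Finset.mem_sdiff] at hj
      obtain ⟨x, hx⟩ := hsub_single j hj.1 hj.2
      exact hC.facet_inequality_of_subsingleton hj.1 hx
    have hden : ∀ᶠ s in 𝓝[>] (0 : ℝ), ∀ p ∈ J, 0 < 1 - s * ⟪b.1, f p⟫ ∧ 0 < 1 - s * ⟪b.1, f' p⟫ := by
      rw [Finset.eventually_all]
      intro p _
      filter_upwards [(eventually_denom b (f p)).filter_mono nhdsWithin_le_nhds,
        (eventually_denom b (f' p)).filter_mono nhdsWithin_le_nhds] with s h1 h2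
      exact ⟨by linarith [h1.1], by linarith [h2.1]⟩
    filter_upwards [hfac, hver, hden, (hC.lenM_rim_le hJI (fun p hp h => (hJmem p).2 ⟨hp, h⟩)
      hS).filter_mono nhdsWithin_le_nhds, self_mem_nhdsWithin] with s hfac hver hden hper hs
    have hs : 0 < s := hs
    rw [← ENNReal.ofReal_sum_of_nonneg fun p _ => norm_nonneg _] at hper
    have hnn : ∀ p ∈ J, 0 ≤ shift b (X p) (f p) s * ‖f p‖ + shift b (Y p) (f' p) s * ‖f' p‖ + c p * s := by
      intro p hp
      have h1 := (hS p hp).left.shift_nonneg (hden p hp).1 hs.le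
      have h2 := (hS p hp).right.shift_nonneg (hden p hp).2 hs.le
      have h3 := hc0 p hp
      positivity
    have hsum : lenM (rim a b I s) + ENNReal.ofReal (σ s + C * s) ≤
        ENNReal.ofReal (L s) + 2 * lenM (ridgeUp a b I s) := by
      calc _ ≤ (∑ p ∈ I, lenM (rim a b I s ∩ {x | aff p x = 0})) + ENNReal.ofReal (σ s + C * s) := by
            gcongr
            exact lenM_le_sum fun x hx => hx.2.2.2
        _ = ∑ p ∈ I \ J, lenM (rim a b I s ∩ {x | aff p x = 0}) +
            ∑ p ∈ J, (lenM (rim a b I s ∩ {x | aff p x = 0}) + ENNReal.ofReal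
              (shift b (X p) (f p) s * ‖f p‖ + shift b (Y p) (f' p) s * ‖f' p‖ + c p * s)) := by
            rw [← Finset.sum_sdiff hJI, add_assoc, Finset.sum_add_distrib,
              ← ENNReal.ofReal_sum_of_nonneg hnn, Finset.sum_add_distrib, ← Finset.sum_mul]
        _ ≤ ∑ p ∈ I \ J, lenM (ridgeUp a b I s ∩ {x | aff p x = 0}) +
            ∑ p ∈ J, (ENNReal.ofReal ‖pos b (X p) (f p) s - pos b (Y p) (f' p) s‖ +
              lenM (ridgeUp a b I s ∩ {x | aff p x = 0})) :=
            add_le_add (Finset.sum_le_sum hver) (Finset.sum_le_sum hfac)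
        _ = ENNReal.ofReal (L s) + ∑ p ∈ I, lenM (ridgeUp a b I s ∩ {x | aff p x = 0}) := by
            rw [Finset.sum_add_distrib, ← ENNReal.ofReal_sum_of_nonneg fun p _ => norm_nonneg _,
              ← Finset.sum_sdiff hJI]
            ring
        _ ≤ _ := by
            gcongr
            refine sum_lenM_inter_le (n := 2) (lenM_eq_zero_of_subsets fun K hK hKc => ?_)
            obtain ⟨p, r, t, hpr, hpt, hrt, rfl⟩ := Finset.card_eq_three.1 hKc
            rintro x ⟨hx, hx'⟩ y ⟨hy, hy'⟩
            simp only [Finset.insert_subset_iff, Finset.singleton_subset_iff] at hK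
            exact hC.eq_of_three_planes hK.1 hK.2.1 hK.2.2 hpr hpt hrt (hx' p (by simp))
              (hy' p (by simp)) (hx' r (by simp)) (hy' r (by simp)) (hx' t (by simp)) (hy' t (by simp))
    have hσ0 : 0 ≤ σ s + C * s := by
      have := Finset.sum_nonneg hnn
      rwa [Finset.sum_add_distrib, ← Finset.sum_mul] at this
    -- half the sum of the facet inequalities and the perimeter comparison
    by_cases htop : lenM (ridgeUp a b I s) = ⊤
    · rw [htop]; simp
    have hrim : lenM (rim a b I s) ≠ ⊤ := ne_top_of_le_ne_top ENNReal.ofReal_ne_top hper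
    rw [← ENNReal.ofReal_toReal htop, ← ENNReal.ofReal_toReal hrim] at hsum ⊢
    rw [← ENNReal.ofReal_toReal hrim] at hper
    set r := (lenM (rim a b I s)).toReal
    set u := (lenM (ridgeUp a b I s)).toReal
    have hr : 0 ≤ r := ENNReal.toReal_nonneg
    have hu : 0 ≤ u := ENNReal.toReal_nonneg
    have h2u : (2 : ENNReal) * ENNReal.ofReal u = ENNReal.ofReal (2 * u) := by
      rw [ENNReal.ofReal_mul zero_le_two]; simp
    rw [h2u, ← ENNReal.ofReal_add hr hσ0, ← ENNReal.ofReal_add (hLnn s) (by positivity),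
      ENNReal.ofReal_le_ofReal_iff (by have := hLnn s; positivity)] at hsum
    rw [ENNReal.ofReal_le_ofReal_iff (hLnn s)] at hper
    rw [← ENNReal.ofReal_add hr (by positivity)]
    refine le_trans (ENNReal.ofReal_le_ofReal ?_) ENNReal.ofReal_add_le
    linarith
  · -- rotation in the other direction: the new ridges are the traces of the corners, each of which
    -- lies on two sides
    have hdown : ∀ᶠ s in 𝓝[<] (0 : ℝ), ∀ p ∈ J, ridgeDown a b I s ∩ {x | aff p x = 0} ⊆
        segment ℝ (X p) (pos b (X p) (f p) s) ∪ segment ℝ (Y p) (pos b (Y p) (f' p) s) := by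
      rw [Finset.eventually_all]
      exact fun p hp => hC.eventually_ridgeDown (hS p hp)
    have hden : ∀ᶠ s in 𝓝[<] (0 : ℝ), ∀ p ∈ J, 0 < 1 - s * ⟪b.1, f p⟫ ∧ 0 < 1 - s * ⟪b.1, f' p⟫ := by
      rw [Finset.eventually_all]
      intro p _
      filter_upwards [(eventually_denom b (f p)).filter_mono nhdsWithin_le_nhds,
        (eventually_denom b (f' p)).filter_mono nhdsWithin_le_nhds] with s h1 h2
      exact ⟨by linarith [h1.1], by linarith [h2.1]⟩
    filter_upwards [hdown, hden, (hC.lenM_rim_le hJI (fun p hp h => (hJmem p).2 ⟨hp, h⟩)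
      hS).filter_mono nhdsWithin_le_nhds, self_mem_nhdsWithin] with s hdown hden hper hs
    have hs : s < 0 := hs
    rw [← ENNReal.ofReal_sum_of_nonneg fun p _ => norm_nonneg _] at hper
    have hτ : ∀ p ∈ J, 0 ≤ -(shift b (X p) (f p) s * ‖f p‖) ∧
        0 ≤ -(shift b (Y p) (f' p) s * ‖f' p‖) := by
      intro p hp
      have h1 := (hS p hp).left.shift_nonpos (hden p hp).1 hs.le
      have h2 := (hS p hp).right.shift_nonpos (hden p hp).2 hs.le
      constructor <;> nlinarith [norm_nonneg (f p), norm_nonneg (f' p)]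
    have hsum : 2 * lenM (ridgeDown a b I s) ≤ ENNReal.ofReal (-σ s) := by
      calc 2 * lenM (ridgeDown a b I s)
          ≤ ∑ p ∈ I, lenM (ridgeDown a b I s ∩ {x | aff p x = 0}) := by
            refine le_sum_lenM_inter (n := 2) fun x hx => ?_
            obtain ⟨⟨-, p, hp, r, hr, hpr, hpx, hrx⟩, -⟩ := hx
            exact Finset.one_lt_card.2 ⟨p, by simp [hp, hpx], r, by simp [hr, hrx], hpr⟩
        _ = ∑ p ∈ J, lenM (ridgeDown a b I s ∩ {x | aff p x = 0}) := by
            refine (Finset.sum_subset hJI fun j hj hjJ => ?_).symm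
            obtain ⟨x, hx⟩ := hsub_single j hj hjJ
            refine measure_mono_null (t := {x}) (fun y hy => ?_) (measure_singleton x)
            have h0 := hC.nonneg_of_subsingleton hj hx hy.1.1.1 hy.2
            rw [← hx]
            exact ⟨⟨le_antisymm hy.1.2.2.2 h0, hy.1.2.1.le, hy.1.1.1⟩, hy.2⟩
        _ ≤ ∑ p ∈ J, ENNReal.ofReal
              (-(shift b (X p) (f p) s * ‖f p‖) + -(shift b (Y p) (f' p) s * ‖f' p‖)) := by
            refine Finset.sum_le_sum fun p hp => ?_
            refine (measure_mono (hdown p hp)).trans ((measure_union_le _ _).trans ?_)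
            have h1 := (hS p hp).left.shift_nonpos (hden p hp).1 hs.le
            have h2 := (hS p hp).right.shift_nonpos (hden p hp).2 hs.le
            rw [lenM_segment, lenM_segment, norm_pos_sub, norm_pos_sub, abs_of_nonpos h1,
              abs_of_nonpos h2, neg_mul, neg_mul, ENNReal.ofReal_add (hτ p hp).1 (hτ p hp).2]
        _ = ENNReal.ofReal (-σ s) := by
            rw [← ENNReal.ofReal_sum_of_nonneg fun p hp => add_nonneg (hτ p hp).1 (hτ p hp).2]
            congr 1
            rw [hσ, ← Finset.sum_neg_distrib]
            exact Finset.sum_congr rfl fun p _ => by ring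
    have hσ0 : 0 ≤ -σ s := by
      rw [hσ, ← Finset.sum_neg_distrib]
      exact Finset.sum_nonneg fun p hp => by linarith [(hτ p hp).1, (hτ p hp).2]
    have hsum' : lenM (ridgeDown a b I s) ≤ ENNReal.ofReal (-σ s / 2) := by
      rw [ENNReal.ofReal_div_of_pos zero_lt_two, ENNReal.le_div_iff_mul_le (by simp) (by simp),
        mul_comm]
      simpa using hsum
    calc _ ≤ ENNReal.ofReal (L s) + ENNReal.ofReal (-σ s / 2) := add_le_add hper hsum'
      _ = _ := by
        rw [← ENNReal.ofReal_add (hLnn s) (by linarith)]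
        congr 1; ring
  · -- a plane touching the polygon in a vertex only gives slack at a corner there
    rintro ⟨j, hj, hsub⟩
    obtain ⟨x, hx⟩ := hsub_single j hj fun h => ((hJmem j).1 h).2 hsub
    obtain ⟨hbx, p, hp, Y', g, r, hseg, hne, hcor, hpj, hrj⟩ := hC.exists_corner_of_subsingleton hj hx
    have hxj : x ∈ edge a b I j := by rw [hx]; rfl
    have hpJ : p ∈ J := (hJmem p).2 ⟨hp, fun h => hne (h hcor.left_mem hcor.right_mem)⟩
    obtain ⟨g', r', hcor'⟩ := hC.exists_corner hp (hseg.trans (segment_symm ℝ x Y')) hne.symm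
    have hcp : 0 < c p := hcpos p hpJ ⟨x, Y', g, r, g', r', ⟨hp, hne, hcor, hcor'⟩, hbx, j, hj,
      hpj.symm, hrj.symm, hxj.2⟩
    have : 0 < C := Finset.sum_pos' hc0 ⟨p, hpJ, hcp⟩
    positivity
  · obtain ⟨p, hpJ⟩ : J.Nonempty := by
      refine nonempty_of_isBounded_base (hC.bdd.subset (hC.base_filter_subset fun p hp h =>
        (hJmem p).2 ⟨hp, h⟩)) ?_
      obtain ⟨x, hx⟩ := hC.base_nonempty
      exact ⟨x, hx.1, hx.2.1, fun p hp => hx.2.2 p (hJI hp)⟩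
    have : 0 < ∑ p ∈ J, ‖X p - Y p‖ := Finset.sum_pos' (fun p _ => norm_nonneg _)
      ⟨p, hpJ, norm_pos_iff.2 (sub_ne_zero.2 (hS p hpJ).ne)⟩
    simpa [hL, hσ] using this

end

section

variable {a b : E3 × ℝ} {I : Finset (E3 × ℝ)}

/-! ### Volume of the wedges -/

theorem volume_aff_eq_zero {p : E3 × ℝ} (hp : p.1 ≠ 0) : volume {x : E3 | aff p x = 0} = 0 := by
  by_cases hne : ∃ x0, aff p x0 = 0
  · obtain ⟨x0, hx0⟩ := hne
    have h : {x : E3 | aff p x = 0} =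
        (fun x => x + -x0) ⁻¹' (((ℝ ∙ p.1)ᗮ : Submodule ℝ E3) : Set E3) := by
      ext x
      simp only [mem_ofPred_eq, mem_preimage, SetLike.mem_coe, ← sub_eq_add_neg,
        Submodule.mem_orthogonal_singleton_iff_inner_right, inner_sub_eq_aff, hx0, sub_zero]
    rw [h, measure_preimage_add_right]
    refine Measure.addHaar_submodule _ _ fun htop => hp ?_
    have : p.1 ∈ ((ℝ ∙ p.1)ᗮ : Submodule ℝ E3) := htop ▸ Submodule.mem_top
    rwa [Submodule.mem_orthogonal_singleton_iff_inner_right, inner_self_eq_zero] at this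
  · have : {x : E3 | aff p x = 0} = ∅ := by
      ext x; simpa using fun h => hne ⟨x, h⟩
    rw [this, measure_empty]

/-- The open wedge between the plane of the polygon and the plane of slope `u` through the hinge. -/
def wedge (a b : E3 × ℝ) (I : Finset (E3 × ℝ)) (u : ℝ) : Set E3 :=
  {x | x ∈ Ko I ∧ 0 < aff b x ∧ 0 < aff a x / u ∧ aff a x / u < aff b x}

/-- Scaling by the factor `u` orthogonally to the plane `aff a = 0`. -/
noncomputable def stretch (a : E3 × ℝ) (u : ℝ) (x : E3) : E3 := x + ((u - 1) * aff a x) • a.1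

theorem aff_a_stretch (ha : ‖a.1‖ = 1) (u : ℝ) (x : E3) : aff a (stretch a u x) = u * aff a x := by
  rw [stretch, aff_add_grad, ha]; ring

theorem aff_stretch_of_orth (h : ⟪a.1, b.1⟫ = 0) (u : ℝ) (x : E3) :
    aff b (stretch a u x) = aff b x := by
  rw [stretch, aff_add_smul, real_inner_comm, h, mul_zero, add_zero]

theorem stretch_stretch (ha : ‖a.1‖ = 1) (u v : ℝ) (x : E3) :
    stretch a u (stretch a v x) = stretch a (u * v) x := by
  rw [stretch, aff_a_stretch ha, stretch, stretch, add_assoc, ← add_smul]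
  congr 2; ring

theorem stretch_one (x : E3) : stretch a 1 x = x := by simp [stretch]

theorem volume_preimage_stretch (ha : ‖a.1‖ = 1) {u : ℝ} (hu : u ≠ 0) (s : Set E3) :
    volume (stretch a u ⁻¹' s) = ENNReal.ofReal |u⁻¹| * volume s := by
  set T : E3 →ₗ[ℝ] E3 := LinearMap.transvection ((u - 1) • (innerₛₗ ℝ a.1)) a.1 with hT
  have hdet : LinearMap.det T = u := by
    rw [hT, LinearMap.transvection.det]
    simp [ha]
  have h : stretch a u ⁻¹' s = T ⁻¹' ((fun x => x + (-(u - 1) * a.2) • a.1) ⁻¹' s) := by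
    ext x
    have : stretch a u x = T x + (-(u - 1) * a.2) • a.1 := by
      rw [hT, LinearMap.transvection.apply, stretch, add_assoc, ← add_smul]
      congr 2
      simp [aff]; ring
    simp [this]
  rw [h, Measure.addHaar_preimage_linearMap _ (by rwa [hdet]), hdet, measure_preimage_add_right]

theorem continuous_stretch (a : E3 × ℝ) : Continuous fun z : ℝ × E3 => stretch a z.1 z.2 := by
  unfold stretch
  have := continuous_aff a
  fun_prop

/-- The wedge of slope `u`, scaled to slope one. -/
def unitWedge (a b : E3 × ℝ) (I : Finset (E3 × ℝ)) (u : ℝ) : Set E3 :=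
  {x | stretch a u x ∈ Ko I ∧ 0 < aff b x ∧ 0 < aff a x ∧ aff a x < aff b x}

theorem isOpen_unitWedge (a b : E3 × ℝ) (I : Finset (E3 × ℝ)) (u : ℝ) :
    IsOpen (unitWedge a b I u) := by
  refine ((isOpen_Ko I).preimage ?_).inter ((isOpen_aff_pos b).inter ((isOpen_aff_pos a).inter ?_))
  · exact (continuous_stretch a).comp (by fun_prop : Continuous fun x : E3 => (u, x))
  · exact isOpen_lt (continuous_aff a) (continuous_aff b)

theorem ConvexPiece.volume_wedge (hC : ConvexPiece a b I) {u : ℝ} (hu : u ≠ 0) :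
    volume (wedge a b I u) = ENNReal.ofReal |u| * volume (unitWedge a b I u) := by
  have : wedge a b I u = stretch a u⁻¹ ⁻¹' unitWedge a b I u := by
    ext x
    simp only [wedge, unitWedge, mem_ofPred_eq, mem_preimage, stretch_stretch hC.norm_a,
      mul_inv_cancel₀ hu, stretch_one, aff_a_stretch hC.norm_a, aff_stretch_of_orth hC.orth]
    rw [inv_mul_eq_div]
  rw [this, volume_preimage_stretch hC.norm_a (inv_ne_zero hu), inv_inv]

/-- The volumes of the wedges have a first-order expansion, with the same coefficient for both
directions of rotation. -/
theorem ConvexPiece.exists_volume_wedge (hC : ConvexPiece a b I) : ∃ w : ℝ → ℝ,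
    DifferentiableAt ℝ w 0 ∧ w 0 = 0 ∧
    (∀ᶠ u in 𝓝[>] (0 : ℝ), 0 ≤ w u ∧ volume (wedge a b I u) = ENNReal.ofReal (w u)) ∧
    (∀ᶠ u in 𝓝[<] (0 : ℝ), w u ≤ 0 ∧ volume (wedge a b I u) = ENNReal.ofReal (-w u)) := by
  -- a ball containing all scaled wedges of small slope
  obtain ⟨R, hR⟩ := hC.bdd.subset_ball 0
  obtain ⟨s0, hs0, hs⟩ := exists_slope_of_open hC.bdd hC.base_nonempty Metric.isOpen_ball hR
  obtain ⟨M, hM⟩ : ∃ M, ∀ x ∈ Metric.ball (0 : E3) R, aff b x ≤ M := by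
    obtain ⟨M, hM⟩ := (isCompact_closedBall (0 : E3) R).exists_bound_of_continuousOn
      (continuous_aff b).continuousOn
    exact ⟨M, fun x hx => (le_abs_self _).trans (hM x (Metric.ball_subset_closedBall hx))⟩
  have hsmall : ∀ᶠ u in 𝓝 (0 : ℝ), |u| < min s0 1 := by
    have : Tendsto (fun u : ℝ => |u|) (𝓝 0) (𝓝 0) := by simpa using (continuous_abs).tendsto (0 : ℝ)
    exact this.eventually (gt_mem_nhds (by positivity))
  have hsub : ∀ᶠ u in 𝓝 (0 : ℝ), unitWedge a b I u ⊆ Metric.ball (0 : E3) (R + 2 * M) := by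
    filter_upwards [hsmall] with u hu x ⟨hxK, hxb, hxa, hxab⟩
    have hu1 := hu.trans_le (min_le_right _ _)
    have hmem := hs _ (Ko_subset_Kc I hxK) (by rw [aff_stretch_of_orth hC.orth]; exact hxb.le) (by
      rw [aff_a_stretch hC.norm_a, aff_stretch_of_orth hC.orth, abs_mul, abs_of_pos hxa]
      have := hu.trans_le (min_le_left _ _)
      exact mul_le_mul this.le hxab.le hxa.le hs0.le)
    have hbM := hM _ hmem
    rw [aff_stretch_of_orth hC.orth] at hbM
    rw [mem_ball_zero_iff] at hmem ⊢
    have hx : x = stretch a u x - ((u - 1) * aff a x) • a.1 := by simp [stretch]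
    have habs : |u - 1| ≤ 2 := by rw [abs_le]; rw [abs_lt] at hu1; constructor <;> linarith
    calc ‖x‖ ≤ ‖stretch a u x‖ + ‖((u - 1) * aff a x) • a.1‖ := by
          conv_lhs => rw [hx]
          exact norm_sub_le _ _
      _ = ‖stretch a u x‖ + |u - 1| * aff a x := by
          rw [norm_smul, hC.norm_a, mul_one, Real.norm_eq_abs, abs_mul, abs_of_pos hxa]
      _ < R + 2 * M := by
          have : |u - 1| * aff a x ≤ 2 * M := mul_le_mul habs (by linarith) hxa.le (by norm_num)
          linarith
  have hae : ∀ᵐ x : E3, ∀ p ∈ I, aff p (stretch a 0 x) ≠ 0 := by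
    refine (ae_ball_iff (S := (I : Set (E3 × ℝ))) I.countable_toSet).2 ?_
    intro p hp
    have h0 : (p - ⟪p.1, a.1⟫ • a).1 ≠ 0 := by
      intro h
      have := LinearIndependent.pair_iff.1 (hC.linearIndependent_face hp) 1 (-⟪p.1, a.1⟫) (by
        rw [one_smul, neg_smul, ← sub_eq_add_neg]; exact h)
      exact one_ne_zero this.1
    rw [ae_iff]
    refine measure_mono_null (fun x hx => ?_) (volume_aff_eq_zero h0)
    simp only [ne_eq, not_not, mem_ofPred_eq, stretch, aff_add_smul, aff_sub, aff_smul] at hx ⊢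
    linarith
  have hlim : Tendsto (fun u => volume (unitWedge a b I u)) (𝓝 0) (𝓝 (volume (unitWedge a b I 0))) := by
    refine tendsto_measure_of_ae_tendsto_indicator _ (isOpen_unitWedge a b I 0).measurableSet
      (fun u => (isOpen_unitWedge a b I u).measurableSet) measurableSet_ball
      measure_ball_lt_top.ne hsub ?_
    filter_upwards [hae] with x hx
    have hc : ∀ p, Tendsto (fun u => aff p (stretch a u x)) (𝓝 0) (𝓝 (aff p (stretch a 0 x))) :=
      fun p => (((continuous_aff p).comp (continuous_stretch a)).comp
        (by fun_prop : Continuous fun u : ℝ => (u, x))).tendsto 0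
    have : ∀ᶠ u in 𝓝 (0 : ℝ), ∀ p ∈ I, (0 < aff p (stretch a u x) ↔ 0 < aff p (stretch a 0 x)) := by
      rw [Finset.eventually_all]
      intro p hp
      rcases lt_or_gt_of_ne (hx p hp) with h | h
      · filter_upwards [(hc p).eventually (gt_mem_nhds h)] with u hu
        exact ⟨fun h' => absurd h' hu.not_gt, fun h' => absurd h' h.not_gt⟩
      · filter_upwards [(hc p).eventually (lt_mem_nhds h)] with u hu
        exact ⟨fun _ => h, fun _ => hu⟩
    filter_upwards [this] with u hu
    exact and_congr_left fun _ => forall₂_congr hu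
  have hfin : ∀ᶠ u in 𝓝 (0 : ℝ), volume (unitWedge a b I u) ≠ ⊤ := by
    filter_upwards [hsub] with u hu
    exact ((measure_mono hu).trans_lt measure_ball_lt_top).ne
  have hfin0 : volume (unitWedge a b I 0) ≠ ⊤ := hfin.self_of_nhds
  have hlim' := (ENNReal.tendsto_toReal hfin0).comp hlim
  refine ⟨fun u => u * (volume (unitWedge a b I u)).toReal, ?_, zero_mul _, ?_, ?_⟩
  · refine HasDerivAt.differentiableAt (f' := (volume (unitWedge a b I 0)).toReal) ?_
    rw [hasDerivAt_iff_tendsto_slope]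
    refine (hlim'.mono_left nhdsWithin_le_nhds).congr' ?_
    filter_upwards [self_mem_nhdsWithin] with u hu
    rw [slope_def_field]
    have : u ≠ 0 := hu
    simp only [Function.comp]
    field_simp; ring
  · filter_upwards [hfin.filter_mono nhdsWithin_le_nhds, self_mem_nhdsWithin] with u hu (hu0 : 0 < u)
    refine ⟨by positivity, ?_⟩
    rw [hC.volume_wedge hu0.ne', ENNReal.ofReal_mul hu0.le, ENNReal.ofReal_toReal hu, abs_of_pos hu0]
  · filter_upwards [hfin.filter_mono nhdsWithin_le_nhds, self_mem_nhdsWithin] with u hu (hu0 : u < 0)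
    refine ⟨mul_nonpos_of_nonpos_of_nonneg hu0.le ENNReal.toReal_nonneg, ?_⟩
    rw [hC.volume_wedge hu0.ne, ← neg_mul, ENNReal.ofReal_mul (by linarith), ENNReal.ofReal_toReal hu,
      abs_of_neg hu0]

end

section

variable {a b : E3 × ℝ} {I : Finset (E3 × ℝ)}

/-! ### Sign vectors -/

/-- `x` and `y` lie on the same side of every plane of `S`. It is used for families `S` closed under
negation, where it says that `x` and `y` lie in the same open cell of the arrangement. -/
def SameSign (S : Set (E3 × ℝ)) (x y : E3) : Prop := ∀ p ∈ S, (0 < aff p x ↔ 0 < aff p y)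

/-- `x` lies in the closure of the cell of `y`. -/
def Degenerates (S : Set (E3 × ℝ)) (x y : E3) : Prop := ∀ p ∈ S, 0 ≤ aff p y → 0 ≤ aff p x

/-- The set `P` is a union of cells of the arrangement `S`. -/
def SignDetermined (S : Set (E3 × ℝ)) (P : Set E3) : Prop :=
  ∀ x y, SameSign S x y → (x ∈ P ↔ y ∈ P)

/-- `S` is closed under negation. -/
def NegClosed (S : Set (E3 × ℝ)) : Prop := ∀ p ∈ S, -p ∈ S

variable {S : Set (E3 × ℝ)} {P : Set E3} {x y z : E3}

theorem SameSign.symm (h : SameSign S x y) : SameSign S y x := fun p hp => (h p hp).symm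

theorem SameSign.mono {S' : Set (E3 × ℝ)} (h : SameSign S' x y) (hS : S ⊆ S') : SameSign S x y :=
  fun p hp => h p (hS hp)

theorem SignDetermined.mono {S' : Set (E3 × ℝ)} (h : SignDetermined S P) (hS : S ⊆ S') :
    SignDetermined S' P := fun _ _ hxy => h _ _ (hxy.mono hS)

theorem SameSign.neg_iff (hS : NegClosed S) (h : SameSign S x y) {p : E3 × ℝ} (hp : p ∈ S) :
    aff p x < 0 ↔ aff p y < 0 := by
  have := h (-p) (hS p hp)
  simpa using this

theorem SameSign.eq_zero_iff (hS : NegClosed S) (h : SameSign S x y) {p : E3 × ℝ} (hp : p ∈ S) :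
    aff p x = 0 ↔ aff p y = 0 := by
  have h1 := h p hp
  have h2 := h.neg_iff hS hp
  constructor <;> intro h0
  · refine le_antisymm (not_lt.1 fun h' => ?_) (not_lt.1 fun h' => ?_)
    · exact (h1.2 h').ne' h0
    · exact (h2.2 h').ne h0
  · refine le_antisymm (not_lt.1 fun h' => ?_) (not_lt.1 fun h' => ?_)
    · exact (h1.1 h').ne' h0
    · exact (h2.1 h').ne h0

theorem Degenerates.eq_zero (hS : NegClosed S) (h : Degenerates S x y) {p : E3 × ℝ} (hp : p ∈ S)
    (h0 : aff p y = 0) : aff p x = 0 := by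
  refine le_antisymm ?_ (h p hp h0.ge)
  have := h (-p) (hS p hp) (by simp [h0])
  simpa using this

theorem Degenerates.sameSign_move (hS : NegClosed S) (h : Degenerates S x y) {t : ℝ} (h0 : 0 < t)
    (h1 : t ≤ 1) : SameSign S (x + t • (y - x)) y := by
  intro p hp
  rw [aff_move]
  constructor
  · intro hpos
    by_contra! hle
    rcases hle.eq_or_lt with h' | h'
    · rw [h.eq_zero hS hp h', h'] at hpos; simp at hpos
    · have := h (-p) (hS p hp) (by simp [h'.le])
      rw [aff_neg] at this
      nlinarith
  · intro hpos
    have := h p hp hpos.le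
    nlinarith

/-- Two points of the same cell have the same local picture. -/
theorem SameSign.eventually (hfin : S.Finite) (hS : NegClosed S) (h : SameSign S x y) :
    ∀ᶠ w in 𝓝 (0 : E3), SameSign S (x + w) (y + w) := by
  have hmv : ∀ u : E3, Tendsto (fun w : E3 => u + w) (𝓝 0) (𝓝 u) := fun u => by
    have : Continuous fun w : E3 => u + w := by fun_prop
    simpa using this.tendsto 0
  refine (eventually_all_finite hfin).2 fun p hp => ?_
  rcases lt_trichotomy (aff p x) 0 with h' | h' | h'
  · filter_upwards [(hmv x).eventually (eventually_aff_neg h'),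
      (hmv y).eventually (eventually_aff_neg ((h.neg_iff hS hp).1 h'))] with w h1 h2
    exact ⟨fun h3 => absurd h3 h1.not_gt, fun h3 => absurd h3 h2.not_gt⟩
  · refine Eventually.of_forall fun w => ?_
    rw [aff_add_vec, aff_add_vec, h', (h.eq_zero_iff hS hp).1 h']
  · filter_upwards [(hmv x).eventually (eventually_aff_pos h'),
      (hmv y).eventually (eventually_aff_pos ((h p hp).1 h'))] with w h1 h2
    exact ⟨fun _ => h2, fun _ => h1⟩

theorem eventually_nhds_iff_add {φ : E3 → Prop} : (∀ᶠ w in 𝓝 x, φ w) ↔ ∀ᶠ w in 𝓝 (0 : E3), φ (x + w) := by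
  conv_lhs => rw [← map_add_left_nhds_zero x]
  rw [eventually_map]

/-- An equality of germs of two unions of cells at `x` carries over to all points of the cell of
`x`. -/
theorem SameSign.eventually_iff (hfin : S.Finite) (hS : NegClosed S) (h : SameSign S x y) {P Q : Set E3}
    (hP : SignDetermined S P) (hQ : SignDetermined S Q) (hx : ∀ᶠ v in 𝓝 x, (v ∈ P ↔ v ∈ Q)) :
    ∀ᶠ v in 𝓝 y, (v ∈ P ↔ v ∈ Q) := by
  rw [eventually_nhds_iff_add] at hx ⊢
  filter_upwards [hx, h.eventually hfin hS] with w hw hs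
  rw [← hP _ _ hs, ← hQ _ _ hs, hw]

theorem Degenerates.eventually_iff (hfin : S.Finite) (hS : NegClosed S) (h : Degenerates S x y)
    {P Q : Set E3} (hP : SignDetermined S P) (hQ : SignDetermined S Q)
    (hx : ∀ᶠ v in 𝓝 x, (v ∈ P ↔ v ∈ Q)) : ∀ᶠ v in 𝓝 y, (v ∈ P ↔ v ∈ Q) := by
  obtain ⟨t, h0, h1, ht⟩ := exists_small_move (y - x) hx.eventually_nhds one_pos
  exact (h.sameSign_move hS h0 h1.le).eventually_iff hfin hS hP hQ ht

theorem exists_mem_segment_frontier {U : Set E3} (hx : x ∈ U) (hy : y ∉ U) :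
    ∃ z ∈ segment ℝ x y, z ∈ frontier U := by
  by_contra! hne
  obtain ⟨z, -, hz1, hz2⟩ := (convex_segment x y).isPreconnected (interior U) (closure U)ᶜ
    isOpen_interior isClosed_closure.isOpen_compl
    (fun z hz => by
      by_contra hcon
      rw [mem_union, mem_compl_iff, not_or, not_not] at hcon
      exact hne z hz ⟨hcon.2, hcon.1⟩)
    ⟨x, left_mem_segment ℝ x y, by
      by_contra hcon
      exact hne x (left_mem_segment ℝ x y) ⟨subset_closure hx, hcon⟩⟩
    ⟨y, right_mem_segment ℝ x y, fun hcl =>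
      hne y (right_mem_segment ℝ x y) ⟨hcl, fun h => hy (interior_subset h)⟩⟩
  exact hz2 (subset_closure (interior_subset hz1))

/-- A regular closed set whose frontier lies in the planes of `S` is a union of cells of the
arrangement. -/
theorem signDetermined_of_frontier {S : Set (E3 × ℝ)} (hfin : S.Finite) (hS : NegClosed S)
    (hn : ∀ p ∈ S, p.1 ≠ 0) {P : Set E3} (hP : closure (interior P) = P)
    (hfr : ∀ x ∈ frontier P, ∃ p ∈ S, aff p x = 0) : SignDetermined S P := by
  have hcl : IsClosed P := hP ▸ isClosed_closure
  -- off the planes, membership is constant along the segment joining two points of a cell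
  have hgen : ∀ x y, (∀ p ∈ S, aff p x ≠ 0) → SameSign S x y → x ∈ P → y ∈ P := by
    intro x y hx hxy hxP
    by_contra hyP
    obtain ⟨z, hz, hzf⟩ := exists_mem_segment_frontier hxP hyP
    obtain ⟨p, hp, hpz⟩ := hfr z hzf
    obtain ⟨s, t, hs, ht, hst, rfl⟩ := hz
    rcases lt_or_gt_of_ne (hx p hp) with h | h
    · have h' := (hxy.neg_iff hS hp).1 h
      have := convex_aff_pos (-p) (x := x) (y := y) (by simpa using h) (by simpa using h') hs ht hst
      simp [hpz] at this
    · exact (convex_aff_pos p h ((hxy p hp).1 h) hs ht hst).ne' hpz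
  have key : ∀ x y, SameSign S x y → x ∈ P → y ∈ P := by
    intro x y hxy hxP
    -- a generic point of `P` close to `x`
    have hV : IsOpen {v | ∀ p ∈ S, aff p x ≠ 0 → 0 < aff p v * aff p x} := by
      have : {v | ∀ p ∈ S, aff p x ≠ 0 → 0 < aff p v * aff p x} =
          ⋂ p ∈ S, {v | aff p x ≠ 0 → 0 < aff p v * aff p x} := by ext; simp
      rw [this]
      refine hfin.isOpen_biInter fun p _ => ?_
      by_cases h : aff p x = 0
      · simp [h]
      · have hc := continuous_aff p
        simpa [h] using isOpen_lt continuous_const (hc.mul continuous_const)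
    have hxV : x ∈ {v | ∀ p ∈ S, aff p x ≠ 0 → 0 < aff p v * aff p x} :=
      fun p _ h => mul_self_pos.2 h
    obtain ⟨v, hvV, hvP⟩ := mem_closure_iff.1 (hP.symm ▸ hxP) _ hV hxV
    obtain ⟨w, ⟨hwV, hwP⟩, hw⟩ := exists_mem_open_forall_aff_ne S hfin hn (hV.inter isOpen_interior)
      ⟨v, hvV, hvP⟩
    have hev : ∀ᶠ v in 𝓝 y, ∀ p ∈ S, aff p y ≠ 0 → 0 < aff p v * aff p y := by
      refine (eventually_all_finite hfin).2 fun p _ => ?_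
      by_cases h : aff p y = 0
      · simp [h]
      · have hc := continuous_aff p
        filter_upwards [(isOpen_lt continuous_const (hc.mul continuous_const)).mem_nhds
          (show (0 : ℝ) < aff p y * aff p y from mul_self_pos.2 h)] with v hv _ using hv
    rw [← hcl.closure_eq, mem_closure_iff_nhds]
    intro U hU
    obtain ⟨t, ht0, -, htU, ht⟩ := exists_small_move (w - x)
      (Filter.Eventually.and (show ∀ᶠ v in 𝓝 y, v ∈ U from hU) hev) one_pos
    refine ⟨_, htU, hgen w _ hw (fun p hp => ?_) (interior_subset hwP)⟩
    rcases lt_trichotomy (aff p x) 0 with h | h | h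
    · have h1 := ht p hp ((hxy.neg_iff hS hp).1 h).ne
      have h2 := hwV p hp h.ne
      have h3 := (hxy.neg_iff hS hp).1 h
      constructor <;> intro h4 <;> nlinarith
    · rw [aff_add_smul, inner_sub_eq_aff, h, (hxy.eq_zero_iff hS hp).1 h, sub_zero, zero_add]
      exact (mul_pos_iff_of_pos_left ht0).symm
    · have h1 := ht p hp ((hxy p hp).1 h).ne'
      have h2 := hwV p hp h.ne'
      have h3 := (hxy p hp).1 h
      exact ⟨fun _ => pos_of_mul_pos_left h1 h3.le, fun _ => pos_of_mul_pos_left h2 h.le⟩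
  exact fun x y h => ⟨key x y h, key y x h.symm⟩

theorem signDetermined_Ko (hI : (I : Set (E3 × ℝ)) ⊆ S) : SignDetermined S (Ko I) :=
  fun _ _ h => forall₂_congr fun p hp => h p (hI hp)

theorem signDetermined_pos_inter {p : E3 × ℝ} (hp : p ∈ S) {Q : Set E3} (hQ : SignDetermined S Q) :
    SignDetermined S {v | 0 < aff p v ∧ v ∈ Q} := fun _ _ h => and_congr (h p hp) (hQ _ _ h)

theorem SignDetermined.compl (h : SignDetermined S P) : SignDetermined S Pᶜ :=
  fun x y hxy => not_congr (h x y hxy)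

/-- A finite family of planes, closed under negation, of which `P` is a union of cells. -/
theorem IsPolyhedron.exists_arrangement (hP : IsPolyhedron P) : ∃ S : Set (E3 × ℝ), S.Finite ∧
    NegClosed S ∧ (∀ p ∈ S, ‖p.1‖ = 1) ∧ (∀ x ∈ frontier P, ∃ p ∈ S, aff p x = 0) ∧
    SignDetermined S P := by
  obtain ⟨S0, hfin, hn, hfr⟩ := hP.exists_planes
  set S := (fun p : E3 × ℝ => ‖p.1‖⁻¹ • p) '' S0 with hS
  have hunit : ∀ p ∈ S, ‖p.1‖ = 1 := by
    rintro _ ⟨p, hp, rfl⟩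
    rw [Prod.smul_fst, norm_smul, norm_inv, norm_norm, inv_mul_cancel₀ (norm_ne_zero_iff.2 (hn p hp))]
  have h1 : (S ∪ (fun p => -p) '' S).Finite := (hfin.image _).union ((hfin.image _).image _)
  have h2 : NegClosed (S ∪ (fun p => -p) '' S) := by
    rintro p (hp | ⟨p, hp, rfl⟩)
    · exact Or.inr ⟨p, hp, rfl⟩
    · left; simpa using hp
  have h3 : ∀ p ∈ S ∪ (fun p => -p) '' S, ‖p.1‖ = 1 := by
    rintro p (hp | ⟨p, hp, rfl⟩)
    · exact hunit p hp
    · simpa using hunit p hp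
  have h4 : ∀ x ∈ frontier P, ∃ p ∈ S ∪ (fun p => -p) '' S, aff p x = 0 := by
    intro x hx
    obtain ⟨p, hp, hpx⟩ := mem_iUnion₂.1 (hfr hx)
    exact ⟨_, Or.inl ⟨p, hp, rfl⟩, by rw [aff_smul, aff, sub_eq_zero.2 hpx, mul_zero]⟩
  refine ⟨_, h1, h2, h3, h4, signDetermined_of_frontier h1 h2 (fun p hp h => ?_) hP.closure_interior h4⟩
  have := h3 p hp
  rw [h, norm_zero] at this
  exact zero_ne_one this

/-- A point over a plane of small slope through the hinge `aff a = aff b = 0` lies in a cell having a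
point of the plane `aff a = 0` off the hinge in its closure; the bound on the slope is uniform. -/
theorem eventually_exists_degenerates {S : Set (E3 × ℝ)} (hfin : S.Finite) (a b : E3 × ℝ) (R : ℝ) :
    ∀ᶠ s in 𝓝[>] (0 : ℝ), ∀ y ∈ Metric.ball (0 : E3) R, 0 < aff b y → |aff a y| ≤ s * aff b y →
      ∃ z, aff a z = 0 ∧ 0 < aff b z ∧ Degenerates S z y := by
  -- add to `S` the planes `aff a = 0` and a box containing the ball
  set e : Fin 3 → E3 := fun i => EuclideanSpace.single i 1 with he
  set S' : Set (E3 × ℝ) := S ∪ ({a, -a} ∪ ((range fun i => (e i, -R)) ∪ (range fun i => (-e i, -R))))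
    with hS'
  have hfin' : S'.Finite :=
    hfin.union ((toFinite _).union ((finite_range _).union (finite_range _)))
  have key : ∀ T ∈ 𝒫 S', ∀ᶠ s in 𝓝[>] (0 : ℝ), ∀ y ∈ Metric.ball (0 : E3) R, 0 < aff b y →
      |aff a y| ≤ s * aff b y → T = {p ∈ S' | 0 ≤ aff p y} →
      ∃ z, aff a z = 0 ∧ 0 < aff b z ∧ Degenerates S z y := by
    intro T hT
    by_cases hz : ∃ z, aff a z = 0 ∧ 0 < aff b z ∧ ∀ p ∈ T, 0 ≤ aff p z
    · obtain ⟨z, h1, h2, h3⟩ := hz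
      refine Eventually.of_forall fun s y _ _ _ hTy => ⟨z, h1, h2, fun p hp h0 => h3 p ?_⟩
      rw [hTy]; exact ⟨Or.inl hp, h0⟩
    by_cases hTb : (∀ i, (e i, -R) ∈ T) ∧ (∀ i, (-e i, -R) ∈ T) ∧ (a ∈ T ∨ -a ∈ T)
    swap
    · refine Eventually.of_forall fun s y hy _ _ hTy => (hTb ?_).elim
      have hin : ∀ i, |⟪e i, y⟫| ≤ R := fun i => by
        refine (abs_real_inner_le_norm _ _).trans ?_
        rw [mem_ball_zero_iff] at hy
        simpa [he] using hy.le
      refine ⟨fun i => ?_, fun i => ?_, ?_⟩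
      · rw [hTy]
        refine ⟨Or.inr (Or.inr (Or.inl ⟨i, rfl⟩)), ?_⟩
        have := neg_le_of_abs_le (hin i)
        simp only [aff]; linarith
      · rw [hTy]
        refine ⟨Or.inr (Or.inr (Or.inr ⟨i, rfl⟩)), ?_⟩
        have := le_of_abs_le (hin i)
        simp only [aff, inner_neg_left]; linarith
      · rw [hTy]
        rcases le_total 0 (aff a y) with h | h
        · exact Or.inl ⟨Or.inr (Or.inl (Or.inl rfl)), h⟩
        · exact Or.inr ⟨Or.inr (Or.inl (Or.inr rfl)), by simpa using h⟩
    have hbd : Bornology.IsBounded {x | ∀ p ∈ T, 0 ≤ aff p x} := by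
      refine (Metric.isBounded_closedBall (x := (0 : E3)) (r := √3 * R)).subset fun x hx => ?_
      have hin : ∀ i, |x i| ≤ R := fun i => by
        have h1 := hx _ (hTb.1 i)
        have h2 := hx _ (hTb.2.1 i)
        simp only [aff, inner_neg_left, he, EuclideanSpace.inner_single_left] at h1 h2
        simp at h1 h2
        rw [abs_le]; constructor <;> linarith
      have hR : 0 ≤ R := (abs_nonneg _).trans (hin 0)
      rw [mem_closedBall_zero_iff, EuclideanSpace.norm_eq, ← Real.sqrt_sq hR,
        ← Real.sqrt_mul (by norm_num)]
      refine Real.sqrt_le_sqrt ?_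
      rw [Fin.sum_univ_three]
      have h : ∀ i, ‖x i‖ ^ 2 ≤ R ^ 2 := fun i => by
        rw [Real.norm_eq_abs]; exact pow_le_pow_left₀ (abs_nonneg _) (hin i) 2
      linarith [h 0, h 1, h 2]
    obtain ⟨f, hf, hfa⟩ : ∃ f ∈ T, ∀ x, |aff f x| = |aff a x| := by
      rcases hTb.2.2 with h | h
      · exact ⟨a, h, fun _ => rfl⟩
      · exact ⟨-a, h, fun x => by simp⟩
    obtain ⟨c, hc, hgap⟩ := polyhedron_gap (hfin'.subset hT) hbd f b (fun x hx => hx f hf)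
      (fun x hx hfx => not_lt.1 fun hb => hz ⟨x, by
        rw [← abs_eq_zero, ← hfa, hfx, abs_zero], hb, hx⟩)
    filter_upwards [Ioo_mem_nhdsGT hc] with s hs y _ hby hay hTy
    exfalso
    have hyT : ∀ p ∈ T, 0 ≤ aff p y := by rw [hTy]; exact fun p hp => hp.2
    have h1 := hgap y hyT
    have h2 : aff f y ≤ s * aff b y := (le_abs_self _).trans ((hfa y).le.trans hay)
    have := hs.2
    nlinarith
  filter_upwards [(eventually_all_finite hfin'.finite_subsets).2 key] with s hs y h1 h2 h3
  exact hs {p ∈ S' | 0 ≤ aff p y} (sep_subset _ _) y h1 h2 h3 rfl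

end

section

variable {a b : E3 × ℝ} {I : Finset (E3 × ℝ)}

/-! ### Faces that can be rotated about a hinge -/

/-- The plane `aff a = 0` of a face can be rotated about the line `aff a = aff b = 0` (the hinge). The
face is cut by the hinge into finitely many convex pieces, listed in `J` as pairs `(β, I)`, where
`β = b` or `β = -b` is positive on the piece and `I` lists the planes of the neighbouring faces.
Near the points of a piece off the hinge, the complement of `P` is the intersection of the half-spaces
`0 < aff a` and `0 < aff p`, `p ∈ I`. -/
structure HingedFace (P : Set E3) (a b : E3 × ℝ) (J : Finset ((E3 × ℝ) × Finset (E3 × ℝ))) :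
    Prop where
  isPolyhedron : IsPolyhedron P
  sign : ∀ C ∈ J, C.1 = b ∨ C.1 = -b
  piece : ∀ C ∈ J, ConvexPiece a C.1 C.2
  local_eq : ∀ C ∈ J, ∀ z ∈ base a C.1 C.2, 0 < aff C.1 z →
    ∀ᶠ v in 𝓝 z, (v ∉ P ↔ 0 < aff a v ∧ v ∈ Ko C.2)
  disjoint : ∀ C ∈ J, ∀ D ∈ J, C ≠ D → ∀ z ∈ base a C.1 C.2, z ∈ base a D.1 D.2 → 0 < aff C.1 z →
    0 < aff D.1 z → False
  hinge : ∀ C ∈ J, ∀ y ∈ base a C.1 C.2, aff b y = 0 → y ∈ facePoints P →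
    ∀ᶠ v in 𝓝 y, (v ∈ P ↔ aff a v ≤ 0) ∧ (aff b v ≠ 0 → ∃ D ∈ J, 0 < aff D.1 v ∧ v ∈ Ko D.2)

/-- The part of `Kc I` near the polygon that is swept when the plane is rotated by slopes of size at
most `s`. -/
def zone (a b : E3 × ℝ) (I : Finset (E3 × ℝ)) (s : ℝ) : Set E3 :=
  {x | x ∈ Kc I ∧ 0 ≤ aff b x ∧ |aff a x| ≤ s * aff b x}

/-- The slope `s` is so small that the zones of the pieces are bounded, disjoint off the hinge, and `P`
has the structure prescribed by the pieces throughout the zones. -/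
structure GoodSlope (P : Set E3) (a b : E3 × ℝ) (J : Finset ((E3 × ℝ) × Finset (E3 × ℝ)))
    (s : ℝ) : Prop where
  pos : 0 < s
  local_eq : ∀ C ∈ J, ∀ y ∈ zone a C.1 C.2 s, 0 < aff C.1 y →
    ∀ᶠ v in 𝓝 y, (v ∉ P ↔ 0 < aff a v ∧ v ∈ Ko C.2)
  disjoint : ∀ C ∈ J, ∀ D ∈ J, C ≠ D → ∀ y ∈ zone a C.1 C.2 s, y ∈ zone a D.1 D.2 s →
    0 < aff C.1 y → 0 < aff D.1 y → False
  axis : ∀ C ∈ J, ∃ x, ∃ e : ℝ, 0 < e ∧ aff a x = 0 ∧ 0 < aff C.1 x ∧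
    (∀ r : ℝ, |r| ≤ e → x + r • a.1 ∈ Ko C.2) ∧ 2 * s * aff C.1 x ≤ e
  bdd : Bornology.IsBounded (⋃ C ∈ J, zone a C.1 C.2 s)

variable {P : Set E3} {J : Finset ((E3 × ℝ) × Finset (E3 × ℝ))}

/-- The cell of a point of a thin zone has a point of the polygon, off the hinge, in its closure. Hence
the properties of a hinged face at the points of its polygons hold throughout the zones. -/
theorem HingedFace.eventually_goodSlope (hH : HingedFace P a b J) :
    ∀ᶠ s in 𝓝[>] (0 : ℝ), GoodSlope P a b J s := by
  obtain ⟨S0, hfin0, hneg0, -, -, hdet0⟩ := hH.isPolyhedron.exists_arrangement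
  set S1 : Set (E3 × ℝ) := insert a (⋃ C ∈ J, (C.2 : Set (E3 × ℝ))) with hS1
  have hfin1 : S1.Finite := (J.finite_toSet.biUnion fun C _ => C.2.finite_toSet).insert a
  set S := S0 ∪ (S1 ∪ (fun p => -p) '' S1) with hS
  have hfin : S.Finite := hfin0.union (hfin1.union (hfin1.image _))
  have hneg : NegClosed S := by
    rintro p (hp | hp | ⟨p, hp, rfl⟩)
    · exact Or.inl (hneg0 p hp)
    · exact Or.inr (Or.inr ⟨p, hp, rfl⟩)
    · right; left; simpa using hp
  have haS : a ∈ S := Or.inr (Or.inl (mem_insert _ _))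
  have hIS : ∀ C ∈ J, (C.2 : Set (E3 × ℝ)) ⊆ S := fun C hC p hp =>
    Or.inr (Or.inl (mem_insert_of_mem _ (mem_biUnion (show C ∈ (J : Set _) from hC) hp)))
  have hdet : SignDetermined S P := hdet0.mono subset_union_left
  obtain ⟨R, hR⟩ : ∃ R, ∀ C ∈ J, base a C.1 C.2 ⊆ Metric.ball (0 : E3) R := by
    have : Bornology.IsBounded (⋃ C ∈ J, base a C.1 C.2) :=
      (Bornology.isBounded_biUnion_finset J).2 fun C hC => (hH.piece C hC).bdd
    obtain ⟨R, hR⟩ := this.subset_ball 0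
    exact ⟨R, fun C hC => (subset_biUnion_of_mem (u := fun C : (E3 × ℝ) × Finset (E3 × ℝ) =>
      base a C.1 C.2) (show C ∈ (J : Set _) from hC)).trans hR⟩
  have hball : ∀ᶠ s in 𝓝[>] (0 : ℝ), ∀ C ∈ J, zone a C.1 C.2 s ⊆ Metric.ball (0 : E3) R := by
    rw [Finset.eventually_all]
    intro C hC
    obtain ⟨s0, hs0, h⟩ := exists_slope_of_open (hH.piece C hC).bdd (hH.piece C hC).base_nonempty
      Metric.isOpen_ball (hR C hC)
    filter_upwards [Ioo_mem_nhdsGT hs0] with s hs x hx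
    exact h x hx.1 hx.2.1 (hx.2.2.trans (mul_le_mul_of_nonneg_right hs.2.le hx.2.1))
  have haxis : ∀ᶠ s in 𝓝[>] (0 : ℝ), ∀ C ∈ J, ∃ x, ∃ e : ℝ, 0 < e ∧ aff a x = 0 ∧ 0 < aff C.1 x ∧
      (∀ r : ℝ, |r| ≤ e → x + r • a.1 ∈ Ko C.2) ∧ 2 * s * aff C.1 x ≤ e := by
    rw [Finset.eventually_all]
    intro C hC
    obtain ⟨x, hax, hbx, hx⟩ := (hH.piece C hC).interior_point
    obtain ⟨e, he, hball⟩ := Metric.eventually_nhds_iff.1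
      (eventually_move (w := a.1) ((isOpen_Ko C.2).mem_nhds hx))
    have h1 : 0 < e / 2 / (2 * aff C.1 x) := by positivity
    filter_upwards [Ioo_mem_nhdsGT h1] with s hs
    refine ⟨x, e / 2, by positivity, hax, hbx, fun r hr => hball ?_, ?_⟩
    · rw [Real.dist_eq, sub_zero]; linarith
    · have := (lt_div_iff₀ (by positivity)).1 hs.2
      nlinarith
  filter_upwards [self_mem_nhdsWithin, hball, haxis, eventually_exists_degenerates hfin a b R,
    eventually_exists_degenerates hfin a (-b) R] with s hs hball haxis hdeg hdeg'
  have hex : ∀ C ∈ J, ∀ y ∈ zone a C.1 C.2 s, 0 < aff C.1 y →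
      ∃ z, aff a z = 0 ∧ 0 < aff C.1 z ∧ Degenerates S z y := by
    intro C hC y hy hCy
    have hyb := hball C hC hy
    have h2 := hy.2.2
    rcases hH.sign C hC with h | h <;> rw [h] at hCy h2 ⊢
    exacts [hdeg y hyb hCy h2, hdeg' y hyb hCy h2]
  have hK : ∀ C ∈ J, ∀ {y z}, y ∈ Kc C.2 → Degenerates S z y → z ∈ Kc C.2 :=
    fun C hC y z hy hd p hp => hd p (hIS C hC hp) (hy p hp)
  refine ⟨hs, ?_, ?_, haxis, ?_⟩
  · intro C hC y hy hCy
    obtain ⟨z, haz, hCz, hd⟩ := hex C hC y hy hCy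
    have hzb : z ∈ base a C.1 C.2 := ⟨haz, hCz.le, hK C hC hy.1 hd⟩
    exact hd.eventually_iff hfin hneg hdet.compl
      (signDetermined_pos_inter haS (signDetermined_Ko (hIS C hC))) (hH.local_eq C hC z hzb hCz)
  · intro C hC D hD hCD y hyC hyD hCy hDy
    have hCD' : C.1 = D.1 := by
      rcases hH.sign C hC with h | h <;> rcases hH.sign D hD with h' | h' <;> rw [h, h'] <;>
        rw [h] at hCy <;> rw [h'] at hDy <;> rw [aff_neg] at * <;> linarith
    obtain ⟨z, haz, hCz, hd⟩ := hex C hC y hyC hCy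
    exact hH.disjoint C hC D hD hCD z ⟨haz, hCz.le, hK C hC hyC.1 hd⟩
      ⟨haz, hCD' ▸ hCz.le, hK D hD hyD.1 hd⟩ hCz (hCD' ▸ hCz)
  · exact Metric.isBounded_ball.subset (iUnion₂_subset hball)

theorem isClosed_zone (a b : E3 × ℝ) (I : Finset (E3 × ℝ)) (s : ℝ) : IsClosed (zone a b I s) :=
  (isClosed_Kc I).inter ((isClosed_aff_nonneg b).inter
    (isClosed_le (continuous_aff a).abs (continuous_const.mul (continuous_aff b))))

/-! ### Local form of the complement and the skeleton -/

/-- Near a point of the skeleton where the complement is an intersection of open half-spaces, two of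
the planes meet. -/
theorem exists_pair_of_mem_skeleton {Q : Set E3} {T : Finset (E3 × ℝ)} {y : E3}
    (hn : ∀ p ∈ T, p.1 ≠ 0) (hQ : ∀ᶠ v in 𝓝 y, (v ∉ Q ↔ v ∈ Ko T)) (hy : y ∈ skeleton Q) :
    y ∈ Kc T ∧ ∃ p ∈ T, ∃ q ∈ T, p ≠ q ∧ aff p y = 0 ∧ aff q y = 0 := by
  obtain ⟨hfr, hface⟩ := hy
  have hK : y ∈ Kc T := by
    intro p hp
    by_contra! hlt
    refine hfr.2 (mem_interior_iff_mem_nhds.2 ?_)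
    filter_upwards [hQ, eventually_aff_neg hlt] with v hv hpv
    by_contra hvQ
    exact hpv.not_gt (hv.1 hvQ p hp)
  obtain ⟨p, hp, hpy⟩ : ∃ p ∈ T, aff p y = 0 := by
    by_contra! hne
    have hyo : y ∈ Ko T := fun p hp => lt_of_le_of_ne (hK p hp) (hne p hp).symm
    have : ∀ᶠ v in 𝓝 y, v ∉ Q := by
      filter_upwards [hQ, (isOpen_Ko T).mem_nhds hyo] with v hv hvo using hv.2 hvo
    exact absurd hfr.1 (by
      rw [mem_closure_iff_frequently, not_frequently]; exact this)
  refine ⟨hK, p, hp, ?_⟩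
  by_contra! hne
  have hev : ∀ᶠ v in 𝓝 y, ∀ q ∈ T, q ≠ p → 0 < aff q v := by
    rw [Finset.eventually_all]
    intro q hq
    by_cases hqp : q = p
    · simp [hqp]
    · filter_upwards [eventually_aff_pos (lt_of_le_of_ne (hK q hq) (hne q hq (Ne.symm hqp) hpy).symm)]
        with v hv _ using hv
  refine hface ⟨hfr, p.1, hn p hp, ?_⟩
  filter_upwards [hQ, hev] with v hv hev
  rw [inner_sub_eq_aff, hpy, sub_zero, ← not_lt, ← not_iff_not, not_not, hv]
  refine ⟨fun h => h p hp, fun h q hq => ?_⟩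
  by_cases hqp : q = p
  · rwa [hqp]
  · exact hev q hq hqp

/-- If one open half-space through the origin contains another, their normals are positively
proportional. -/
theorem exists_eq_smul_of_pos_imp {n m : E3} (hn : n ≠ 0) (h : ∀ w, 0 < ⟪n, w⟫ → 0 < ⟪m, w⟫) :
    ∃ c : ℝ, 0 < c ∧ m = c • n := by
  have hnn : (0 : ℝ) < ⟪n, n⟫ := by
    rw [real_inner_self_eq_norm_sq]; have := norm_pos_iff.2 hn; positivity
  set w := m - (⟪n, m⟫ / ⟪n, n⟫) • n with hw
  have hnw : ⟪n, w⟫ = 0 := by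
    rw [hw, inner_sub_right, inner_smul_right]; field_simp; ring
  have hmw : ⟪m, w⟫ = ⟪w, w⟫ := by
    have : m = w + (⟪n, m⟫ / ⟪n, n⟫) • n := by rw [hw]; abel
    conv_lhs => rw [this]
    rw [inner_add_left, real_inner_smul_left, hnw, mul_zero, add_zero]
  have hw0 : w = 0 := by
    by_contra hw0
    have hww : (0 : ℝ) < ⟪w, w⟫ := by
      rw [real_inner_self_eq_norm_sq]; have := norm_pos_iff.2 hw0; positivity
    -- the direction `n - t w` with large `t` leaves the half-space of `m`
    have h1 := h (n - (⟪m, n⟫ / ⟪w, w⟫) • w) (by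
      rw [inner_sub_right, inner_smul_right, hnw, mul_zero, sub_zero]; exact hnn)
    rw [inner_sub_right, inner_smul_right, hmw, div_mul_cancel₀ _ hww.ne', sub_self] at h1
    exact lt_irrefl _ h1
  refine ⟨⟪n, m⟫ / ⟪n, n⟫, div_pos ?_ hnn, sub_eq_zero.1 hw0⟩
  rw [real_inner_comm]
  exact h n hnn

/-- If the complement is an intersection of open half-spaces near `y`, and two of the bounding planes
with independent normals pass through `y`, then `y` lies in the skeleton. -/
theorem mem_skeleton_of_pair {Q : Set E3} {T : Finset (E3 × ℝ)} {y : E3} (hne : (Ko T).Nonempty)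
    (hQ : ∀ᶠ v in 𝓝 y, (v ∉ Q ↔ v ∈ Ko T)) (hy : y ∈ Kc T) {p q : E3 × ℝ} (hp : p ∈ T) (hq : q ∈ T)
    (hli : LinearIndependent ℝ ![p.1, q.1]) (hpy : aff p y = 0) (hqy : aff q y = 0) :
    y ∈ skeleton Q := by
  have hyQ : y ∈ Q := by
    by_contra h
    exact (hQ.self_of_nhds.1 h p hp).ne' hpy
  obtain ⟨x, hx⟩ := hne
  refine ⟨⟨subset_closure hyQ, fun hint => ?_⟩, ?_⟩
  · have hev := hQ.and (show ∀ᶠ v in 𝓝 y, v ∈ Q from mem_interior_iff_mem_nhds.1 hint)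
    obtain ⟨t, ht0, ht1, h1, h2⟩ := exists_small_move (x - y) hev one_pos
    refine h1.2 (fun r hr => ?_) h2
    rw [aff_move]
    have := hy r hr
    have := hx r hr
    nlinarith [mul_pos ht0 this]
  · rintro ⟨-, n, hn, hface⟩
    -- the half-space must agree with each of the two planes
    have hdir : ∀ w, 0 < ⟪n, w⟫ → ∀ r ∈ T, aff r y = 0 → 0 < ⟪r.1, w⟫ := by
      intro w hw r hr hry
      obtain ⟨t, ht0, -, h1, h2⟩ := exists_small_move w (hQ.and hface) one_pos
      have h3 := h1.1 (by
        rw [h2, add_sub_cancel_left, inner_smul_right, not_le]; positivity) r hr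
      rw [aff_add_smul, hry, zero_add] at h3
      exact pos_of_mul_pos_right h3 ht0.le
    obtain ⟨c, -, hc⟩ := exists_eq_smul_of_pos_imp hn fun w hw => hdir w hw p hp hpy
    obtain ⟨d, -, hd⟩ := exists_eq_smul_of_pos_imp hn fun w hw => hdir w hw q hq hqy
    have hq0 : q.1 ≠ 0 := hli.ne_zero 1
    have := LinearIndependent.pair_iff.1 hli d (-c) (by
      rw [hc, hd, smul_smul, smul_smul, ← add_smul]; ring_nf; simp)
    apply hq0
    rw [hd, this.1, zero_smul]

end

section

variable {a b : E3 × ℝ} {I : Finset (E3 × ℝ)}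
variable {P : Set E3} {J : Finset ((E3 × ℝ) × Finset (E3 × ℝ))}

/-! ### The rotated polyhedron -/

/-- The polyhedron obtained from `P` by replacing the plane `aff a = 0` of the face by the plane
`aff a = s * aff b`: on the side of the hinge where the plane moves outwards a wedge is added, on the
other side one is removed. -/
def rotate (P : Set E3) (a b : E3 × ℝ) (J : Finset ((E3 × ℝ) × Finset (E3 × ℝ))) (s : ℝ) : Set E3 :=
  {x | (x ∈ P ∨ ∃ C ∈ J, x ∈ Kc C.2 ∧ 0 < aff C.1 x ∧ 0 < aff a x ∧ aff a x ≤ s * aff b x) ∧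
    ¬ ∃ C ∈ J, x ∈ Ko C.2 ∧ 0 < aff C.1 x ∧ s * aff b x < aff a x ∧ aff a x ≤ 0}

theorem rotate_zero : rotate P a b J 0 = P := by
  ext x
  constructor
  · rintro ⟨h | ⟨C, -, -, -, h1, h2⟩, -⟩
    · exact h
    · rw [zero_mul] at h2; exact absurd h1 h2.not_gt
  · refine fun h => ⟨Or.inl h, ?_⟩
    rintro ⟨C, -, -, -, h1, h2⟩
    rw [zero_mul] at h1; exact absurd h1 h2.not_gt

theorem mem_Ko_insert [DecidableEq (E3 × ℝ)] {p : E3 × ℝ} {x : E3} :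
    x ∈ Ko (insert p I) ↔ 0 < aff p x ∧ x ∈ Ko I := by simp [Ko]

theorem mem_Kc_insert [DecidableEq (E3 × ℝ)] {p : E3 × ℝ} {x : E3} :
    x ∈ Kc (insert p I) ↔ 0 ≤ aff p x ∧ x ∈ Kc I := by simp [Kc]

theorem mem_frontier_iff_frequently {Q : Set E3} {y : E3} :
    y ∈ frontier Q ↔ (∃ᶠ v in 𝓝 y, v ∈ Q) ∧ ∃ᶠ v in 𝓝 y, v ∉ Q := by
  rw [frontier_eq_closure_inter_closure, mem_inter_iff, mem_closure_iff_frequently,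
    mem_closure_iff_frequently]
  rfl

theorem mem_frontier_congr {Q U : Set E3} {y : E3} (h : ∀ᶠ v in 𝓝 y, (v ∈ Q ↔ v ∈ U)) :
    y ∈ frontier Q ↔ y ∈ frontier U := by
  rw [mem_frontier_iff_frequently, mem_frontier_iff_frequently, frequently_congr h,
    frequently_congr (h.mono fun _ h => not_congr h)]

theorem mem_facePoints_congr {Q U : Set E3} {y : E3} (h : ∀ᶠ v in 𝓝 y, (v ∈ Q ↔ v ∈ U)) :
    y ∈ facePoints Q ↔ y ∈ facePoints U := by
  refine and_congr (mem_frontier_congr h) (exists_congr fun n => and_congr_right fun _ =>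
    eventually_congr ?_)
  filter_upwards [h] with v hv
  rw [hv]

theorem mem_skeleton_congr {Q U : Set E3} {y : E3} (h : ∀ᶠ v in 𝓝 y, (v ∈ Q ↔ v ∈ U)) :
    y ∈ skeleton Q ↔ y ∈ skeleton U :=
  and_congr (mem_frontier_congr h) (not_congr (mem_facePoints_congr h))

theorem mem_closure_interior_congr {Q U : Set E3} {y : E3} (h : ∀ᶠ v in 𝓝 y, (v ∈ Q ↔ v ∈ U)) :
    y ∈ closure (interior Q) ↔ y ∈ closure (interior U) := by
  rw [mem_closure_iff_frequently, mem_closure_iff_frequently]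
  refine frequently_congr ?_
  filter_upwards [h.eventually_nhds] with v hv
  rw [mem_interior_iff_mem_nhds, mem_interior_iff_mem_nhds]
  exact eventually_congr hv

theorem move_mem_zone {s0 : ℝ} {C : (E3 × ℝ) × Finset (E3 × ℝ)} {y x : E3} {t : ℝ} (hy : y ∈ Kc C.2)
    (hay : aff a y = 0) (hCy : aff C.1 y = 0) (hx : x ∈ zone a C.1 C.2 s0) (hCx : 0 < aff C.1 x)
    (ht : 0 < t) (ht1 : t ≤ 1) :
    y + t • (x - y) ∈ zone a C.1 C.2 s0 ∧ 0 < aff C.1 (y + t • (x - y)) := by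
  have h1 : aff C.1 (y + t • (x - y)) = t * aff C.1 x := by rw [aff_move, hCy]; ring
  have h2 : aff a (y + t • (x - y)) = t * aff a x := by rw [aff_move, hay]; ring
  refine ⟨⟨Convex.move_mem (convex_Kc _) hy hx.1 ht.le ht1, ?_, ?_⟩, ?_⟩
  · rw [h1]; exact (mul_pos ht hCx).le
  · rw [h1, h2, abs_mul, abs_of_pos ht, mul_left_comm]
    exact mul_le_mul_of_nonneg_left hx.2.2 ht.le
  · rw [h1]; exact mul_pos ht hCx

section

variable (hH : HingedFace P a b J) {s0 : ℝ} (hg : GoodSlope P a b J s0)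
include hH

theorem HingedFace.abs_eq {C : (E3 × ℝ) × Finset (E3 × ℝ)} (hC : C ∈ J) (x : E3) :
    |aff b x| = |aff C.1 x| := by
  rcases hH.sign C hC with h | h <;> simp [h]

theorem HingedFace.eq_zero_iff {C : (E3 × ℝ) × Finset (E3 × ℝ)} (hC : C ∈ J) {x : E3} :
    aff C.1 x = 0 ↔ aff b x = 0 := by
  rw [← abs_eq_zero, ← hH.abs_eq hC, abs_eq_zero]

theorem HingedFace.abs_slope {C : (E3 × ℝ) × Finset (E3 × ℝ)} (hC : C ∈ J) {x : E3}
    (hx : 0 ≤ aff C.1 x) {s t : ℝ} (hs : |s| ≤ t) : |s * aff b x| ≤ t * aff C.1 x := by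
  rw [abs_mul, hH.abs_eq hC, abs_of_nonneg hx]
  exact mul_le_mul_of_nonneg_right hs hx

/-- The slope of the rotated plane relative to the functional that is positive on the piece. -/
theorem HingedFace.exists_slope {C : (E3 × ℝ) × Finset (E3 × ℝ)} (hC : C ∈ J) (s : ℝ) :
    ∃ r : ℝ, |r| = |s| ∧ ∀ x, r * aff C.1 x = s * aff b x := by
  rcases hH.sign C hC with h | h
  · exact ⟨s, rfl, fun x => by rw [h]⟩
  · exact ⟨-s, abs_neg s, fun x => by rw [h, aff_neg]; ring⟩

theorem HingedFace.exists_zone_of_rotate {C : (E3 × ℝ) × Finset (E3 × ℝ)} (hC : C ∈ J) {x : E3}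
    {s : ℝ} (hs : |s| ≤ s0) (hK : x ∈ Kc C.2) (hCx : 0 < aff C.1 x)
    (h : (0 < aff a x ∧ aff a x ≤ s * aff b x) ∨ (s * aff b x < aff a x ∧ aff a x ≤ 0)) :
    x ∈ zone a C.1 C.2 s0 := by
  have h1 := abs_le.1 (hH.abs_slope hC hCx.le hs)
  have h2 : 0 ≤ s0 * aff C.1 x := mul_nonneg ((abs_nonneg s).trans hs) hCx.le
  refine ⟨hK, hCx.le, abs_le.2 ?_⟩
  rcases h with h | h <;> constructor <;> linarith [h.1, h.2, h1.1, h1.2]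

/-- Away from the zones nothing changes. -/
theorem HingedFace.eventually_rotate_iff {s : ℝ} (hs : |s| ≤ s0) {y : E3}
    (hy : ∀ C ∈ J, y ∉ zone a C.1 C.2 s0) : ∀ᶠ v in 𝓝 y, (v ∈ rotate P a b J s ↔ v ∈ P) := by
  have hev : ∀ᶠ v in 𝓝 y, ∀ C ∈ J, v ∉ zone a C.1 C.2 s0 := by
    rw [Finset.eventually_all]
    exact fun C hC => (isClosed_zone a C.1 C.2 s0).isOpen_compl.mem_nhds (hy C hC)
  filter_upwards [hev] with v hv
  constructor
  · rintro ⟨h | ⟨C, hC, hK, hCv, h⟩, -⟩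
    · exact h
    · exact absurd (hH.exists_zone_of_rotate hC hs hK hCv (Or.inl h)) (hv C hC)
  · refine fun h => ⟨Or.inl h, ?_⟩
    rintro ⟨C, hC, hK, hCv, h⟩
    exact hv C hC (hH.exists_zone_of_rotate hC hs (Ko_subset_Kc _ hK) hCv (Or.inr h))

theorem HingedFace.zone_cases (y : E3) : (∃ C ∈ J, y ∈ zone a C.1 C.2 s0 ∧ 0 < aff C.1 y) ∨
    (∃ C ∈ J, y ∈ base a C.1 C.2 ∧ aff b y = 0) ∨ ∀ C ∈ J, y ∉ zone a C.1 C.2 s0 := by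
  by_cases h : ∀ C ∈ J, y ∉ zone a C.1 C.2 s0
  · exact Or.inr (Or.inr h)
  push Not at h
  obtain ⟨C, hC, hy⟩ := h
  rcases hy.2.1.eq_or_lt with h0 | h0
  · refine Or.inr (Or.inl ⟨C, hC, ⟨?_, h0.le, hy.1⟩, (hH.eq_zero_iff hC).1 h0.symm⟩)
    have := hy.2.2
    rw [← h0, mul_zero] at this
    exact abs_nonpos_iff.1 this
  · exact Or.inl ⟨C, hC, hy, h0⟩

include hg

/-- In the zone of a piece, the complement of the rotated polyhedron is bounded by the rotated plane and
the planes of the piece. -/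
theorem HingedFace.eventually_notMem_rotate_iff {C : (E3 × ℝ) × Finset (E3 × ℝ)} (hC : C ∈ J) {s : ℝ}
    (hs : |s| ≤ s0) {y : E3} (hy : y ∈ zone a C.1 C.2 s0) (hCy : 0 < aff C.1 y) :
    ∀ᶠ v in 𝓝 y, (v ∉ rotate P a b J s ↔ s * aff b v < aff a v ∧ v ∈ Ko C.2) := by
  have hev : ∀ᶠ v in 𝓝 y, ∀ D ∈ J, D ≠ C → v ∈ zone a D.1 D.2 s0 → ¬ 0 < aff D.1 v := by
    rw [Finset.eventually_all]
    intro D hD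
    by_cases hDC : D = C
    · simp [hDC]
    by_cases hyD : y ∈ zone a D.1 D.2 s0
    · have h1 : ¬ 0 < aff D.1 y := fun h => hg.disjoint D hD C hC hDC y hyD hy h hCy
      have h2 : aff D.1 y ≠ 0 := fun h => hCy.ne' ((hH.eq_zero_iff hC).2 ((hH.eq_zero_iff hD).1 h))
      filter_upwards [eventually_aff_neg (lt_of_le_of_ne (not_lt.1 h1) h2)] with v hv _ _ using hv.not_gt
    · filter_upwards [(isClosed_zone a D.1 D.2 s0).isOpen_compl.mem_nhds hyD] with v hv _ h using
        absurd h hv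
  filter_upwards [hev, hg.local_eq C hC y hy hCy, eventually_aff_pos hCy] with v hev hP hCv
  constructor
  · intro hv
    by_cases hrem : ∃ D ∈ J, v ∈ Ko D.2 ∧ 0 < aff D.1 v ∧ s * aff b v < aff a v ∧ aff a v ≤ 0
    · obtain ⟨D, hD, hK, hDv, h⟩ := hrem
      by_cases hDC : D = C
      · subst hDC; exact ⟨h.1, hK⟩
      · exact absurd hDv (hev D hD hDC
          (hH.exists_zone_of_rotate hD hs (Ko_subset_Kc _ hK) hDv (Or.inr h)))
    · have hno : ¬ (v ∈ P ∨ ∃ C ∈ J, v ∈ Kc C.2 ∧ 0 < aff C.1 v ∧ 0 < aff a v ∧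
          aff a v ≤ s * aff b v) := fun h => hv ⟨h, hrem⟩
      push Not at hno
      obtain ⟨ha, hK⟩ := hP.1 hno.1
      exact ⟨hno.2 C hC (Ko_subset_Kc _ hK) hCv ha, hK⟩
  · rintro ⟨hlt, hK⟩ ⟨h | ⟨D, hD, hKD, hDv, h⟩, hno⟩
    · by_cases ha : 0 < aff a v
      · exact hP.2 ⟨ha, hK⟩ h
      · exact hno ⟨C, hC, hK, hCv, hlt, not_lt.1 ha⟩
    · exact h.2.not_gt hlt

theorem HingedFace.eventually_notMem_rotate_iff_Ko [DecidableEq (E3 × ℝ)]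
    {C : (E3 × ℝ) × Finset (E3 × ℝ)} (hC : C ∈ J) {s : ℝ}
    (hs : |s| ≤ s0) {y : E3} (hy : y ∈ zone a C.1 C.2 s0) (hCy : 0 < aff C.1 y) :
    ∀ᶠ v in 𝓝 y, (v ∉ rotate P a b J s ↔ v ∈ Ko (insert (a - s • b) C.2)) := by
  filter_upwards [hH.eventually_notMem_rotate_iff hg hC hs hy hCy] with v hv
  rw [hv, mem_Ko_insert, aff_sub, aff_smul, sub_pos]

theorem HingedFace.exists_axis {C : (E3 × ℝ) × Finset (E3 × ℝ)} (hC : C ∈ J) {r : ℝ}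
    (hr : |r| ≤ s0) : ∃ x ∈ zone a C.1 C.2 s0, x ∈ Ko C.2 ∧ 0 < aff C.1 x ∧
      aff a x = r * aff C.1 x := by
  obtain ⟨x, e, -, hax, hCx, hK, hse⟩ := hg.axis C hC
  have h2 : |r * aff C.1 x| ≤ s0 * aff C.1 x := by
    rw [abs_mul, abs_of_pos hCx]; exact mul_le_mul_of_nonneg_right hr hCx.le
  have h1 : |r * aff C.1 x| ≤ e := by
    have := hg.pos
    nlinarith
  have ha : aff a (x + (r * aff C.1 x) • a.1) = r * aff C.1 x := by
    rw [aff_add_grad, hax, (hH.piece C hC).norm_a]; ring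
  have hc : aff C.1 (x + (r * aff C.1 x) • a.1) = aff C.1 x := by
    rw [aff_add_smul, real_inner_comm, (hH.piece C hC).orth]; ring
  exact ⟨_, ⟨Ko_subset_Kc _ (hK _ h1), by rw [hc]; exact hCx.le, by rw [ha, hc]; exact h2⟩, hK _ h1,
    by rw [hc]; exact hCx, by rw [ha, hc]⟩

theorem HingedFace.hinge_mem {C : (E3 × ℝ) × Finset (E3 × ℝ)} (hC : C ∈ J) {y : E3}
    (hy : y ∈ base a C.1 C.2) (hby : aff b y = 0) (s : ℝ) : y ∈ rotate P a b J s := by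
  have hCy := (hH.eq_zero_iff hC).2 hby
  obtain ⟨x, hxz, hxK, hCx, hax⟩ := hH.exists_axis hg hC (r := 0) (by simpa using hg.pos.le)
  have hcl : IsClosed P := hH.isPolyhedron.isCompact.isClosed
  have hyP : y ∈ P := by
    rw [← hcl.closure_eq]
    refine mem_closure_of_moves one_pos (w := x - y) fun t ht0 ht1 => ?_
    have hz := move_mem_zone hy.2.2 hy.1 hCy hxz hCx ht0 ht1.le
    by_contra hcon
    have := ((hg.local_eq C hC _ hz.1 hz.2).self_of_nhds.1 hcon).1
    rw [aff_move, hy.1, hax] at this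
    simp at this
  refine ⟨Or.inl hyP, ?_⟩
  rintro ⟨D, hD, -, hDy, -⟩
  exact hDy.ne' ((hH.eq_zero_iff hD).2 hby)

theorem HingedFace.hinge_mem_frontier {C : (E3 × ℝ) × Finset (E3 × ℝ)} (hC : C ∈ J) {y : E3}
    (hy : y ∈ base a C.1 C.2) (hby : aff b y = 0) {s : ℝ} (hs : |s| < s0) :
    y ∈ frontier (rotate P a b J s) := by
  have hCy := (hH.eq_zero_iff hC).2 hby
  rw [frontier_eq_closure_inter_closure]
  refine ⟨subset_closure (hH.hinge_mem hg hC hy hby s), ?_⟩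
  obtain ⟨x, hxz, hxK, hCx, hax⟩ := hH.exists_axis hg hC (r := s0) (abs_of_pos hg.pos).le
  refine mem_closure_of_moves one_pos (w := x - y) fun t ht0 ht1 => ?_
  have hz := move_mem_zone hy.2.2 hy.1 hCy hxz hCx ht0 ht1.le
  refine (hH.eventually_notMem_rotate_iff hg hC hs.le hz.1 hz.2).self_of_nhds.2 ⟨?_, ?_⟩
  · have h1 := abs_le.1 (hH.abs_slope hC hCx.le le_rfl (s := s))
    rw [aff_move, aff_move, hby, hy.1, hax]
    have : |s| * aff C.1 x < s0 * aff C.1 x := mul_lt_mul_of_pos_right hs hCx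
    nlinarith [h1.2]
  · intro p hp
    rw [aff_move]
    have := hy.2.2 p hp
    have := hxK p hp
    nlinarith [mul_pos ht0 this]

/-- At a flat point of the hinge the rotated polyhedron is again a half-space. -/
theorem HingedFace.hinge_notMem_skeleton {C : (E3 × ℝ) × Finset (E3 × ℝ)} (hC : C ∈ J) {y : E3}
    (hy : y ∈ base a C.1 C.2) (hby : aff b y = 0) (hyP : y ∈ facePoints P) {s : ℝ} (hs : |s| ≤ s0) :
    y ∉ skeleton (rotate P a b J s) := by
  rintro ⟨hfr, hface⟩
  refine hface ⟨hfr, (a - s • b).1, ?_, ?_⟩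
  · intro h0
    have h1 : ⟪a.1, (a - s • b).1⟫ = 1 := by
      have horth : ⟪a.1, b.1⟫ = 0 := by
        have := (hH.piece C hC).orth
        rcases hH.sign C hC with h | h <;> simpa [h] using this
      simp [inner_sub_right, inner_smul_right, horth, (hH.piece C hC).norm_a]
    rw [h0, inner_zero_right] at h1
    exact zero_ne_one h1
  filter_upwards [hH.hinge C hC y hy hby hyP] with v ⟨hvP, hvD⟩
  have hval : ⟪(a - s • b).1, v - y⟫ ≤ 0 ↔ aff a v ≤ s * aff b v := by
    rw [inner_sub_eq_aff, aff_sub, aff_sub, aff_smul, aff_smul, hy.1, hby]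
    constructor <;> intro h <;> linarith
  rw [hval]
  by_cases hbv : aff b v = 0
  · rw [hbv, mul_zero, ← hvP]
    constructor
    · rintro ⟨h | ⟨D, hD, -, hDv, -⟩, -⟩
      · exact h
      · exact absurd ((hH.eq_zero_iff hD).2 hbv) hDv.ne'
    · refine fun h => ⟨Or.inl h, ?_⟩
      rintro ⟨D, hD, -, hDv, -⟩
      exact hDv.ne' ((hH.eq_zero_iff hD).2 hbv)
  · obtain ⟨D, hD, hDv, hK⟩ := hvD hbv
    by_cases hz : v ∈ zone a D.1 D.2 s0
    · rw [← not_iff_not, (hH.eventually_notMem_rotate_iff hg hD hs hz hDv).self_of_nhds, not_le]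
      exact and_iff_left hK
    · -- far from the planes between which the rotation takes place
      have hab := abs_le.1 (hH.abs_slope hD hDv.le hs)
      have hfar : s0 * aff D.1 v < |aff a v| := by
        by_contra! h; exact hz ⟨Ko_subset_Kc _ hK, hDv.le, h⟩
      have hnz : ∀ E ∈ J, ¬ (v ∈ zone a E.1 E.2 s0 ∧ 0 < aff E.1 v) := by
        rintro E hE ⟨hEz, hEv⟩
        have h1 := hH.abs_eq hE v
        rw [hH.abs_eq hD, abs_of_pos hDv, abs_of_pos hEv] at h1
        have := hEz.2.2
        rw [← h1] at this
        exact hfar.not_ge this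
      have hQ : v ∈ rotate P a b J s ↔ v ∈ P := by
        constructor
        · rintro ⟨h | ⟨E, hE, hKE, hEv, h⟩, -⟩
          · exact h
          · exact absurd ⟨hH.exists_zone_of_rotate hE hs hKE hEv (Or.inl h), hEv⟩ (hnz E hE)
        · refine fun h => ⟨Or.inl h, ?_⟩
          rintro ⟨E, hE, hKE, hEv, h⟩
          exact hnz E hE ⟨hH.exists_zone_of_rotate hE hs (Ko_subset_Kc _ hKE) hEv (Or.inr h), hEv⟩
      rw [hQ, hvP]
      rcases lt_abs.1 hfar with h | h
      · constructor <;> intro h' <;> nlinarith [hg.pos]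
      · constructor <;> intro h' <;> nlinarith [hg.pos]

/-- Membership in a polyhedron is checked locally: in the zones the complement of the rotated set is an
open convex cell, at the hinge the zones are approached by segments, and elsewhere nothing changes. -/
theorem HingedFace.isPolyhedron_rotate {s : ℝ} (hs : |s| < s0) : IsPolyhedron (rotate P a b J s) := by
  classical
  have hPcl : IsClosed P := hH.isPolyhedron.isCompact.isClosed
  have hcl : IsClosed (rotate P a b J s) := by
    rw [← isOpen_compl_iff, isOpen_iff_mem_nhds]
    intro y hy
    rcases hH.zone_cases (s0 := s0) y with ⟨C, hC, hz, hCy⟩ | ⟨C, hC, hyb, hby⟩ | hno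
    · have h := hH.eventually_notMem_rotate_iff_Ko hg hC hs.le hz hCy
      filter_upwards [h, (isOpen_Ko _).mem_nhds (h.self_of_nhds.1 hy)] with v hv hv' using hv.2 hv'
    · exact absurd (hH.hinge_mem hg hC hyb hby s) hy
    · have h := hH.eventually_rotate_iff hs.le hno
      have hyP : y ∈ Pᶜ := fun h' => hy (h.self_of_nhds.2 h')
      filter_upwards [h, hPcl.isOpen_compl.mem_nhds hyP] with v hv hv' h'
      exact hv' (hv.1 h')
  -- where one of the bounding functionals is not positive, arbitrarily small moves make it negative
  have hzone : ∀ C ∈ J, ∀ y ∈ zone a C.1 C.2 s0, 0 < aff C.1 y → y ∈ rotate P a b J s →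
      y ∈ closure (interior (rotate P a b J s)) := by
    intro C hC y hz hCy hy
    have h := hH.eventually_notMem_rotate_iff_Ko hg hC hs.le hz hCy
    have hno : y ∉ Ko (insert (a - s • b) C.2) := fun h' => h.self_of_nhds.2 h' hy
    simp only [Ko, mem_ofPred_eq, not_forall, not_lt] at hno
    obtain ⟨p, hp, hpy⟩ := hno
    have hp0 : p.1 ≠ 0 := by
      obtain ⟨x, hxz, hxK, hCx, hax⟩ := hH.exists_axis hg hC (r := s0) (abs_of_pos hg.pos).le
      refine grad_ne_zero (x := x) (y := y) (ne_of_gt (hpy.trans_lt ?_))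
      rcases Finset.mem_insert.1 hp with rfl | hp
      · rw [aff_sub, aff_smul, hax, sub_pos]
        have h1 := abs_le.1 (hH.abs_slope hC hCx.le le_rfl (s := s))
        exact h1.2.trans_lt (mul_lt_mul_of_pos_right hs hCx)
      · exact hxK p hp
    rw [mem_closure_iff_nhds]
    intro U hU
    obtain ⟨v, hpv, hvU, hv⟩ := exists_aff_neg_near hp0 hpy
      (Filter.Eventually.and (show ∀ᶠ v in 𝓝 y, v ∈ U from hU) h.eventually_nhds)
    refine ⟨v, hvU, mem_interior_iff_mem_nhds.2 ?_⟩
    filter_upwards [hv, eventually_aff_neg hpv] with w hw hpw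
    by_contra hcon
    exact (hw.1 hcon p hp).not_gt hpw
  have hreg : ∀ y ∈ rotate P a b J s, y ∈ closure (interior (rotate P a b J s)) := by
    intro y hy
    rcases hH.zone_cases (s0 := s0) y with ⟨C, hC, hz, hCy⟩ | ⟨C, hC, hyb, hby⟩ | hno
    · exact hzone C hC y hz hCy hy
    · -- approach the hinge along the rotated plane
      obtain ⟨r, hr, hrb⟩ := hH.exists_slope hC s
      obtain ⟨x, hxz, hxK, hCx, hax⟩ := hH.exists_axis hg hC (hr.trans_le hs.le)
      rw [← isClosed_closure.closure_eq]
      refine mem_closure_of_moves one_pos (w := x - y) fun t ht0 ht1 => ?_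
      have hz := move_mem_zone hyb.2.2 hyb.1 ((hH.eq_zero_iff hC).2 hby) hxz hCx ht0 ht1.le
      refine hzone C hC _ hz.1 hz.2 ?_
      by_contra hcon
      have := ((hH.eventually_notMem_rotate_iff hg hC hs.le hz.1 hz.2).self_of_nhds.1 hcon).1
      rw [aff_move, aff_move, hby, hyb.1, hax, hrb] at this
      linarith
    · have h := hH.eventually_rotate_iff hs.le hno
      rw [mem_closure_interior_congr h, hH.isPolyhedron.closure_interior]
      exact h.self_of_nhds.1 hy
  refine ⟨?_, ?_, ?_, ?_⟩
  · obtain ⟨x, hx⟩ := hH.isPolyhedron.nonempty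
    by_cases hxQ : x ∈ rotate P a b J s
    · exact ⟨x, hxQ⟩
    rcases hH.zone_cases (s0 := s0) x with ⟨C, hC, -⟩ | ⟨C, hC, hyb, hby⟩ | hno
    · obtain ⟨z, hz, -, hCz, haz⟩ := hH.exists_axis hg hC (r := -s0) (by rw [abs_neg, abs_of_pos hg.pos])
      refine ⟨z, by_contra fun hcon => ?_⟩
      have h1 := ((hH.eventually_notMem_rotate_iff hg hC hs.le hz hCz).self_of_nhds.1 hcon).1
      have h2 := abs_le.1 (hH.abs_slope hC hCz.le hs.le)
      rw [haz] at h1; linarith [h2.1]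
    · exact ⟨x, hH.hinge_mem hg hC hyb hby s⟩
    · exact ⟨x, (hH.eventually_rotate_iff hs.le hno).self_of_nhds.2 hx⟩
  · refine Metric.isCompact_of_isClosed_isBounded hcl
      ((hH.isPolyhedron.isCompact.isBounded.union hg.bdd).subset ?_)
    rintro x ⟨h | ⟨C, hC, hK, hCx, h⟩, -⟩
    · exact Or.inl h
    · exact Or.inr (mem_biUnion (show C ∈ (J : Set _) from hC)
        (hH.exists_zone_of_rotate hC hs.le hK hCx (Or.inl h)))
  · exact (hcl.closure_interior_subset).antisymm hreg
  · obtain ⟨S, hfin, -, hn, hfr, -⟩ := hH.isPolyhedron.exists_arrangement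
    refine ⟨{p ∈ S ∪ ({a, a - s • b} ∪ ⋃ C ∈ J, (C.2 : Set (E3 × ℝ))) | p.1 ≠ 0},
      (hfin.union ((toFinite _).union (J.finite_toSet.biUnion fun C _ => C.2.finite_toSet))).subset
        (sep_subset _ _), fun p hp => hp.2, fun y hy => ?_⟩
    suffices h : ∃ p ∈ S ∪ ({a, a - s • b} ∪ ⋃ C ∈ J, (C.2 : Set (E3 × ℝ))), p.1 ≠ 0 ∧
        aff p y = 0 by
      obtain ⟨p, hp, hp0, hpy⟩ := h
      exact mem_biUnion (show p ∈ {p ∈ S ∪ ({a, a - s • b} ∪ ⋃ C ∈ J, (C.2 : Set (E3 × ℝ))) | p.1 ≠ 0}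
        from ⟨hp, hp0⟩) (sub_eq_zero.1 hpy)
    have hyQ : y ∈ rotate P a b J s := hcl.frontier_subset hy
    rcases hH.zone_cases (s0 := s0) y with ⟨C, hC, hz, hCy⟩ | ⟨C, hC, hyb, hby⟩ | hno
    · have h := hH.eventually_notMem_rotate_iff_Ko hg hC hs.le hz hCy
      obtain ⟨x, hxz, hxK, hCx, hax⟩ := hH.exists_axis hg hC (r := s0) (abs_of_pos hg.pos).le
      have hxK' : ∀ p ∈ insert (a - s • b) C.2, 0 < aff p x := by
        intro p hp
        rcases Finset.mem_insert.1 hp with rfl | hp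
        · rw [aff_sub, aff_smul, hax, sub_pos]
          have h1 := abs_le.1 (hH.abs_slope hC hCx.le le_rfl (s := s))
          exact h1.2.trans_lt (mul_lt_mul_of_pos_right hs hCx)
        · exact hxK p hp
      obtain ⟨p, hp, hpy⟩ : ∃ p ∈ insert (a - s • b) C.2, aff p y = 0 := by
        by_contra! hne
        by_cases hyK : ∀ p ∈ insert (a - s • b) C.2, 0 < aff p y
        · exact h.self_of_nhds.2 hyK hyQ
        · push Not at hyK
          obtain ⟨p, hp, hpy⟩ := hyK
          refine hy.2 (mem_interior_iff_mem_nhds.2 ?_)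
          filter_upwards [h, eventually_aff_neg (lt_of_le_of_ne hpy (hne p hp))] with v hv hpv
          by_contra hcon
          exact (hv.1 hcon p hp).not_gt hpv
      refine ⟨p, Or.inr ?_, grad_ne_zero (x := x) (y := y) (by rw [hpy]; exact (hxK' p hp).ne'), hpy⟩
      rcases Finset.mem_insert.1 hp with rfl | hp
      · exact Or.inl (Or.inr rfl)
      · exact Or.inr (mem_biUnion (show C ∈ (J : Set _) from hC) hp)
    · refine ⟨a, Or.inr (Or.inl (Or.inl rfl)), ?_, hyb.1⟩
      have := (hH.piece C hC).norm_a
      rw [← norm_ne_zero_iff, this]; exact one_ne_zero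
    · rw [mem_frontier_congr (hH.eventually_rotate_iff hs.le hno)] at hy
      obtain ⟨p, hp, hpy⟩ := hfr y hy
      exact ⟨p, Or.inl hp, norm_ne_zero_iff.1 (by rw [hn p hp]; exact one_ne_zero), hpy⟩

end

end

section

variable {a b : E3 × ℝ} {P : Set E3} {J : Finset ((E3 × ℝ) × Finset (E3 × ℝ))}

/-! ### Continuity of the rotation -/

section

variable (hH : HingedFace P a b J) {s0 : ℝ} (hg : GoodSlope P a b J s0)
include hH hg

/-- A point of the zone removed for the slope `s'` but not for `s` is close to the boundary for the
slope `s'`: move it down to the rotated plane, or to the first neighbouring face on the way. -/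
theorem HingedFace.exists_frontier_below {C : (E3 × ℝ) × Finset (E3 × ℝ)} (hC : C ∈ J) {s s' : ℝ}
    (hs' : |s'| ≤ s0) {x : E3} (hx : x ∈ zone a C.1 C.2 s0) (hCx : 0 < aff C.1 x)
    (hK : x ∈ Ko C.2) (h1 : s' * aff b x < aff a x) (h2 : aff a x ≤ s * aff b x) :
    ∃ y ∈ frontier (rotate P a b J s'), dist x y ≤ |aff b x| * |s - s'| := by
  have hna := (hH.piece C hC).norm_a
  have horth : ⟪b.1, a.1⟫ = 0 := by
    rw [real_inner_comm]
    have := (hH.piece C hC).orth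
    rcases hH.sign C hC with h | h <;> simpa [h] using this
  set τ := aff a x - s' * aff b x with hτ
  have hτ0 : 0 < τ := sub_pos.2 h1
  set U := {v | s' * aff b v < aff a v ∧ v ∈ Ko C.2} with hU
  have hmove : ∀ r : ℝ, aff a (x + r • a.1) = aff a x + r ∧ aff b (x + r • a.1) = aff b x := fun r =>
    ⟨by rw [aff_add_grad, hna]; ring, by rw [aff_add_smul, horth]; ring⟩
  obtain ⟨y, hyseg, hyf⟩ := exists_mem_segment_frontier (U := U) (x := x) (y := x + (-τ) • a.1)
    ⟨h1, hK⟩ (fun h => by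
      have := h.1
      rw [(hmove _).1, (hmove _).2, hτ] at this
      linarith)
  obtain ⟨t, ⟨ht0, ht1⟩, rfl⟩ := (segment_eq_image' ℝ x (x + (-τ) • a.1)) ▸ hyseg
  have hy : x + t • (x + -τ • a.1 - x) = x + (-(t * τ)) • a.1 := by
    rw [add_sub_cancel_left, smul_smul]; congr 2; ring
  beta_reduce at hyf
  rw [hy] at hyf
  have hcl : x + (-(t * τ)) • a.1 ∈ Kc C.2 :=
    closure_minimal (fun v hv => Ko_subset_Kc _ hv.2) (isClosed_Kc C.2) hyf.1
  have hCy : aff C.1 (x + (-(t * τ)) • a.1) = aff C.1 x := by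
    rw [aff_add_smul, real_inner_comm, (hH.piece C hC).orth]; ring
  have hz : x + (-(t * τ)) • a.1 ∈ zone a C.1 C.2 s0 := by
    refine ⟨hcl, by rw [hCy]; exact hCx.le, ?_⟩
    rw [hCy, (hmove _).1]
    have h3 := abs_le.1 (hH.abs_slope hC hCx.le hs')
    have h4 := abs_le.1 hx.2.2
    have h5 : t * τ ≤ τ := mul_le_of_le_one_left hτ0.le ht1
    have h6 : 0 ≤ t * τ := mul_nonneg ht0 hτ0.le
    exact abs_le.2 ⟨by linarith [h3.1], by linarith [h4.2]⟩
  refine ⟨x + (-(t * τ)) • a.1, ?_, ?_⟩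
  · have hev := hH.eventually_notMem_rotate_iff hg hC hs' hz (by rw [hCy]; exact hCx)
    rw [← frontier_compl]
    exact (mem_frontier_congr (U := U) hev).2 hyf
  · rw [dist_eq_norm, sub_add_cancel_left, norm_neg, norm_smul, hna, mul_one, norm_neg,
      Real.norm_of_nonneg (mul_nonneg ht0 hτ0.le), ← abs_mul]
    calc t * τ ≤ τ := mul_le_of_le_one_left hτ0.le ht1
      _ ≤ aff b x * (s - s') := by rw [hτ]; linarith
      _ ≤ _ := le_abs_self _

/-- A boundary point for the slope `s` lying below the plane of slope `s'` is close to the boundary for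
the slope `s'`: move it towards a fixed point inside the piece and above all planes considered. -/
theorem HingedFace.exists_frontier_above {C : (E3 × ℝ) × Finset (E3 × ℝ)} (hC : C ∈ J) :
    ∃ K : ℝ, 0 ≤ K ∧ ∀ s s' : ℝ, |s'| ≤ s0 / 2 → ∀ x ∈ zone a C.1 C.2 s0, 0 < aff C.1 x →
      s * aff b x ≤ aff a x → x ∉ frontier (rotate P a b J s') →
      (x ∉ Ko C.2 ∨ aff a x ≤ s' * aff b x) →
      ∃ y ∈ frontier (rotate P a b J s'), dist x y ≤ K * |s - s'| := by
  obtain ⟨z, hz, hzK, hCz, haz⟩ := hH.exists_axis hg hC (r := s0) (abs_of_pos hg.pos).le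
  obtain ⟨R, hR⟩ := hg.bdd.exists_norm_le
  have hR' : ∀ x ∈ zone a C.1 C.2 s0, ‖x‖ ≤ R := fun x hx => hR x
    (mem_biUnion (show C ∈ (J : Set _) from hC) hx)
  have hR0 : 0 ≤ R := (norm_nonneg z).trans (hR' z hz)
  obtain ⟨M, hM⟩ := (isCompact_closedBall (0 : E3) R).exists_bound_of_continuousOn
      (continuous_aff b).continuousOn
  have hM' : ∀ x ∈ zone a C.1 C.2 s0, |aff b x| ≤ M := fun x hx => hM x (by
    rw [mem_closedBall_zero_iff]; exact hR' x hx)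
  have hM0 : 0 ≤ M := (abs_nonneg _).trans (hM' z hz)
  set δ := s0 / 2 * aff C.1 z with hδ
  have hδ0 : 0 < δ := by have := hg.pos; positivity
  refine ⟨M * (2 * R) / δ, by positivity, fun s s' hs' x hx hCx hsx hxf hxU => ?_⟩
  have hs0 := hg.pos
  have hs'0 : |s'| ≤ s0 := by linarith
  set U := {v | s' * aff b v < aff a v ∧ v ∈ Ko C.2} with hU
  -- the height above the plane of slope `s'`
  set φ : E3 → ℝ := fun v => aff a v - s' * aff b v with hφ
  have hφz : δ ≤ φ z := by
    have := abs_le.1 (hH.abs_slope hC hCz.le hs')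
    simp only [hφ, haz, hδ]; linarith [this.2]
  have hφmove : ∀ t : ℝ, φ (x + t • (z - x)) = (1 - t) * φ x + t * φ z := fun t => by
    simp only [hφ, aff_move]; ring
  have hKmove : ∀ t : ℝ, 0 < t → t ≤ 1 → x + t • (z - x) ∈ Ko C.2 := by
    intro t h0 h1 p hp
    rw [aff_move]
    have := hx.1 p hp
    have := hzK p hp
    nlinarith [mul_pos h0 this]
  have hCmove : ∀ t : ℝ, 0 ≤ t → t ≤ 1 → 0 < aff C.1 (x + t • (z - x)) := by
    intro t h0 h1
    exact Convex.move_mem (convex_aff_pos C.1) hCx hCz h0 h1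
  -- otherwise `x` would be approached by `U` without belonging to it
  have hneg : φ x < 0 := by
    by_contra! hpos
    have hev := hH.eventually_notMem_rotate_iff hg hC hs'0 hx hCx
    refine hxf ?_
    rw [← frontier_compl]
    refine (mem_frontier_congr (U := U) hev).2 ?_
    rw [frontier_eq_closure_inter_closure]
    refine ⟨mem_closure_of_moves one_pos (w := z - x) fun t h0 h1 => ⟨?_, hKmove t h0 h1.le⟩,
      subset_closure fun h => ?_⟩
    · have h2 := hφmove t
      have : 0 < φ (x + t • (z - x)) := by
        rw [h2]; nlinarith [mul_pos h0 hδ0]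
      exact sub_pos.1 this
    · rcases hxU with h' | h'
      · exact h' h.2
      · exact h'.not_gt h.1
  -- the segment from `x` to `z` crosses the plane of slope `s'` for this parameter
  set t := -φ x / (φ z - φ x) with ht
  have hden : 0 < φ z - φ x := by linarith
  have ht0 : 0 < t := div_pos (by linarith) hden
  have ht1 : t < 1 := by rw [ht, div_lt_one hden]; linarith
  have hφt : φ (x + t • (z - x)) = 0 := by
    rw [hφmove, ht]; field_simp; ring
  set y := x + t • (z - x) with hy
  have hyz : y ∈ zone a C.1 C.2 s0 := by
    have h1 := hCmove t ht0.le ht1.le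
    refine ⟨Ko_subset_Kc _ (hKmove t ht0 ht1.le), h1.le, ?_⟩
    rw [sub_eq_zero.1 hφt]
    exact hH.abs_slope hC h1.le hs'0
  refine ⟨y, ?_, ?_⟩
  · have hev := hH.eventually_notMem_rotate_iff hg hC hs'0 hyz (hCmove t ht0.le ht1.le)
    rw [← frontier_compl]
    refine (mem_frontier_congr (U := U) hev).2 ?_
    rw [frontier_eq_closure_inter_closure]
    refine ⟨mem_closure_of_moves one_pos (w := z - y) fun r h0 h1 => ⟨?_, ?_⟩,
      subset_closure fun h => ?_⟩
    · have h2 : φ (y + r • (z - y)) = (1 - r) * φ y + r * φ z := by simp only [hφ, aff_move]; ring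
      have : 0 < φ (y + r • (z - y)) := by
        rw [h2, hφt]; nlinarith [mul_pos h0 hδ0]
      exact sub_pos.1 this
    · exact Convex.move_mem (convex_Ko C.2) (hKmove t ht0 ht1.le) hzK h0.le h1.le
    · exact (sub_pos.2 h.1).ne' hφt
  · have h1 : -φ x ≤ M * |s - s'| := by
      calc -φ x ≤ aff b x * (s' - s) := by simp only [hφ]; linarith
        _ ≤ |aff b x * (s' - s)| := le_abs_self _
        _ = |aff b x| * |s - s'| := by rw [abs_mul, abs_sub_comm]
        _ ≤ _ := mul_le_mul_of_nonneg_right (hM' x hx) (abs_nonneg _)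
    have h2 : t ≤ M * |s - s'| / δ := by
      rw [ht]
      exact div_le_div₀ (by positivity) h1 hδ0 (by linarith)
    have h3 : ‖z - x‖ ≤ 2 * R := (norm_sub_le _ _).trans (by linarith [hR' z hz, hR' x hx])
    rw [hy, dist_eq_norm, sub_add_cancel_left, norm_neg, norm_smul, Real.norm_of_nonneg ht0.le]
    calc t * ‖z - x‖ ≤ M * |s - s'| / δ * (2 * R) := mul_le_mul h2 h3 (norm_nonneg _) (by positivity)
      _ = _ := by ring

/-- The rotated polyhedra and their boundaries depend Lipschitz continuously on the slope. -/
theorem HingedFace.exists_lipschitz : ∃ K : ℝ, 0 ≤ K ∧ ∀ s s' : ℝ, |s| ≤ s0 / 2 → |s'| ≤ s0 / 2 →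
    (∀ x ∈ rotate P a b J s, ∃ y ∈ rotate P a b J s', dist x y ≤ K * |s - s'|) ∧
    (∀ x ∈ frontier (rotate P a b J s), ∃ y ∈ frontier (rotate P a b J s'),
      dist x y ≤ K * |s - s'|) := by
  have hs0 := hg.pos
  choose! k hk0 hk using fun C hC => hH.exists_frontier_above hg (C := C) hC
  obtain ⟨R, hR⟩ := hg.bdd.exists_norm_le
  obtain ⟨M, hM⟩ := (isCompact_closedBall (0 : E3) R).exists_bound_of_continuousOn
      (continuous_aff b).continuousOn
  have hM' : ∀ C ∈ J, ∀ x ∈ zone a C.1 C.2 s0, |aff b x| ≤ M := fun C hC x hx => hM x (by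
    rw [mem_closedBall_zero_iff]
    exact hR x (mem_biUnion (show C ∈ (J : Set _) from hC) hx))
  set K := |M| + ∑ C ∈ J, k C with hK
  have hK0 : 0 ≤ ∑ C ∈ J, k C := Finset.sum_nonneg hk0
  have hMK : M ≤ K := (le_abs_self M).trans (by linarith)
  have hkK : ∀ C ∈ J, k C ≤ K := fun C hC =>
    (Finset.single_le_sum hk0 hC).trans (by linarith [abs_nonneg M])
  refine ⟨K, by positivity, fun s s' hs hs' => ⟨fun x hx => ?_, fun x hx => ?_⟩⟩
  · by_cases hx' : x ∈ rotate P a b J s'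
    · exact ⟨x, hx', by rw [dist_self]; positivity⟩
    rcases hH.zone_cases (s0 := s0) x with ⟨C, hC, hz, hCx⟩ | ⟨C, hC, hyb, hby⟩ | hno
    · have h1 := (hH.eventually_notMem_rotate_iff hg hC (by linarith) hz hCx).self_of_nhds.1 hx'
      have h2 : aff a x ≤ s * aff b x := by
        by_contra! hlt
        exact (hH.eventually_notMem_rotate_iff hg hC (by linarith) hz hCx).self_of_nhds.2 ⟨hlt, h1.2⟩ hx
      obtain ⟨y, hy, hd⟩ := hH.exists_frontier_below hg hC (s := s) (s' := s') (by linarith) hz hCx h1.2 h1.1 h2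
      have hcl := (hH.isPolyhedron_rotate hg (s := s') (by linarith)).isCompact.isClosed
      exact ⟨y, hcl.frontier_subset hy, hd.trans
        (mul_le_mul_of_nonneg_right ((hM' C hC x hz).trans hMK) (abs_nonneg _))⟩
    · exact absurd (hH.hinge_mem hg hC hyb hby s') hx'
    · exact absurd ((hH.eventually_rotate_iff (by linarith) hno).self_of_nhds.2
        ((hH.eventually_rotate_iff (by linarith) hno).self_of_nhds.1 hx)) hx'
  · by_cases hx' : x ∈ frontier (rotate P a b J s')
    · exact ⟨x, hx', by rw [dist_self]; positivity⟩
    rcases hH.zone_cases (s0 := s0) x with ⟨C, hC, hz, hCx⟩ | ⟨C, hC, hyb, hby⟩ | hno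
    · have hev := hH.eventually_notMem_rotate_iff hg hC (s := s) (by linarith) hz hCx
      have hcl := (hH.isPolyhedron_rotate hg (s := s) (by linarith)).isCompact.isClosed
      have hxs := hcl.frontier_subset hx
      rw [← frontier_compl] at hx
      have hxU := (mem_frontier_congr (U := {v | s * aff b v < aff a v ∧ v ∈ Ko C.2}) hev).1 hx
      have hsx : s * aff b x ≤ aff a x := by
        have hsub : {v | s * aff b v < aff a v ∧ v ∈ Ko C.2} ⊆ {v | s * aff b v ≤ aff a v} :=
          fun v hv => hv.1.le
        exact closure_minimal hsub
          (isClosed_le (continuous_const.mul (continuous_aff b)) (continuous_aff a)) hxU.1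
      by_cases hin : x ∈ Ko C.2 ∧ s' * aff b x < aff a x
      · have h2 : aff a x ≤ s * aff b x := by
          by_contra! hlt
          exact hev.self_of_nhds.2 ⟨hlt, hin.1⟩ hxs
        obtain ⟨y, hy, hd⟩ := hH.exists_frontier_below hg hC (s := s) (s' := s') (by linarith) hz hCx hin.1 hin.2 h2
        exact ⟨y, hy, hd.trans
          (mul_le_mul_of_nonneg_right ((hM' C hC x hz).trans hMK) (abs_nonneg _))⟩
      · rw [not_and_or, not_lt] at hin
        obtain ⟨y, hy, hd⟩ := hk C hC s s' hs' x hz hCx hsx hx' hin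
        exact ⟨y, hy, hd.trans (mul_le_mul_of_nonneg_right (hkK C hC) (abs_nonneg _))⟩
    · exact absurd (hH.hinge_mem_frontier hg hC hyb hby (by linarith)) hx'
    · exact absurd ((mem_frontier_congr (hH.eventually_rotate_iff (by linarith) hno)).2
        ((mem_frontier_congr (hH.eventually_rotate_iff (by linarith) hno)).1 hx)) hx'

/-- For both directions of rotation `τ = 1` and `τ = -1`, the rotated polyhedra form a perturbation. -/
theorem HingedFace.isPerturbation {ε : ℝ} (hε : 0 < ε) (hε' : ε ≤ s0 / 2) {τ : ℝ} (hτ : |τ| = 1) :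
    IsPerturbation P ε fun t => rotate P a b J (τ * t) := by
  have hs0 := hg.pos
  have habs : ∀ t ∈ Icc 0 ε, |τ * t| ≤ s0 / 2 := fun t ht => by
    rw [abs_mul, hτ, one_mul, abs_of_nonneg ht.1]; exact ht.2.trans hε'
  obtain ⟨K, hK0, hK⟩ := hH.exists_lipschitz hg
  have hsub : ∀ s t : ℝ, |τ * s - τ * t| = |s - t| := fun s t => by
    rw [← mul_sub, abs_mul, hτ, one_mul]
  have hlim : ∀ s : ℝ, Tendsto (fun t => ENNReal.ofReal (K * |t - s|)) (𝓝[Icc 0 ε] s) (𝓝 0) := by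
    intro s
    have hc : Continuous fun t : ℝ => ENNReal.ofReal (K * |t - s|) := by
      refine ENNReal.continuous_ofReal.comp ?_
      fun_prop
    have := hc.tendsto s
    simp only [sub_self, abs_zero, mul_zero, ENNReal.ofReal_zero] at this
    exact this.mono_left nhdsWithin_le_nhds
  have hle : ∀ {x y : E3} {r : ℝ}, dist x y ≤ r → edist x y ≤ ENNReal.ofReal r := fun h => by
    rw [edist_dist]; exact ENNReal.ofReal_le_ofReal h
  refine ⟨hε, by rw [mul_zero, rotate_zero], fun t ht => ?_, fun s hs => ?_, fun s hs => ?_⟩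
  · exact hH.isPolyhedron_rotate hg (by linarith [habs t ht])
  · refine tendsto_of_tendsto_of_tendsto_of_le_of_le' tendsto_const_nhds (hlim s)
      (Eventually.of_forall fun _ => zero_le) ?_
    filter_upwards [self_mem_nhdsWithin] with t ht
    refine Metric.hausdorffEDist_le_of_mem_edist (fun x hx => ?_) fun x hx => ?_
    · obtain ⟨y, hy, hd⟩ := (hK _ _ (habs t ht) (habs s hs)).1 x hx
      rw [hsub] at hd; exact ⟨y, hy, hle hd⟩
    · obtain ⟨y, hy, hd⟩ := (hK _ _ (habs s hs) (habs t ht)).1 x hx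
      rw [hsub, abs_sub_comm] at hd; exact ⟨y, hy, hle hd⟩
  · refine tendsto_of_tendsto_of_tendsto_of_le_of_le' tendsto_const_nhds (hlim s)
      (Eventually.of_forall fun _ => zero_le) ?_
    filter_upwards [self_mem_nhdsWithin] with t ht
    refine Metric.hausdorffEDist_le_of_mem_edist (fun x hx => ?_) fun x hx => ?_
    · obtain ⟨y, hy, hd⟩ := (hK _ _ (habs t ht) (habs s hs)).2 x hx
      rw [hsub] at hd; exact ⟨y, hy, hle hd⟩
    · obtain ⟨y, hy, hd⟩ := (hK _ _ (habs s hs) (habs t ht)).2 x hx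
      rw [hsub, abs_sub_comm] at hd; exact ⟨y, hy, hle hd⟩

end

end

section

variable {a b : E3 × ℝ} {I : Finset (E3 × ℝ)}
variable {P : Set E3} {J : Finset ((E3 × ℝ) × Finset (E3 × ℝ))}

/-! ### Finiteness of the edge length -/

/-- If near a boundary point membership in `P` depends only on the side of a plane through it, then `P`
is locally one of the two half-spaces bounded by the plane. -/
theorem halfSpace_of_side (hP : IsPolyhedron P) {y n : E3} (hy : y ∈ frontier P) (hn : n ≠ 0) {r : ℝ}
    (hr : 0 < r) (hside : ∀ v ∈ Metric.ball y r, ∀ v' ∈ Metric.ball y r,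
      (0 < ⟪n, v - y⟫ ∧ 0 < ⟪n, v' - y⟫ ∨ ⟪n, v - y⟫ < 0 ∧ ⟪n, v' - y⟫ < 0) → (v ∈ P ↔ v' ∈ P)) :
    (∀ᶠ v in 𝓝 y, (v ∈ P ↔ ⟪n, v - y⟫ ≤ 0)) ∨ ∀ᶠ v in 𝓝 y, (v ∈ P ↔ ⟪-n, v - y⟫ ≤ 0) := by
  have hcl : IsClosed P := hP.isCompact.isClosed
  have hnn : 0 < ‖n‖ ^ 2 := pow_pos (norm_pos_iff.2 hn) 2
  -- points on the plane are limits of points on either side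
  have hlim : ∀ m : E3, (m = n ∨ m = -n) → (∀ v ∈ Metric.ball y r, 0 < ⟪m, v - y⟫ → v ∈ P) →
      ∀ v ∈ Metric.ball y r, 0 ≤ ⟪m, v - y⟫ → v ∈ P := by
    intro m hm h v hv h0
    have hmm : 0 < ‖m‖ ^ 2 := by rcases hm with rfl | rfl <;> simpa using hnn
    rw [← hcl.closure_eq, mem_closure_iff_nhds]
    intro U hU
    obtain ⟨t, ht, -, h1, h2⟩ := exists_small_move m (x := v)
      (Filter.Eventually.and (show ∀ᶠ w in 𝓝 v, w ∈ U from hU) (Metric.isOpen_ball.mem_nhds hv)) one_pos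
    refine ⟨_, h1, h _ h2 ?_⟩
    rw [add_sub_right_comm, inner_add_right, inner_smul_right, real_inner_self_eq_norm_sq]
    positivity
  have hrep : ∀ m : E3, ∃ t : ℝ, 0 < t ∧ y + t • m ∈ Metric.ball y r := fun m => by
    obtain ⟨t, ht, -, h⟩ := exists_small_move m (Metric.ball_mem_nhds y hr) one_pos
    exact ⟨t, ht, h⟩
  have key : ∀ m : E3, (m = n ∨ m = -n) → (∃ v ∈ Metric.ball y r, 0 < ⟪m, v - y⟫ ∧ v ∉ P) →
      (∃ v ∈ Metric.ball y r, ⟪m, v - y⟫ < 0 ∧ v ∈ P) → ∀ᶠ v in 𝓝 y, (v ∈ P ↔ ⟪m, v - y⟫ ≤ 0) := by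
    rintro m hm ⟨v, hv, hvm, hvP⟩ ⟨w, hw, hwm, hwP⟩
    have hneg : ∀ x, ⟪-m, x⟫ = -⟪m, x⟫ := fun x => inner_neg_left _ _
    have hs : ∀ x ∈ Metric.ball y r, ∀ x' ∈ Metric.ball y r,
      (0 < ⟪m, x - y⟫ ∧ 0 < ⟪m, x' - y⟫ ∨ ⟪m, x - y⟫ < 0 ∧ ⟪m, x' - y⟫ < 0) →
      (x ∈ P ↔ x' ∈ P) := by
      intro x hx x' hx' h
      refine hside x hx x' hx' ?_
      rcases hm with rfl | rfl
      · exact h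
      · rw [inner_neg_left, inner_neg_left] at h
        rcases h with ⟨h1, h2⟩ | ⟨h1, h2⟩
        · right; constructor <;> linarith
        · left; constructor <;> linarith
    filter_upwards [Metric.ball_mem_nhds y hr] with x hx
    constructor
    · intro hxP
      by_contra! hlt
      exact hvP ((hs x hx v hv (Or.inl ⟨hlt, hvm⟩)).1 hxP)
    · intro hle
      refine hlim (-m) (by rcases hm with rfl | rfl <;> simp) (fun x' hx' h => ?_) x hx (by
        rw [hneg]; linarith)
      rw [hneg] at h
      exact (hs x' hx' w hw (Or.inr ⟨by linarith, hwm⟩)).2 hwP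
  obtain ⟨t, ht, htm⟩ := hrep n
  obtain ⟨t', ht', htm'⟩ := hrep (-n)
  have h1 : 0 < ⟪n, y + t • n - y⟫ := by
    rw [add_sub_cancel_left, inner_smul_right, real_inner_self_eq_norm_sq]; positivity
  have h2 : ⟪n, y + t' • -n - y⟫ < 0 := by
    rw [add_sub_cancel_left, inner_smul_right, inner_neg_right, real_inner_self_eq_norm_sq]
    nlinarith [mul_pos ht' hnn]
  by_cases hp : y + t • n ∈ P <;> by_cases hm : y + t' • -n ∈ P
  · -- both sides belong to `P`: an interior point
    refine absurd (mem_interior_iff_mem_nhds.2 ?_) hy.2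
    filter_upwards [Metric.ball_mem_nhds y hr] with v hv
    rcases le_total 0 ⟪n, v - y⟫ with h | h
    · exact hlim n (Or.inl rfl) (fun x hx hx0 => (hside x hx _ htm (Or.inl ⟨hx0, h1⟩)).2 hp) v hv h
    · refine hlim (-n) (Or.inr rfl) (fun x hx hx0 => ?_) v hv (by rw [inner_neg_left]; linarith)
      rw [inner_neg_left] at hx0
      exact (hside x hx _ htm' (Or.inr ⟨by linarith, h2⟩)).2 hm
  · exact Or.inr (key (-n) (Or.inr rfl) ⟨_, htm', by rw [inner_neg_left]; linarith, hm⟩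
      ⟨_, htm, by rw [inner_neg_left]; linarith, hp⟩)
  · exact Or.inl (key n (Or.inl rfl) ⟨_, htm, h1, hp⟩ ⟨_, htm', h2, hm⟩)
  · -- neither side belongs to `P`, which is the closure of its interior
    have hyP : y ∈ closure (interior P) := by rw [hP.closure_interior]; exact hcl.frontier_subset hy
    obtain ⟨v, hvr, hvi⟩ := mem_closure_iff.1 hyP _ Metric.isOpen_ball (Metric.mem_ball_self hr)
    obtain ⟨w, ⟨hwr, hwi⟩, hw⟩ := exists_mem_open_forall_aff_ne {((n, ⟪n, y⟫) : E3 × ℝ)}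
      (finite_singleton _) (by simpa using hn) (Metric.isOpen_ball.inter isOpen_interior) ⟨v, hvr, hvi⟩
    have hw0 : ⟪n, w - y⟫ ≠ 0 := by
      have := hw _ rfl
      rwa [aff, ← inner_sub_right] at this
    rcases lt_or_gt_of_ne hw0 with h | h
    · exact absurd ((hside w hwr _ htm' (Or.inr ⟨h, h2⟩)).1 (interior_subset hwi)) hm
    · exact absurd ((hside w hwr _ htm (Or.inl ⟨h, h1⟩)).1 (interior_subset hwi)) hp

/-- If all planes of the arrangement through a boundary point are parallel, then `P` is locally a
half-space. -/
theorem halfSpace_of_parallel (hP : IsPolyhedron P) {S : Set (E3 × ℝ)} (hfin : S.Finite)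
    (hdet : SignDetermined S P) {y n : E3} (hy : y ∈ frontier P) (hn : n ≠ 0)
    (hpar : ∀ p ∈ S, aff p y = 0 → ∃ c : ℝ, p.1 = c • n) :
    (∀ᶠ v in 𝓝 y, (v ∈ P ↔ ⟪n, v - y⟫ ≤ 0)) ∨ ∀ᶠ v in 𝓝 y, (v ∈ P ↔ ⟪-n, v - y⟫ ≤ 0) := by
  -- near `y` only the side of the plane matters
  obtain ⟨r, hr, hside⟩ : ∃ r > 0, ∀ v ∈ Metric.ball y r, ∀ v' ∈ Metric.ball y r,
      (0 < ⟪n, v - y⟫ ∧ 0 < ⟪n, v' - y⟫ ∨ ⟪n, v - y⟫ < 0 ∧ ⟪n, v' - y⟫ < 0) →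
      (v ∈ P ↔ v' ∈ P) := by
    have hev : ∀ᶠ v in 𝓝 y, ∀ p ∈ S, (0 < aff p y → 0 < aff p v) ∧ (aff p y < 0 → aff p v < 0) := by
      refine (eventually_all_finite hfin).2 fun p _ => ?_
      rcases lt_trichotomy (aff p y) 0 with h | h | h
      · filter_upwards [eventually_aff_neg h] with v hv using ⟨fun h' => absurd h' h.not_gt, fun _ => hv⟩
      · simp [h]
      · filter_upwards [eventually_aff_pos h] with v hv using ⟨fun _ => hv, fun h' => absurd h' h.not_gt⟩
    obtain ⟨r, hr, hball⟩ := Metric.eventually_nhds_iff_ball.1 hev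
    refine ⟨r, hr, fun v hv v' hv' hsgn => hdet _ _ fun p hp => ?_⟩
    rcases lt_trichotomy (aff p y) 0 with h | h | h
    · have h1 := (hball v hv p hp).2 h
      have h2 := (hball v' hv' p hp).2 h
      exact ⟨fun h' => absurd h' h1.not_gt, fun h' => absurd h' h2.not_gt⟩
    · obtain ⟨c, hc⟩ := hpar p hp h
      have hval : ∀ w, aff p w = c * ⟪n, w - y⟫ := fun w => by
        rw [← real_inner_smul_left, ← hc, inner_sub_eq_aff, h, sub_zero]
      rw [hval, hval]
      rcases hsgn with ⟨h1, h2⟩ | ⟨h1, h2⟩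
      · rw [mul_pos_iff_of_pos_right h1, mul_pos_iff_of_pos_right h2]
      · rw [mul_pos_iff, mul_pos_iff]
        simp [h1, h2, h1.not_gt, h2.not_gt]
    · have h1 := (hball v hv p hp).1 h
      have h2 := (hball v' hv' p hp).1 h
      exact ⟨fun _ => h2, fun _ => h1⟩
  exact halfSpace_of_side hP hy hn hr hside

theorem exists_segment_of_bounded_line {p q : E3 × ℝ} (hli : LinearIndependent ℝ ![p.1, q.1]) (R : ℝ) :
    ∃ X Y : E3, {x | aff p x = 0 ∧ aff q x = 0 ∧ x ∈ Metric.closedBall (0 : E3) R} ⊆ segment ℝ X Y := by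
  set E := {x | aff p x = 0 ∧ aff q x = 0 ∧ x ∈ Metric.closedBall (0 : E3) R} with hE
  rcases E.eq_empty_or_nonempty with he | hne
  · exact ⟨0, 0, by rw [he]; exact empty_subset _⟩
  obtain ⟨d, hd, hpd, hqd⟩ := exists_ne_zero_orthogonal p.1 q.1
  have hc : IsCompact E := by
    refine (isCompact_closedBall (0 : E3) R).of_isClosed_subset ?_ fun x hx => hx.2.2
    exact (isClosed_aff_eq p).inter ((isClosed_aff_eq q).inter Metric.isClosed_closedBall)
  have hconv : Convex ℝ E :=
    (convex_aff_eq_zero p).inter ((convex_aff_eq_zero q).inter (convex_closedBall _ _))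
  obtain ⟨X, -, Y, -, h, -⟩ := exists_segment_of_line hc hconv hne d fun x hx y hy => by
    refine exists_eq_smul_of_orthogonal hli hd hpd hqd ?_ ?_
    · rw [inner_sub_eq_aff, hy.1, hx.1, sub_zero]
    · rw [inner_sub_eq_aff, hy.2.1, hx.2.1, sub_zero]
  exact ⟨X, Y, h.subset⟩

/-- The skeleton lies in finitely many segments, the intersections of two planes with a large ball. -/
theorem IsPolyhedron.lenM_skeleton_lt_top (hP : IsPolyhedron P) : lenM (skeleton P) < ⊤ := by
  classical
  obtain ⟨S, hfin, -, hunit, hfr, hdet⟩ := hP.exists_arrangement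
  have hn : ∀ p ∈ S, p.1 ≠ 0 := fun p hp => norm_ne_zero_iff.1 (by rw [hunit p hp]; exact one_ne_zero)
  obtain ⟨R, hR⟩ := hP.isCompact.isBounded.subset_closedBall (0 : E3)
  set L : (E3 × ℝ) × (E3 × ℝ) → Set E3 := fun z => if LinearIndependent ℝ ![z.1.1, z.2.1] then
    {x | aff z.1 x = 0 ∧ aff z.2 x = 0 ∧ x ∈ Metric.closedBall (0 : E3) R} else ∅ with hL
  have hsub : skeleton P ⊆ ⋃ z ∈ S ×ˢ S, L z := by
    intro y hy
    obtain ⟨p, hp, hpy⟩ := hfr y hy.1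
    obtain ⟨q, hq, hqy, hli⟩ : ∃ q ∈ S, aff q y = 0 ∧ LinearIndependent ℝ ![p.1, q.1] := by
      by_contra! hno
      refine hy.2 ⟨hy.1, ?_⟩
      rcases halfSpace_of_parallel hP hfin hdet hy.1 (hn p hp) fun q hq hqy => by
        by_contra! hc
        exact hno q hq hqy ((LinearIndependent.pair_iff' (hn p hp)).2 fun c => (hc c).symm) with h | h
      exacts [⟨p.1, hn p hp, h⟩, ⟨-p.1, neg_ne_zero.2 (hn p hp), h⟩]
    refine mem_biUnion (show (p, q) ∈ S ×ˢ S from ⟨hp, hq⟩) ?_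
    rw [hL]
    simp only [if_pos hli]
    exact ⟨hpy, hqy, hR (hP.isCompact.isClosed.frontier_subset hy.1)⟩
  refine (measure_mono hsub).trans_lt ?_
  refine (measure_biUnion_lt_top (hfin.prod hfin) fun z _ => ?_)
  by_cases hli : LinearIndependent ℝ ![z.1.1, z.2.1]
  · obtain ⟨X, Y, h⟩ := exists_segment_of_bounded_line hli R
    rw [hL]
    simp only [if_pos hli]
    refine (measure_mono h).trans_lt ?_
    rw [lenM_segment]; exact ENNReal.ofReal_lt_top
  · rw [hL]; simp [if_neg hli]

end

section

variable {a b : E3 × ℝ} {I : Finset (E3 × ℝ)}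
variable {P : Set E3} {J : Finset ((E3 × ℝ) × Finset (E3 × ℝ))}

/-! ### Edge length of the rotated polyhedron -/

/-- The part of the skeleton in a zone that disappears when the plane is rotated by the slope `u`. -/
def oldEdges (a b : E3 × ℝ) (I : Finset (E3 × ℝ)) (u : ℝ) : Set E3 := rim a b I 0 ∪ ridgeUp a b I u

/-- The part of the skeleton that appears when the plane is rotated by the slope `u`. -/
def newEdges (a b : E3 × ℝ) (I : Finset (E3 × ℝ)) (u : ℝ) : Set E3 := rim a b I u ∪ ridgeDown a b I u

theorem measurableSet_rim (a b : E3 × ℝ) (I : Finset (E3 × ℝ)) (u : ℝ) : MeasurableSet (rim a b I u) := by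
  have h : rim a b I u = Kc I ∩ ({x | aff a x = u * aff b x} ∩ ({x | 0 < aff b x} ∩
      ⋃ p ∈ I, {x | aff p x = 0})) := by
    ext x; simp only [rim, mem_ofPred_eq, mem_inter_iff, mem_iUnion, exists_prop]
  rw [h]
  refine (isClosed_Kc I).measurableSet.inter (IsClosed.measurableSet ?_ |>.inter
    ((isOpen_aff_pos b).measurableSet.inter
      (I.measurableSet_biUnion fun p _ => (isClosed_aff_eq p).measurableSet)))
  exact isClosed_eq (continuous_aff a) (continuous_const.mul (continuous_aff b))

theorem measurableSet_ridgeUp (a b : E3 × ℝ) (I : Finset (E3 × ℝ)) (u : ℝ) :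
    MeasurableSet (ridgeUp a b I u) := by
  classical
  have h : ridgeUp a b I u = Kc I ∩ ((⋃ p ∈ I, ⋃ q ∈ I.erase p, {x | aff p x = 0} ∩ {x | aff q x = 0}) ∩
      ({x | 0 < aff b x} ∩ ({x | 0 < aff a x} ∩ {x | aff a x < u * aff b x}))) := by
    ext x
    simp only [ridgeUp, ridge, mem_ofPred_eq, mem_inter_iff, mem_iUnion, Finset.mem_erase]
    constructor
    · rintro ⟨⟨hK, p, hp, q, hq, hpq, h1, h2⟩, h⟩
      exact ⟨hK, ⟨p, hp, q, ⟨hpq.symm, hq⟩, h1, h2⟩, h⟩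
    · rintro ⟨hK, ⟨p, hp, q, ⟨hpq, hq⟩, h1, h2⟩, h⟩
      exact ⟨⟨hK, p, hp, q, hq, hpq.symm, h1, h2⟩, h⟩
  rw [h]
  refine (isClosed_Kc I).measurableSet.inter (MeasurableSet.inter ?_
    ((isOpen_aff_pos b).measurableSet.inter ((isOpen_aff_pos a).measurableSet.inter
      (isOpen_lt (continuous_aff a) (continuous_const.mul (continuous_aff b))).measurableSet)))
  exact I.measurableSet_biUnion fun p _ => (I.erase p).measurableSet_biUnion fun q _ =>
    ((isClosed_aff_eq p).inter (isClosed_aff_eq q)).measurableSet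

/-- First-order bound for the change of the edge length in the zone of one piece. -/
theorem ConvexPiece.exists_first_order (hC : ConvexPiece a b I) : ∃ (Ψ : ℝ → ℝ) (c : ℝ), 0 ≤ c ∧
    DifferentiableAt ℝ Ψ 0 ∧ 0 < Ψ 0 ∧ ENNReal.ofReal (Ψ 0) ≤ lenM (rim a b I 0) ∧
    (∀ᶠ u in 𝓝[≠] (0 : ℝ), lenM (newEdges a b I u) + ENNReal.ofReal (Ψ 0 + c * max u 0) ≤
      ENNReal.ofReal (Ψ u) + lenM (oldEdges a b I u)) ∧
    ((∃ j ∈ I, (edge a b I j).Subsingleton) → 0 < c) := by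
  obtain ⟨Ψ, c, hc, hd, h0, hup, hdown, hpos, hΨ⟩ := hC.exists_length_bound
  refine ⟨Ψ, c, hc, hd, hΨ, h0, ?_, hpos⟩
  rw [← Iio_union_Ioi, nhdsWithin_union, eventually_sup]
  constructor
  · filter_upwards [hdown, self_mem_nhdsWithin] with u hu (hu0 : u < 0)
    rw [max_eq_right hu0.le, mul_zero, add_zero]
    refine add_le_add ((measure_union_le _ _).trans hu) (h0.trans (measure_mono subset_union_left))
  · filter_upwards [hup, self_mem_nhdsWithin] with u hu (hu0 : 0 < u)
    rw [max_eq_left hu0.le, ENNReal.ofReal_add hΨ.le (by positivity)]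
    have h1 : newEdges a b I u = rim a b I u := by
      refine union_eq_left.2 fun x hx => ?_
      have h2 := hx.2.2.1
      nlinarith [mul_pos hu0 hx.2.1, hx.2.2.2]
    have h2 : lenM (oldEdges a b I u) = lenM (rim a b I 0) + lenM (ridgeUp a b I u) := by
      refine measure_union (Set.disjoint_left.2 fun x hx hx' => ?_) (measurableSet_ridgeUp _ _ _ _)
      have h3 := hx.2.1
      rw [zero_mul] at h3
      exact hx'.2.2.1.ne' h3
    rw [h1, h2]
    calc lenM (rim a b I u) + (ENNReal.ofReal (Ψ 0) + ENNReal.ofReal (c * u))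
        = (lenM (rim a b I u) + ENNReal.ofReal (c * u)) + ENNReal.ofReal (Ψ 0) := by ring
      _ ≤ (ENNReal.ofReal (Ψ u) + lenM (ridgeUp a b I u)) + lenM (rim a b I 0) := add_le_add hu h0
      _ = _ := by ring

open Classical in
/-- The sign relating the functional `β = ±b` of a piece to `b`. -/
noncomputable def pieceSign (b β : E3 × ℝ) : ℝ := if β = b then 1 else -1

theorem abs_pieceSign (b β : E3 × ℝ) : |pieceSign b β| = 1 := by
  unfold pieceSign; split_ifs <;> simp

theorem HingedFace.mul_pieceSign (hH : HingedFace P a b J) {C : (E3 × ℝ) × Finset (E3 × ℝ)}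
    (hC : C ∈ J) (s : ℝ) (x : E3) : pieceSign b C.1 * s * aff C.1 x = s * aff b x := by
  unfold pieceSign
  split_ifs with h
  · rw [h]; ring
  · rw [(hH.sign C hC).resolve_left h, aff_neg]; ring

theorem GoodSlope.mem_zone_of_oldEdges {s0 : ℝ} (hg : GoodSlope P a b J s0)
    {C : (E3 × ℝ) × Finset (E3 × ℝ)} {u : ℝ}
    (hu : |u| ≤ s0) : ∀ y ∈ oldEdges a C.1 C.2 u, y ∈ zone a C.1 C.2 s0 ∧ 0 < aff C.1 y ∧
      0 ≤ aff a y ∧ (aff a y = 0 ∨ aff a y < u * aff C.1 y) := by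
  have hs0 := hg.pos
  rintro y (h | h)
  · have ha : aff a y = 0 := by rw [h.2.1, zero_mul]
    exact ⟨⟨h.1, h.2.2.1.le, by rw [ha, abs_zero]; exact mul_nonneg hs0.le h.2.2.1.le⟩, h.2.2.1, ha.ge,
      Or.inl ha⟩
  · refine ⟨⟨h.1.1, h.2.1.le, ?_⟩, h.2.1, h.2.2.1.le, Or.inr h.2.2.2⟩
    rw [abs_of_pos h.2.2.1]
    exact h.2.2.2.le.trans (mul_le_mul_of_nonneg_right ((le_abs_self u).trans hu) h.2.1.le)

section

variable (hH : HingedFace P a b J) {s0 : ℝ} (hg : GoodSlope P a b J s0)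
include hH hg

theorem HingedFace.mem_skeleton_of_zone [DecidableEq (E3 × ℝ)] {C : (E3 × ℝ) × Finset (E3 × ℝ)}
    (hC : C ∈ J) {y : E3} (hy : y ∈ zone a C.1 C.2 s0) (hCy : 0 < aff C.1 y) (hay : 0 ≤ aff a y)
    {p q : E3 × ℝ} (hp : p ∈ C.2) (hq : q ∈ insert a C.2) (hpq : p ≠ q) (hpy : aff p y = 0)
    (hqy : aff q y = 0) : y ∈ skeleton P := by
  obtain ⟨x, hax, hx⟩ := (hH.piece C hC).exists_pos
  refine mem_skeleton_of_pair (T := insert a C.2) ⟨x, mem_Ko_insert.2 ⟨hax, hx⟩⟩ ?_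
    (mem_Kc_insert.2 ⟨hay, hy.1⟩) (Finset.mem_insert_of_mem hp) hq ?_ hpy hqy
  · filter_upwards [hg.local_eq C hC y hy hCy] with v hv
    rw [hv, mem_Ko_insert]
  · rcases Finset.mem_insert.1 hq with rfl | hq
    · exact (hH.piece C hC).linearIndependent_face hp
    · exact (hH.piece C hC).linearIndependent_pair hp hq hpq hpy hqy

theorem HingedFace.oldEdges_subset_skeleton {C : (E3 × ℝ) × Finset (E3 × ℝ)} (hC : C ∈ J) {u : ℝ}
    (hu : |u| ≤ s0) : oldEdges a C.1 C.2 u ⊆ skeleton P := by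
  classical
  intro y hy
  obtain ⟨hz, hCy, hay, -⟩ := hg.mem_zone_of_oldEdges hu y hy
  rcases hy with h | h
  · obtain ⟨p, hp, hpy⟩ := h.2.2.2
    have ha : aff a y = 0 := by rw [h.2.1, zero_mul]
    refine hH.mem_skeleton_of_zone hg hC hz hCy hay hp (Finset.mem_insert_self _ _) ?_ hpy ha
    rintro rfl
    have := ((hH.piece C hC).linearIndependent_face hp).injective.ne (show (0 : Fin 2) ≠ 1 by decide)
    exact this rfl
  · obtain ⟨-, p, hp, q, hq, hpq, hpy, hqy⟩ := h.1
    exact hH.mem_skeleton_of_zone hg hC hz hCy hay hp (Finset.mem_insert_of_mem hq) hpq hpy hqy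

/-- The new edges lie in the zones, or were edges before and are not among those that disappear. -/
theorem HingedFace.skeleton_rotate_subset {s : ℝ} (hs : |s| < s0) : skeleton (rotate P a b J s) ⊆
    (skeleton P \ ⋃ C ∈ J, oldEdges a C.1 C.2 (pieceSign b C.1 * s)) ∪
      ⋃ C ∈ J, newEdges a C.1 C.2 (pieceSign b C.1 * s) := by
  classical
  have hu : ∀ C : (E3 × ℝ) × Finset (E3 × ℝ), |pieceSign b C.1 * s| ≤ s0 := fun C => by
    rw [abs_mul, abs_pieceSign, one_mul]; exact hs.le
  intro y hy
  rcases hH.zone_cases (s0 := s0) y with ⟨C, hC, hz, hCy⟩ | ⟨C, hC, hyb, hby⟩ | hno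
  · set u := pieceSign b C.1 * s with hu'
    have hub : ∀ x, aff (a - s • b) x = aff a x - u * aff C.1 x := fun x => by
      rw [aff_sub, aff_smul, hH.mul_pieceSign hC]
    have hli : ∀ p ∈ insert (a - s • b) C.2, p.1 ≠ 0 := by
      obtain ⟨x, hxz, hxK, hCx, hax⟩ := hH.exists_axis hg hC (r := s0) (abs_of_pos hg.pos).le
      obtain ⟨x', hxz', hxK', hCx', hax'⟩ := hH.exists_axis hg hC (r := 0) (by simpa using hg.pos.le)
      intro p hp
      rcases Finset.mem_insert.1 hp with rfl | hp
      · intro h0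
        have horth : ⟪a.1, b.1⟫ = 0 := by
          have := (hH.piece C hC).orth
          rcases hH.sign C hC with h | h <;> simpa [h] using this
        have h1 : ⟪a.1, (a - s • b).1⟫ = 1 := by
          simp [inner_sub_right, inner_smul_right, horth, (hH.piece C hC).norm_a]
        rw [h0, inner_zero_right] at h1
        exact zero_ne_one h1
      · exact ((hH.piece C hC).linearIndependent_face hp).ne_zero 0
    obtain ⟨hK, p, hp, q, hq, hpq, hpy, hqy⟩ := exists_pair_of_mem_skeleton hli
      (hH.eventually_notMem_rotate_iff_Ko hg hC hs.le hz hCy) hy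
    obtain ⟨hsl, hK⟩ := mem_Kc_insert.1 hK
    rw [hub] at hsl
    have hin : ∀ C' ∈ J, y ∈ newEdges a C'.1 C'.2 (pieceSign b C'.1 * s) →
        y ∈ ⋃ C ∈ J, newEdges a C.1 C.2 (pieceSign b C.1 * s) := fun C' hC' h =>
      mem_biUnion (show C' ∈ (J : Set _) from hC') h
    rcases hsl.eq_or_lt with heq | hlt
    · -- an edge in the rotated plane
      right
      refine hin C hC (Or.inl ⟨hK, (sub_eq_zero.1 heq.symm), hCy, ?_⟩)
      rcases Finset.mem_insert.1 hp with rfl | hp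
      · exact ⟨q, (Finset.mem_insert.1 hq).resolve_left (Ne.symm hpq), hqy⟩
      · exact ⟨p, hp, hpy⟩
    · have hpC : p ∈ C.2 := (Finset.mem_insert.1 hp).resolve_left (by
        rintro rfl; rw [hub] at hpy; exact hlt.ne' hpy)
      have hqC : q ∈ C.2 := (Finset.mem_insert.1 hq).resolve_left (by
        rintro rfl; rw [hub] at hqy; exact hlt.ne' hqy)
      -- an edge above the rotated plane, on two neighbouring planes
      rcases le_or_gt (aff a y) 0 with hay | hay
      · right
        exact hin C hC (Or.inr ⟨⟨hK, p, hpC, q, hqC, hpq, hpy, hqy⟩, hCy, sub_pos.1 hlt, hay⟩)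
      · left
        refine ⟨hH.mem_skeleton_of_zone hg hC hz hCy hay.le hpC (Finset.mem_insert_of_mem hqC) hpq
          hpy hqy, fun hold => ?_⟩
        obtain ⟨D, hD, hyD⟩ := mem_iUnion₂.1 hold
        obtain ⟨hzD, hDy, -, h⟩ := hg.mem_zone_of_oldEdges (hu D) y hyD
        by_cases hDC : D = C
        · subst hDC
          rcases h with h | h
          · exact hay.ne' h
          · exact (sub_pos.1 hlt).not_gt h
        · exact hg.disjoint D hD C hC hDC y hzD hz hDy hCy
  · left
    refine ⟨⟨?_, fun hface => hH.hinge_notMem_skeleton hg hC hyb hby hface hs.le hy⟩, fun hold => ?_⟩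
    · have := hH.hinge_mem_frontier hg hC hyb hby (s := 0) (by simpa using hg.pos)
      rwa [rotate_zero] at this
    · obtain ⟨D, hD, hyD⟩ := mem_iUnion₂.1 hold
      obtain ⟨-, hDy, -⟩ := hg.mem_zone_of_oldEdges (hu D) y hyD
      exact hDy.ne' ((hH.eq_zero_iff hD).2 hby)
  · left
    refine ⟨(mem_skeleton_congr (hH.eventually_rotate_iff hs.le hno)).1 hy, fun hold => ?_⟩
    obtain ⟨D, hD, hyD⟩ := mem_iUnion₂.1 hold
    exact hno D hD (hg.mem_zone_of_oldEdges (hu D) y hyD).1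

/-- The edges that disappear lie in the skeleton of `P` and are pairwise disjoint, so their lengths can be
subtracted; those that appear are only counted from above. -/
theorem HingedFace.lenM_skeleton_rotate {s : ℝ} (hs : |s| < s0) :
    lenM (skeleton (rotate P a b J s)) +
      ∑ C ∈ J, lenM (oldEdges a C.1 C.2 (pieceSign b C.1 * s)) ≤
    lenM (skeleton P) + ∑ C ∈ J, lenM (newEdges a C.1 C.2 (pieceSign b C.1 * s)) := by
  have hu : ∀ C : (E3 × ℝ) × Finset (E3 × ℝ), |pieceSign b C.1 * s| ≤ s0 := fun C => by
    rw [abs_mul, abs_pieceSign, one_mul]; exact hs.le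
  have hmeas : ∀ C ∈ J, MeasurableSet (oldEdges a C.1 C.2 (pieceSign b C.1 * s)) := fun C _ =>
    (measurableSet_rim _ _ _ _).union (measurableSet_ridgeUp _ _ _ _)
  have hdis : (J : Set _).PairwiseDisjoint
      (fun C : (E3 × ℝ) × Finset (E3 × ℝ) => oldEdges a C.1 C.2 (pieceSign b C.1 * s)) := by
    intro C hC D hD hCD
    refine Set.disjoint_left.2 fun y hyC hyD => ?_
    obtain ⟨hzC, hCy, -⟩ := hg.mem_zone_of_oldEdges (hu C) y hyC
    obtain ⟨hzD, hDy, -⟩ := hg.mem_zone_of_oldEdges (hu D) y hyD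
    exact hg.disjoint C hC D hD hCD y hzC hzD hCy hDy
  set W := ⋃ C ∈ J, oldEdges a C.1 C.2 (pieceSign b C.1 * s) with hW
  have hWm : MeasurableSet W := J.measurableSet_biUnion hmeas
  have hWs : W ⊆ skeleton P := iUnion₂_subset fun C hC => hH.oldEdges_subset_skeleton hg hC (hu C)
  rw [← measure_biUnion_finset hdis hmeas, ← hW]
  calc lenM (skeleton (rotate P a b J s)) + lenM W
      ≤ (lenM (skeleton P \ W) + ∑ C ∈ J, lenM (newEdges a C.1 C.2 (pieceSign b C.1 * s))) +
        lenM W := by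
        refine add_le_add_left ?_ _
        exact (measure_mono (hH.skeleton_rotate_subset hg hs)).trans
          ((measure_union_le _ _).trans (add_le_add_right (measure_biUnion_finset_le _ _) _))
    _ = (lenM (skeleton P ∩ W) + lenM (skeleton P \ W)) +
        ∑ C ∈ J, lenM (newEdges a C.1 C.2 (pieceSign b C.1 * s)) := by
        rw [inter_eq_right.2 hWs]; ring
    _ = _ := by rw [measure_inter_add_sdiff (μ := lenM) _ hWm]

end

theorem tendsto_sign_mul {τ : ℝ} (hτ : |τ| = 1) :
    Tendsto (fun s : ℝ => τ * s) (𝓝[≠] 0) (𝓝[≠] 0) := by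
  have hτ0 : τ ≠ 0 := by rintro rfl; simp at hτ
  refine tendsto_nhdsWithin_iff.2 ⟨?_, ?_⟩
  · have : Continuous fun s : ℝ => τ * s := by fun_prop
    simpa using (this.tendsto 0).mono_left nhdsWithin_le_nhds
  · filter_upwards [self_mem_nhdsWithin] with s hs
    exact mul_ne_zero hτ0 hs

/-- The edge length of the rotated polyhedron is bounded by a differentiable function of the slope, up
to a first-order gain, which is present for at least one of the two directions if some plane touches
the face only in a vertex. -/
theorem HingedFace.exists_edgeLength_bound (hH : HingedFace P a b J) :
    ∃ (f : ℝ → ℝ) (c d : ℝ), DifferentiableAt ℝ f 0 ∧ f 0 = 0 ∧ 0 ≤ c ∧ 0 ≤ d ∧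
      (∀ᶠ s in 𝓝[≠] (0 : ℝ), edgeLength (rotate P a b J s) + c * max s 0 + d * max (-s) 0 ≤
        edgeLength P + f s) ∧
      (∀ C ∈ J, 0 < edgeLength P ∧ ((∃ j ∈ C.2, (edge a C.1 C.2 j).Subsingleton) → 0 < c + d)) := by
  classical
  choose! Ψ k hk hd hΨ h0 hev hpos using fun C hC => (hH.piece C hC).exists_first_order
  have hfinP : lenM (skeleton P) < ⊤ := hH.isPolyhedron.lenM_skeleton_lt_top
  obtain ⟨s0, hg⟩ := hH.eventually_goodSlope.exists
  have hs0 := hg.pos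
  set ε : (E3 × ℝ) × Finset (E3 × ℝ) → ℝ := fun C => pieceSign b C.1 with hε
  have hdC : ∀ C ∈ J, DifferentiableAt ℝ (fun s => Ψ C (ε C * s)) 0 := fun C hC => by
    refine DifferentiableAt.comp (f := fun s : ℝ => ε C * s) 0 ?_ (by fun_prop)
    rw [mul_zero]; exact hd C hC
  -- positive slopes give a gain on the pieces where `b` is positive, negative slopes on the others
  refine ⟨fun s => ∑ C ∈ J, (Ψ C (ε C * s) - Ψ C 0), ∑ C ∈ J with C.1 = b, k C,
    ∑ C ∈ J with C.1 ≠ b, k C, ?_, ?_, ?_, ?_, ?_, ?_⟩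
  · exact DifferentiableAt.fun_sum fun C hC => (hdC C hC).sub_const _
  · simp
  · exact Finset.sum_nonneg fun C hC => hk C (Finset.filter_subset _ _ hC)
  · exact Finset.sum_nonneg fun C hC => hk C (Finset.filter_subset _ _ hC)
  · have hev' : ∀ᶠ s in 𝓝[≠] (0 : ℝ), ∀ C ∈ J, lenM (newEdges a C.1 C.2 (ε C * s)) +
        ENNReal.ofReal (Ψ C 0 + k C * max (ε C * s) 0) ≤
        ENNReal.ofReal (Ψ C (ε C * s)) + lenM (oldEdges a C.1 C.2 (ε C * s)) := by
      rw [Finset.eventually_all]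
      exact fun C hC => (tendsto_sign_mul (abs_pieceSign b C.1)).eventually (hev C hC)
    have hΨs : ∀ᶠ s in 𝓝[≠] (0 : ℝ), ∀ C ∈ J, 0 < Ψ C (ε C * s) := by
      rw [Finset.eventually_all]
      intro C hC
      refine ((hdC C hC).continuousAt.eventually (lt_mem_nhds ?_)).filter_mono nhdsWithin_le_nhds
      beta_reduce; rw [mul_zero]; exact hΨ C hC
    have hsmall : ∀ᶠ s in 𝓝[≠] (0 : ℝ), |s| < s0 := by
      have : Tendsto (fun u : ℝ => |u|) (𝓝 0) (𝓝 0) := by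
        simpa using (continuous_abs).tendsto (0 : ℝ)
      exact (this.eventually (gt_mem_nhds hs0)).filter_mono nhdsWithin_le_nhds
    filter_upwards [hev', hΨs, hsmall] with s hev' hΨs hs
    have hlen := hH.lenM_skeleton_rotate hg hs
    have hold : ∑ C ∈ J, lenM (oldEdges a C.1 C.2 (ε C * s)) ≠ ⊤ := by
      refine ENNReal.sum_ne_top.2 fun C hC => ((measure_mono
        (hH.oldEdges_subset_skeleton hg hC ?_)).trans_lt hfinP).ne
      rw [abs_mul, abs_pieceSign, one_mul]; exact hs.le
    have hnn : ∀ C ∈ J, 0 ≤ Ψ C 0 + k C * max (ε C * s) 0 := fun C hC =>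
      add_nonneg (hΨ C hC).le (mul_nonneg (hk C hC) (le_max_right _ _))
    have hsum : lenM (skeleton (rotate P a b J s)) +
        ENNReal.ofReal (∑ C ∈ J, (Ψ C 0 + k C * max (ε C * s) 0)) ≤
        lenM (skeleton P) + ENNReal.ofReal (∑ C ∈ J, Ψ C (ε C * s)) := by
      have h1 := Finset.sum_le_sum hev'
      rw [Finset.sum_add_distrib, Finset.sum_add_distrib,
        ← ENNReal.ofReal_sum_of_nonneg hnn,
        ← ENNReal.ofReal_sum_of_nonneg fun C hC => (hΨs C hC).le] at h1
      refine (ENNReal.add_le_add_iff_right hold).1 ?_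
      calc _ = (lenM (skeleton (rotate P a b J s)) + ∑ C ∈ J, lenM (oldEdges a C.1 C.2 (ε C * s))) +
            ENNReal.ofReal (∑ C ∈ J, (Ψ C 0 + k C * max (ε C * s) 0)) := by ring
        _ ≤ (lenM (skeleton P) + ∑ C ∈ J, lenM (newEdges a C.1 C.2 (ε C * s))) +
            ENNReal.ofReal (∑ C ∈ J, (Ψ C 0 + k C * max (ε C * s) 0)) := add_le_add_left hlen _
        _ = lenM (skeleton P) + (∑ C ∈ J, lenM (newEdges a C.1 C.2 (ε C * s)) +
            ENNReal.ofReal (∑ C ∈ J, (Ψ C 0 + k C * max (ε C * s) 0))) := by ring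
        _ ≤ _ := (add_le_add_right h1 _).trans (by rw [add_assoc])
    have hfinQ : lenM (skeleton (rotate P a b J s)) < ⊤ :=
      (hH.isPolyhedron_rotate hg hs).lenM_skeleton_lt_top
    have hreal := ENNReal.toReal_mono (ENNReal.add_ne_top.2 ⟨hfinP.ne, ENNReal.ofReal_ne_top⟩) hsum
    rw [ENNReal.toReal_add hfinQ.ne ENNReal.ofReal_ne_top, ENNReal.toReal_add hfinP.ne
      ENNReal.ofReal_ne_top, ENNReal.toReal_ofReal (Finset.sum_nonneg hnn),
      ENNReal.toReal_ofReal (Finset.sum_nonneg fun C hC => (hΨs C hC).le),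
      Finset.sum_add_distrib] at hreal
    have hsplit : ∑ C ∈ J, k C * max (ε C * s) 0 = (∑ C ∈ J with C.1 = b, k C) * max s 0 +
        (∑ C ∈ J with C.1 ≠ b, k C) * max (-s) 0 := by
      rw [← Finset.sum_filter_add_sum_filter_not J (fun C => C.1 = b), Finset.sum_mul, Finset.sum_mul]
      congr 1
      · refine Finset.sum_congr rfl fun C hC => ?_
        simp [hε, pieceSign, (Finset.mem_filter.1 hC).2]
      · refine Finset.sum_congr rfl fun C hC => ?_
        simp [hε, pieceSign, (Finset.mem_filter.1 hC).2]
    rw [hsplit] at hreal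
    simp only [edgeLength, Finset.sum_sub_distrib]
    linarith
  · intro C hC
    constructor
    · refine ENNReal.toReal_pos (ne_of_gt ?_) hfinP.ne
      calc (0 : ENNReal) < ENNReal.ofReal (Ψ C 0) := ENNReal.ofReal_pos.2 (hΨ C hC)
        _ ≤ _ := (h0 C hC).trans (measure_mono (subset_union_left.trans
          (hH.oldEdges_subset_skeleton hg hC (u := 0) (by simpa using hs0.le))))
    · intro hj
      have h1 := hpos C hC hj
      rw [Finset.sum_filter_add_sum_filter_not]
      exact Finset.sum_pos' hk ⟨C, hC, h1⟩

end

section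

variable {a b : E3 × ℝ} {I : Finset (E3 × ℝ)}
variable {P : Set E3} {J : Finset ((E3 × ℝ) × Finset (E3 × ℝ))}

/-! ### Volume of the rotated polyhedron and the Melzak ratio -/

theorem isOpen_wedge (a b : E3 × ℝ) (I : Finset (E3 × ℝ)) (u : ℝ) : IsOpen (wedge a b I u) :=
  (isOpen_Ko I).inter ((isOpen_aff_pos b).inter
    ((isOpen_lt continuous_const ((continuous_aff a).div_const u)).inter
      (isOpen_lt ((continuous_aff a).div_const u) (continuous_aff b))))

theorem wedge_subset_zone {u s0 : ℝ} (hu0 : u ≠ 0) (hu : |u| ≤ s0) :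
    ∀ x ∈ wedge a b I u, x ∈ zone a b I s0 ∧ 0 < aff b x := by
  rintro x ⟨hK, hb, h1, h2⟩
  refine ⟨⟨Ko_subset_Kc _ hK, hb.le, ?_⟩, hb⟩
  have h3 : |aff a x| = |u| * (aff a x / u) := by
    conv_rhs => rw [← abs_of_pos h1, ← abs_mul]
    congr 1; field_simp
  rw [h3]
  exact mul_le_mul hu h2.le h1.le ((abs_nonneg u).trans hu)

/-- The volume changes by the wedges on the pieces: they are added where the plane moves out of `P` and
removed where it moves in. -/
theorem HingedFace.volume_rotate (hH : HingedFace P a b J) {s0 : ℝ} (hg : GoodSlope P a b J s0)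
    {s : ℝ} (hs : |s| < s0) :
    volume P + ∑ C ∈ J, volume {x | 0 < pieceSign b C.1 * s ∧ x ∈ wedge a C.1 C.2 (pieceSign b C.1 * s)} ≤
      volume (rotate P a b J s) +
        ∑ C ∈ J, volume {x | pieceSign b C.1 * s < 0 ∧ x ∈ wedge a C.1 C.2 (pieceSign b C.1 * s)} := by
  have hu : ∀ C : (E3 × ℝ) × Finset (E3 × ℝ), |pieceSign b C.1 * s| ≤ s0 := fun C => by
    rw [abs_mul, abs_pieceSign, one_mul]; exact hs.le
  set W : (E3 × ℝ) × Finset (E3 × ℝ) → Set E3 := fun C =>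
    {x | 0 < pieceSign b C.1 * s ∧ x ∈ wedge a C.1 C.2 (pieceSign b C.1 * s)} with hW
  have hmeas : ∀ C ∈ J, MeasurableSet (W C) := fun C _ =>
    MeasurableSet.inter (MeasurableSet.const _) (isOpen_wedge _ _ _ _).measurableSet
  have hdis : (J : Set _).PairwiseDisjoint W := by
    intro C hC D hD hCD
    refine Set.disjoint_left.2 fun y hyC hyD => ?_
    have h1 := wedge_subset_zone hyC.1.ne' (hu C) y hyC.2
    have h2 := wedge_subset_zone hyD.1.ne' (hu D) y hyD.2
    exact hg.disjoint C hC D hD hCD y h1.1 h2.1 h1.2 h2.2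
  have hWP : Disjoint P (⋃ C ∈ J, W C) := by
    refine Set.disjoint_left.2 fun y hyP hy => ?_
    obtain ⟨C, hC, hyC⟩ := mem_iUnion₂.1 hy
    have h1 := wedge_subset_zone hyC.1.ne' (hu C) y hyC.2
    refine (hg.local_eq C hC y h1.1 h1.2).self_of_nhds.2 ⟨?_, hyC.2.1⟩ hyP
    have := (div_pos_iff_of_pos_right hyC.1).1 hyC.2.2.2.1
    exact this
  rw [← measure_biUnion_finset hdis hmeas, ← measure_union hWP (J.measurableSet_biUnion hmeas)]
  rcases J.eq_empty_or_nonempty with rfl | ⟨C0, hC0⟩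
  · have hQ : rotate P a b ∅ s = P := by ext x; simp [rotate]
    simp [hQ]
  have ha0 : a.1 ≠ 0 := by
    rw [← norm_ne_zero_iff, (hH.piece C0 hC0).norm_a]; exact one_ne_zero
  have hsub : P ∪ (⋃ C ∈ J, W C) ⊆ rotate P a b J s ∪ ({x | aff a x = 0} ∪
      ⋃ C ∈ J, {x | pieceSign b C.1 * s < 0 ∧ x ∈ wedge a C.1 C.2 (pieceSign b C.1 * s)}) := by
    rintro x (hx | hx)
    · by_cases hxQ : x ∈ rotate P a b J s
      · exact Or.inl hxQ
      right
      have : ∃ C ∈ J, x ∈ Ko C.2 ∧ 0 < aff C.1 x ∧ s * aff b x < aff a x ∧ aff a x ≤ 0 := by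
        by_contra hno; exact hxQ ⟨Or.inl hx, hno⟩
      obtain ⟨C, hC, hK, hCx, h1, h2⟩ := this
      rcases h2.eq_or_lt with h2 | h2
      · exact Or.inl h2
      · right
        rw [← hH.mul_pieceSign hC] at h1
        have hneg : pieceSign b C.1 * s < 0 := by
          by_contra! hnn
          have := mul_nonneg hnn hCx.le
          linarith
        exact mem_biUnion (show C ∈ (J : Set _) from hC) ⟨hneg, hK, hCx, div_pos_of_neg_of_neg h2 hneg,
          (div_lt_iff_of_neg hneg).2 (by linarith)⟩
    · left
      obtain ⟨C, hC, hpos, hK, hCx, h1, h2⟩ := mem_iUnion₂.1 hx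
      have ha : 0 < aff a x := (div_pos_iff_of_pos_right hpos).1 h1
      rw [div_lt_iff₀' hpos, hH.mul_pieceSign hC] at h2
      refine ⟨Or.inr ⟨C, hC, Ko_subset_Kc _ hK, hCx, ha, h2.le⟩, ?_⟩
      rintro ⟨D, -, -, -, -, h⟩
      exact h.not_gt ha
  refine (measure_mono hsub).trans ((measure_union_le _ _).trans (add_le_add_right ?_ _))
  refine (measure_union_le _ _).trans ?_
  rw [volume_aff_eq_zero ha0, zero_add]
  exact measure_biUnion_finset_le _ _

theorem IsPolyhedron.volume_pos (hP : IsPolyhedron P) : 0 < (volume P).toReal := by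
  refine ENNReal.toReal_pos (ne_of_gt ?_) hP.isCompact.measure_lt_top.ne
  have hne : (interior P).Nonempty := by
    rw [← closure_nonempty_iff, hP.closure_interior]; exact hP.nonempty
  exact (isOpen_interior.measure_pos volume hne).trans_le (measure_mono interior_subset)

/-- The volume of the rotated polyhedron is bounded below by a differentiable function of the slope which
agrees with it at slope zero. -/
theorem HingedFace.exists_volume_bound (hH : HingedFace P a b J) : ∃ w : ℝ → ℝ,
    DifferentiableAt ℝ w 0 ∧ w 0 = 0 ∧
    ∀ᶠ s in 𝓝[≠] (0 : ℝ), (volume P).toReal + w s ≤ (volume (rotate P a b J s)).toReal := by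
  choose! w hd h0 hup hdown using fun C hC => (hH.piece C hC).exists_volume_wedge
  obtain ⟨s0, hg⟩ := hH.eventually_goodSlope.exists
  set ε : (E3 × ℝ) × Finset (E3 × ℝ) → ℝ := fun C => pieceSign b C.1 with hε
  refine ⟨fun s => ∑ C ∈ J, w C (ε C * s), ?_, ?_, ?_⟩
  · refine DifferentiableAt.fun_sum fun C hC =>
      DifferentiableAt.comp (f := fun s : ℝ => ε C * s) 0 ?_ (by fun_prop)
    rw [mul_zero]; exact hd C hC
  · refine Finset.sum_eq_zero fun C hC => ?_
    rw [mul_zero, h0 C hC]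
  have hboth : ∀ C ∈ J, ∀ᶠ u in 𝓝[≠] (0 : ℝ),
      volume {x | 0 < u ∧ x ∈ wedge a C.1 C.2 u} = ENNReal.ofReal (w C u) ∧
      volume {x | u < 0 ∧ x ∈ wedge a C.1 C.2 u} = ENNReal.ofReal (-w C u) := by
    intro C hC
    rw [← Iio_union_Ioi, nhdsWithin_union, eventually_sup]
    constructor
    · filter_upwards [hdown C hC, self_mem_nhdsWithin] with u ⟨h1, h2⟩ (hu : u < 0)
      simp [hu, hu.not_gt, h2, ENNReal.ofReal_of_nonpos h1]
    · filter_upwards [hup C hC, self_mem_nhdsWithin] with u ⟨h1, h2⟩ (hu : 0 < u)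
      simp [hu, hu.not_gt, h2, ENNReal.ofReal_of_nonpos (neg_nonpos.2 h1)]
  have hev : ∀ᶠ s in 𝓝[≠] (0 : ℝ), ∀ C ∈ J,
      volume {x | 0 < ε C * s ∧ x ∈ wedge a C.1 C.2 (ε C * s)} = ENNReal.ofReal (w C (ε C * s)) ∧
      volume {x | ε C * s < 0 ∧ x ∈ wedge a C.1 C.2 (ε C * s)} = ENNReal.ofReal (-w C (ε C * s)) := by
    rw [Finset.eventually_all]
    exact fun C hC => (tendsto_sign_mul (abs_pieceSign b C.1)).eventually (hboth C hC)
  have hsmall : ∀ᶠ s in 𝓝[≠] (0 : ℝ), |s| < s0 := by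
    have : Tendsto (fun u : ℝ => |u|) (𝓝 0) (𝓝 0) := by
      simpa using (continuous_abs).tendsto (0 : ℝ)
    exact (this.eventually (gt_mem_nhds hg.pos)).filter_mono nhdsWithin_le_nhds
  filter_upwards [hev, hsmall] with s hev hs
  have h := hH.volume_rotate hg hs
  rw [Finset.sum_congr rfl fun C hC => (hev C hC).1, Finset.sum_congr rfl fun C hC => (hev C hC).2] at h
  have hP : volume P ≠ ⊤ := hH.isPolyhedron.isCompact.measure_lt_top.ne
  have hQ : volume (rotate P a b J s) ≠ ⊤ :=
    (hH.isPolyhedron_rotate hg hs).isCompact.measure_lt_top.ne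
  have hfin : ∀ φ : (E3 × ℝ) × Finset (E3 × ℝ) → ℝ, ∑ C ∈ J, ENNReal.ofReal (φ C) ≠ ⊤ := fun φ =>
    ENNReal.sum_ne_top.2 fun C _ => ENNReal.ofReal_ne_top
  have hr := ENNReal.toReal_mono (ENNReal.add_ne_top.2 ⟨hQ, hfin _⟩) h
  rw [ENNReal.toReal_add hP (hfin _), ENNReal.toReal_add hQ (hfin _),
    ENNReal.toReal_sum fun C _ => ENNReal.ofReal_ne_top,
    ENNReal.toReal_sum fun C _ => ENNReal.ofReal_ne_top] at hr
  have hsplit : ∑ C ∈ J, w C (ε C * s) = ∑ C ∈ J, (ENNReal.ofReal (w C (ε C * s))).toReal -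
      ∑ C ∈ J, (ENNReal.ofReal (-w C (ε C * s))).toReal := by
    rw [← Finset.sum_sub_distrib]
    refine Finset.sum_congr rfl fun C _ => ?_
    rw [ENNReal.toReal_ofReal', ENNReal.toReal_ofReal', max_zero_sub_max_neg_zero_eq_self]
  simp only [hsplit]
  linarith

/-- A first-order criterion for the decrease of the quotient `e ^ 3 / v`. -/
theorem eventually_ratio_lt {f w : ℝ → ℝ} {f' w' e v : ℝ} (hf : HasDerivAt f f' 0)
    (hw : HasDerivAt w w' 0) (hf0 : f 0 = 0) (hw0 : w 0 = 0) (he : 0 < e) (hv : 0 < v)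
    (h : 3 * f' * v - e * w' < 0) :
    ∀ᶠ t in 𝓝[>] (0 : ℝ), 0 < v + w t ∧ (e + f t) ^ 3 / (v + w t) < e ^ 3 / v := by
  have hd : HasDerivAt (fun t => (e + f t) ^ 3 / (v + w t))
      ((3 * (e + f 0) ^ 2 * f' * (v + w 0) - (e + f 0) ^ 3 * w') / (v + w 0) ^ 2) 0 := by
    have h1 : HasDerivAt (fun t => (e + f t) ^ 3) (3 * (e + f 0) ^ 2 * f') 0 := by
      have := (hf.const_add e).fun_pow 3
      simpa using this
    exact h1.div (hw.const_add v) (by rw [hw0]; simpa using hv.ne')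
  have hneg : (3 * (e + f 0) ^ 2 * f' * (v + w 0) - (e + f 0) ^ 3 * w') / (v + w 0) ^ 2 < 0 := by
    rw [hf0, hw0, add_zero, add_zero]
    refine div_neg_of_neg_of_pos ?_ (by positivity)
    have : 3 * e ^ 2 * f' * v - e ^ 3 * w' = e ^ 2 * (3 * f' * v - e * w') := by ring
    rw [this]
    exact mul_neg_of_pos_of_neg (by positivity) h
  have hsl := (hasDerivAt_iff_tendsto_slope.1 hd).eventually (gt_mem_nhds hneg)
  have hsl' := hsl.filter_mono (nhdsWithin_mono 0 (fun t (ht : 0 < t) => ht.ne'))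
  have hvt : ∀ᶠ t in 𝓝[>] (0 : ℝ), 0 < v + w t := by
    have := (hw.const_add v).continuousAt.eventually (lt_mem_nhds (show 0 < v + w 0 by simpa [hw0]))
    exact this.filter_mono nhdsWithin_le_nhds
  filter_upwards [hsl', hvt, self_mem_nhdsWithin] with t ht hvt (ht0 : 0 < t)
  refine ⟨hvt, ?_⟩
  rw [slope_def_field, sub_zero, div_neg_iff] at ht
  rcases ht with ht | ht
  · exact absurd ht.2 ht0.not_gt
  · have := ht.1
    rw [hf0, hw0, add_zero, add_zero] at this
    linarith

/-- If one of the planes neighbouring a hinged face touches the face only in a vertex, rotating the face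
in one of the two directions improves the Melzak ratio. -/
theorem HingedFace.canBeImproved (hH : HingedFace P a b J) {C : (E3 × ℝ) × Finset (E3 × ℝ)}
    (hC : C ∈ J) (hj : ∃ j ∈ C.2, (edge a C.1 C.2 j).Subsingleton) : CanBeImproved P := by
  obtain ⟨f, c, d, hf, hf0, hc, hd, hlen, hpos⟩ := hH.exists_edgeLength_bound
  obtain ⟨w, hw, hw0, hvol⟩ := hH.exists_volume_bound
  obtain ⟨s0, hg⟩ := hH.eventually_goodSlope.exists
  have he := (hpos C hC).1
  have hcd := (hpos C hC).2 hj
  have hv := hH.isPolyhedron.volume_pos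
  -- it suffices to find a direction in which the first-order variation is negative
  suffices h : ∃ τ c' : ℝ, |τ| = 1 ∧ (∀ t : ℝ, 0 < t → c' * t = c * max (τ * t) 0 + d * max (-(τ * t)) 0) ∧
      3 * (τ * deriv f 0 - c') * (volume P).toReal - edgeLength P * (τ * deriv w 0) < 0 by
    obtain ⟨τ, c', hτ, hc', hneg⟩ := h
    have hlin : ∀ {φ : ℝ → ℝ}, DifferentiableAt ℝ φ 0 →
        HasDerivAt (fun t => φ (τ * t)) (τ * deriv φ 0) 0 := fun {φ} hφ => by
      have h1 : HasDerivAt (fun t : ℝ => τ * t) τ 0 := by simpa using (hasDerivAt_id (0 : ℝ)).const_mul τ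
      have h2 : HasDerivAt φ (deriv φ 0) (τ * 0) := by rw [mul_zero]; exact hφ.hasDerivAt
      have h3 := h2.comp (0 : ℝ) h1
      rw [mul_comm] at h3
      exact h3
    have hder : HasDerivAt (fun t => f (τ * t) - c' * t) (τ * deriv f 0 - c') 0 := by
      have h1 : HasDerivAt (fun t : ℝ => c' * t) c' 0 := by simpa using (hasDerivAt_id (0 : ℝ)).const_mul c'
      exact (hlin hf).sub h1
    have hratio := eventually_ratio_lt hder (hlin hw) (by simp [hf0]) (by simp [hw0]) he hv hneg
    have hτt : Tendsto (fun t : ℝ => τ * t) (𝓝[>] 0) (𝓝[≠] 0) :=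
      (tendsto_sign_mul hτ).mono_left (nhdsWithin_mono 0 fun t (ht : 0 < t) => ht.ne')
    have hgood : ∀ᶠ t in 𝓝[>] (0 : ℝ), melzakRatio (rotate P a b J (τ * t)) < melzakRatio P := by
      filter_upwards [hratio, hτt.eventually hlen, hτt.eventually hvol, self_mem_nhdsWithin] with t
        ⟨hvt, hrt⟩ hlt hvolt (ht : 0 < t)
      have h1 : edgeLength (rotate P a b J (τ * t)) ≤ edgeLength P + (f (τ * t) - c' * t) := by
        rw [hc' t ht]; linarith
      refine lt_of_le_of_lt ?_ hrt
      have h0 : 0 ≤ edgeLength (rotate P a b J (τ * t)) := ENNReal.toReal_nonneg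
      exact div_le_div₀ (pow_nonneg (h0.trans h1) 3) (pow_le_pow_left₀ h0 h1 3) hvt hvolt
    obtain ⟨ε, hε, hlt⟩ := mem_nhdsGT_iff_exists_Ioc_subset.1 hgood
    have hs0 := hg.pos
    refine ⟨min ε (s0 / 2), fun t => rotate P a b J (τ * t),
      hH.isPerturbation hg (lt_min hε (by positivity)) (min_le_right _ _) hτ, fun t ht => ?_⟩
    exact hlt ⟨ht.1, ht.2.trans (min_le_left _ _)⟩
  -- the two variations add up to `-3 * (c + d) * v < 0`, so at least one of them is negative
  by_cases hplus : 3 * (deriv f 0 - c) * (volume P).toReal - edgeLength P * deriv w 0 < 0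
  · refine ⟨1, c, abs_one, fun t ht => ?_, by rwa [one_mul, one_mul]⟩
    rw [one_mul, max_eq_left ht.le, max_eq_right (by linarith)]; ring
  · refine ⟨-1, d, by simp, fun t ht => ?_, ?_⟩
    · rw [neg_one_mul, neg_neg, max_eq_left ht.le, max_eq_right (by linarith)]; ring
    · have := mul_pos hcd hv
      nlinarith

end

section

variable {P : Set E3} {S : Set (E3 × ℝ)} {z : E3}

/-! ### Facets through a point -/

/-- `S` is a finite family of planes with unit normals, closed under negation, of which `P` is a union
of cells. -/
structure IsArrangement (P : Set E3) (S : Set (E3 × ℝ)) : Prop where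
  finite : S.Finite
  neg : NegClosed S
  unit : ∀ p ∈ S, ‖p.1‖ = 1
  frontier_subset : ∀ x ∈ frontier P, ∃ p ∈ S, aff p x = 0
  det : SignDetermined S P

/-- The points of the boundary plane of `aff p ≤ 0` near which `P` coincides with this half-space. -/
def flat (P : Set E3) (p : E3 × ℝ) : Set E3 :=
  {y | aff p y = 0 ∧ ∀ᶠ v in 𝓝 y, (v ∈ P ↔ aff p v ≤ 0)}

/-- The half-spaces of the arrangement that bound `P` near points arbitrarily close to `z`. -/
def facets (P : Set E3) (S : Set (E3 × ℝ)) (z : E3) : Set (E3 × ℝ) := {p ∈ S | z ∈ closure (flat P p)}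

/-- Near `z` the complement of `P` is the intersection of the open half-spaces of the facets
through `z`. -/
def ConvexAt (P : Set E3) (S : Set (E3 × ℝ)) (z : E3) : Prop :=
  ∀ᶠ v in 𝓝 z, (v ∉ P ↔ ∀ p ∈ facets P S z, 0 < aff p v)

theorem aff_eq_zero_of_mem_facets {p : E3 × ℝ} (hp : p ∈ facets P S z) : aff p z = 0 :=
  closure_minimal (fun _ hy => hy.1) (isClosed_aff_eq p) hp.2

theorem IsArrangement.grad_ne_zero (hS : IsArrangement P S) {p : E3 × ℝ} (hp : p ∈ S) : p.1 ≠ 0 :=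
  norm_ne_zero_iff.1 (by rw [hS.unit p hp]; exact one_ne_zero)

theorem IsArrangement.finite_facets (hS : IsArrangement P S) (z : E3) : (facets P S z).Finite :=
  hS.finite.subset (sep_subset _ _)

theorem IsArrangement.insert_plane (hS : IsArrangement P S) {a : E3 × ℝ} (ha : ‖a.1‖ = 1) :
    IsArrangement P (S ∪ {a, -a}) where
  finite := hS.finite.union (toFinite _)
  neg := by
    rintro p (hp | rfl | rfl)
    · exact Or.inl (hS.neg p hp)
    · exact Or.inr (Or.inr rfl)
    · right; left; exact neg_neg _
  unit := by
    rintro p (hp | rfl | rfl)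
    · exact hS.unit p hp
    · exact ha
    · simpa using ha
  frontier_subset x hx := by
    obtain ⟨p, hp, hpx⟩ := hS.frontier_subset x hx
    exact ⟨p, Or.inl hp, hpx⟩
  det := hS.det.mono subset_union_left

theorem signDetermined_nonpos {p : E3 × ℝ} (hp : p ∈ S) : SignDetermined S {v | aff p v ≤ 0} :=
  fun x y h => by
    have := h p hp
    simp only [mem_ofPred_eq, ← not_lt, this]

theorem eq_of_normal_eq {p q : E3 × ℝ} {y : E3} (h : p.1 = q.1) (hp : aff p y = 0) (hq : aff q y = 0) :
    p = q := by
  refine Prod.ext h ?_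
  simp only [aff] at hp hq
  rw [h] at hp
  linarith

/-- Half-spaces with unit normals are determined by their germ at a boundary point. -/
theorem eq_of_pos_imp {p q : E3 × ℝ} (hp : ‖p.1‖ = 1) (hq : ‖q.1‖ = 1) {y : E3} (hpy : aff p y = 0)
    (hqy : aff q y = 0) (h : ∀ᶠ v in 𝓝 y, 0 < aff p v → 0 < aff q v) : p = q := by
  have hp0 : p.1 ≠ 0 := norm_ne_zero_iff.1 (by rw [hp]; exact one_ne_zero)
  obtain ⟨c, hc, hcq⟩ := exists_eq_smul_of_pos_imp (n := p.1) (m := q.1) hp0 fun w hw => by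
    obtain ⟨t, ht, -, h'⟩ := exists_small_move w h one_pos
    rw [aff_add_smul, aff_add_smul, hpy, hqy, zero_add, zero_add] at h'
    exact pos_of_mul_pos_right (h' (by positivity)) ht.le
  refine eq_of_normal_eq ?_ hpy hqy
  rw [hcq, norm_smul, hp, mul_one, Real.norm_of_nonneg hc.le] at hq
  rw [hcq, hq, one_smul]

theorem flat_subset_facePoints {p : E3 × ℝ} (hp : p.1 ≠ 0) : flat P p ⊆ facePoints P := by
  rintro y ⟨hpy, hy⟩
  refine ⟨?_, p.1, hp, ?_⟩
  · rw [mem_frontier_iff_frequently]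
    constructor
    · exact (show y ∈ P from hy.self_of_nhds.2 hpy.le) |> fun h =>
        mem_closure_iff_frequently.1 (subset_closure h)
    · rw [frequently_iff]
      intro U hU
      obtain ⟨t, ht, -, h1, h2⟩ := exists_small_move p.1
        (Filter.Eventually.and (show ∀ᶠ v in 𝓝 y, v ∈ U from hU) hy) one_pos
      refine ⟨_, h1, fun hP => ?_⟩
      have h3 := h2.1 hP
      rw [aff_add_grad, hpy, zero_add] at h3
      have := norm_pos_iff.2 hp
      exact absurd h3 (not_le.2 (by positivity))
  · filter_upwards [hy] with v hv
    rw [hv, inner_sub_eq_aff, hpy, sub_zero]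

theorem eventually_mem_flat {p : E3 × ℝ} {y : E3} (hy : y ∈ flat P p) :
    ∀ᶠ v in 𝓝 y, aff p v = 0 → v ∈ flat P p := by
  filter_upwards [hy.2.eventually_nhds] with v hv h using ⟨h, hv⟩

/-- Near `z`, a generic point `w` of `P` is separated from any open set outside `P` by a facet
through `z`: the facet where a generic segment leaves `P` for the last time. -/
theorem IsArrangement.exists_separating_facet (hP : IsPolyhedron P) (hS : IsArrangement P S) (z : E3) :
    ∃ r > 0, ∀ w ∈ Metric.ball z r, w ∈ P → (∀ p ∈ S, aff p w ≠ 0) → ∀ V : Set E3, IsOpen V →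
      V.Nonempty → V ⊆ Metric.ball z r → (∀ v ∈ V, v ∉ P) →
      ∃ q ∈ facets P S z, ∃ v ∈ V, aff q w < 0 ∧ 0 < aff q v := by
  have hcl : IsClosed P := hP.isCompact.isClosed
  have hev : ∀ᶠ v in 𝓝 z, ∀ p ∈ S, 0 < aff p z → 0 < aff p v := by
    refine (eventually_all_finite hS.finite).2 fun p _ => ?_
    by_cases h : 0 < aff p z
    · filter_upwards [eventually_aff_pos h] with v hv _ using hv
    · simp [h]
  obtain ⟨r, hr, hball⟩ := Metric.eventually_nhds_iff_ball.1 hev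
  refine ⟨r, hr, fun w hw hwP hwS V hV hVne hVr hVP => ?_⟩
  -- the planes through `w` and the intersection of two planes of `S` are to be avoided
  set Φ : (E3 × ℝ) × (E3 × ℝ) → E3 × ℝ := fun t => aff t.2 w • t.1 - aff t.1 w • t.2 with hΦ
  obtain ⟨v, hvV, hv⟩ := exists_mem_open_forall_aff_ne {p ∈ Φ '' (S ×ˢ S) | p.1 ≠ 0}
    (((hS.finite.prod hS.finite).image Φ).subset (sep_subset _ _)) (fun p hp => hp.2) hV hVne
  have hvr := hVr hvV
  set T := {t : ℝ | t ∈ Icc (0 : ℝ) 1 ∧ w + t • (v - w) ∈ P} with hT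
  have hTc : IsCompact T := isCompact_Icc.inter_right (hcl.preimage (by fun_prop))
  obtain ⟨t, ⟨⟨ht0, ht1⟩, htP⟩, hmax⟩ := hTc.exists_isGreatest ⟨0, ⟨le_rfl, zero_le_one⟩, by simpa using hwP⟩
  set y := w + t • (v - w) with hy
  have hyr : y ∈ Metric.ball z r := Convex.move_mem (convex_ball z r) hw hvr ht0 ht1
  have ht1' : t < 1 := by
    refine lt_of_le_of_ne ht1 fun h => hVP v hvV ?_
    rw [hy, h, one_smul, add_sub_cancel] at htP
    exact htP
  have hafter : ∀ e : ℝ, 0 < e → t + e ≤ 1 → y + e • (v - w) ∉ P := by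
    intro e he hle hmem
    have h1 : y + e • (v - w) = w + (t + e) • (v - w) := by rw [hy]; module
    rw [h1] at hmem
    have := hmax ⟨⟨by linarith, hle⟩, hmem⟩
    linarith
  have hyf : y ∈ frontier P := by
    rw [frontier_eq_closure_inter_closure]
    refine ⟨subset_closure htP, mem_closure_of_moves (w := v - w) (sub_pos.2 ht1') fun e h0 h1 => ?_⟩
    exact hafter e h0 (by linarith)
  have ht0' : 0 < t := by
    refine lt_of_le_of_ne ht0 fun h => ?_
    obtain ⟨p, hp, hpy⟩ := hS.frontier_subset y hyf
    rw [hy, ← h, zero_smul, add_zero] at hpy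
    exact hwS p hp hpy
  obtain ⟨p, hp, hpy⟩ := hS.frontier_subset y hyf
  have hpar : ∀ q ∈ S, aff q y = 0 → ∃ c : ℝ, q.1 = c • p.1 := by
    intro q hq hqy
    by_contra! hc
    have hli : LinearIndependent ℝ ![p.1, q.1] :=
      (LinearIndependent.pair_iff' (hS.grad_ne_zero hp)).2 fun c => (hc c).symm
    have hne : (Φ (p, q)).1 ≠ 0 := by
      intro h0
      have := LinearIndependent.pair_iff.1 hli (aff q w) (-aff p w) (by
        rw [neg_smul, ← sub_eq_add_neg]; exact h0)
      exact hwS q hq this.1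
    refine hv _ ⟨mem_image_of_mem Φ (show (p, q) ∈ S ×ˢ S from ⟨hp, hq⟩), hne⟩ ?_
    have h1 : aff (Φ (p, q)) y = 0 := by simp [hΦ, aff_sub, hpy, hqy]
    have h2 : aff (Φ (p, q)) w = 0 := by simp [hΦ, aff_sub]; ring
    rw [hy, aff_move, h2, mul_zero, zero_add] at h1
    exact (mul_eq_zero.1 h1).resolve_left ht0'.ne'
  obtain ⟨q, hq, hqy, hqP⟩ : ∃ q ∈ S, aff q y = 0 ∧ ∀ᶠ v in 𝓝 y, (v ∈ P ↔ aff q v ≤ 0) := by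
    rcases halfSpace_of_parallel hP hS.finite hS.det hyf (hS.grad_ne_zero hp) hpar with h | h
    · refine ⟨p, hp, hpy, ?_⟩
      filter_upwards [h] with v hv
      rw [hv, inner_sub_eq_aff, hpy, sub_zero]
    · refine ⟨-p, hS.neg p hp, by simpa using hpy, ?_⟩
      filter_upwards [h] with v hv
      rw [hv, inner_neg_left, inner_sub_eq_aff, hpy, sub_zero, aff_neg]
  have hslope : 0 < aff q v - aff q w := by
    obtain ⟨e, he, he1, h⟩ := exists_small_move (v - w) hqP (sub_pos.2 ht1')
    have h1 := mt h.2 (hafter e he (by linarith))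
    rw [aff_add_smul, hqy, zero_add, inner_sub_eq_aff, not_le] at h1
    exact pos_of_mul_pos_right h1 he.le
  have hq0 : (1 - t) * aff q w + t * aff q v = 0 := by rw [← aff_move, ← hy, hqy]
  refine ⟨q, ⟨hq, ?_⟩, v, hvV, by nlinarith, by nlinarith⟩
  -- the picture at `y` recurs along the segment from `z` to `y`
  refine mem_closure_of_moves one_pos (w := y - z) fun s hs0 hs1 => ?_
  have hsame : SameSign S y (z + s • (y - z)) := by
    intro p hp
    have hsr : z + s • (y - z) ∈ Metric.ball z r :=
      Convex.move_mem (convex_ball z r) (Metric.mem_ball_self hr) hyr hs0.le hs1.le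
    rcases lt_trichotomy (aff p z) 0 with h | h | h
    · have h1 := hball _ hyr (-p) (hS.neg p hp) (by simpa using h)
      have h2 := hball _ hsr (-p) (hS.neg p hp) (by simpa using h)
      rw [aff_neg] at h1 h2
      constructor <;> intro h3 <;> linarith
    · rw [aff_move p z y s, h, mul_zero, zero_add, mul_pos_iff_of_pos_left hs0]
    · exact ⟨fun _ => hball _ hsr p hp h, fun _ => hball _ hyr p hp h⟩
  exact ⟨(hsame.eq_zero_iff hS.neg hq).1 hqy,
    hsame.eventually_iff hS.finite hS.neg hS.det (signDetermined_nonpos hq) hqP⟩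

/-- If the complement of `P` is convex near a boundary point, it is the intersection of the half-spaces
of the facets through this point. -/
theorem IsArrangement.convexAt (hP : IsPolyhedron P) (hS : IsArrangement P S) (hz : z ∈ frontier P)
    (hconv : ∃ r > 0, Convex ℝ (Metric.ball z r ∩ Pᶜ)) : ConvexAt P S z := by
  have hcl : IsClosed P := hP.isCompact.isClosed
  obtain ⟨r1, hr1, hsep⟩ := hS.exists_separating_facet hP z
  obtain ⟨r2, hr2, hconv⟩ := hconv
  set V := Metric.ball z (min r1 r2) ∩ Pᶜ with hV
  have hr : 0 < min r1 r2 := lt_min hr1 hr2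
  have hVo : IsOpen V := Metric.isOpen_ball.inter hcl.isOpen_compl
  have hVc : Convex ℝ V := by
    have : V = Metric.ball z r1 ∩ (Metric.ball z r2 ∩ Pᶜ) := by
      rw [hV, ← inter_assoc]
      congr 1
      ext x; simp
    rw [this]
    exact (convex_ball z r1).inter hconv
  have hVne : V.Nonempty := by
    rw [frontier_eq_closure_inter_closure] at hz
    exact mem_closure_iff.1 hz.2 _ Metric.isOpen_ball (Metric.mem_ball_self hr)
  filter_upwards [Metric.ball_mem_nhds z hr] with v hvr
  constructor
  · intro hvP p hp
    by_contra! hpv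
    obtain ⟨v2, hpv2, hv2⟩ := exists_aff_neg_near (hS.grad_ne_zero hp.1) hpv (hVo.mem_nhds ⟨hvr, hvP⟩)
    obtain ⟨y, hyr, hpy, hyP⟩ := mem_closure_iff.1 hp.2 _ Metric.isOpen_ball (Metric.mem_ball_self hr)
    -- join `v2` to points just outside the facet
    obtain ⟨t, ht0, ht1, htP⟩ := exists_small_move (v2 - y) hyP.eventually_nhds one_pos
    have hneg : aff p (y + t • (v2 - y)) < 0 := by
      rw [aff_move, hpy]; nlinarith
    have hev := ((htP.and (eventually_aff_neg hneg)))
    have hev2 : ∀ᶠ u in 𝓝 y, u ∈ Metric.ball z (min r1 r2) ∧ (u ∈ P ↔ aff p u ≤ 0) :=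
      Filter.Eventually.and (Metric.isOpen_ball.mem_nhds hyr) hyP
    have h1 := (eventually_move (w := (1 - t) • p.1) hev).filter_mono
      (nhdsWithin_le_nhds (s := Ioi 0))
    have h2 := (eventually_move (w := p.1) hev2).filter_mono (nhdsWithin_le_nhds (s := Ioi 0))
    obtain ⟨τ, ⟨⟨h3, h4⟩, h5, h6⟩, hτ⟩ := ((h1.and h2).and self_mem_nhdsWithin).exists
    have hτ0 : (0 : ℝ) < τ := hτ
    have hyV : y + τ • p.1 ∈ V := by
      refine ⟨h5, fun h => ?_⟩
      have h7 := h6.1 h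
      rw [aff_add_grad, hpy, hS.unit p hp.1] at h7
      linarith
    have hm := Convex.move_mem hVc hyV hv2 ht0.le ht1.le
    have heq : y + τ • p.1 + t • (v2 - (y + τ • p.1)) = y + t • (v2 - y) + τ • (1 - t) • p.1 := by
      module
    rw [heq] at hm
    exact hm.2 (h3.2 h4.le)
  · intro hall hvP
    have hO : IsOpen (Metric.ball z (min r1 r2) ∩ ⋂ p ∈ facets P S z, {x | 0 < aff p x}) :=
      Metric.isOpen_ball.inter ((hS.finite_facets z).isOpen_biInter fun p _ => isOpen_aff_pos p)
    have hvc : v ∈ closure (interior P) := by rw [hP.closure_interior]; exact hvP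
    obtain ⟨x, hxO, hxP⟩ := mem_closure_iff.1 hvc _ hO ⟨hvr, mem_iInter₂.2 hall⟩
    obtain ⟨w, ⟨hwO, hwP⟩, hwS⟩ := exists_mem_open_forall_aff_ne S hS.finite
      (fun p hp => hS.grad_ne_zero hp) (hO.inter isOpen_interior) ⟨x, hxO, hxP⟩
    obtain ⟨q, hq, -, -, hqw, -⟩ := hsep w
      (Metric.ball_subset_ball (min_le_left _ _) hwO.1) (interior_subset hwP) hwS V hVo hVne
      (inter_subset_left.trans (Metric.ball_subset_ball (min_le_left _ _))) fun v hv => hv.2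
    exact hqw.not_gt (mem_iInter₂.1 hwO.2 q hq)

/-- The facets near a point of local convexity of the complement. -/
theorem ConvexAt.eventually_flat (hS : IsArrangement P S) (h : ConvexAt P S z) {p : E3 × ℝ}
    (hp : p ∈ facets P S z) : ∀ᶠ y in 𝓝 z,
      (y ∈ flat P p ↔ aff p y = 0 ∧ ∀ q ∈ facets P S z, q ≠ p → 0 < aff q y) := by
  filter_upwards [Filter.Eventually.eventually_nhds h] with y hy
  constructor
  · rintro ⟨hpy, hyP⟩
    refine ⟨hpy, fun q hq hqp => ?_⟩
    have himp : ∀ᶠ v in 𝓝 y, 0 < aff p v → 0 < aff q v := by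
      filter_upwards [hy, hyP] with v h1 h2 h3
      exact h1.1 (fun h4 => h3.not_ge (h2.1 h4)) q hq
    have hge : 0 ≤ aff q y := by
      by_contra! hlt
      obtain ⟨t, ht, -, h1, h2⟩ := exists_small_move p.1 (himp.and (eventually_aff_neg hlt)) one_pos
      refine h2.not_gt (h1 ?_)
      rw [aff_add_grad, hpy, hS.unit p hp.1]; linarith
    refine lt_of_le_of_ne hge fun h0 => hqp ?_
    exact (eq_of_pos_imp (hS.unit p hp.1) (hS.unit q hq.1) hpy h0.symm himp).symm
  · rintro ⟨hpy, hq⟩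
    refine ⟨hpy, ?_⟩
    have hev : ∀ᶠ v in 𝓝 y, ∀ q ∈ facets P S z, q ≠ p → 0 < aff q v := by
      refine (eventually_all_finite (hS.finite_facets z)).2 fun q hq' => ?_
      by_cases hqp : q = p
      · simp [hqp]
      · filter_upwards [eventually_aff_pos (hq q hq' hqp)] with v hv _ using hv
    filter_upwards [hy, hev] with v h1 h2
    rw [← not_iff_not, h1, not_le]
    refine ⟨fun h3 => h3 p hp, fun h3 q hq => ?_⟩
    by_cases hqp : q = p
    · rwa [hqp]
    · exact h2 q hq hqp

end

section

variable {P F : Set E3} {S : Set (E3 × ℝ)} {a b : E3 × ℝ} {x y z : E3}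

/-! ### The plane of a face -/

/-- `P` looks the same near `x` and near `y`, up to translation. -/
def GermEq (P : Set E3) (x y : E3) : Prop := ∀ᶠ w in 𝓝 (0 : E3), (x + w ∈ P ↔ y + w ∈ P)

/-- The complement of `P` is convex near `z`. -/
def ComplConvexAt (P : Set E3) (z : E3) : Prop := ∃ r > 0, Convex ℝ (Metric.ball z r ∩ Pᶜ)

theorem GermEq.symm (h : GermEq P x y) : GermEq P y x := h.mono fun _ h => h.symm

theorem GermEq.trans (h : GermEq P x y) (h' : GermEq P y z) : GermEq P x z := by
  filter_upwards [h, h'] with w h1 h2 using h1.trans h2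

theorem GermEq.mem_flat (h : GermEq P x y) (hx : x ∈ flat P a) (hy : aff a y = 0) : y ∈ flat P a := by
  refine ⟨hy, eventually_nhds_iff_add.2 ?_⟩
  filter_upwards [h, eventually_nhds_iff_add.1 hx.2] with w h1 h2
  rw [← h1, h2, aff_add_vec, aff_add_vec, hx.1, hy]

theorem GermEq.complConvexAt (h : GermEq P x y) (hx : ComplConvexAt P x) : ComplConvexAt P y := by
  obtain ⟨r, hr, hc⟩ := hx
  obtain ⟨e, he, hw⟩ := Metric.eventually_nhds_iff_ball.1 h
  refine ⟨min r e, lt_min hr he, ?_⟩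
  have heq : Metric.ball y (min r e) ∩ Pᶜ = (fun v => (x - y) + v) ⁻¹'
      (Metric.ball x (min r e) ∩ (Metric.ball x r ∩ Pᶜ)) := by
    ext v
    have h1 : x - y + v ∈ Metric.ball x (min r e) ↔ v ∈ Metric.ball y (min r e) := by
      rw [Metric.mem_ball, Metric.mem_ball, dist_eq_norm, dist_eq_norm]
      congr! 2; abel
    rw [mem_preimage, mem_inter_iff, mem_inter_iff, mem_inter_iff, h1]
    refine and_congr_right fun h2 => ?_
    have h3 : v - y ∈ Metric.ball (0 : E3) e := by
      have := lt_of_lt_of_le (Metric.mem_ball.1 h2) (min_le_right r e)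
      rwa [mem_ball_zero_iff, ← dist_eq_norm]
    have h4 := hw _ h3
    rw [add_sub_cancel, show x + (v - y) = x - y + v by abel] at h4
    rw [mem_compl_iff, mem_compl_iff, h4]
    exact ⟨fun h => ⟨Metric.ball_subset_ball (min_le_left _ _) (h1.2 h2), h⟩, fun h => h.2⟩
  rw [heq]
  exact ((convex_ball x _).inter hc).translate_preimage_right _

theorem GermEq.locallyInvariant (h : GermEq P x y) {u : E3} (hx : LocallyInvariant P x u) :
    LocallyInvariant P y u := by
  obtain ⟨r, hr, hinv⟩ := hx
  obtain ⟨e, he, hw⟩ := Metric.eventually_nhds_iff_ball.1 h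
  have key : ∀ v ∈ Metric.ball y (min r e), x + (v - y) ∈ Metric.ball x r ∧
      (x + (v - y) ∈ P ↔ v ∈ P) := by
    intro v hv
    rw [Metric.mem_ball, dist_eq_norm] at hv
    refine ⟨?_, ?_⟩
    · rw [Metric.mem_ball, dist_eq_norm, add_sub_cancel_left]
      exact hv.trans_le (min_le_left _ _)
    · have := hw (v - y) (by rw [mem_ball_zero_iff]; exact hv.trans_le (min_le_right _ _))
      rwa [add_sub_cancel] at this
  refine ⟨min r e, lt_min hr he, fun v hv s hvs => ?_⟩
  have h1 := key v hv
  have h2 := key _ hvs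
  rw [show x + (v + s • u - y) = x + (v - y) + s • u by abel] at h2
  rw [← h1.2, ← h2.2]
  exact hinv _ h1.1 s h2.1

theorem LocallyInvariant.neg {u : E3} (h : LocallyInvariant P x u) : LocallyInvariant P x (-u) := by
  obtain ⟨r, hr, hinv⟩ := h
  refine ⟨r, hr, fun v hv s hvs => ?_⟩
  have h1 : v + s • -u = v + (-s) • u := by module
  rw [h1] at hvs ⊢
  exact hinv v hv (-s) hvs

/-- `P` is invariant under translation along `u` within the ball of radius `r` about `z`. -/
def InvariantOn (P : Set E3) (z u : E3) (r : ℝ) : Prop :=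
  ∀ y ∈ Metric.ball z r, ∀ s : ℝ, y + s • u ∈ Metric.ball z r → (y ∈ P ↔ y + s • u ∈ P)

theorem InvariantOn.germEq {u : E3} {r : ℝ} (h : InvariantOn P z u r) (hx : x ∈ Metric.ball z r) {s : ℝ}
    (hs : x + s • u ∈ Metric.ball z r) : GermEq P x (x + s • u) := by
  have h1 := eventually_nhds_iff_add.1 (Metric.isOpen_ball.eventually_mem hx)
  have h2 := eventually_nhds_iff_add.1 (Metric.isOpen_ball.eventually_mem hs)
  filter_upwards [h1, h2] with w h1 h2
  rw [add_right_comm] at h2 ⊢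
  exact h _ h1 s h2

theorem InvariantOn.locallyInvariant {u : E3} {r : ℝ} (h : InvariantOn P z u r)
    (hx : x ∈ Metric.ball z r) : LocallyInvariant P x u := by
  obtain ⟨e, he, hsub⟩ := Metric.isOpen_iff.1 Metric.isOpen_ball x hx
  exact ⟨e, he, fun y hy s hs => h y (hsub hy) s (hsub hs)⟩

theorem aff_eq_zero_of_mem_frontier (hx : x ∈ frontier P) (h : ∀ᶠ v in 𝓝 x, (v ∈ P ↔ aff a v ≤ 0)) :
    aff a x = 0 := by
  rw [mem_frontier_iff_frequently] at hx
  refine le_antisymm (not_lt.1 fun h0 => ?_) (not_lt.1 fun h0 => ?_)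
  · refine hx.1 ?_
    filter_upwards [h, eventually_aff_pos h0] with v h1 h2
    rw [h1]; exact h2.not_ge
  · refine hx.2 ?_
    filter_upwards [h, eventually_aff_neg h0] with v h1 h2
    rw [not_not, h1]; exact h2.le

theorem exists_mem_flat_of_mem_facePoints (hx : x ∈ facePoints P) : ∃ p : E3 × ℝ, ‖p.1‖ = 1 ∧ x ∈ flat P p := by
  obtain ⟨-, n, hn, h⟩ := hx
  have hn' := norm_pos_iff.2 hn
  refine ⟨(‖n‖⁻¹ • n, ⟪‖n‖⁻¹ • n, x⟫), ?_, by simp [aff], ?_⟩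
  · rw [norm_smul, norm_inv, norm_norm, inv_mul_cancel₀ hn'.ne']
  · filter_upwards [h] with v hv
    rw [hv, aff, ← inner_sub_right, real_inner_smul_left]
    constructor
    · intro h; exact mul_nonpos_of_nonneg_of_nonpos (by positivity) h
    · intro h; exact nonpos_of_mul_nonpos_right h (by positivity)

theorem eq_of_mem_flat {p q : E3 × ℝ} (hp : ‖p.1‖ = 1) (hq : ‖q.1‖ = 1) (hxp : x ∈ flat P p)
    (hxq : x ∈ flat P q) : p = q := by
  refine eq_of_pos_imp hp hq hxp.1 hxq.1 ?_
  filter_upwards [hxp.2, hxq.2] with v h1 h2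
  rw [← not_le, ← not_le, ← h1, ← h2]
  exact id

/-- A face is contained in a plane, and `P` is locally on one side of it. -/
theorem IsOpenFace.exists_plane (hF : IsOpenFace P F) : ∃ a : E3 × ℝ, ‖a.1‖ = 1 ∧ F ⊆ flat P a := by
  obtain ⟨x, hx, rfl⟩ := hF
  obtain ⟨a, ha, hxa⟩ := exists_mem_flat_of_mem_facePoints hx
  refine ⟨a, ha, fun y hy => ?_⟩
  by_contra hya
  have hsub := connectedComponentIn_subset (facePoints P) x
  obtain ⟨w, hw, hw1, q, hq, hqa, hw2⟩ := isPreconnected_connectedComponentIn (F := facePoints P) (x := x)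
    {v | ∀ᶠ v' in 𝓝 v, (v' ∈ P ↔ aff a v' ≤ 0)}
    {v | ∃ q : E3 × ℝ, ‖q.1‖ = 1 ∧ q ≠ a ∧ ∀ᶠ v' in 𝓝 v, (v' ∈ P ↔ aff q v' ≤ 0)}
    (isOpen_iff_eventually.2 fun v hv => hv.eventually_nhds)
    (isOpen_iff_eventually.2 fun v ⟨q, h1, h2, hv⟩ => hv.eventually_nhds.mono fun _ h => ⟨q, h1, h2, h⟩)
    (fun v hv => by
      obtain ⟨q, hq, hvq⟩ := exists_mem_flat_of_mem_facePoints (hsub hv)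
      by_cases h : q = a
      · left; rw [← h]; exact hvq.2
      · right; exact ⟨q, hq, h, hvq.2⟩)
    ⟨x, mem_connectedComponentIn hx, hxa.2⟩
    ⟨y, hy, by
      obtain ⟨q, hq, hyq⟩ := exists_mem_flat_of_mem_facePoints (hsub hy)
      exact ⟨q, hq, fun h => hya (h ▸ hyq), hyq.2⟩⟩
  have hwf := (hsub hw).1
  exact hqa (eq_of_mem_flat hq ha ⟨aff_eq_zero_of_mem_frontier hwf hw2, hw2⟩
    ⟨aff_eq_zero_of_mem_frontier hwf hw1, hw1⟩)

/-- The face `F` of `P` lies in the plane `aff a = 0`, which belongs to the arrangement `S`. -/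
structure FacePlane (P F : Set E3) (S : Set (E3 × ℝ)) (a : E3 × ℝ) : Prop where
  isPolyhedron : IsPolyhedron P
  face : IsOpenFace P F
  arrangement : IsArrangement P S
  mem : a ∈ S
  subset_flat : F ⊆ flat P a

theorem exists_facePlane (hP : IsPolyhedron P) (hF : IsOpenFace P F) :
    ∃ (S : Set (E3 × ℝ)) (a : E3 × ℝ), FacePlane P F S a := by
  obtain ⟨S, h1, h2, h3, h4, h5⟩ := hP.exists_arrangement
  obtain ⟨a, ha, hFa⟩ := hF.exists_plane
  exact ⟨S ∪ {a, -a}, a, hP, hF, (IsArrangement.mk h1 h2 h3 h4 h5).insert_plane ha,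
    Or.inr (Or.inl rfl), hFa⟩

namespace FacePlane

theorem norm_eq (h : FacePlane P F S a) : ‖a.1‖ = 1 := h.arrangement.unit a h.mem

theorem grad_ne_zero (h : FacePlane P F S a) : a.1 ≠ 0 := h.arrangement.grad_ne_zero h.mem

theorem subset_facePoints (h : FacePlane P F S a) : F ⊆ facePoints P :=
  h.subset_flat.trans (flat_subset_facePoints h.grad_ne_zero)

theorem closure_subset_frontier (h : FacePlane P F S a) : closure F ⊆ frontier P :=
  closure_minimal (fun _ hx => (h.subset_facePoints hx).1) isClosed_frontier

theorem aff_eq_zero (h : FacePlane P F S a) (hx : x ∈ closure F) : aff a x = 0 :=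
  closure_minimal (fun _ hy => (h.subset_flat hy).1) (isClosed_aff_eq a) hx

theorem mem_facets (h : FacePlane P F S a) (hx : x ∈ closure F) : a ∈ facets P S x :=
  ⟨h.mem, closure_mono h.subset_flat hx⟩

theorem isBounded (h : FacePlane P F S a) : Bornology.IsBounded (closure F) :=
  h.isPolyhedron.isCompact.isBounded.subset
    (h.closure_subset_frontier.trans h.isPolyhedron.isCompact.isClosed.frontier_subset)

/-- The face absorbs the connected subsets of its plane near which `P` is the half-space. -/
theorem subset_of_isPreconnected (h : FacePlane P F S a) {V : Set E3} (hV : IsPreconnected V)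
    (hVs : V ⊆ flat P a) (hne : (V ∩ F).Nonempty) : V ⊆ F := by
  obtain ⟨y, hyV, hyF⟩ := hne
  obtain ⟨x, hx, rfl⟩ := h.face
  rw [connectedComponentIn_eq hyF]
  exact hV.subset_connectedComponentIn hyV (hVs.trans (flat_subset_facePoints h.grad_ne_zero))

theorem exists_ball_subset_flat (h : x ∈ flat P a) :
    ∃ r > 0, Metric.ball x r ∩ {v | aff a v = 0} ⊆ flat P a := by
  obtain ⟨r, hr, hb⟩ := Metric.eventually_nhds_iff_ball.1 (eventually_mem_flat h)
  exact ⟨r, hr, fun v hv => hb v hv.1 hv.2⟩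

theorem mem_of_mem_flat (h : FacePlane P F S a) (hx : x ∈ closure F) (hxa : x ∈ flat P a) : x ∈ F := by
  obtain ⟨r, hr, hb⟩ := exists_ball_subset_flat hxa
  obtain ⟨y, hyr, hyF⟩ := mem_closure_iff.1 hx _ Metric.isOpen_ball (Metric.mem_ball_self hr)
  exact h.subset_of_isPreconnected ((convex_ball x r).inter (convex_aff_eq_zero a)).isPreconnected hb
    ⟨y, ⟨hyr, (h.subset_flat hyF).1⟩, hyF⟩ ⟨Metric.mem_ball_self hr, hxa.1⟩

theorem eventually_mem (h : FacePlane P F S a) (hx : x ∈ F) : ∀ᶠ v in 𝓝 x, aff a v = 0 → v ∈ F := by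
  obtain ⟨r, hr, hb⟩ := exists_ball_subset_flat (h.subset_flat hx)
  filter_upwards [Metric.ball_mem_nhds x hr] with v hv hav
  exact h.subset_of_isPreconnected ((convex_ball x r).inter (convex_aff_eq_zero a)).isPreconnected hb
    ⟨x, ⟨Metric.mem_ball_self hr, (h.subset_flat hx).1⟩, hx⟩ ⟨hv, hav⟩

theorem mem_of_mem_facePoints (h : FacePlane P F S a) (hx : x ∈ closure F) (hxf : x ∈ facePoints P) :
    x ∈ F := by
  obtain ⟨q, hq, hxq⟩ := exists_mem_flat_of_mem_facePoints hxf
  obtain ⟨y, hyF, hyq⟩ := ((mem_closure_iff_frequently.1 hx).and_eventually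
    hxq.2.eventually_nhds).exists
  have hyf := (h.subset_facePoints hyF).1
  have := eq_of_mem_flat hq h.norm_eq ⟨aff_eq_zero_of_mem_frontier hyf hyq, hyq⟩ (h.subset_flat hyF)
  exact h.mem_of_mem_flat hx (this ▸ hxq)

/-- Directions of local invariance at a point of a face are parallel to the face. -/
theorem inner_eq_zero (h : FacePlane P F S a) (hx : x ∈ closure F) {u : E3}
    (hu : LocallyInvariant P x u) : ⟪a.1, u⟫ = 0 := by
  obtain ⟨r, hr, hinv⟩ := hu
  obtain ⟨y, hyr, hyF⟩ := mem_closure_iff.1 hx _ Metric.isOpen_ball (Metric.mem_ball_self hr)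
  have hya := h.subset_flat hyF
  have hyP : y ∈ P := hya.2.self_of_nhds.2 hya.1.le
  have key : ∀ w : E3, (w = u ∨ w = -u) → ⟪a.1, w⟫ ≤ 0 := by
    intro w hw
    obtain ⟨t, ht, -, h1, h2⟩ := exists_small_move w
      (hya.2.and (Metric.isOpen_ball.eventually_mem hyr)) one_pos
    have h3 : y + t • w ∈ P := by
      rcases hw with rfl | rfl
      · exact (hinv y hyr t h2).1 hyP
      · have : y + t • -u = y + (-t) • u := by module
        rw [this] at h2 ⊢
        exact (hinv y hyr (-t) h2).1 hyP
    have h4 := h1.1 h3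
    rw [aff_add_smul, hya.1, zero_add] at h4
    exact nonpos_of_mul_nonpos_right h4 ht
  have h1 := key u (Or.inl rfl)
  have h2 := key (-u) (Or.inr rfl)
  rw [inner_neg_right] at h2
  linarith

/-- Local translation invariance of `P` carries the face along. -/
theorem move_mem_closure (h : FacePlane P F S a) {u : E3} {r : ℝ} (hinv : InvariantOn P z u r)
    (hu : ⟪a.1, u⟫ = 0) (hx : x ∈ closure F) (hxr : x ∈ Metric.ball z r) {s : ℝ}
    (hs : x + s • u ∈ Metric.ball z r) : x + s • u ∈ closure F := by
  have hcont : Continuous fun v : E3 => v + s • u := by fun_prop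
  rw [mem_closure_iff_frequently] at hx ⊢
  refine (hcont.tendsto x).frequently ?_
  refine (hx.and_eventually ((Metric.isOpen_ball.eventually_mem hxr).and
    (hcont.continuousAt.eventually (Metric.isOpen_ball.eventually_mem hs)))).mono ?_
  rintro v ⟨hv, hvr, hvs⟩
  have hseg : segment ℝ v (v + s • u) ⊆ flat P a := by
    intro w hw
    have hwr := (convex_ball z r).segment_subset hvr hvs hw
    rw [segment_eq_image'] at hw
    obtain ⟨t, -, rfl⟩ := hw
    have heq : v + t • (v + s • u - v) = v + (t * s) • u := by module
    beta_reduce at hwr ⊢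
    rw [heq] at hwr ⊢
    refine (hinv.germEq hvr hwr).mem_flat (h.subset_flat hv) ?_
    rw [aff_add_smul, (h.subset_flat hv).1, hu]; simp
  exact h.subset_of_isPreconnected (convex_segment _ _).isPreconnected hseg
    ⟨v, left_mem_segment ℝ _ _, hv⟩ (right_mem_segment ℝ _ _)

end FacePlane

end

section

variable {P F : Set E3} {S : Set (E3 × ℝ)} {a b : E3 × ℝ} {x y z : E3}

/-! ### Convexity of the complement along a face -/

theorem NegativelyExposed.complConvexAt (h : NegativelyExposed P z) : ComplConvexAt P z := by
  obtain ⟨U, hU, hzU, hc⟩ := h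
  obtain ⟨r, hr, hb⟩ := Metric.isOpen_iff.1 hU z hzU
  refine ⟨r, hr, ?_⟩
  rw [← inter_eq_left.2 hb, inter_assoc]
  exact (convex_ball z r).inter hc

theorem complConvexAt_of_mem_flat (h : z ∈ flat P a) : ComplConvexAt P z := by
  obtain ⟨r, hr, hb⟩ := Metric.eventually_nhds_iff_ball.1 h.2
  refine ⟨r, hr, ?_⟩
  have : Metric.ball z r ∩ Pᶜ = Metric.ball z r ∩ {v | 0 < aff a v} := by
    ext v
    refine and_congr_right fun hv => ?_
    rw [mem_compl_iff, hb v hv, not_le]; rfl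
  rw [this]
  exact (convex_ball z r).inter (convex_aff_pos a)

theorem ComplConvexAt.eventually (h : ComplConvexAt P z) : ∀ᶠ x in 𝓝 z, ComplConvexAt P x := by
  obtain ⟨r, hr, hc⟩ := h
  filter_upwards [Metric.ball_mem_nhds z hr] with x hx
  obtain ⟨e, he, hb⟩ := Metric.isOpen_iff.1 Metric.isOpen_ball x hx
  refine ⟨e, he, ?_⟩
  rw [← inter_eq_left.2 hb, inter_assoc]
  exact (convex_ball x e).inter hc

namespace FacePlane

/-- A point of a face near which `P` is invariant in two independent directions is a relative interior
point of the face. -/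
theorem mem_of_locallyInvariant (h : FacePlane P F S a) (hx : x ∈ closure F) {u v : E3}
    (hu : LocallyInvariant P x u) (hv : LocallyInvariant P x v) (huv : LinearIndependent ℝ ![u, v]) :
    x ∈ F := by
  have hau := h.inner_eq_zero hx hu
  have hav := h.inner_eq_zero hx hv
  have hli : LinearIndependent ℝ ![a.1, u, v] := linearIndependent_cons_orthogonal huv h.grad_ne_zero
    (by rw [real_inner_comm]; exact hau) (by rw [real_inner_comm]; exact hav)
  set B := basisOfLinearIndependentOfCardEqFinrank hli (by simp) with hB
  have hB0 : B 0 = a.1 := by simp [hB]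
  have hB1 : B 1 = u := by simp [hB]
  have hB2 : B 2 = v := by simp [hB]
  obtain ⟨r, hr, hu⟩ := hu
  obtain ⟨r', hr', hv⟩ := hv
  -- a point `y` of the face near `x` is reached by two short translations
  have h1 : ∀ᶠ y in 𝓝 x, x + B.coord 1 (y - x) • u ∈ Metric.ball x r ∩ Metric.ball x r' ∧
      y ∈ Metric.ball x r' := by
    refine Filter.Eventually.and ?_ (Metric.ball_mem_nhds x hr')
    have hcont : Continuous fun y : E3 => x + B.coord 1 (y - x) • u := by
      have : Continuous (B.coord 1) := LinearMap.continuous_of_finiteDimensional _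
      fun_prop
    refine hcont.continuousAt.eventually_mem ?_
    simp only [sub_self, map_zero, zero_smul, add_zero]
    exact inter_mem (Metric.ball_mem_nhds x hr) (Metric.ball_mem_nhds x hr')
  obtain ⟨y, hyF, ⟨hy1, hy2⟩, hy3⟩ := ((mem_closure_iff_frequently.1 hx).and_eventually h1).exists
  have hsum := B.sum_repr (y - x)
  rw [Fin.sum_univ_three, hB0, hB1, hB2] at hsum
  have h0 : B.repr (y - x) 0 = 0 := by
    have := congrArg (fun w => ⟪a.1, w⟫) hsum
    simp only [inner_add_right, inner_smul_right, hau, hav, mul_zero, add_zero,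
      real_inner_self_eq_norm_sq, h.norm_eq, inner_sub_eq_aff, (h.subset_flat hyF).1,
      h.aff_eq_zero hx] at this
    simpa using this
  have hy : y = x + B.coord 1 (y - x) • u + B.repr (y - x) 2 • v := by
    rw [h0, zero_smul, zero_add] at hsum
    rw [Module.Basis.coord_apply, add_assoc, hsum, add_sub_cancel]
  have h2 : GermEq P x (x + B.coord 1 (y - x) • u) :=
    InvariantOn.germEq hu (Metric.mem_ball_self hr) hy1
  have h3 : GermEq P (x + B.coord 1 (y - x) • u) y := by
    have := InvariantOn.germEq hv hy2 (s := B.repr (y - x) 2) (by rw [← hy]; exact hy3)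
    rwa [← hy] at this
  exact h.mem_of_mem_flat hx ((h2.trans h3).symm.mem_flat (h.subset_flat hyF) (h.aff_eq_zero hx))

/-- If the complement of `P` is convex near the vertices of the face off the line `aff b = 0`, then it
is so near every point of the face off this line: the germ of `P` at a point of an edge is carried
along the edge, away from the line, to an endpoint of the edge. -/
theorem complConvexAt (h : FacePlane P F S a)
    (hneg : ∀ H ∈ faceVertices P F, aff b H ≠ 0 → NegativelyExposed P H) (hz : z ∈ closure F)
    (hbz : aff b z ≠ 0) : ComplConvexAt P z := by
  have hcases : ∀ x ∈ closure F, aff b x ≠ 0 → ¬ ComplConvexAt P x →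
      ∃ u ≠ 0, LocallyInvariant P x u := by
    intro x hx hbx hnc
    by_contra! hu
    exact hnc (hneg x ⟨⟨h.closure_subset_frontier hx, hu⟩, hx⟩ hbx).complConvexAt
  by_contra hnc
  obtain ⟨u, hu0, hu, hbu⟩ : ∃ u ≠ 0, LocallyInvariant P z u ∧ 0 ≤ aff b z * ⟪b.1, u⟫ := by
    obtain ⟨u, hu0, hu⟩ := hcases z hz hbz hnc
    rcases le_total 0 (aff b z * ⟪b.1, u⟫) with h' | h'
    · exact ⟨u, hu0, hu, h'⟩
    · exact ⟨-u, neg_ne_zero.2 hu0, hu.neg, by rw [inner_neg_right]; linarith⟩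
  set T : Set ℝ := {t | 0 ≤ t ∧ ∀ t' ∈ Icc 0 t, GermEq P z (z + t' • u) ∧ z + t' • u ∈ closure F}
    with hT
  have hT0 : (0 : ℝ) ∈ T := by
    refine ⟨le_rfl, fun t' ht' => ?_⟩
    obtain rfl : t' = 0 := le_antisymm ht'.2 ht'.1
    rw [zero_smul, add_zero]
    exact ⟨Eventually.of_forall fun _ => Iff.rfl, hz⟩
  have hTb : BddAbove T := by
    obtain ⟨R, hR⟩ := h.isBounded.subset_closedBall z
    refine ⟨R / ‖u‖, fun t ht => ?_⟩
    have := hR (ht.2 t ⟨ht.1, le_rfl⟩).2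
    rw [Metric.mem_closedBall, dist_eq_norm, add_sub_cancel_left, norm_smul,
      Real.norm_of_nonneg ht.1] at this
    rwa [le_div_iff₀ (norm_pos_iff.2 hu0)]
  set t1 := sSup T with ht1
  have ht10 : 0 ≤ t1 := le_csSup hTb hT0
  have hfreq : ∃ᶠ t in 𝓝 t1, t ∈ T := mem_closure_iff_frequently.1 (csSup_mem_closure ⟨0, hT0⟩ hTb)
  have hcont : Continuous fun t : ℝ => z + t • u := by fun_prop
  have hnear : ∀ {φ : E3 → Prop}, (∀ᶠ x in 𝓝 (z + t1 • u), φ x) → ∃ t ∈ T, φ (z + t • u) := by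
    intro φ hφ
    exact (hfreq.and_eventually (hcont.continuousAt.eventually hφ)).exists
  have hz1 : z + t1 • u ∈ closure F := by
    rw [← isClosed_closure.closure_eq, mem_closure_iff_nhds]
    intro V hV
    obtain ⟨t, ht, htV⟩ := hnear (φ := fun x => x ∈ V) hV
    exact ⟨_, htV, (ht.2 t ⟨ht.1, le_rfl⟩).2⟩
  have hbz1 : aff b (z + t1 • u) ≠ 0 := by
    intro h0
    rw [aff_add_smul] at h0
    have h2 : aff b z * (aff b z + t1 * ⟪b.1, u⟫) = 0 := by rw [h0, mul_zero]
    have h3 : 0 < aff b z * aff b z := mul_self_pos.2 hbz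
    nlinarith [mul_nonneg ht10 hbu]
  have hnc1 : ¬ ComplConvexAt P (z + t1 • u) := by
    intro hc
    obtain ⟨t, ht, htc⟩ := hnear hc.eventually
    exact hnc ((ht.2 t ⟨ht.1, le_rfl⟩).1.symm.complConvexAt htc)
  obtain ⟨v, hv0, r, hr, hv⟩ := hcases _ hz1 hbz1 hnc1
  by_cases hli : LinearIndependent ℝ ![u, v]
  · obtain ⟨t, ht, htr⟩ := hnear (φ := fun x => x ∈ Metric.ball (z + t1 • u) r)
      (Metric.ball_mem_nhds _ hr)
    obtain ⟨hg, hcl⟩ := ht.2 t ⟨ht.1, le_rfl⟩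
    have hF := h.mem_of_locallyInvariant hcl (hg.locallyInvariant hu)
      (InvariantOn.locallyInvariant hv htr) hli
    exact hnc (hg.symm.complConvexAt (complConvexAt_of_mem_flat (h.subset_flat hF)))
  · rw [LinearIndependent.pair_iff' hu0] at hli
    push Not at hli
    obtain ⟨c, hc⟩ := hli
    have hc0 : c ≠ 0 := by rintro rfl; exact hv0 (by rw [← hc, zero_smul])
    have hinv : InvariantOn P (z + t1 • u) u r := by
      intro y hy s hs
      have : s • u = (s / c) • v := by rw [← hc, smul_smul, div_mul_cancel₀ _ hc0]
      rw [this] at hs ⊢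
      exact hv y hy _ hs
    obtain ⟨δ, hδ, -, hδr⟩ := exists_small_move u (φ := fun x => x ∈ Metric.ball (z + t1 • u) r)
      (Metric.ball_mem_nhds (z + t1 • u) hr) one_pos
    obtain ⟨t, ht, htr⟩ := hnear (φ := fun x => x ∈ Metric.ball (z + t1 • u) r)
      (Metric.ball_mem_nhds _ hr)
    obtain ⟨hg, hcl⟩ := ht.2 t ⟨ht.1, le_rfl⟩
    have htt : t ≤ t1 := le_csSup hTb ht
    have hmem : t1 + δ ∈ T := by
      refine ⟨by linarith, fun t' ht' => ?_⟩
      rcases le_or_gt t' t with hle | hlt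
      · exact ht.2 t' ⟨ht'.1, hle⟩
      have hr' : z + t' • u ∈ Metric.ball (z + t1 • u) r := by
        have h0 : 0 < t1 + δ - t := by linarith
        have := Convex.move_mem (convex_ball (z + t1 • u) r) htr hδr
          (t := (t' - t) / (t1 + δ - t)) (div_nonneg (by linarith) h0.le)
          ((div_le_one h0).2 (by linarith [ht'.2]))
        have heq : z + t1 • u + δ • u - (z + t • u) = (t1 + δ - t) • u := by module
        rw [heq, smul_smul, div_mul_cancel₀ _ h0.ne'] at this
        convert this using 1
        module
      have heq : z + t' • u = z + t • u + (t' - t) • u := by module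
      rw [heq] at hr' ⊢
      exact ⟨hg.trans (hinv.germEq htr hr'), h.move_mem_closure hinv (h.inner_eq_zero hz hu) hcl htr hr'⟩
    have := le_csSup hTb hmem
    rw [← ht1] at this
    linarith

end FacePlane

end

section

variable {P F : Set E3} {S : Set (E3 × ℝ)} {a b : E3 × ℝ} {x y z : E3}

/-! ### The pieces of a face on one side of a line -/

/-- On the side `aff b > 0` of a line in the plane of the face `F`, the complement of `P` is convex near
every point of the face. -/
structure ConvexSide (P F : Set E3) (S : Set (E3 × ℝ)) (a b : E3 × ℝ) : Prop
    extends FacePlane P F S a where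
  convexAt : ∀ z ∈ closure F, 0 < aff b z → ConvexAt P S z

/-- The connected component of `x` in the part of `F` on the side `aff b > 0`. -/
def piece (F : Set E3) (b : E3 × ℝ) (x : E3) : Set E3 :=
  connectedComponentIn (F ∩ {v | 0 < aff b v}) x

theorem piece_subset : piece F b x ⊆ F ∩ {v | 0 < aff b v} := connectedComponentIn_subset _ _

theorem mem_piece (hx : x ∈ F) (hbx : 0 < aff b x) : x ∈ piece F b x :=
  mem_connectedComponentIn ⟨hx, hbx⟩

theorem piece_eq (hy : y ∈ piece F b x) : piece F b x = piece F b y := connectedComponentIn_eq hy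

theorem closure_piece_subset : closure (piece F b x) ⊆ closure F :=
  closure_mono (piece_subset.trans inter_subset_left)

theorem subset_piece {V : Set E3} (hV : IsPreconnected V) (hVs : V ⊆ F ∩ {v | 0 < aff b v})
    (hne : (V ∩ piece F b x).Nonempty) : V ⊆ piece F b x := by
  obtain ⟨y, hyV, hyF⟩ := hne
  rw [piece_eq hyF]
  exact hV.subset_connectedComponentIn hyV hVs

/-- The part of the plane `aff a = 0` where the planes of `T` other than `a` are positive. -/
def openCell (a : E3 × ℝ) (T : Set (E3 × ℝ)) : Set E3 :=
  {v | aff a v = 0 ∧ ∀ p ∈ T, p ≠ a → 0 < aff p v}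

theorem convex_openCell (a : E3 × ℝ) (T : Set (E3 × ℝ)) : Convex ℝ (openCell a T) := by
  have : openCell a T = {v | aff a v = 0} ∩ ⋂ p ∈ {p ∈ T | p ≠ a}, {v | 0 < aff p v} := by
    ext v; simp [openCell]
  rw [this]
  exact (convex_aff_eq_zero a).inter (convex_iInter₂ fun p _ => convex_aff_pos p)

/-- Orthogonal projection to the plane `aff a = 0`, for a unit normal `a.1`. -/
noncomputable def planeProj (a : E3 × ℝ) (v : E3) : E3 := v - aff a v • a.1

theorem continuous_planeProj (a : E3 × ℝ) : Continuous (planeProj a) := by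
  unfold planeProj
  have := continuous_aff a
  fun_prop

theorem aff_planeProj (ha : ‖a.1‖ = 1) (v : E3) : aff a (planeProj a v) = 0 := by
  rw [planeProj, sub_eq_add_neg, ← neg_smul, aff_add_grad, ha]; ring

theorem planeProj_eq (hx : aff a x = 0) : planeProj a x = x := by
  rw [planeProj, hx, zero_smul, sub_zero]

theorem FacePlane.exists_ball_inter_eq (h : FacePlane P F S a) (hz : z ∈ closure F)
    (hc : ConvexAt P S z) : ∃ r > 0, ∀ v ∈ Metric.ball z r, (v ∈ F ↔ v ∈ openCell a (facets P S z)) := by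
  obtain ⟨r, hr, hb⟩ := Metric.eventually_nhds_iff_ball.1
    (hc.eventually_flat h.arrangement (h.mem_facets hz))
  refine ⟨r, hr, fun v hv => ⟨fun hvF => (hb v hv).1 (h.subset_flat hvF), fun hvc => ?_⟩⟩
  obtain ⟨y, hyr, hyF⟩ := mem_closure_iff.1 hz _ Metric.isOpen_ball (Metric.mem_ball_self hr)
  exact h.subset_of_isPreconnected
    ((convex_ball z r).inter (convex_openCell a (facets P S z))).isPreconnected
    (fun w hw => (hb w hw.1).2 hw.2) ⟨y, ⟨hyr, (hb y hyr).1 (h.subset_flat hyF)⟩, hyF⟩ ⟨hv, hvc⟩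

theorem FacePlane.eventually_mem_closure (h : FacePlane P F S a) (hz : z ∈ closure F)
    (hc : ConvexAt P S z) : ∀ᶠ v in 𝓝 z, v ∈ closure F → ∀ p ∈ facets P S z, 0 ≤ aff p v := by
  obtain ⟨r, hr, hb⟩ := h.exists_ball_inter_eq hz hc
  filter_upwards [Metric.ball_mem_nhds z hr] with v hv hvF p hp
  by_cases hpa : p = a
  · rw [hpa, h.aff_eq_zero hvF]
  have hsub : Metric.ball z r ∩ F ⊆ {v | 0 ≤ aff p v} :=
    fun w hw => (((hb w hw.1).1 hw.2).2 p hp hpa).le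
  exact closure_minimal hsub (isClosed_aff_nonneg p)
    (Metric.isOpen_ball.inter_closure ⟨hv, hvF⟩)

namespace ConvexSide

/-- A segment in the closed face, off the line, whose endpoints lie in the open face, lies in the open
face: it cannot touch a facet from inside. -/
theorem segment_subset (h : ConvexSide P F S a b) (hx : x ∈ F) (hy : y ∈ F) (hbx : 0 < aff b x)
    (hby : 0 < aff b y) (hcl : ∀ s ∈ Icc (0 : ℝ) 1, x + s • (y - x) ∈ closure F) :
    ∀ s ∈ Icc (0 : ℝ) 1, x + s • (y - x) ∈ F := by
  have hcont : Continuous fun s : ℝ => x + s • (y - x) := by fun_prop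
  have haz : ∀ s : ℝ, aff a (x + s • (y - x)) = 0 := by
    intro s
    rw [aff_move, (h.subset_flat hx).1, (h.subset_flat hy).1]; ring
  have key : Icc (0 : ℝ) 1 ⊆ {s | x + s • (y - x) ∈ F} := by
    refine IsClosed.Icc_subset_of_forall_mem_nhdsWithin ?_ (by simpa using hx) ?_
    · refine isClosed_of_closure_subset fun s hs => ?_
      have hs01 : s ∈ Icc (0 : ℝ) 1 := closure_minimal inter_subset_right isClosed_Icc hs
      refine ⟨?_, hs01⟩
      rcases hs01.1.eq_or_lt with rfl | hs0
      · simpa using hx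
      rcases hs01.2.eq_or_lt with rfl | hs1
      · simpa using hy
      have hzF := hcl s hs01
      have hbz : 0 < aff b (x + s • (y - x)) := by
        rw [aff_move]; nlinarith
      have hc := h.convexAt _ hzF hbz
      obtain ⟨r, hr, hb⟩ := h.exists_ball_inter_eq hzF hc
      by_contra hnF
      obtain ⟨p, hp, hpa⟩ : ∃ p ∈ facets P S (x + s • (y - x)), p ≠ a := by
        by_contra! hne
        exact hnF ((hb _ (Metric.mem_ball_self hr)).2 ⟨haz s, fun p hp hpa => absurd (hne p hp) hpa⟩)
      have hp0 := aff_eq_zero_of_mem_facets hp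
      obtain ⟨e, he, hball⟩ := Metric.eventually_nhds_iff_ball.1
        ((hcont.continuousAt (x := s)).eventually ((h.eventually_mem_closure hzF hc).and
          (Metric.ball_mem_nhds _ hr)))
      obtain ⟨s', hs'e, hs'F, hs'01⟩ := mem_closure_iff.1 hs (Metric.ball s (min e (min s (1 - s))))
        Metric.isOpen_ball (Metric.mem_ball_self (by
          have : 0 < 1 - s := sub_pos.2 hs1
          positivity))
      rw [Metric.mem_ball, Real.dist_eq] at hs'e
      have h1 : |s' - s| < e := hs'e.trans_le (min_le_left _ _)
      have h2 : |s' - s| < s := hs'e.trans_le ((min_le_right _ _).trans (min_le_left _ _))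
      have h3 : |s' - s| < 1 - s := hs'e.trans_le ((min_le_right _ _).trans (min_le_right _ _))
      have hpos : 0 < aff p (x + s' • (y - x)) :=
        ((hb _ (hball s' (by rw [Metric.mem_ball, Real.dist_eq]; exact h1)).2).1 hs'F).2 p hp hpa
      -- the reflected parameter
      have hrefl : 0 ≤ aff p (x + (2 * s - s') • (y - x)) := by
        refine (hball (2 * s - s') ?_).1 (hcl _ ?_) p hp
        · rw [Metric.mem_ball, Real.dist_eq, show 2 * s - s' - s = -(s' - s) by ring, abs_neg]
          exact h1
        · rw [abs_lt] at h2 h3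
          constructor <;> linarith
      rw [aff_move] at hp0 hpos hrefl
      nlinarith
    · rintro s ⟨hs, hs01⟩
      have hs' : x + s • (y - x) ∈ F := hs
      have := (hcont.continuousAt (x := s)).eventually (h.eventually_mem hs')
      refine mem_nhdsWithin_of_mem_nhds ?_
      filter_upwards [this] with t ht using ht (haz t)
  exact key

/-- The points of a piece are visible from each other. -/
theorem segment_subset_of_mem_piece (h : ConvexSide P F S a b) (hx : x ∈ F) (hbx : 0 < aff b x)
    (hy : y ∈ piece F b x) : ∀ s ∈ Icc (0 : ℝ) 1, x + s • (y - x) ∈ F := by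
  set U : Set E3 := {y | ∀ s ∈ Icc (0 : ℝ) 1, x + s • (planeProj a y - x) ∈ F} with hU
  have hax := (h.subset_flat hx).1
  have hUo : IsOpen U := by
    rw [isOpen_iff_eventually]
    intro y hy
    refine isCompact_Icc.eventually_forall_of_forall_eventually fun s hs => ?_
    have hcont : Continuous fun w : E3 × ℝ => x + w.2 • (planeProj a w.1 - x) := by
      have := continuous_planeProj a
      fun_prop
    have := (hcont.continuousAt (x := (y, s))).eventually (h.eventually_mem (hy s hs))
    filter_upwards [this] with w hw
    refine hw ?_
    rw [aff_move, hax, aff_planeProj h.norm_eq]; ring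
  have hsub : piece F b x ⊆ U := by
    refine isPreconnected_connectedComponentIn.subset_of_closure_inter_subset hUo
      ⟨x, mem_piece hx hbx, fun s _ => by rw [planeProj_eq hax]; simpa using hx⟩ ?_
    rintro y ⟨hyU, hyC⟩
    have hyF := piece_subset hyC
    have hay := (h.subset_flat hyF.1).1
    have hcl : ∀ s ∈ Icc (0 : ℝ) 1, x + s • (planeProj a y - x) ∈ closure F := by
      intro s hs
      have hcont : Continuous fun w : E3 => x + s • (planeProj a w - x) := by
        have := continuous_planeProj a
        fun_prop
      exact hcont.closure_preimage_subset F (closure_mono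
        (show U ⊆ (fun w : E3 => x + s • (planeProj a w - x)) ⁻¹' F from fun w hw => hw s hs) hyU)
    intro s hs
    rw [planeProj_eq hay] at hcl ⊢
    exact h.segment_subset hx hyF.1 hbx hyF.2 hcl s hs
  intro s hs
  have := hsub hy s hs
  rwa [planeProj_eq (h.subset_flat (piece_subset hy).1).1] at this

theorem convex_piece (h : ConvexSide P F S a b) (x : E3) : Convex ℝ (piece F b x) := by
  rw [convex_iff_segment_subset]
  intro y hy y' hy'
  have hyF := piece_subset hy
  have hseg : segment ℝ y y' ⊆ F ∩ {v | 0 < aff b v} := by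
    intro w hw
    refine ⟨?_, (convex_aff_pos b).segment_subset hyF.2 (piece_subset hy').2 hw⟩
    rw [segment_eq_image'] at hw
    obtain ⟨s, hs, rfl⟩ := hw
    exact h.segment_subset_of_mem_piece hyF.1 hyF.2 (by rwa [← piece_eq hy]) s hs
  exact subset_piece (convex_segment y y').isPreconnected hseg ⟨y, left_mem_segment ℝ y y', hy⟩

/-- Near each point of its closure off the line, a piece coincides with the face. -/
theorem exists_ball_piece (h : ConvexSide P F S a b) (hz : z ∈ closure F) (hbz : 0 < aff b z) :
    ∃ r > 0, (∀ v ∈ Metric.ball z r, (v ∈ F ↔ v ∈ openCell a (facets P S z)) ∧ 0 < aff b v) ∧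
      ∀ x, (Metric.ball z r ∩ piece F b x).Nonempty → Metric.ball z r ∩ F ⊆ piece F b x := by
  obtain ⟨r1, hr1, hb1⟩ := h.exists_ball_inter_eq hz (h.convexAt z hz hbz)
  obtain ⟨r2, hr2, hb2⟩ := Metric.eventually_nhds_iff_ball.1 (eventually_aff_pos hbz)
  have hboth : ∀ v ∈ Metric.ball z (min r1 r2),
      (v ∈ F ↔ v ∈ openCell a (facets P S z)) ∧ 0 < aff b v := fun v hv =>
    ⟨hb1 v (Metric.ball_subset_ball (min_le_left _ _) hv),
      hb2 v (Metric.ball_subset_ball (min_le_right _ _) hv)⟩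
  refine ⟨min r1 r2, lt_min hr1 hr2, hboth, fun x hne => ?_⟩
  have heq : Metric.ball z (min r1 r2) ∩ F = Metric.ball z (min r1 r2) ∩ openCell a (facets P S z) := by
    ext v
    exact and_congr_right fun hv => (hboth v hv).1
  refine subset_piece ?_ (fun v hv => ⟨hv.2, (hboth v hv.1).2⟩) ?_
  · rw [heq]
    exact ((convex_ball _ _).inter (convex_openCell _ _)).isPreconnected
  · obtain ⟨v, hv, hvp⟩ := hne
    exact ⟨v, ⟨hv, (piece_subset hvp).1⟩, hvp⟩

theorem exists_mem_closure_piece (h : ConvexSide P F S a b) (hz : z ∈ closure F) (hbz : 0 < aff b z) :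
    ∃ x ∈ F, 0 < aff b x ∧ z ∈ closure (piece F b x) := by
  obtain ⟨r, hr, hb, hsub⟩ := h.exists_ball_piece hz hbz
  obtain ⟨x, hxr, hxF⟩ := mem_closure_iff.1 hz _ Metric.isOpen_ball (Metric.mem_ball_self hr)
  refine ⟨x, hxF, (hb x hxr).2, closure_mono (hsub x ⟨x, hxr, mem_piece hxF (hb x hxr).2⟩) ?_⟩
  exact Metric.isOpen_ball.inter_closure ⟨Metric.mem_ball_self hr, hz⟩

theorem eventually_mem_piece (h : ConvexSide P F S a b) (hz : z ∈ closure (piece F b x))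
    (hbz : 0 < aff b z) :
    ∀ᶠ v in 𝓝 z, (v ∈ piece F b x ↔ v ∈ openCell a (facets P S z)) := by
  obtain ⟨r, hr, hb, hsub⟩ := h.exists_ball_piece (closure_piece_subset hz) hbz
  have hne := mem_closure_iff.1 hz _ Metric.isOpen_ball (Metric.mem_ball_self hr)
  filter_upwards [Metric.ball_mem_nhds z hr] with v hv
  rw [← (hb v hv).1]
  exact ⟨fun hvp => (piece_subset hvp).1, fun hvF => hsub x hne ⟨hv, hvF⟩⟩

theorem piece_eq_of_mem_closure (h : ConvexSide P F S a b) {x' : E3} (hz : z ∈ closure (piece F b x))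
    (hz' : z ∈ closure (piece F b x')) (hbz : 0 < aff b z) : piece F b x = piece F b x' := by
  obtain ⟨r, hr, hb, hsub⟩ := h.exists_ball_piece (closure_piece_subset hz) hbz
  obtain ⟨y, hyr, hy⟩ := mem_closure_iff.1 hz _ Metric.isOpen_ball (Metric.mem_ball_self hr)
  have hy' := hsub x' (mem_closure_iff.1 hz' _ Metric.isOpen_ball (Metric.mem_ball_self hr))
    ⟨hyr, (piece_subset hy).1⟩
  rw [piece_eq hy, piece_eq hy']

end ConvexSide

end

section

variable {P F : Set E3} {S : Set (E3 × ℝ)} {a b : E3 × ℝ} {x y z : E3} {p : E3 × ℝ}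

/-! ### The half-spaces bounding a piece -/

/-- The half-spaces other than that of the face which bound `P` near some point of the closure of `C`
off the line `aff b = 0`. -/
def sides (P : Set E3) (S : Set (E3 × ℝ)) (a b : E3 × ℝ) (C : Set E3) : Set (E3 × ℝ) :=
  {p | p ∈ S ∧ p ≠ a ∧ ∃ z ∈ closure C, 0 < aff b z ∧ p ∈ facets P S z}

namespace ConvexSide

theorem finite_sides (h : ConvexSide P F S a b) (C : Set E3) : (sides P S a b C).Finite :=
  h.arrangement.finite.subset fun _ hp => hp.1

theorem pos_of_mem_sides (h : ConvexSide P F S a b) (hp : p ∈ sides P S a b (piece F b x))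
    (hy : y ∈ piece F b x) : 0 < aff p y := by
  obtain ⟨-, hpa, z, hz, hbz, hpz⟩ := hp
  have hp0 := aff_eq_zero_of_mem_facets hpz
  have hcl := closure_piece_subset hz
  have hge : ∀ w ∈ piece F b x, 0 ≤ aff p w := by
    intro w hw
    obtain ⟨t, ht, ht1, hev⟩ := exists_small_move (w - z)
      (h.eventually_mem_closure hcl (h.convexAt z hcl hbz)) one_pos
    have hm := Convex.move_mem (h.convex_piece x).closure hz (subset_closure hw) ht.le ht1.le
    have h1 := hev (closure_piece_subset hm) p hpz
    rw [aff_move, hp0, mul_zero, zero_add] at h1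
    exact nonneg_of_mul_nonneg_right h1 ht
  refine lt_of_le_of_ne (hge y hy) fun h0 => ?_
  -- otherwise `aff p` would change sign at `y`
  obtain ⟨w, hw, hev⟩ := ((mem_closure_iff_frequently.1 hz).and_eventually
    (h.eventually_mem_piece hz hbz)).exists
  have hpw : 0 < aff p w := (hev.1 hw).2 p hpz hpa
  have hyF := piece_subset hy
  have hev := h.eventually_mem_piece (subset_closure hy) hyF.2
  obtain ⟨t, ht, -, hty⟩ := exists_small_move (y - w) hev one_pos
  have h3 : aff a (y + t • (y - w)) = 0 := by
    rw [aff_add_smul, inner_sub_eq_aff, (h.subset_flat hyF.1).1,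
      (h.subset_flat (piece_subset hw).1).1]; ring
  have h4 : y + t • (y - w) ∈ piece F b x :=
    hty.2 ⟨h3, fun q hq hqa => absurd (aff_eq_zero_of_mem_facets hq)
      ((hev.self_of_nhds.1 hy).2 q hq hqa).ne'⟩
  have h5 := hge _ h4
  rw [aff_add_smul, inner_sub_eq_aff, ← h0] at h5
  nlinarith

/-- A half-space bounding a piece near one of its points off the line does so near all its points off
the line that lie in the boundary plane. -/
theorem mem_facets_of_mem_sides (h : ConvexSide P F S a b) (hp : p ∈ sides P S a b (piece F b x))
    (hz : z ∈ closure (piece F b x)) (hbz : 0 < aff b z) (hpz : aff p z = 0) : p ∈ facets P S z := by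
  obtain ⟨hpS, hpa, z0, hz0, hbz0, hpz0⟩ := hp
  have hp0 := aff_eq_zero_of_mem_facets hpz0
  have hcont : Continuous fun s : ℝ => z0 + s • (z - z0) := by fun_prop
  have hmem : ∀ s ∈ Icc (0 : ℝ) 1, z0 + s • (z - z0) ∈ closure (piece F b x) := fun s hs =>
    Convex.move_mem (h.convex_piece x).closure hz0 hz hs.1 hs.2
  have hzero : ∀ s : ℝ, aff p (z0 + s • (z - z0)) = 0 := fun s => by
    rw [aff_move, hp0, hpz]; ring
  have key : Icc (0 : ℝ) 1 ⊆ {s | z0 + s • (z - z0) ∈ closure (flat P p)} := by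
    refine IsClosed.Icc_subset_of_forall_mem_nhdsWithin
      ((isClosed_closure.preimage hcont).inter isClosed_Icc) (by simpa using hpz0.2) ?_
    rintro s ⟨hs, hs0, hs1⟩
    have hsc := hmem s ⟨hs0, hs1.le⟩
    have hbs : 0 < aff b (z0 + s • (z - z0)) := by rw [aff_move]; nlinarith
    have hps : p ∈ facets P S (z0 + s • (z - z0)) := ⟨hpS, hs⟩
    have hsF := closure_piece_subset hsc
    have hc := h.convexAt _ hsF hbs
    obtain ⟨r, hr, hb⟩ := Metric.eventually_nhds_iff_ball.1
      ((hc.eventually_flat h.arrangement hps).and (h.eventually_mem_closure hsF hc))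
    obtain ⟨w0, hw0r, hw0⟩ := mem_closure_iff.1 hs _ Metric.isOpen_ball (Metric.mem_ball_self hr)
    have hw0' := (hb w0 hw0r).1.1 hw0
    have h1 : ∀ᶠ s' in 𝓝[>] s, s' ∈ Ioo s 1 := Ioo_mem_nhdsGT hs1
    have h2 : ∀ᶠ s' in 𝓝[>] s, z0 + s' • (z - z0) ∈ Metric.ball (z0 + s • (z - z0)) r :=
      ((hcont.continuousAt (x := s)).eventually_mem (Metric.ball_mem_nhds _ hr)).filter_mono
        nhdsWithin_le_nhds
    filter_upwards [h1, h2] with s' hs' hs'r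
    refine mem_closure_of_moves (w := w0 - (z0 + s' • (z - z0))) one_pos fun t ht ht1 => ?_
    refine (hb _ (Convex.move_mem (convex_ball _ r) hs'r hw0r ht.le ht1.le)).1.2 ⟨?_, fun q hq hqp => ?_⟩
    · rw [aff_move, hzero, hw0'.1]; ring
    · have h3 := (hb _ hs'r).2 (closure_piece_subset (hmem s' ⟨hs0.trans hs'.1.le, hs'.2.le⟩)) q hq
      have h4 := hw0'.2 q hq hqp
      rw [aff_move]
      nlinarith
  have := key (right_mem_Icc.2 zero_le_one)
  simp only [mem_ofPred_eq, one_smul, add_sub_cancel] at this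
  exact ⟨hpS, this⟩

variable {I : Finset (E3 × ℝ)}

/-- A piece is the open polygon cut out by its sides. -/
theorem mem_piece_iff (h : ConvexSide P F S a b) (hI : (I : Set (E3 × ℝ)) = sides P S a b (piece F b x))
    (hx : x ∈ F) (hbx : 0 < aff b x) :
    z ∈ piece F b x ↔ aff a z = 0 ∧ 0 < aff b z ∧ z ∈ Ko I := by
  have hIm : ∀ p, p ∈ I ↔ p ∈ sides P S a b (piece F b x) := fun p => by rw [← hI]; rfl
  constructor
  · intro hz
    have hzF := piece_subset hz
    exact ⟨(h.subset_flat hzF.1).1, hzF.2, fun p hp => h.pos_of_mem_sides ((hIm p).1 hp) hz⟩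
  · rintro ⟨haz, hbz, hzI⟩
    have hxC := mem_piece hx hbx
    have hxK : x ∈ Ko I := fun p hp => h.pos_of_mem_sides ((hIm p).1 hp) hxC
    have hax := (h.subset_flat hx).1
    -- a point of the closure where the sides are positive belongs to the piece
    have hstep : ∀ v ∈ closure (piece F b x), 0 < aff b v → v ∈ Ko I →
        ∀ᶠ w in 𝓝 v, aff a w = 0 → w ∈ piece F b x := by
      intro v hv hbv hvI
      have hno : ∀ p ∈ facets P S v, p = a := by
        intro p hp
        by_contra hpa
        exact (hvI p ((hIm p).2 ⟨hp.1, hpa, v, hv, hbv, hp⟩)).ne' (aff_eq_zero_of_mem_facets hp)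
      filter_upwards [h.eventually_mem_piece hv hbv] with w hw haw
      exact hw.2 ⟨haw, fun p hp hpa => absurd (hno p hp) hpa⟩
    have hcont : Continuous fun s : ℝ => x + s • (z - x) := by fun_prop
    have hline : ∀ s ∈ Icc (0 : ℝ) 1, aff a (x + s • (z - x)) = 0 ∧ 0 < aff b (x + s • (z - x)) ∧
        x + s • (z - x) ∈ Ko I := by
      intro s hs
      refine ⟨?_, ?_, Convex.move_mem (convex_Ko I) hxK hzI hs.1 hs.2⟩
      · rw [aff_move, hax, haz]; ring
      · exact Convex.move_mem (convex_aff_pos b) hbx hbz hs.1 hs.2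
    have key : Icc (0 : ℝ) 1 ⊆ {s | x + s • (z - x) ∈ closure (piece F b x)} := by
      refine IsClosed.Icc_subset_of_forall_mem_nhdsWithin
        ((isClosed_closure.preimage hcont).inter isClosed_Icc)
        (by simpa using subset_closure hxC) ?_
      rintro s ⟨hs, hs0, hs1⟩
      obtain ⟨h1, h2, h3⟩ := hline s ⟨hs0, hs1.le⟩
      have h4 := ((hcont.continuousAt (x := s)).eventually (hstep _ hs h2 h3)).filter_mono
        (nhdsWithin_le_nhds (s := Ioi s))
      filter_upwards [h4, Ioo_mem_nhdsGT hs1] with s' hs' hs'1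
      exact subset_closure (hs' (hline s' ⟨hs0.trans hs'1.1.le, hs'1.2.le⟩).1)
    have h1 := key (right_mem_Icc.2 zero_le_one)
    simp only [mem_ofPred_eq, one_smul, add_sub_cancel] at h1
    exact (hstep z h1 hbz hzI).self_of_nhds haz

theorem closure_piece (h : ConvexSide P F S a b) (hI : (I : Set (E3 × ℝ)) = sides P S a b (piece F b x))
    (hx : x ∈ F) (hbx : 0 < aff b x) : closure (piece F b x) = base a b I := by
  have hxm := (h.mem_piece_iff hI hx hbx).1 (mem_piece hx hbx)
  apply Subset.antisymm
  · refine closure_minimal (fun z hz => ?_) (isClosed_base a b I)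
    obtain ⟨h1, h2, h3⟩ := (h.mem_piece_iff hI hx hbx).1 hz
    exact ⟨h1, h2.le, Ko_subset_Kc I h3⟩
  · rintro y ⟨hay, hby, hyI⟩
    refine mem_closure_of_moves (w := x - y) one_pos fun t ht ht1 => ?_
    refine (h.mem_piece_iff hI hx hbx).2 ⟨?_, ?_, fun p hp => ?_⟩
    · rw [aff_move, hay, hxm.1]; ring
    · rw [aff_move]; nlinarith
    · rw [aff_move]; nlinarith [hyI p hp, hxm.2.2 p hp]

theorem mem_facets_iff (h : ConvexSide P F S a b)
    (hI : (I : Set (E3 × ℝ)) = sides P S a b (piece F b x))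
    (hz : z ∈ closure (piece F b x)) (hbz : 0 < aff b z) :
    p ∈ facets P S z ↔ p = a ∨ p ∈ I ∧ aff p z = 0 := by
  have hIm : ∀ p, p ∈ I ↔ p ∈ sides P S a b (piece F b x) := fun p => by rw [← hI]; rfl
  constructor
  · intro hp
    by_cases hpa : p = a
    · exact Or.inl hpa
    · exact Or.inr ⟨(hIm p).2 ⟨hp.1, hpa, z, hz, hbz, hp⟩, aff_eq_zero_of_mem_facets hp⟩
  · rintro (rfl | ⟨hp, hpz⟩)
    · exact h.mem_facets (closure_piece_subset hz)
    · exact h.mem_facets_of_mem_sides ((hIm p).1 hp) hz hbz hpz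

/-- Near the closure of a piece, off the line, the complement of `P` is cut out by the face and the
sides of the piece. -/
theorem eventually_notMem_iff (h : ConvexSide P F S a b)
    (hI : (I : Set (E3 × ℝ)) = sides P S a b (piece F b x)) (hx : x ∈ F) (hbx : 0 < aff b x)
    (hz : z ∈ base a b I) (hbz : 0 < aff b z) : ∀ᶠ v in 𝓝 z, (v ∉ P ↔ 0 < aff a v ∧ v ∈ Ko I) := by
  have hzc : z ∈ closure (piece F b x) := by rw [h.closure_piece hI hx hbx]; exact hz
  have hpos : ∀ᶠ v in 𝓝 z, ∀ p ∈ I, 0 < aff p z → 0 < aff p v := by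
    rw [Finset.eventually_all]
    intro p _
    by_cases h0 : 0 < aff p z
    · filter_upwards [eventually_aff_pos h0] with v hv _ using hv
    · simp [h0]
  filter_upwards [h.convexAt z (closure_piece_subset hzc) hbz, hpos] with v hv hpos
  rw [hv]
  constructor
  · intro hall
    refine ⟨hall a ((h.mem_facets_iff hI hzc hbz).2 (Or.inl rfl)), fun p hp => ?_⟩
    rcases (hz.2.2 p hp).eq_or_lt with h0 | h0
    · exact hall p ((h.mem_facets_iff hI hzc hbz).2 (Or.inr ⟨hp, h0.symm⟩))
    · exact hpos p hp h0
  · rintro ⟨hav, hvI⟩ p hp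
    rcases (h.mem_facets_iff hI hzc hbz).1 hp with rfl | ⟨hp, -⟩
    · exact hav
    · exact hvI p hp

theorem convexPiece (h : ConvexSide P F S a b) (hab : ⟪a.1, b.1⟫ = 0)
    (hI : (I : Set (E3 × ℝ)) = sides P S a b (piece F b x)) (hx : x ∈ F) (hbx : 0 < aff b x) :
    ConvexPiece a b I where
  norm_a := h.norm_eq
  orth := hab
  bdd := by
    rw [← h.closure_piece hI hx hbx]
    exact h.isBounded.subset closure_piece_subset
  interior_point := ⟨x, (h.mem_piece_iff hI hx hbx).1 (mem_piece hx hbx)⟩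
  touch p hp := by
    have hp' : p ∈ sides P S a b (piece F b x) := by rw [← hI]; exact hp
    obtain ⟨-, -, z, hz, hbz, hpz⟩ := hp'
    rw [h.closure_piece hI hx hbx] at hz
    exact ⟨z, ⟨hz, aff_eq_zero_of_mem_facets hpz⟩, hbz⟩
  facet p hp := by
    have hp' : p ∈ sides P S a b (piece F b x) := by rw [← hI]; exact hp
    obtain ⟨-, hpa, z, hz, hbz, hpz⟩ := hp'
    have hzb : z ∈ base a b I := by rw [← h.closure_piece hI hx hbx]; exact hz
    have hzF := closure_piece_subset hz
    have hpos : ∀ᶠ v in 𝓝 z, ∀ q ∈ I, 0 < aff q z → 0 < aff q v := by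
      rw [Finset.eventually_all]
      intro q _
      by_cases h0 : 0 < aff q z
      · filter_upwards [eventually_aff_pos h0] with v hv _ using hv
      · simp [h0]
    obtain ⟨w, hw, hwf, hwpos⟩ := ((mem_closure_iff_frequently.1 hpz.2).and_eventually
      (((h.convexAt z hzF hbz).eventually_flat h.arrangement hpz).and hpos)).exists
    obtain ⟨hpw, hqw⟩ := hwf.1 hw
    refine ⟨w, hpw, hqw a (h.mem_facets hzF) (Ne.symm hpa), fun q hq hqp => ?_⟩
    rcases (hzb.2.2 q hq).eq_or_lt with h0 | h0
    · exact hqw q ((h.mem_facets_iff hI hz hbz).2 (Or.inr ⟨hq, h0.symm⟩)) hqp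
    · exact hwpos q hq h0

end ConvexSide

end

section

variable {P F : Set E3} {S : Set (E3 × ℝ)} {a b : E3 × ℝ} {x y z : E3} {I : Finset (E3 × ℝ)}

/-! ### The face as a hinged face -/

/-- At a point of the open face on the line, a half-disc on either side of the line lies in one piece,
and the sides of this piece do not pass through the point. -/
theorem ConvexSide.exists_piece_of_hinge (h : ConvexSide P F S a b) (hab : ⟪a.1, b.1⟫ = 0)
    (hb : b.1 ≠ 0) (hy : y ∈ F) (hby : aff b y = 0) :
    ∃ x ∈ F, 0 < aff b x ∧ ∀ p ∈ sides P S a b (piece F b x), 0 < aff p y := by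
  obtain ⟨r, hr, hball⟩ := Metric.eventually_nhds_iff_ball.1 (h.eventually_mem hy)
  have hay := (h.subset_flat hy).1
  set D : Set E3 := Metric.ball y r ∩ ({v | aff a v = 0} ∩ {v | 0 < aff b v}) with hD
  have hDc : Convex ℝ D :=
    (convex_ball y r).inter ((convex_aff_eq_zero a).inter (convex_aff_pos b))
  obtain ⟨t, ht, -, htr⟩ := exists_small_move b.1 (φ := fun v => v ∈ Metric.ball y r)
    (Metric.ball_mem_nhds y hr) one_pos
  have hxD : y + t • b.1 ∈ D := by
    refine ⟨htr, ?_, ?_⟩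
    · show aff a _ = 0
      rw [aff_add_smul, hay, hab]; ring
    · show 0 < aff b _
      have := norm_pos_iff.2 hb
      rw [aff_add_grad, hby]; positivity
  have hDF : D ⊆ F ∩ {v | 0 < aff b v} := fun v hv => ⟨hball v hv.1 hv.2.1, hv.2.2⟩
  obtain ⟨hxF, hbx⟩ := hDF hxD
  have hDp : D ⊆ piece F b (y + t • b.1) :=
    subset_piece hDc.isPreconnected hDF ⟨_, hxD, mem_piece hxF hbx⟩
  have hyD : y ∈ closure D := by
    refine mem_closure_of_moves (w := y + t • b.1 - y) one_pos fun s hs hs1 => ⟨?_, ?_, ?_⟩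
    · exact Convex.move_mem (convex_ball y r) (Metric.mem_ball_self hr) htr hs.le hs1.le
    · show aff a _ = 0
      rw [aff_move, hay, show aff a _ = 0 from hxD.2.1]; ring
    · show 0 < aff b _
      rw [aff_move, hby, mul_zero, zero_add]; exact mul_pos hs hbx
  refine ⟨_, hxF, hbx, fun p hp => ?_⟩
  have hge : 0 ≤ aff p y :=
    closure_minimal (fun v hv => (h.pos_of_mem_sides hp (hDp hv)).le) (isClosed_aff_nonneg p) hyD
  refine lt_of_le_of_ne hge fun h0 => ?_
  -- the segment from `y` to a point of the side would run along the side through the half-disc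
  obtain ⟨-, -, z, hz, hbz, hpz⟩ := id hp
  obtain ⟨s, hs, -, hsr⟩ := exists_small_move (z - y) (φ := fun v => v ∈ Metric.ball y r)
    (Metric.ball_mem_nhds y hr) one_pos
  have hmem : y + s • (z - y) ∈ D := by
    refine ⟨hsr, ?_, ?_⟩
    · show aff a _ = 0
      rw [aff_move, hay, h.aff_eq_zero (closure_piece_subset hz)]; ring
    · show 0 < aff b _
      rw [aff_move, hby, mul_zero, zero_add]; exact mul_pos hs hbz
  have h1 := h.pos_of_mem_sides hp (hDp hmem)
  rw [aff_move, ← h0, aff_eq_zero_of_mem_facets hpz] at h1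
  simp at h1

/-- If the complement of `P` is convex near the points of the face off the line `aff b = 0`, then the
pieces of the face on the two sides of this line make it a hinged face. -/
theorem FacePlane.exists_hingedFace (h : FacePlane P F S a) (hab : ⟪a.1, b.1⟫ = 0) (hb : b.1 ≠ 0)
    (hconv : ∀ z ∈ closure F, aff b z ≠ 0 → ConvexAt P S z) :
    ∃ J, HingedFace P a b J ∧
      ∀ z ∈ closure F, aff b z ≠ 0 → ∃ C ∈ J, z ∈ base a C.1 C.2 ∧ 0 < aff C.1 z := by
  classical
  have hside : ∀ β, (β = b ∨ β = -b) → ConvexSide P F S a β := by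
    rintro β (rfl | rfl)
    · exact ⟨h, fun z hz hbz => hconv z hz hbz.ne'⟩
    · refine ⟨h, fun z hz hbz => hconv z hz ?_⟩
      rw [aff_neg] at hbz
      intro h0
      rw [h0] at hbz
      simp at hbz
  have hunit : ∀ β, (β = b ∨ β = -b) → ⟪a.1, β.1⟫ = 0 ∧ β.1 ≠ 0 := by
    rintro β (rfl | rfl)
    · exact ⟨hab, hb⟩
    · exact ⟨by simp [hab], by simpa using hb⟩
  set J : Finset ((E3 × ℝ) × Finset (E3 × ℝ)) :=
    (({b, -b} : Finset (E3 × ℝ)) ×ˢ h.arrangement.finite.toFinset.powerset).filter fun C =>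
      ∃ x ∈ F, 0 < aff C.1 x ∧ (C.2 : Set (E3 × ℝ)) = sides P S a C.1 (piece F C.1 x) with hJ
  have hmemJ : ∀ C, C ∈ J ↔ (C.1 = b ∨ C.1 = -b) ∧
      ∃ x ∈ F, 0 < aff C.1 x ∧ (C.2 : Set (E3 × ℝ)) = sides P S a C.1 (piece F C.1 x) := by
    intro C
    simp only [hJ, Finset.mem_filter, Finset.mem_product, Finset.mem_insert, Finset.mem_singleton,
      Finset.mem_powerset]
    refine ⟨fun hC => ⟨hC.1.1, hC.2⟩, fun hC => ⟨⟨hC.1, fun p hp => ?_⟩, hC.2⟩⟩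
    obtain ⟨x, -, -, hx⟩ := hC.2
    have hp' : p ∈ sides P S a C.1 (piece F C.1 x) := by rw [← hx]; exact hp
    exact h.arrangement.finite.mem_toFinset.2 hp'.1
  have hexists : ∀ β, (β = b ∨ β = -b) → ∀ x ∈ F, 0 < aff β x →
      ∃ I : Finset (E3 × ℝ), (I : Set (E3 × ℝ)) = sides P S a β (piece F β x) ∧ (β, I) ∈ J := by
    intro β hβ x hx hbx
    have hfin := (hside β hβ).finite_sides (piece F β x)
    exact ⟨hfin.toFinset, hfin.coe_toFinset, (hmemJ _).2 ⟨hβ, x, hx, hbx, hfin.coe_toFinset⟩⟩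
  refine ⟨J, ⟨h.isPolyhedron, fun C hC => ((hmemJ C).1 hC).1, ?_, ?_, ?_, ?_⟩, ?_⟩
  · intro C hC
    obtain ⟨hβ, x, hx, hbx, hI⟩ := (hmemJ C).1 hC
    exact (hside _ hβ).convexPiece (hunit _ hβ).1 hI hx hbx
  · intro C hC z hz hbz
    obtain ⟨hβ, x, hx, hbx, hI⟩ := (hmemJ C).1 hC
    exact (hside _ hβ).eventually_notMem_iff hI hx hbx hz hbz
  · rintro ⟨β, I⟩ hC ⟨β', I'⟩ hD hne z hz hz' hbz hbz'
    obtain ⟨hβ, x, hx, hbx, hI⟩ := (hmemJ _).1 hC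
    obtain ⟨hβ', x', hx', hbx', hI'⟩ := (hmemJ _).1 hD
    dsimp only at *
    obtain rfl : β = β' := by
      rcases hβ with rfl | rfl <;> rcases hβ' with rfl | rfl
      · rfl
      · rw [aff_neg] at hbz'; linarith
      · rw [aff_neg] at hbz; linarith
      · rfl
    rw [← (hside _ hβ).closure_piece hI hx hbx] at hz
    rw [← (hside _ hβ).closure_piece hI' hx' hbx'] at hz'
    rw [← (hside _ hβ).piece_eq_of_mem_closure hz hz' hbz, ← hI] at hI'
    exact hne (by rw [Finset.coe_injective hI'])
  · intro C hC y hy hby hyf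
    obtain ⟨hβ, x, hx, hbx, hI⟩ := (hmemJ C).1 hC
    rw [← (hside _ hβ).closure_piece hI hx hbx] at hy
    have hyF := h.mem_of_mem_facePoints (closure_piece_subset hy) hyf
    have key : ∀ β, (β = b ∨ β = -b) →
        ∀ᶠ v in 𝓝 y, 0 < aff β v → ∃ D ∈ J, 0 < aff D.1 v ∧ v ∈ Ko D.2 := by
      intro β hβ
      obtain ⟨x', hx', hbx', hpos⟩ := (hside β hβ).exists_piece_of_hinge (hunit β hβ).1 (hunit β hβ).2
        hyF (by rcases hβ with rfl | rfl <;> simp [hby])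
      obtain ⟨I', hI', hIJ⟩ := hexists β hβ x' hx' hbx'
      have hyK : y ∈ Ko I' := fun p hp => hpos p (by rw [← hI']; exact hp)
      filter_upwards [(isOpen_Ko I').mem_nhds hyK] with v hv hbv
      exact ⟨_, hIJ, hbv, hv⟩
    filter_upwards [(h.subset_flat hyF).2, key b (Or.inl rfl), key (-b) (Or.inr rfl)] with v h1 h2 h3
    refine ⟨h1, fun hbv => ?_⟩
    rcases hbv.lt_or_gt with h4 | h4
    · exact h3 (by rw [aff_neg]; linarith)
    · exact h2 h4
  · intro z hz hbz
    obtain ⟨β, hβ, hbz⟩ : ∃ β, (β = b ∨ β = -b) ∧ 0 < aff β z := by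
      rcases hbz.lt_or_gt with h4 | h4
      · exact ⟨-b, Or.inr rfl, by rw [aff_neg]; linarith⟩
      · exact ⟨b, Or.inl rfl, h4⟩
    obtain ⟨x, hx, hbx, hzx⟩ := (hside β hβ).exists_mem_closure_piece hz hbz
    obtain ⟨I, hI, hIJ⟩ := hexists β hβ x hx hbx
    rw [(hside β hβ).closure_piece hI hx hbx] at hzx
    exact ⟨_, hIJ, hzx, hbz⟩

end

section

variable {P : Set E3} {a b : E3 × ℝ} {H : E3} {I : Finset (E3 × ℝ)}

/-! ### Degrees of vertices -/

/-- If three independent half-spaces cut out the complement of `P` near `H`, then exactly three edges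
start at `H`. -/
theorem degree_eq_three {u : Fin 3 → E3 × ℝ} (hu : ∀ i, aff (u i) H = 0)
    (hP : ∀ᶠ v in 𝓝 H, (v ∉ P ↔ ∀ i, 0 < aff (u i) v)) {e : Fin 3 → E3} (he : ∀ i, ‖e i‖ = 1)
    (hpos : ∀ i, 0 < ⟪(u i).1, e i⟫) (hzero : ∀ i j, i ≠ j → ⟪(u i).1, e j⟫ = 0) :
    degree P H = 3 := by
  classical
  set T : Finset (E3 × ℝ) := Finset.univ.image u with hT
  have hTm : ∀ i, u i ∈ T := fun i => Finset.mem_image_of_mem u (Finset.mem_univ i)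
  have hTo : ∀ v, v ∈ Ko T ↔ ∀ i, 0 < aff (u i) v := fun v => by simp [Ko, hT]
  have hTc : ∀ v, v ∈ Kc T ↔ ∀ i, 0 ≤ aff (u i) v := fun v => by simp [Kc, hT]
  have hli : ∀ j k, j ≠ k → LinearIndependent ℝ ![(u j).1, (u k).1] := by
    intro j k hjk
    rw [LinearIndependent.pair_iff]
    intro s t hst
    have h1 := congrArg (fun w => ⟪w, e j⟫) hst
    have h2 := congrArg (fun w => ⟪w, e k⟫) hst
    simp only [inner_add_left, real_inner_smul_left, hzero _ _ hjk, hzero _ _ hjk.symm, inner_zero_left,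
      mul_zero, add_zero, zero_add] at h1 h2
    exact ⟨(mul_eq_zero.1 h1).resolve_right (hpos j).ne', (mul_eq_zero.1 h2).resolve_right (hpos k).ne'⟩
  have hn : ∀ p ∈ T, p.1 ≠ 0 := by
    intro p hp
    obtain ⟨i, -, rfl⟩ := Finset.mem_image.1 hp
    intro h0
    have := hpos i
    rw [h0, inner_zero_left] at this
    exact this.false
  have hne : (Ko T).Nonempty := by
    refine ⟨H + (1 : ℝ) • (e 0 + e 1 + e 2), (hTo _).2 fun i => ?_⟩
    rw [aff_add_smul, hu, inner_add_right, inner_add_right]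
    fin_cases i
    · have := hpos 0
      simpa [hzero 0 1, hzero 0 2] using this
    · have := hpos 1
      simpa [hzero 1 0, hzero 1 2] using this
    · have := hpos 2
      simpa [hzero 2 0, hzero 2 1] using this
  have hPT : ∀ᶠ v in 𝓝 H, ∀ᶠ v' in 𝓝 v, (v' ∉ P ↔ v' ∈ Ko T) := by
    refine Filter.Eventually.eventually_nhds ?_
    filter_upwards [hP] with v hv
    rw [hv, hTo]
  have hset : {w : E3 | ‖w‖ = 1 ∧ ∀ᶠ s in 𝓝[>] (0 : ℝ), H + s • w ∈ edgePoints P} = range e := by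
    ext w
    constructor
    · rintro ⟨hw, hev⟩
      have h1 := (eventually_move (w := w) hPT).filter_mono (nhdsWithin_le_nhds (s := Ioi 0))
      obtain ⟨s, ⟨hsk, hsP⟩, hs⟩ := ((hev.and h1).and self_mem_nhdsWithin).exists
      have hs0 : (0 : ℝ) < s := hs
      obtain ⟨hK, p, hp, q, hq, hpq, hps, hqs⟩ := exists_pair_of_mem_skeleton hn hsP hsk.1
      obtain ⟨j, -, rfl⟩ := Finset.mem_image.1 hp
      obtain ⟨k, -, rfl⟩ := Finset.mem_image.1 hq
      have hjk : j ≠ k := fun h0 => hpq (by rw [h0])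
      rw [aff_add_smul, hu, zero_add] at hps hqs
      obtain ⟨i, hij, hik⟩ : ∃ i : Fin 3, i ≠ j ∧ i ≠ k :=
        (by decide : ∀ j k : Fin 3, j ≠ k → ∃ i, i ≠ j ∧ i ≠ k) j k hjk
      obtain ⟨r, rfl⟩ := exists_eq_smul_of_orthogonal (hli j k hjk)
        (norm_ne_zero_iff.1 (by rw [he i]; exact one_ne_zero)) (hzero j i hij.symm)
        (hzero k i hik.symm) ((mul_eq_zero.1 hps).resolve_left hs0.ne')
        ((mul_eq_zero.1 hqs).resolve_left hs0.ne')
      have h2 := (hTc _).1 hK i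
      rw [aff_add_smul, hu, zero_add, inner_smul_right] at h2
      have h3 : 0 ≤ r := nonneg_of_mul_nonneg_left (nonneg_of_mul_nonneg_right h2 hs0) (hpos i)
      rw [norm_smul, he, mul_one, Real.norm_of_nonneg h3] at hw
      exact ⟨i, by rw [hw, one_smul]⟩
    · rintro ⟨i, rfl⟩
      refine ⟨he i, ?_⟩
      have h1 := (eventually_move (w := e i) hPT).filter_mono (nhdsWithin_le_nhds (s := Ioi 0))
      filter_upwards [h1, self_mem_nhdsWithin] with s hsP hs
      have hs0 : (0 : ℝ) < s := hs
      obtain ⟨j, k, hjk, hij, hik, hall⟩ : ∃ j k : Fin 3, j ≠ k ∧ i ≠ j ∧ i ≠ k ∧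
          ∀ l, l = i ∨ l = j ∨ l = k :=
        (by decide : ∀ i : Fin 3, ∃ j k : Fin 3, j ≠ k ∧ i ≠ j ∧ i ≠ k ∧
          ∀ l, l = i ∨ l = j ∨ l = k) i
      have hval : ∀ l, aff (u l) (H + s • e i) = s * ⟪(u l).1, e i⟫ := fun l => by
        rw [aff_add_smul, hu, zero_add]
      have hj0 : aff (u j) (H + s • e i) = 0 := by rw [hval, hzero j i hij.symm, mul_zero]
      have hk0 : aff (u k) (H + s • e i) = 0 := by rw [hval, hzero k i hik.symm, mul_zero]
      have hi0 : 0 < aff (u i) (H + s • e i) := by rw [hval]; exact mul_pos hs0 (hpos i)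
      have hsk : H + s • e i ∈ skeleton P := by
        refine mem_skeleton_of_pair hne hsP ((hTc _).2 fun l => ?_) (hTm j) (hTm k) (hli j k hjk)
          hj0 hk0
        rcases hall l with rfl | rfl | rfl
        exacts [hi0.le, hj0.ge, hk0.ge]
      refine ⟨hsk, fun hv => hv.2 (e i) (norm_ne_zero_iff.1 (by rw [he i]; exact one_ne_zero)) ?_⟩
      obtain ⟨r, hr, hball⟩ := Metric.eventually_nhds_iff_ball.1 (hsP.and (eventually_aff_pos hi0))
      have hiff : ∀ v ∈ Metric.ball (H + s • e i) r,
          (v ∉ P ↔ 0 < aff (u j) v ∧ 0 < aff (u k) v) := by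
        intro v hv
        obtain ⟨h2, h3⟩ := hball v hv
        rw [h2, hTo]
        refine ⟨fun h4 => ⟨h4 j, h4 k⟩, fun h4 l => ?_⟩
        rcases hall l with rfl | rfl | rfl
        exacts [h3, h4.1, h4.2]
      refine ⟨r, hr, fun v hv t hvt => ?_⟩
      rw [← not_iff_not, hiff v hv, hiff _ hvt, aff_add_smul, aff_add_smul, hzero j i hij.symm,
        hzero k i hik.symm, mul_zero, add_zero, add_zero]
  have hinj : Function.Injective e := by
    intro i j hij
    by_contra hne
    have := hpos i
    rw [hij, hzero i j hne] at this
    exact this.false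
  rw [degree, hset, ← image_univ, ncard_image_of_injective _ hinj, ncard_univ]
  simp

/-- At a vertex, the planes bounding the complement have independent normals. -/
theorem exists_inner_ne_zero_of_mem_vertices (hv : H ∈ vertices P)
    (hloc : ∀ᶠ v in 𝓝 H, (v ∉ P ↔ 0 < aff a v ∧ v ∈ Ko I)) {d : E3} (hd : d ≠ 0)
    (had : ⟪a.1, d⟫ = 0) (hK : H ∈ Kc I) : ∃ p ∈ I, aff p H = 0 ∧ ⟪p.1, d⟫ ≠ 0 := by
  by_contra! hall
  refine hv.2 d hd ?_
  have hpos : ∀ᶠ v in 𝓝 H, ∀ p ∈ I, 0 < aff p H → 0 < aff p v := by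
    rw [Finset.eventually_all]
    intro q _
    by_cases h0 : 0 < aff q H
    · filter_upwards [eventually_aff_pos h0] with v hv _ using hv
    · simp [h0]
  obtain ⟨r, hr, hball⟩ := Metric.eventually_nhds_iff_ball.1 (hloc.and hpos)
  have hiff : ∀ v ∈ Metric.ball H r,
      (v ∉ P ↔ 0 < aff a v ∧ ∀ p ∈ I, aff p H = 0 → 0 < aff p v) := by
    intro v hv
    rw [(hball v hv).1]
    refine and_congr_right fun _ => ⟨fun h p hp _ => h p hp, fun h p hp => ?_⟩
    rcases (hK p hp).eq_or_lt with h0 | h0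
    · exact h p hp h0.symm
    · exact (hball v hv).2 p hp h0
  refine ⟨r, hr, fun v hv t hvt => ?_⟩
  rw [← not_iff_not, hiff v hv, hiff _ hvt, aff_add_smul, had, mul_zero, add_zero]
  refine and_congr_right fun _ => forall₂_congr fun p hp => forall_congr' fun h0 => ?_
  rw [aff_add_smul, hall p hp h0, mul_zero, add_zero]

/-- If no side of the piece degenerates to a point, its vertices off the hinge have degree three: at
most two nondegenerate sides of a convex polygon meet at a point. -/
theorem ConvexPiece.degree_eq_three (hC : ConvexPiece a b I) (hH : H ∈ base a b I)
    (hloc : ∀ᶠ v in 𝓝 H, (v ∉ P ↔ 0 < aff a v ∧ v ∈ Ko I)) (hv : H ∈ vertices P)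
    (hns : ∀ j ∈ I, ¬ (edge a b I j).Subsingleton) : degree P H = 3 := by
  have hK := hH.2.2
  have haH := hH.1
  have hdir : ∀ p ∈ I, aff p H = 0 → ∃ d : E3, ⟪a.1, d⟫ = 0 ∧ ⟪p.1, d⟫ = 0 ∧
      ∀ q ∈ I, q ≠ p → aff q H = 0 → 0 < ⟪q.1, d⟫ := by
    intro p hp hpH
    have := hns p hp
    rw [Set.not_subsingleton_iff] at this
    obtain ⟨Y, hY, hYH⟩ := this.exists_ne H
    refine ⟨Y - H, ?_, ?_, fun q hq hqp hqH => ?_⟩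
    · rw [inner_sub_eq_aff, hY.1.1, haH, sub_zero]
    · rw [inner_sub_eq_aff, hY.2, hpH, sub_zero]
    · rw [inner_sub_eq_aff, hqH, sub_zero]
      refine lt_of_le_of_ne (hY.1.2.2 q hq) fun h0 => hYH ?_
      exact hC.eq_of_two_planes hq hp hqp hY.1.1 haH h0.symm hqH hY.2 hpH
  have ha0 : a.1 ≠ 0 := norm_ne_zero_iff.1 (by rw [hC.norm_a]; exact one_ne_zero)
  -- two sides pass through the vertex
  obtain ⟨d0, hd0, had0, -⟩ := exists_ne_zero_orthogonal a.1 a.1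
  obtain ⟨p, hp, hpH, -⟩ := exists_inner_ne_zero_of_mem_vertices hv hloc hd0 had0 hK
  obtain ⟨d1, hd1, had1, hpd1⟩ := exists_ne_zero_orthogonal a.1 p.1
  obtain ⟨q, hq, hqH, hqd1⟩ := exists_inner_ne_zero_of_mem_vertices hv hloc hd1 had1 hK
  have hqp : q ≠ p := by rintro rfl; exact hqd1 hpd1
  obtain ⟨dp, hadp, hpdp, hpos_p⟩ := hdir p hp hpH
  obtain ⟨dq, hadq, hqdq, hpos_q⟩ := hdir q hq hqH
  have hqdp := hpos_p q hq hqp hqH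
  have hpdq := hpos_q p hp hqp.symm hpH
  -- a third one is impossible
  have honly : ∀ r ∈ I, aff r H = 0 → r = p ∨ r = q := by
    intro r hr hrH
    by_contra! hne
    obtain ⟨dr, hadr, hrdr, hpos_r⟩ := hdir r hr hrH
    obtain ⟨α, β, γ, h0, hrel⟩ := exists_relation_of_orthogonal ![dp, dq, dr] ha0 (by
      intro i
      rw [real_inner_comm]
      fin_cases i
      exacts [hadp, hadq, hadr])
    simp only [Matrix.cons_val_zero, Matrix.cons_val_one, Matrix.cons_val] at hrel
    have e1 := congrArg (fun w => ⟪p.1, w⟫) hrel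
    have e2 := congrArg (fun w => ⟪q.1, w⟫) hrel
    have e3 := congrArg (fun w => ⟪r.1, w⟫) hrel
    simp only [inner_add_right, inner_smul_right, hpdp, hqdq, hrdr, inner_zero_right, mul_zero,
      zero_add, add_zero] at e1 e2 e3
    have k1 := hpos_r p hp hne.1.symm hpH
    have k2 := hpos_r q hq hne.2.symm hqH
    have k3 := hpos_p r hr hne.1 hrH
    have k4 := hpos_q r hr hne.2 hrH
    rcases lt_trichotomy α 0 with hα | hα | hα
    · have hβ : 0 < β := by by_contra! h; nlinarith
      have hγ : 0 < γ := by by_contra! h; nlinarith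
      nlinarith [mul_pos hβ hpdq, mul_pos hγ k1]
    · subst hα
      have hβ : β = 0 := by simpa [k4.ne'] using e3
      have hγ : γ = 0 := by simpa [k2.ne'] using e2
      simp [hβ, hγ] at h0
    · have hβ : β < 0 := by by_contra! h; nlinarith
      have hγ : γ < 0 := by by_contra! h; nlinarith
      nlinarith [mul_neg_of_neg_of_pos hβ hpdq, mul_neg_of_neg_of_pos hγ k1]
  -- the direction of the third edge
  obtain ⟨da, hpda, hqda, hada⟩ : ∃ d : E3, ⟪p.1, d⟫ = 0 ∧ ⟪q.1, d⟫ = 0 ∧ 0 < ⟪a.1, d⟫ := by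
    obtain ⟨d, hd, hpd, hqd⟩ := exists_ne_zero_orthogonal p.1 q.1
    have had : ⟪a.1, d⟫ ≠ 0 := by
      intro had
      obtain ⟨r, hr, hrH, hrd⟩ := exists_inner_ne_zero_of_mem_vertices hv hloc hd had hK
      rcases honly r hr hrH with rfl | rfl
      exacts [hrd hpd, hrd hqd]
    rcases had.lt_or_gt with h | h
    · exact ⟨-d, by simp [hpd], by simp [hqd], by rw [inner_neg_right]; linarith⟩
    · exact ⟨d, hpd, hqd, h⟩
  have hnorm : ∀ {w d : E3}, 0 < ⟪w, d⟫ → 0 < ‖d‖ := by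
    intro w d h
    refine norm_pos_iff.2 ?_
    rintro rfl
    simp at h
  set e : Fin 3 → E3 := ![‖da‖⁻¹ • da, ‖dq‖⁻¹ • dq, ‖dp‖⁻¹ • dp] with he
  have hpos : ∀ᶠ v in 𝓝 H, ∀ r ∈ I, 0 < aff r H → 0 < aff r v := by
    rw [Finset.eventually_all]
    intro r _
    by_cases h0 : 0 < aff r H
    · filter_upwards [eventually_aff_pos h0] with v hv _ using hv
    · simp [h0]
  have na := hnorm hada
  have np := hnorm hqdp
  have nq := hnorm hpdq
  refine Melzak.degree_eq_three (u := ![a, p, q]) (e := e) ?_ ?_ ?_ ?_ ?_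
  · intro i; fin_cases i; exacts [haH, hpH, hqH]
  · filter_upwards [hloc, hpos] with v hv hpos
    rw [hv, Fin.forall_fin_succ, Fin.forall_fin_two]
    refine and_congr_right fun _ => ⟨fun h => ⟨h p hp, h q hq⟩, fun h r hr => ?_⟩
    rcases (hK r hr).eq_or_lt with h0 | h0
    · rcases honly r hr h0.symm with rfl | rfl
      exacts [h.1, h.2]
    · exact hpos r hr h0
  · intro i
    fin_cases i
    · exact norm_smul_inv_norm (𝕜 := ℝ) (norm_pos_iff.1 na)
    · exact norm_smul_inv_norm (𝕜 := ℝ) (norm_pos_iff.1 nq)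
    · exact norm_smul_inv_norm (𝕜 := ℝ) (norm_pos_iff.1 np)
  · have hmul : ∀ {w d : E3}, 0 < ‖d‖ → 0 < ⟪w, d⟫ → 0 < ⟪w, ‖d‖⁻¹ • d⟫ := fun h0 h => by
      rw [inner_smul_right]; exact mul_pos (inv_pos.2 h0) h
    intro i
    fin_cases i
    exacts [hmul na hada, hmul nq hpdq, hmul np hqdp]
  · have hmul : ∀ {w d : E3} {c : ℝ}, ⟪w, d⟫ = 0 → ⟪w, c • d⟫ = 0 := fun h => by
      rw [inner_smul_right, h, mul_zero]
    intro i j hij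
    fin_cases i <;> fin_cases j
    exacts [absurd rfl hij, hmul hadq, hmul hadp, hmul hpda, absurd rfl hij, hmul hpdp, hmul hqda,
      hmul hqdq, absurd rfl hij]

end

end Melzak

/-! ### The dichotomy -/

theorem mainTheorem10 (P F : Set Melzak.E3) (A B : Melzak.E3)
    (hP : Melzak.IsPolyhedron P)
    (hF : Melzak.IsOpenFace P F)
    (hAB : Melzak.AdjacentOnFace P F A B)
    (hneg : ∀ H ∈ Melzak.faceVertices P F, H ≠ A → H ≠ B → Melzak.NegativelyExposed P H) :
    (∀ H ∈ Melzak.faceVertices P F, H ∉ affineSpan ℝ {A, B} → Melzak.degree P H = 3) ∨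
      Melzak.CanBeImproved P := by
  by_cases himp : Melzak.CanBeImproved P
  · exact Or.inr himp
  refine Or.inl fun H hH hHl => ?_
  obtain ⟨S, a, h⟩ := Melzak.exists_facePlane hP hF
  obtain ⟨hne, hA, hB, -⟩ := hAB
  -- the line through `A` and `B` in the plane of the face
  obtain ⟨d, hd, had, hdAB⟩ := Melzak.exists_ne_zero_orthogonal a.1 (B - A)
  obtain ⟨b, hb⟩ : ∃ b : Melzak.E3 × ℝ, b = (d, ⟪d, A⟫) := ⟨_, rfl⟩
  have hbA : Melzak.aff b A = 0 := by rw [hb, Melzak.aff, sub_self]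
  have hdAB' : ⟪b.1, B - A⟫ = 0 := by rw [hb, real_inner_comm]; exact hdAB
  have hbB : Melzak.aff b B = 0 := by
    rw [Melzak.inner_sub_eq_aff, hbA, sub_zero] at hdAB'; exact hdAB'
  have hab : ⟪a.1, b.1⟫ = 0 := by rw [hb]; exact had
  have hb0 : b.1 ≠ 0 := by rw [hb]; exact hd
  have haA := h.aff_eq_zero hA.2
  have hline : ∀ x, Melzak.aff a x = 0 → Melzak.aff b x = 0 → x ∈ affineSpan ℝ {A, B} := by
    intro x hax hbx
    have hBA : B - A ≠ 0 := sub_ne_zero.2 hne.symm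
    have hli : LinearIndependent ℝ ![a.1, b.1] := by
      rw [LinearIndependent.pair_iff]
      intro s t hst
      have h1 := congrArg (fun w => ⟪a.1, w⟫) hst
      have h2 := congrArg (fun w => ⟪w, b.1⟫) hst
      simp only [inner_add_right, inner_smul_right, hab, mul_zero, add_zero, inner_zero_right,
        mul_eq_zero, inner_self_eq_zero, h.grad_ne_zero, or_false] at h1
      simp only [inner_add_left, real_inner_smul_left, hab, mul_zero, zero_add, inner_zero_left,
        mul_eq_zero, inner_self_eq_zero, hb0, or_false] at h2
      exact ⟨h1, h2⟩
    have haBA : ⟪a.1, B - A⟫ = 0 := by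
      rw [Melzak.inner_sub_eq_aff, h.aff_eq_zero hB.2, haA, sub_zero]
    obtain ⟨r, hr⟩ := Melzak.exists_eq_smul_of_orthogonal hli hBA haBA hdAB'
      (w := x - A) (by rw [Melzak.inner_sub_eq_aff, hax, haA, sub_zero])
      (by rw [Melzak.inner_sub_eq_aff, hbx, hbA, sub_zero])
    have hx : x = AffineMap.lineMap A B r := by
      rw [AffineMap.lineMap_apply_module', ← hr, sub_add_cancel]
    rw [hx]
    exact AffineMap.lineMap_mem_affineSpan_pair r A B
  have hconv : ∀ z ∈ closure F, Melzak.aff b z ≠ 0 → Melzak.ConvexAt P S z := by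
    intro z hz hbz
    refine h.arrangement.convexAt hP (h.closure_subset_frontier hz) (h.complConvexAt ?_ hz hbz)
    intro G hG hbG
    exact hneg G hG (fun h0 => hbG (h0 ▸ hbA)) fun h0 => hbG (h0 ▸ hbB)
  obtain ⟨J, hJ, hcover⟩ := h.exists_hingedFace hab hb0 hconv
  obtain ⟨C, hC, hHC, hbC⟩ := hcover H hH.2 fun hbH => hHl (hline H (h.aff_eq_zero hH.2) hbH)
  exact (hJ.piece C hC).degree_eq_three hHC (hJ.local_eq C hC H hHC hbC) hH.1 fun j hj hsub =>
    himp (hJ.canBeImproved hC ⟨j, hj, hsub⟩)
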